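/- Let $N$ be an oriented (Hausdorff, second countable) smooth $10$-manifold without boundary, with a Lorentz metric $g_N$, a smooth function $\phi$ and smooth forms $C_1\in\Omega^1(N)$, $B_2\in\Omega^2(N)$, $C_3\in\Omega^3(N)$. Put $G_2=dC_1$, $H_3=dB_2$, $G_4=dC_3$, $\tilde G_4=G_4-C_1\wedge H_3$. Let $g_{S^1}$ be a rotation invariant Riemannian metric on the oriented circle $S^1$ with volume form $\alpha^{10}$. Give $M=N\times S^1$ the product orientation; all fields on $N$ and $S^1$ are pulled back to $M$ by the projections. Let $C=C_3+B_2\wedge\alpha^{10}$, $G=dC$, and let $g_M$ be the symmetric bilinear field on $M$ with $$g_M(X,Y)=e^{-2\phi/3}g_N(X,Y)+e^{4\phi/3}C_1(X)C_1(Y),\quad g_M(X,S)=-e^{4\phi/3}C_1(X)\alpha^{10}(S),\quad g_M(S,S')=e^{4\phi/3}g_{S^1}(S,S')$$ for $X,Y$ tangent to $N$ and $S,S'$ tangent to $S^1$. Let $\kappa_{10},\kappa_{11}\neq0$ be real constants with $\frac1{\kappa_{10}^2}=\frac1{\kappa_{11}^2}\int_{S^1}\alpha^{10}$. Here $|F|^2=\frac1{k!}F_{\mu_1\ldots\mu_k}F^{\mu_1\ldots\mu_k}$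 for a $k$-form $F$, $R$ is the scalar curvature, and $*d\phi$ is the contraction of $\mathrm{dvol}_{g_N}$ with the $g_N$-gradient of $\phi$. Assume that either $N$ is compact, or the three top-degree forms under the integral signs of $S_{NS}$, $S_{RIIA}$ and $S_{CSIIA}$ below are absolutely integrable on $N$ and the total differentials $d(e^{-2\phi}*d\phi)$ and $d(C_3\wedge G_4\wedge B_2)$ are absolutely integrable on $N$ with integral $0$. Then $g_M$ is a Lorentz metric, $C$ is smooth, all integrals below converge absolutely, and the action of eleven-dimensional supergravity on $M$, $$S_{11}=\frac{1}{2\kappa_{11}^2}\int_M\left(R^M-\tfrac12|G|^2\right)\mathrm{dvol}_{g_M}-\frac1{12\kappa_{11}^2}\int_MC\wedge G\wedge G,$$ is equal to the string frame action of type IIA supergravity on $N$, $$S_{IIA}=S_{NS}+S_{RIIA}+S_{CSIIA},\qquad S_{NS}=\frac1{2\kappa_{10}^2}\int_Ne^{-2\phi}\left(R^N+4|d\phi|^2-\tfrac12|H_3|^2\right)\mathrm{dvol}_{g_N},$$ $$S_{RIIA}=-\frac1{4\kappa_{10}^2}\int_N\left(|G_2|^2+|\tilde G_4|^2\right)\mathrm{dvol}_{g_N},\qquad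 S_{CSIIA}=-\frac1{4\kappa_{10}^2}\int_NB_2\wedge G_4\wedge G_4.$$ -/

import Mathlib

open scoped Manifold ContDiff

noncomputable section

namespace Sugra

section Pointwise

variable {V : Type*} [AddCommGroup V] [Module ℝ V] [TopologicalSpace V]

/-- The tensor product `(ξ ⊗ η)(v₁, …, v_{k+l}) = ξ(v₁, …, v_k) · η(v_{k+1}, …, v_{k+l})`. -/
def tensorForm {k l : ℕ} (ξ : V [⋀^Fin k]→L[ℝ] ℝ) (η : V [⋀^Fin l]→L[ℝ] ℝ) :
    ContinuousMultilinearMap ℝ (fun _ : Fin (k + l) => V) ℝ where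
  toMultilinearMap :=
    (LinearMap.mul' ℝ ℝ).compMultilinearMap
      ((MultilinearMap.domCoprod ξ.toMultilinearMap η.toMultilinearMap).domDomCongr finSumFinEquiv)
  cont := by
    change Continuous fun v : Fin (k + l) → V =>
      ξ (fun i => v (finSumFinEquiv (Sum.inl i))) * η (fun i => v (finSumFinEquiv (Sum.inr i)))
    exact (ξ.cont.comp (continuous_pi fun i => continuous_apply _)).mul
      (η.cont.comp (continuous_pi fun i => continuous_apply _))

theorem tensorForm_apply {k l : ℕ} (ξ : V [⋀^Fin k]→L[ℝ] ℝ) (η : V [⋀^Fin l]→L[ℝ] ℝ)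
    (v : Fin (k + l) → V) :
    tensorForm ξ η v = ξ (fun i => v (Fin.castAdd l i)) * η (fun i => v (Fin.natAdd k i)) := rfl

/-- The wedge product of alternating forms,
`(ξ ∧ η)(v) = 1 / (k! l!) ∑_σ sgn(σ) ξ(v_{σ 1}, …, v_{σ k}) η(v_{σ (k+1)}, …, v_{σ (k+l)})`,
so that `(α ∧ β)(X, Y) = α(X) β(Y) - α(Y) β(X)` for `1`-forms. -/
def wedgeAt {k l : ℕ} (ξ : V [⋀^Fin k]→L[ℝ] ℝ) (η : V [⋀^Fin l]→L[ℝ] ℝ) :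
    V [⋀^Fin (k + l)]→L[ℝ] ℝ :=
  ((k.factorial : ℝ) * (l.factorial : ℝ))⁻¹ •
    ContinuousMultilinearMap.alternatization (tensorForm ξ η)

theorem wedgeAt_apply {k l : ℕ} (ξ : V [⋀^Fin k]→L[ℝ] ℝ) (η : V [⋀^Fin l]→L[ℝ] ℝ)
    (v : Fin (k + l) → V) :
    wedgeAt ξ η v = ((k.factorial : ℝ) * (l.factorial : ℝ))⁻¹ *
      ∑ σ : Equiv.Perm (Fin (k + l)), ((Equiv.Perm.sign σ : ℤ) : ℝ) *
        (ξ (fun i => v (σ (Fin.castAdd l i))) * η (fun i => v (σ (Fin.natAdd k i)))) := by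
  simp only [wedgeAt, ContinuousAlternatingMap.smul_apply, smul_eq_mul,
    ContinuousMultilinearMap.alternatization_apply_apply, tensorForm_apply,
    Units.smul_def, zsmul_eq_mul, Function.comp_apply]

/-- The interior product `i_X ξ = ξ(X, ·, …, ·)`. -/
def interiorAt {k : ℕ} (X : V) (ξ : V [⋀^Fin (k + 1)]→L[ℝ] ℝ) : V [⋀^Fin k]→L[ℝ] ℝ where
  toMultilinearMap := (AlternatingMap.curryLeft ξ.toAlternatingMap X).toMultilinearMap
  cont := by
    change Continuous fun v : Fin k → V => ξ (Matrix.vecCons X v)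
    exact ξ.cont.comp (continuous_pi fun i => by
      refine Fin.cases ?_ (fun j => ?_) i
      · exact continuous_const
      · exact continuous_apply j)
  map_eq_zero_of_eq' := (AlternatingMap.curryLeft ξ.toAlternatingMap X).map_eq_zero_of_eq'

variable {n : ℕ}

/-- The matrix `g_{μν} = g(b_μ, b_ν)`. -/
def gram (b : Module.Basis (Fin n) ℝ V) (g : LinearMap.BilinForm ℝ V) :
    Matrix (Fin n) (Fin n) ℝ :=
  Matrix.of fun i j => g (b i) (b j)

/-- The scalar product of `k`-forms,
`⟨F, G⟩ = 1 / k! ∑ F_{μ₁…μ_k} G_{ν₁…ν_k} g^{μ₁ν₁} ⋯ g^{μ_kν_k}`. -/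
def innerAt (b : Module.Basis (Fin n) ℝ V) (g : LinearMap.BilinForm ℝ V) {k : ℕ}
    (F G : V [⋀^Fin k]→L[ℝ] ℝ) : ℝ :=
  (k.factorial : ℝ)⁻¹ * ∑ μ : Fin k → Fin n, ∑ ν : Fin k → Fin n,
    (∏ i, (gram b g)⁻¹ (μ i) (ν i)) * F (fun i => b (μ i)) * G (fun i => b (ν i))

/-- `|F|² = ⟨F, F⟩`. -/
def normSqAt (b : Module.Basis (Fin n) ℝ V) (g : LinearMap.BilinForm ℝ V) {k : ℕ}
    (F : V [⋀^Fin k]→L[ℝ] ℝ) : ℝ :=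
  innerAt b g F F

/-- The vector `α^♯` with `g(α^♯, Y) = α(Y)`. -/
def sharpAt (b : Module.Basis (Fin n) ℝ V) (g : LinearMap.BilinForm ℝ V)
    (α : V [⋀^Fin 1]→L[ℝ] ℝ) : V :=
  ∑ i, ∑ j, ((gram b g)⁻¹ i j * α (fun _ => b j)) • b i

/-- A `1`-form as a linear functional. -/
def asLinear (α : V [⋀^Fin 1]→L[ℝ] ℝ) : V →ₗ[ℝ] ℝ :=
  ((ContinuousAlternatingMap.ofSubsingleton ℝ V ℝ (0 : Fin 1)).symm α : V →L[ℝ] ℝ)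

theorem asLinear_apply (α : V [⋀^Fin 1]→L[ℝ] ℝ) (X : V) : asLinear α X = α (fun _ => X) := rfl

end Pointwise

section Manifold

variable {E : Type*} [NormedAddCommGroup E] [NormedSpace ℝ E]
  {H : Type*} [TopologicalSpace H] (I : ModelWithCorners ℝ E H)
  (M : Type*) [TopologicalSpace M] [ChartedSpace H M]

/-- (Not necessarily smooth) differential `k`-forms on `M`. -/
abbrev DForm (k : ℕ) := ∀ x : M, TangentSpace I x [⋀^Fin k]→L[ℝ] ℝ

/-- (Not necessarily smooth) fields of bilinear forms on the tangent spaces of `M`. -/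
abbrev BilinField := ∀ x : M, LinearMap.BilinForm ℝ (TangentSpace I x)

variable {I M}

/-- The wedge product of differential forms. -/
def wedge {k l : ℕ} (ξ : DForm I M k) (η : DForm I M l) : DForm I M (k + l) :=
  fun x => wedgeAt (ξ x) (η x)

/-- The coordinate representation of a form in the preferred chart at `x₀`, that is, its pull-back
under the inverse of this chart. -/
def formInChart {k : ℕ} (ξ : DForm I M k) (x₀ : M) (y : E) : E [⋀^Fin k]→L[ℝ] ℝ :=
  (ξ ((extChartAt I x₀).symm y)).compContinuousLinearMap
    (mfderiv 𝓘(ℝ, E) I (extChartAt I x₀).symm y : E →L[ℝ] TangentSpace I ((extChartAt I x₀).symm y))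

/-- A form is smooth if all its coordinate representations are. -/
def IsSmoothForm {k : ℕ} (ξ : DForm I M k) : Prop :=
  ∀ x₀ : M, ContDiffOn ℝ ∞ (formInChart ξ x₀) (extChartAt I x₀).target

/-- The exterior derivative, computed in the preferred chart at each point. -/
def extD {k : ℕ} (ξ : DForm I M k) : DForm I M (k + 1) := fun x =>
  (extDeriv (formInChart ξ x) (extChartAt I x x)).compContinuousLinearMap
    (mfderiv I 𝓘(ℝ, E) (extChartAt I x) x : TangentSpace I x →L[ℝ] E)

/-- The differential `dφ` of a function, as a `1`-form. -/
def dFun (φ : M → ℝ) : DForm I M 1 := fun x =>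
  ContinuousAlternatingMap.ofSubsingleton ℝ (TangentSpace I x) ℝ (0 : Fin 1)
    (mfderiv I 𝓘(ℝ, ℝ) φ x : TangentSpace I x →L[ℝ] ℝ)

/-- The pull-back of a form under a map. -/
def pullback {E' : Type*} [NormedAddCommGroup E'] [NormedSpace ℝ E'] {H' : Type*}
    [TopologicalSpace H'] {I' : ModelWithCorners ℝ E' H'} {M' : Type*} [TopologicalSpace M']
    [ChartedSpace H' M'] (f : M → M') {k : ℕ} (ξ : DForm I' M' k) : DForm I M k :=
  fun x => (ξ (f x)).compContinuousLinearMap (mfderiv I I' f x)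

/-! ### Metrics and scalar curvature

A basis `b` of the model space `E` fixes the coordinates `x^μ` of the charts. As the tangent spaces
are copies of `E`, it also is a basis of each of them. -/

variable {n : ℕ} (b : Module.Basis (Fin n) ℝ E)

/-- The basis of the tangent space at `x` given by the basis `b` of the model space. -/
def tbasis (x : M) : Module.Basis (Fin n) ℝ (TangentSpace I x) := b

/-- The components `g_{μν} = g(∂_μ, ∂_ν)` in the preferred chart at `x₀`. -/
def metricInChart (g : BilinField I M) (x₀ : M) (y : E) : Matrix (Fin n) (Fin n) ℝ :=
  Matrix.of fun i j => g ((extChartAt I x₀).symm y)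
    (mfderiv 𝓘(ℝ, E) I (extChartAt I x₀).symm y (b i))
    (mfderiv 𝓘(ℝ, E) I (extChartAt I x₀).symm y (b j))

/-- Smoothness of a field of bilinear forms: its components in the charts are smooth. -/
def IsSmoothBilin (g : BilinField I M) : Prop :=
  ∀ (x₀ : M) (i j : Fin n),
    ContDiffOn ℝ ∞ (fun y => metricInChart b g x₀ y i j) (extChartAt I x₀).target

/-- Lorentz metrics: smooth, symmetric, and at every point there is an orthonormal basis with exactly
one timelike vector. -/
structure IsLorentzMetric (g : BilinField I M) : Prop where
  smooth : IsSmoothBilin b g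
  symm : ∀ (x : M) (X Y : TangentSpace I x), g x X Y = g x Y X
  signature : ∀ x : M, ∃ (e : Module.Basis (Fin n) ℝ (TangentSpace I x)) (t : Fin n),
    ∀ i j, g x (e i) (e j) = if i = j then (if i = t then -1 else 1) else 0

/-- Riemannian metrics. -/
structure IsRiemannianMetric (g : BilinField I M) : Prop where
  smooth : IsSmoothBilin b g
  symm : ∀ (x : M) (X Y : TangentSpace I x), g x X Y = g x Y X
  pos : ∀ (x : M) (X : TangentSpace I x), X ≠ 0 → 0 < g x X X

/-- The partial derivative `∂_i f` with respect to the coordinates given by `b`. -/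
def pd (i : Fin n) (f : E → ℝ) (y : E) : ℝ := fderiv ℝ f y (b i)

/-- The Christoffel symbols `Γ^k_{ij}` of the Levi-Civita connection of the metric with components
`h_{ij}`. -/
def christoffel (h : E → Matrix (Fin n) (Fin n) ℝ) (k i j : Fin n) (y : E) : ℝ :=
  (1 / 2) * ∑ l, (h y)⁻¹ k l *
    (pd b i (fun z => h z j l) y + pd b j (fun z => h z i l) y - pd b l (fun z => h z i j) y)

/-- The component of `∂_l` in `R(∂_i, ∂_j) ∂_k`, where
`R(X, Y) Z = ∇_X ∇_Y Z - ∇_Y ∇_X Z - ∇_{[X, Y]} Z`. -/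
def riemann (h : E → Matrix (Fin n) (Fin n) ℝ) (l i j k : Fin n) (y : E) : ℝ :=
  pd b i (christoffel b h l j k) y - pd b j (christoffel b h l i k) y +
    ∑ m, (christoffel b h l i m y * christoffel b h m j k y -
      christoffel b h l j m y * christoffel b h m i k y)

/-- `Ric(∂_j, ∂_k) = tr (Z ↦ R(Z, ∂_j) ∂_k)`. -/
def ricci (h : E → Matrix (Fin n) (Fin n) ℝ) (j k : Fin n) (y : E) : ℝ :=
  ∑ i, riemann b h i i j k y

/-- The scalar curvature, computed in the preferred chart at each point. -/
def scalarCurvature (g : BilinField I M) (x : M) : ℝ :=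
  ∑ j, ∑ k, (metricInChart b g x (extChartAt I x x))⁻¹ j k *
    ricci b (metricInChart b g x) j k (extChartAt I x x)

/-- `⟨F, G⟩` for differential forms. -/
def innerForm (g : BilinField I M) {k : ℕ} (F G : DForm I M k) (x : M) : ℝ :=
  innerAt (tbasis b x) (g x) (F x) (G x)

/-- `|F|²` for differential forms. -/
def normSq (g : BilinField I M) {k : ℕ} (F : DForm I M k) (x : M) : ℝ :=
  innerForm b g F F x

/-! ### Orientations, volume forms and integration

An orientation is given by a smooth nowhere vanishing form `τ` of top degree; only the class of `τ`
up to multiplication with positive functions matters below. -/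

/-- `τ` is a smooth nowhere vanishing form. -/
structure IsOrientationForm (τ : DForm I M n) : Prop where
  smooth : IsSmoothForm τ
  ne_zero : ∀ x, τ x ≠ 0

/-- The volume form of a metric `g` on the manifold oriented by `τ`: the positive multiple of `τ`
with `dvol_g = √|det g_{μν}|` on oriented bases, i.e. `±1` on `g`-orthonormal ones. -/
def volForm (τ : DForm I M n) (g : BilinField I M) : DForm I M n := fun x =>
  (Real.sqrt |(gram (tbasis b x) (g x)).det| / |τ x (tbasis b x)|) • τ x

/-- The measure `|ξ|` of a form of top degree: on the domain of each chart it is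
`|ξ(∂_1, …, ∂_n)| dx^1 ⋯ dx^n`. These local measures agree on the overlaps, so that their supremum
is the measure which restricts to each of them. -/
def formMeasure [MeasurableSpace E] [BorelSpace E] (ξ : DForm I M n) :
    @MeasureTheory.Measure M (borel M) :=
  letI : MeasurableSpace M := borel M
  ⨆ x₀ : M, MeasureTheory.Measure.map (extChartAt I x₀).symm
    ((b.addHaar.restrict (extChartAt I x₀).target).withDensity
      fun y => ENNReal.ofReal |formInChart ξ x₀ y b|)

/-- The sign (`1`, `-1` or `0`) of a form of top degree with respect to the orientation `τ`. -/
def formSign (τ ξ : DForm I M n) (x : M) : ℝ :=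
  Real.sign (τ x (tbasis b x) * ξ x (tbasis b x))

/-- The integral of a form of top degree over `M` with the orientation `τ`. -/
def integralForm [MeasurableSpace E] [BorelSpace E] (τ ξ : DForm I M n) : ℝ :=
  letI : MeasurableSpace M := borel M
  ∫ x, formSign b τ ξ x ∂(formMeasure b ξ)

/-- Absolute convergence of the integral of a form of top degree. -/
def IntegrableForm [MeasurableSpace E] [BorelSpace E] (τ ξ : DForm I M n) :
    Prop :=
  letI : MeasurableSpace M := borel M
  MeasureTheory.Integrable (fun x => formSign b τ ξ x) (formMeasure b ξ)

end Manifold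

section Eleven

variable {E : Type*} [NormedAddCommGroup E] [NormedSpace ℝ E]
  {H : Type*} [TopologicalSpace H] {I : ModelWithCorners ℝ E H}
  {M : Type*} [TopologicalSpace M] [ChartedSpace H M] (b : Module.Basis (Fin 11) ℝ E)

/-- `(R - |G|² / 2) dvol_g` with `G = dC`. -/
def einsteinMaxwell11 (τ : DForm I M 11) (g : BilinField I M) (C : DForm I M 3) : DForm I M 11 :=
  fun x => (scalarCurvature b g x - (1 / 2) * normSq b g (extD C) x) • volForm b τ g x

/-- `C ∧ G ∧ G` with `G = dC`. -/
def chernSimons11 (C : DForm I M 3) : DForm I M 11 := wedge (wedge C (extD C)) (extD C)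

/-- The bosonic action of eleven-dimensional supergravity. -/
def action11 [MeasurableSpace E] [BorelSpace E] (κ : ℝ) (τ : DForm I M 11)
    (g : BilinField I M) (C : DForm I M 3) : ℝ :=
  1 / (2 * κ ^ 2) * integralForm b τ (einsteinMaxwell11 b τ g C)
    - 1 / (12 * κ ^ 2) * integralForm b τ (chernSimons11 C)

end Eleven

section TypeIIA

variable {E : Type*} [NormedAddCommGroup E] [NormedSpace ℝ E]
  {H : Type*} [TopologicalSpace H] {I : ModelWithCorners ℝ E H}
  {N : Type*} [TopologicalSpace N] [ChartedSpace H N] (b : Module.Basis (Fin 10) ℝ E)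

/-- `G̃₄ = G₄ - C₁ ∧ H₃` with `G₄ = dC₃` and `H₃ = dB₂`. -/
def tildeG4 (C₁ : DForm I N 1) (B₂ : DForm I N 2) (C₃ : DForm I N 3) : DForm I N 4 :=
  extD C₃ - (wedge C₁ (extD B₂) : DForm I N 4)

/-- `e^{-2φ} (R + 4 |dφ|² - |H₃|² / 2) dvol_g`. -/
def densityNS (τ : DForm I N 10) (g : BilinField I N) (φ : N → ℝ) (B₂ : DForm I N 2) :
    DForm I N 10 :=
  fun x => (Real.exp (-2 * φ x) * (scalarCurvature b g x + 4 * normSq b g (dFun φ) x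
    - (1 / 2) * normSq b g (extD B₂) x)) • volForm b τ g x

/-- `(|G₂|² + |G̃₄|²) dvol_g` with `G₂ = dC₁`. -/
def densityR (τ : DForm I N 10) (g : BilinField I N) (C₁ : DForm I N 1) (B₂ : DForm I N 2)
    (C₃ : DForm I N 3) : DForm I N 10 :=
  fun x => (normSq b g (extD C₁) x + normSq b g (tildeG4 C₁ B₂ C₃) x) • volForm b τ g x

/-- `B₂ ∧ G₄ ∧ G₄`. -/
def densityCS (B₂ : DForm I N 2) (C₃ : DForm I N 3) : DForm I N 10 :=
  wedge (wedge B₂ (extD C₃)) (extD C₃)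

/-- The bosonic action of type IIA supergravity in the string frame, `S_NS + S_RIIA + S_CSIIA`. -/
def actionIIA [MeasurableSpace E] [BorelSpace E] (κ : ℝ) (τ : DForm I N 10)
    (g : BilinField I N) (φ : N → ℝ) (C₁ : DForm I N 1) (B₂ : DForm I N 2) (C₃ : DForm I N 3) : ℝ :=
  1 / (2 * κ ^ 2) * integralForm b τ (densityNS b τ g φ B₂)
    + -(1 / (4 * κ ^ 2)) * integralForm b τ (densityR b τ g C₁ B₂ C₃)
    + -(1 / (4 * κ ^ 2)) * integralForm b τ (densityCS B₂ C₃)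

/-- The `9`-form `e^{-2φ} * dφ`, where the Hodge star of the `1`-form `dφ` is `i_{(dφ)^♯} dvol_g`. -/
def dilatonFlux (τ : DForm I N 10) (g : BilinField I N) (φ : N → ℝ) : DForm I N 9 := fun x =>
  Real.exp (-2 * φ x) •
    interiorAt (sharpAt (tbasis b x) (g x) (dFun (I := I) φ x)) (volForm b τ g x)

/-- The `9`-form `C₃ ∧ G₄ ∧ B₂`. -/
def chernSimonsFlux (B₂ : DForm I N 2) (C₃ : DForm I N 3) : DForm I N 9 :=
  wedge (wedge C₃ (extD C₃)) B₂

end TypeIIA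

section Reduction

/-- The model with corners of `N × S¹`. -/
abbrev IM := (𝓡 10).prod (𝓡 1)

/-- The standard coordinates on `ℝ¹⁰`. -/
def bN : Module.Basis (Fin 10) ℝ (EuclideanSpace ℝ (Fin 10)) :=
  (EuclideanSpace.basisFun (Fin 10) ℝ).toBasis

/-- The standard coordinate on `ℝ¹`. -/
def bS : Module.Basis (Fin 1) ℝ (EuclideanSpace ℝ (Fin 1)) :=
  (EuclideanSpace.basisFun (Fin 1) ℝ).toBasis

/-- The standard coordinates on `ℝ¹⁰ × ℝ¹`. -/
def bM : Module.Basis (Fin 11) ℝ (EuclideanSpace ℝ (Fin 10) × EuclideanSpace ℝ (Fin 1)) :=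
  (bN.prod bS).reindex finSumFinEquiv

/-- Metrics on the circle that are invariant under rotations. -/
structure IsInvariantCircleMetric (gS : BilinField (𝓡 1) Circle) : Prop where
  riemannian : IsRiemannianMetric bS gS
  invariant : ∀ (z w : Circle) (S T : TangentSpace (𝓡 1) w),
    gS (z * w) (mfderiv (𝓡 1) (𝓡 1) (fun u : Circle => z * u) w S)
      (mfderiv (𝓡 1) (𝓡 1) (fun u : Circle => z * u) w T) = gS w S T

variable {N : Type*} [TopologicalSpace N] [ChartedSpace (EuclideanSpace ℝ (Fin 10)) N]

/-- The product orientation of `N × S¹`. -/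
def productOrientation (τN : DForm (𝓡 10) N 10) (τS : DForm (𝓡 1) Circle 1) :
    DForm IM (N × Circle) 11 :=
  wedge (pullback Prod.fst τN : DForm IM (N × Circle) 10)
    (pullback Prod.snd τS : DForm IM (N × Circle) 1)

/-- The metric `g_M` on `N × S¹`, where `X` and `S` are the components of a tangent vector along
`N` and `S¹`:
`g_M(X, Y) = e^{-2φ/3} g_N(X, Y) + e^{4φ/3} C₁(X) C₁(Y)`, `g_M(X, S) = -e^{4φ/3} C₁(X) α(S)`
and `g_M(S, T) = e^{4φ/3} g_{S¹}(S, T)`. -/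
def liftMetric (gN : BilinField (𝓡 10) N) (φ : N → ℝ) (C₁ : DForm (𝓡 10) N 1)
    (gS : BilinField (𝓡 1) Circle) (α : DForm (𝓡 1) Circle 1) : BilinField IM (N × Circle) :=
  fun p =>
    let dN : TangentSpace IM p →ₗ[ℝ] TangentSpace (𝓡 10) p.1 := mfderiv IM (𝓡 10) Prod.fst p
    let dS : TangentSpace IM p →ₗ[ℝ] TangentSpace (𝓡 1) p.2 := mfderiv IM (𝓡 1) Prod.snd p
    let c : TangentSpace IM p →ₗ[ℝ] ℝ := asLinear (C₁ p.1) ∘ₗ dN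
    let a : TangentSpace IM p →ₗ[ℝ] ℝ := asLinear (α p.2) ∘ₗ dS
    Real.exp (-2 * φ p.1 / 3) • (gN p.1).comp dN dN
      + Real.exp (4 * φ p.1 / 3) •
        (LinearMap.BilinForm.linMulLin c c - LinearMap.BilinForm.linMulLin c a
          - LinearMap.BilinForm.linMulLin a c + (gS p.2).comp dS dS)

/-- The `3`-form `C = π_N^* C₃ + π_N^* B₂ ∧ π_{S¹}^* α` on `N × S¹`. -/
def liftC (B₂ : DForm (𝓡 10) N 2) (C₃ : DForm (𝓡 10) N 3) (α : DForm (𝓡 1) Circle 1) :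
    DForm IM (N × Circle) 3 :=
  (pullback Prod.fst C₃ : DForm IM (N × Circle) 3)
    + (wedge (pullback Prod.fst B₂ : DForm IM (N × Circle) 2)
        (pullback Prod.snd α : DForm IM (N × Circle) 1) : DForm IM (N × Circle) 3)

end Reduction

end Sugra

end

open Sugra

noncomputable section

namespace Sugra

set_option linter.unusedSectionVars false
set_option maxSynthPendingDepth 3

/-! ### Alternating sums and the algebra of the wedge product -/

section AltSum

variable {X : Type*}

/-- The sum `∑_σ sgn(σ) T(v ∘ σ)` over all permutations. -/
def altSum {n : ℕ} (T : (Fin n → X) → ℝ) (v : Fin n → X) : ℝ :=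
  ∑ σ : Equiv.Perm (Fin n), ((Equiv.Perm.sign σ : ℤ) : ℝ) * T (v ∘ σ)

theorem altSum_comp_perm {n : ℕ} (T : (Fin n → X) → ℝ) (τ : Equiv.Perm (Fin n)) (v : Fin n → X) :
    altSum (fun u => T (u ∘ τ)) v = ((Equiv.Perm.sign τ : ℤ) : ℝ) * altSum T v := by
  unfold altSum
  rw [Finset.mul_sum]
  refine Fintype.sum_equiv (Equiv.mulRight τ) _ _ fun σ => ?_
  rw [← mul_assoc, Equiv.coe_mulRight, Equiv.Perm.sign_mul]
  congr 1
  rcases Int.units_eq_one_or (Equiv.Perm.sign τ) with h | h <;> simp [h]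

theorem altSum_cast {n m : ℕ} (h : n = m) (T : (Fin n → X) → ℝ) (v : Fin n → X) :
    altSum T v = altSum (fun u : Fin m → X => T (u ∘ Fin.cast h)) (v ∘ Fin.cast h.symm) := by
  subst h; rfl

theorem altSum_const_mul {n : ℕ} (c : ℝ) (T : (Fin n → X) → ℝ) (v : Fin n → X) :
    altSum (fun u => c * T u) v = c * altSum T v := by
  unfold altSum
  rw [Finset.mul_sum]
  exact Finset.sum_congr rfl fun σ _ => by ring

theorem altSum_add {n : ℕ} (S T : (Fin n → X) → ℝ) (v : Fin n → X) :
    altSum (fun u => S u + T u) v = altSum S v + altSum T v := by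
  unfold altSum
  rw [← Finset.sum_add_distrib]
  exact Finset.sum_congr rfl fun σ _ => by ring

theorem altSum_sum {n : ℕ} {ι : Type*} (s : Finset ι) (T : ι → (Fin n → X) → ℝ) (v : Fin n → X) :
    altSum (fun u => ∑ i ∈ s, T i u) v = ∑ i ∈ s, altSum (T i) v := by
  unfold altSum
  rw [Finset.sum_comm]
  exact Finset.sum_congr rfl fun σ _ => by rw [Finset.mul_sum]

/-- A permutation of the first and of the last indices. -/
def blockPerm {m l : ℕ} (τ : Equiv.Perm (Fin m)) (ρ : Equiv.Perm (Fin l)) :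
    Equiv.Perm (Fin (m + l)) :=
  finSumFinEquiv.permCongr (Equiv.Perm.sumCongr τ ρ)

theorem sign_blockPerm {m l : ℕ} (τ : Equiv.Perm (Fin m)) (ρ : Equiv.Perm (Fin l)) :
    Equiv.Perm.sign (blockPerm τ ρ) = Equiv.Perm.sign τ * Equiv.Perm.sign ρ := by
  rw [blockPerm, Equiv.Perm.sign_permCongr, Equiv.Perm.sign_sumCongr]

theorem blockPerm_comp_castAdd {m l : ℕ} (τ : Equiv.Perm (Fin m)) (ρ : Equiv.Perm (Fin l)) :
    blockPerm τ ρ ∘ Fin.castAdd l = Fin.castAdd l ∘ τ := by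
  ext i; simp [blockPerm, Equiv.permCongr_apply]

theorem blockPerm_comp_natAdd {m l : ℕ} (τ : Equiv.Perm (Fin m)) (ρ : Equiv.Perm (Fin l)) :
    blockPerm τ ρ ∘ Fin.natAdd m = Fin.natAdd m ∘ ρ := by
  ext i; simp [blockPerm, Equiv.permCongr_apply]

theorem sign_mul_self_real {n : ℕ} (σ : Equiv.Perm (Fin n)) :
    ((Equiv.Perm.sign σ : ℤ) : ℝ) * ((Equiv.Perm.sign σ : ℤ) : ℝ) = 1 := by
  rcases Int.units_eq_one_or (Equiv.Perm.sign σ) with h | h <;> simp [h]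

theorem altSum_altSum_left {m l : ℕ} (S : (Fin m → X) → (Fin l → X) → ℝ) (v : Fin (m + l) → X) :
    altSum (fun u : Fin (m + l) → X =>
        altSum (fun w => S w (u ∘ Fin.natAdd m)) (u ∘ Fin.castAdd l)) v
      = m.factorial * altSum (fun u => S (u ∘ Fin.castAdd l) (u ∘ Fin.natAdd m)) v := by
  conv_lhs => enter [1, u]; unfold altSum
  rw [altSum_sum, Finset.sum_congr rfl (g := fun _ =>
    altSum (fun u => S (u ∘ Fin.castAdd l) (u ∘ Fin.natAdd m)) v)]
  · simp [Fintype.card_perm]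
  intro τ _
  rw [altSum_const_mul]
  have := altSum_comp_perm (fun u => S (u ∘ Fin.castAdd l) (u ∘ Fin.natAdd m))
    (blockPerm τ (1 : Equiv.Perm (Fin l))) v
  simp only [Function.comp_assoc, blockPerm_comp_castAdd, blockPerm_comp_natAdd, sign_blockPerm,
    Equiv.Perm.coe_one, Equiv.Perm.sign_one, mul_one, Function.comp_id] at this
  simp only [Function.comp_assoc]
  rw [this, ← mul_assoc, sign_mul_self_real, one_mul]

theorem altSum_altSum_right {m l : ℕ} (S : (Fin m → X) → (Fin l → X) → ℝ) (v : Fin (m + l) → X) :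
    altSum (fun u : Fin (m + l) → X =>
        altSum (fun w => S (u ∘ Fin.castAdd l) w) (u ∘ Fin.natAdd m)) v
      = l.factorial * altSum (fun u => S (u ∘ Fin.castAdd l) (u ∘ Fin.natAdd m)) v := by
  conv_lhs => enter [1, u]; unfold altSum
  rw [altSum_sum, Finset.sum_congr rfl (g := fun _ =>
    altSum (fun u => S (u ∘ Fin.castAdd l) (u ∘ Fin.natAdd m)) v)]
  · simp [Fintype.card_perm]
  intro τ _
  rw [altSum_const_mul]
  have := altSum_comp_perm (fun u => S (u ∘ Fin.castAdd l) (u ∘ Fin.natAdd m))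
    (blockPerm (1 : Equiv.Perm (Fin m)) τ) v
  simp only [Function.comp_assoc, blockPerm_comp_castAdd, blockPerm_comp_natAdd, sign_blockPerm,
    Equiv.Perm.coe_one, Equiv.Perm.sign_one, one_mul, Function.comp_id] at this
  simp only [Function.comp_assoc]
  rw [this, ← mul_assoc, sign_mul_self_real, one_mul]

theorem finRotate_pow_val (n l : ℕ) (i : Fin n) :
    (((finRotate n) ^ l) i : ℕ) = (i + l) % n := by
  induction l with
  | zero => simp [Nat.mod_eq_of_lt i.2]
  | succ l ih =>
    cases n with
    | zero => exact i.elim0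
    | succ n =>
      rw [pow_succ', Equiv.Perm.mul_apply, finRotate_apply, Fin.val_add, ih]
      simp [Nat.add_assoc]

/-- Exchanging two blocks of variables. -/
theorem altSum_swap {k l : ℕ} (S : (Fin k → X) → (Fin l → X) → ℝ) (v : Fin (k + l) → X) :
    altSum (fun u => S (u ∘ Fin.castAdd l) (u ∘ Fin.natAdd k)) v
      = (-1) ^ (k * l) * altSum (fun u : Fin (l + k) → X =>
          S (u ∘ Fin.natAdd l) (u ∘ Fin.castAdd k)) (v ∘ Fin.cast (Nat.add_comm l k)) := by
  rw [altSum_cast (Nat.add_comm l k)]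
  have hcast : (v ∘ Fin.cast (Nat.add_comm l k)) ∘ Fin.cast (Nat.add_comm l k).symm = v := by
    ext i; rfl
  rw [hcast]
  have h := altSum_comp_perm (fun u : Fin (k + l) → X =>
    S ((u ∘ Fin.cast (Nat.add_comm l k)) ∘ Fin.natAdd l)
      ((u ∘ Fin.cast (Nat.add_comm l k)) ∘ Fin.castAdd k)) ((finRotate (k + l)) ^ k) v
  have h2 : ((finRotate (k + l)) ^ k : Equiv.Perm (Fin (k + l)))
      ∘ Fin.cast (Nat.add_comm l k) ∘ Fin.natAdd l = Fin.castAdd l := by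
    ext i
    simp only [Function.comp_apply, finRotate_pow_val, Fin.val_cast, Fin.val_natAdd,
      Fin.val_castAdd]
    rw [show l + i.1 + k = i.1 + (k + l) by ring, Nat.add_mod_right,
      Nat.mod_eq_of_lt (by omega)]
  have h3 : ((finRotate (k + l)) ^ k : Equiv.Perm (Fin (k + l)))
      ∘ Fin.cast (Nat.add_comm l k) ∘ Fin.castAdd k = Fin.natAdd k := by
    ext i
    simp only [Function.comp_apply, finRotate_pow_val, Fin.val_cast, Fin.val_natAdd,
      Fin.val_castAdd]
    rw [Nat.mod_eq_of_lt (by omega), Nat.add_comm]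
  simp only [Function.comp_assoc] at h ⊢
  rw [h2, h3] at h
  rw [h]
  congr 1
  rw [map_pow, sign_finRotate]
  push_cast
  rw [← pow_mul]
  rcases Nat.eq_zero_or_pos k with rfl | hk
  · simp
  obtain ⟨k, rfl⟩ : ∃ j, k = j + 1 := ⟨k - 1, by omega⟩
  rw [show k + 1 + l - 1 = k + l by omega, show (k + l) * (k + 1) = k * (k + 1) + (k + 1) * l by ring,
    pow_add, (Nat.even_mul_succ_self k).neg_one_pow, one_mul]

theorem altSum_removeNth {n : ℕ} (T : X → (Fin n → X) → ℝ) (v : Fin (n + 1) → X) :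
    altSum (fun u : Fin (n + 1) → X => ∑ i : Fin (n + 1), (-1 : ℝ) ^ (i : ℕ) *
      T (u i) (i.removeNth u)) v
      = (n + 1) * altSum (fun u => T (u 0) (u ∘ Fin.succ)) v := by
  rw [altSum_sum, Finset.sum_congr rfl (g := fun _ => altSum (fun u => T (u 0) (u ∘ Fin.succ)) v)]
  · simp
  intro i _
  have h := altSum_comp_perm (fun u => T (u 0) (u ∘ Fin.succ)) (i.cycleRange.symm) v
  rw [altSum_const_mul]
  have h2 : (i.cycleRange.symm : Fin (n + 1) → Fin (n + 1)) ∘ Fin.succ = i.succAbove := by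
    ext j; simp [Fin.cycleRange_symm_succ]
  simp only [Function.comp_assoc, h2, Function.comp_apply, Fin.cycleRange_symm_zero,
    Equiv.Perm.sign_symm, Fin.sign_cycleRange] at h
  have h3 : ∀ u : Fin (n + 1) → X, i.removeNth u = u ∘ i.succAbove := fun u => rfl
  simp only [h3]
  rw [h, ← mul_assoc]
  push_cast
  rw [← mul_pow]
  simp

end AltSum

section WedgeAlgebra

variable {V : Type*} [AddCommGroup V] [Module ℝ V] [TopologicalSpace V]

theorem altSum_form {n : ℕ} (ξ : V [⋀^Fin n]→L[ℝ] ℝ) (v : Fin n → V) :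
    altSum ξ v = n.factorial * ξ v := by
  unfold altSum
  rw [Finset.sum_congr rfl (g := fun _ => ξ v)]
  · simp [Fintype.card_perm]
  intro σ _
  have : ξ (v ∘ σ) = Equiv.Perm.sign σ • ξ v := ξ.toAlternatingMap.map_perm v σ
  rw [this, Units.smul_def, zsmul_eq_mul, ← mul_assoc, sign_mul_self_real, one_mul]

theorem wedgeAt_eq_altSum {k l : ℕ} (ξ : V [⋀^Fin k]→L[ℝ] ℝ) (η : V [⋀^Fin l]→L[ℝ] ℝ)
    (v : Fin (k + l) → V) :
    wedgeAt ξ η v = ((k.factorial : ℝ) * (l.factorial : ℝ))⁻¹ *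
      altSum (fun u => ξ (u ∘ Fin.castAdd l) * η (u ∘ Fin.natAdd k)) v :=
  wedgeAt_apply ξ η v

theorem wedgeAt_assoc {k l m : ℕ} (ξ : V [⋀^Fin k]→L[ℝ] ℝ) (η : V [⋀^Fin l]→L[ℝ] ℝ)
    (ζ : V [⋀^Fin m]→L[ℝ] ℝ) (v : Fin (k + l + m) → V) :
    wedgeAt (wedgeAt ξ η) ζ v = wedgeAt ξ (wedgeAt η ζ) (v ∘ Fin.cast (Nat.add_assoc k l m).symm) := by
  have hL : wedgeAt (wedgeAt ξ η) ζ v =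
      ((k.factorial : ℝ) * (l.factorial : ℝ) * (m.factorial : ℝ))⁻¹ *
      altSum (fun u => ξ ((u ∘ Fin.castAdd m) ∘ Fin.castAdd l) * η ((u ∘ Fin.castAdd m) ∘ Fin.natAdd k)
        * ζ (u ∘ Fin.natAdd (k + l))) v := by
    have h := altSum_altSum_left (fun (w : Fin (k + l) → V) (z : Fin m → V) =>
      ξ (w ∘ Fin.castAdd l) * η (w ∘ Fin.natAdd k) * ζ z) v
    have h2 : (fun u : Fin (k + l + m) → V => wedgeAt ξ η (u ∘ Fin.castAdd m) * ζ (u ∘ Fin.natAdd (k + l)))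
      = fun u => ((k.factorial : ℝ) * (l.factorial : ℝ))⁻¹ * altSum (fun w =>
          ξ (w ∘ Fin.castAdd l) * η (w ∘ Fin.natAdd k) * ζ (u ∘ Fin.natAdd (k + l))) (u ∘ Fin.castAdd m) := by
      funext u
      rw [wedgeAt_eq_altSum, mul_assoc, mul_comm (altSum _ _), ← altSum_const_mul]
      congr 1
      exact congrArg (fun T => altSum T _) (funext fun w => by ring)
    rw [wedgeAt_eq_altSum, h2, altSum_const_mul, h]
    have := Nat.factorial_ne_zero (k + l)
    field_simp
  have hR : ∀ w, wedgeAt ξ (wedgeAt η ζ) w =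
      ((k.factorial : ℝ) * (l.factorial : ℝ) * (m.factorial : ℝ))⁻¹ *
      altSum (fun u => ξ (u ∘ Fin.castAdd (l + m)) * η ((u ∘ Fin.natAdd k) ∘ Fin.castAdd m)
        * ζ ((u ∘ Fin.natAdd k) ∘ Fin.natAdd l)) w := by
    intro w
    have h := altSum_altSum_right (fun (w : Fin k → V) (z : Fin (l + m) → V) =>
      ξ w * η (z ∘ Fin.castAdd m) * ζ (z ∘ Fin.natAdd l)) w
    have h2 : (fun u : Fin (k + (l + m)) → V =>
        ξ (u ∘ Fin.castAdd (l + m)) * wedgeAt η ζ (u ∘ Fin.natAdd k))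
      = fun u => ((l.factorial : ℝ) * (m.factorial : ℝ))⁻¹ * altSum (fun w =>
          ξ (u ∘ Fin.castAdd (l + m)) * η (w ∘ Fin.castAdd m) * ζ (w ∘ Fin.natAdd l))
            (u ∘ Fin.natAdd k) := by
      funext u
      rw [wedgeAt_eq_altSum, mul_left_comm, ← altSum_const_mul]
      congr 1
      exact congrArg (fun T => altSum T _) (funext fun w => by ring)
    rw [wedgeAt_eq_altSum, h2, altSum_const_mul, h]
    have := Nat.factorial_ne_zero (l + m)
    field_simp
  rw [hL, hR, altSum_cast (Nat.add_assoc k l m)]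
  have e : ∀ u : Fin (k + (l + m)) → V, (u ∘ Fin.cast (Nat.add_assoc k l m)) ∘ Fin.natAdd (k + l)
      = (u ∘ Fin.natAdd k) ∘ Fin.natAdd l := by
    intro u; ext i
    simp only [Function.comp_apply]
    congr 1
    ext; simp [Nat.add_assoc]
  simp only [e]
  rfl

theorem wedgeAt_comm {k l : ℕ} (ξ : V [⋀^Fin k]→L[ℝ] ℝ) (η : V [⋀^Fin l]→L[ℝ] ℝ)
    (v : Fin (k + l) → V) :
    wedgeAt ξ η v = (-1) ^ (k * l) * wedgeAt η ξ (v ∘ Fin.cast (Nat.add_comm l k)) := by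
  rw [wedgeAt_eq_altSum, wedgeAt_eq_altSum,
    altSum_swap (fun w z => ξ w * η z) v, mul_comm (k.factorial : ℝ)]
  simp only [mul_comm (ξ _)]
  ring

theorem wedgeAt_add_left {k l : ℕ} (ξ ξ' : V [⋀^Fin k]→L[ℝ] ℝ) (η : V [⋀^Fin l]→L[ℝ] ℝ) :
    wedgeAt (ξ + ξ') η = wedgeAt ξ η + wedgeAt ξ' η := by
  ext v
  simp only [wedgeAt_eq_altSum, ContinuousAlternatingMap.add_apply, add_mul, altSum_add, mul_add]

theorem wedgeAt_add_right {k l : ℕ} (ξ : V [⋀^Fin k]→L[ℝ] ℝ) (η η' : V [⋀^Fin l]→L[ℝ] ℝ) :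
    wedgeAt ξ (η + η') = wedgeAt ξ η + wedgeAt ξ η' := by
  ext v
  simp only [wedgeAt_eq_altSum, ContinuousAlternatingMap.add_apply, altSum_add, mul_add]

theorem wedgeAt_smul_left {k l : ℕ} (c : ℝ) (ξ : V [⋀^Fin k]→L[ℝ] ℝ) (η : V [⋀^Fin l]→L[ℝ] ℝ) :
    wedgeAt (c • ξ) η = c • wedgeAt ξ η := by
  ext v
  simp only [wedgeAt_eq_altSum, ContinuousAlternatingMap.smul_apply, smul_eq_mul, mul_assoc,
    altSum_const_mul]
  ring

theorem wedgeAt_smul_right {k l : ℕ} (c : ℝ) (ξ : V [⋀^Fin k]→L[ℝ] ℝ) (η : V [⋀^Fin l]→L[ℝ] ℝ) :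
    wedgeAt ξ (c • η) = c • wedgeAt ξ η := by
  ext v
  simp only [wedgeAt_eq_altSum, ContinuousAlternatingMap.smul_apply, smul_eq_mul, mul_left_comm _ c,
    altSum_const_mul]

/-- The wedge product as a bilinear map. -/
def wedgeLin (V : Type*) [AddCommGroup V] [Module ℝ V] [TopologicalSpace V] (k l : ℕ) :
    (V [⋀^Fin k]→L[ℝ] ℝ) →ₗ[ℝ] (V [⋀^Fin l]→L[ℝ] ℝ) →ₗ[ℝ] (V [⋀^Fin (k + l)]→L[ℝ] ℝ) :=
  LinearMap.mk₂ ℝ wedgeAt wedgeAt_add_left (fun c ξ η => wedgeAt_smul_left c ξ η)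
    wedgeAt_add_right (fun c ξ η => wedgeAt_smul_right c ξ η)

/-- The value of a wedge product only depends on the values of the factors. -/
theorem wedgeAt_congr {W : Type*} [AddCommGroup W] [Module ℝ W] [TopologicalSpace W] {k l : ℕ}
    {ξ : V [⋀^Fin k]→L[ℝ] ℝ} {η : V [⋀^Fin l]→L[ℝ] ℝ} {ξ' : W [⋀^Fin k]→L[ℝ] ℝ}
    {η' : W [⋀^Fin l]→L[ℝ] ℝ} {v : Fin (k + l) → V} {w : Fin (k + l) → W}
    (h : ∀ s : Fin k → Fin (k + l), ξ (v ∘ s) = ξ' (w ∘ s))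
    (h' : ∀ s : Fin l → Fin (k + l), η (v ∘ s) = η' (w ∘ s)) : wedgeAt ξ η v = wedgeAt ξ' η' w := by
  rw [wedgeAt_eq_altSum, wedgeAt_eq_altSum]
  unfold altSum
  simp only [Function.comp_assoc, h, h']

theorem wedgeAt_comp {W : Type*} [AddCommGroup W] [Module ℝ W] [TopologicalSpace W] {k l : ℕ}
    (ξ : V [⋀^Fin k]→L[ℝ] ℝ) (η : V [⋀^Fin l]→L[ℝ] ℝ) (A : W →L[ℝ] V) :
    (wedgeAt ξ η).compContinuousLinearMap A
      = wedgeAt (ξ.compContinuousLinearMap A) (η.compContinuousLinearMap A) := by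
  ext w
  rw [ContinuousAlternatingMap.compContinuousLinearMap_apply]
  exact wedgeAt_congr (fun s => by
    rw [ContinuousAlternatingMap.compContinuousLinearMap_apply]; rfl) (fun s => by
    rw [ContinuousAlternatingMap.compContinuousLinearMap_apply]; rfl)

end WedgeAlgebra

section NormedWedge

variable {E : Type*} [NormedAddCommGroup E] [NormedSpace ℝ E]

theorem factorial_mul_alternatizeUncurryFin {n : ℕ} (L : E →L[ℝ] E [⋀^Fin n]→L[ℝ] ℝ)
    (v : Fin (n + 1) → E) :
    n.factorial * ContinuousAlternatingMap.alternatizeUncurryFin L v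
      = altSum (fun u : Fin (n + 1) → E => L (u 0) (u ∘ Fin.succ)) v := by
  have h := altSum_form (ContinuousAlternatingMap.alternatizeUncurryFin L) v
  have h2 : (fun u => ContinuousAlternatingMap.alternatizeUncurryFin L u) =
    (fun u => ∑ i : Fin (n + 1), (-1 : ℝ) ^ (i : ℕ) * L (u i) (i.removeNth u)) := by
    funext u
    rw [ContinuousAlternatingMap.alternatizeUncurryFin_apply]
    simp
  have h3 : altSum (⇑(ContinuousAlternatingMap.alternatizeUncurryFin L)) v =
    (n + 1) * altSum (fun u : Fin (n + 1) → E => L (u 0) (u ∘ Fin.succ)) v := by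
    rw [← altSum_removeNth (fun x u => L x u)]
    exact congrArg (fun T => altSum T v) h2
  rw [h3, Nat.factorial_succ] at h
  push_cast at h
  have hn : (n : ℝ) + 1 ≠ 0 := by positivity
  rw [mul_assoc] at h
  exact (mul_left_cancel₀ hn h).symm

/-- The wedge product of a `1`-form and a form. -/
theorem wedgeAt_one_left {n : ℕ} (α : E [⋀^Fin 1]→L[ℝ] ℝ) (ξ : E [⋀^Fin n]→L[ℝ] ℝ)
    (v : Fin (n + 1) → E) :
    wedgeAt α ξ (v ∘ Fin.cast (Nat.add_comm 1 n))
      = ∑ i : Fin (n + 1), (-1 : ℝ) ^ (i : ℕ) * (α (fun _ => v i) * ξ (i.removeNth v)) := by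
  set L : E →L[ℝ] E [⋀^Fin n]→L[ℝ] ℝ :=
    ((ContinuousAlternatingMap.ofSubsingleton ℝ E ℝ (0 : Fin 1)).symm α : E →L[ℝ] ℝ).smulRight ξ
  have h := factorial_mul_alternatizeUncurryFin L v
  have hL : ∀ x u, L x u = α (fun _ => x) * ξ u := fun x u => rfl
  have h2 : ContinuousAlternatingMap.alternatizeUncurryFin L v
    = ∑ i : Fin (n + 1), (-1 : ℝ) ^ (i : ℕ) * (α (fun _ => v i) * ξ (i.removeNth v)) := by
    rw [ContinuousAlternatingMap.alternatizeUncurryFin_apply]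
    simp [hL]
  rw [← h2, wedgeAt_eq_altSum, altSum_cast (Nat.add_comm 1 n)]
  simp only [hL] at h
  have hf : (n.factorial : ℝ) ≠ 0 := by exact_mod_cast n.factorial_ne_zero
  rw [Nat.factorial_one, Nat.cast_one, one_mul, inv_mul_eq_iff_eq_mul₀ hf, h]
  have h5 : ∀ u : Fin (n + 1) → E, (u ∘ Fin.cast (Nat.add_comm 1 n)) ∘ Fin.castAdd n = fun _ => u 0 := by
    intro u; ext i
    have : i = 0 := Subsingleton.elim _ _
    subst this; rfl
  have h6 : ∀ u : Fin (n + 1) → E, (u ∘ Fin.cast (Nat.add_comm 1 n)) ∘ Fin.natAdd 1 = u ∘ Fin.succ := by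
    intro u; ext i
    simp only [Function.comp_apply]
    congr 1
    ext; simp
  simp only [h5, h6]
  rfl

/-- The Leibniz rule: the first factor is differentiated. -/
theorem alternatize_wedge_left {k l : ℕ} (L : E →L[ℝ] E [⋀^Fin k]→L[ℝ] ℝ) (η : E [⋀^Fin l]→L[ℝ] ℝ)
    (P : E →L[ℝ] E [⋀^Fin (k + l)]→L[ℝ] ℝ) (hP : ∀ x, P x = wedgeAt (L x) η)
    (v : Fin (k + l + 1) → E) :
    ContinuousAlternatingMap.alternatizeUncurryFin P v
      = wedgeAt (ContinuousAlternatingMap.alternatizeUncurryFin L) η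
        (v ∘ Fin.cast (Nat.add_right_comm k 1 l)) := by
  have hP' := factorial_mul_alternatizeUncurryFin P v
  have hf : ((k + l).factorial : ℝ) ≠ 0 := by exact_mod_cast (k + l).factorial_ne_zero
  have hk : (k.factorial : ℝ) ≠ 0 := by exact_mod_cast k.factorial_ne_zero
  have hl : (l.factorial : ℝ) ≠ 0 := by exact_mod_cast l.factorial_ne_zero
  have hk' : ((k + 1).factorial : ℝ) ≠ 0 := by exact_mod_cast (k + 1).factorial_ne_zero
  have hcast : ∀ (T : (Fin (k + l + 1) → E) → ℝ), altSum T v =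
    altSum (fun u : Fin (1 + (k + l)) → E => T (u ∘ Fin.cast (Nat.add_comm (k + l) 1)))
      (v ∘ Fin.cast (Nat.add_comm (k + l) 1).symm) := fun T => altSum_cast _ T v
  have key : altSum (fun u : Fin (k + l + 1) → E => P (u 0) (u ∘ Fin.succ)) v
     = (k + l).factorial * ((k.factorial : ℝ) * l.factorial)⁻¹ * altSum (fun u : Fin (k + l + 1) → E =>
        L (u 0) ((u ∘ Fin.succ) ∘ Fin.castAdd l) * η ((u ∘ Fin.succ) ∘ Fin.natAdd k)) v := by
    rw [hcast, hcast]
    have h1 := altSum_altSum_right (m := 1) (l := k + l) (fun (w : Fin 1 → E) (z : Fin (k + l) → E) =>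
      L (w 0) (z ∘ Fin.castAdd l) * η (z ∘ Fin.natAdd k)) (v ∘ Fin.cast (Nat.add_comm (k + l) 1).symm)
    have e1 : ∀ u : Fin (1 + (k + l)) → E,
        (u ∘ Fin.cast (Nat.add_comm (k + l) 1)) 0 = (u ∘ Fin.castAdd (k + l)) 0 := fun u => rfl
    have e2 : ∀ u : Fin (1 + (k + l)) → E,
        (u ∘ Fin.cast (Nat.add_comm (k + l) 1)) ∘ Fin.succ = u ∘ Fin.natAdd 1 := by
      intro u; ext i
      simp only [Function.comp_apply]
      congr 1
      ext; simp [Nat.add_comm]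
    simp only [e1, e2, hP, wedgeAt_eq_altSum, altSum_const_mul]
    rw [h1]
    ring
  have key2 : wedgeAt (ContinuousAlternatingMap.alternatizeUncurryFin L) η
        (v ∘ Fin.cast (Nat.add_right_comm k 1 l)) = ((k.factorial : ℝ) * l.factorial)⁻¹ *
        altSum (fun u : Fin (k + l + 1) → E =>
        L (u 0) ((u ∘ Fin.succ) ∘ Fin.castAdd l) * η ((u ∘ Fin.succ) ∘ Fin.natAdd k)) v := by
    have h1 := altSum_altSum_left (m := k + 1) (l := l) (fun (w : Fin (k + 1) → E) (z : Fin l → E) =>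
      L (w 0) (w ∘ Fin.succ) * η z) (v ∘ Fin.cast (Nat.add_right_comm k 1 l))
    rw [wedgeAt_eq_altSum]
    have e0 : ∀ w, ContinuousAlternatingMap.alternatizeUncurryFin L w = (k.factorial : ℝ)⁻¹ *
        altSum (fun u : Fin (k + 1) → E => L (u 0) (u ∘ Fin.succ)) w := fun w => by
      rw [← factorial_mul_alternatizeUncurryFin L w]; field_simp
    have e1 : (fun u : Fin (k + 1 + l) → E => ContinuousAlternatingMap.alternatizeUncurryFin L
        (u ∘ Fin.castAdd l) * η (u ∘ Fin.natAdd (k + 1))) = fun u => (k.factorial : ℝ)⁻¹ *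
        altSum (fun w : Fin (k + 1) → E => L (w 0) (w ∘ Fin.succ) * η (u ∘ Fin.natAdd (k + 1)))
          (u ∘ Fin.castAdd l) := by
      funext u
      rw [e0, mul_assoc, mul_comm (altSum _ _), ← altSum_const_mul]
      congr 1
      exact congrArg (fun T => altSum T _) (funext fun w => by ring)
    rw [e1, altSum_const_mul, h1, altSum_cast (Nat.add_right_comm k 1 l)]
    have e2 : (v ∘ Fin.cast (Nat.add_right_comm k 1 l)) ∘ Fin.cast (Nat.add_right_comm k 1 l).symm = v := by
      ext i; rfl
    rw [e2]
    have e3 : ∀ u : Fin (k + l + 1) → E,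
      ((u ∘ Fin.cast (Nat.add_right_comm k 1 l)) ∘ Fin.castAdd l) 0 = u 0 := fun u => rfl
    have e4 : ∀ u : Fin (k + l + 1) → E,
      ((u ∘ Fin.cast (Nat.add_right_comm k 1 l)) ∘ Fin.castAdd l) ∘ Fin.succ
        = (u ∘ Fin.succ) ∘ Fin.castAdd l := fun u => rfl
    have e5 : ∀ u : Fin (k + l + 1) → E,
      (u ∘ Fin.cast (Nat.add_right_comm k 1 l)) ∘ Fin.natAdd (k + 1)
        = (u ∘ Fin.succ) ∘ Fin.natAdd k := by
      intro u; ext i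
      simp only [Function.comp_apply]
      congr 1
      ext; simp; ring
    simp only [e3, e4, e5]
    field_simp
  rw [key2]
  rw [key] at hP'
  field_simp at hP' ⊢
  linarith

/-- The Leibniz rule: the second factor is differentiated. -/
theorem alternatize_wedge_right {k l : ℕ} (ξ : E [⋀^Fin k]→L[ℝ] ℝ) (L : E →L[ℝ] E [⋀^Fin l]→L[ℝ] ℝ)
    (P : E →L[ℝ] E [⋀^Fin (k + l)]→L[ℝ] ℝ) (hP : ∀ x, P x = wedgeAt ξ (L x))
    (v : Fin (k + l + 1) → E) :
    ContinuousAlternatingMap.alternatizeUncurryFin P v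
      = (-1) ^ k * wedgeAt ξ (ContinuousAlternatingMap.alternatizeUncurryFin L) v := by
  have hkl : l + k = k + l := Nat.add_comm l k
  have main : ∀ (m : ℕ) (hm : l + k = m) (Q : E →L[ℝ] E [⋀^Fin m]→L[ℝ] ℝ)
      (Q' : E →L[ℝ] E [⋀^Fin (l + k)]→L[ℝ] ℝ) (c : ℝ)
      (hQ : ∀ x w, Q x w = c * Q' x (w ∘ Fin.cast hm)) (v : Fin (m + 1) → E),
      ContinuousAlternatingMap.alternatizeUncurryFin Q v
        = c * ContinuousAlternatingMap.alternatizeUncurryFin Q' (v ∘ Fin.cast (by rw [hm])) := by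
    intro m hm Q Q' c hQ v
    subst hm
    simp only [ContinuousAlternatingMap.alternatizeUncurryFin_apply, hQ, Finset.mul_sum]
    refine Finset.sum_congr rfl fun i _ => ?_
    simp only [zsmul_eq_mul]
    push_cast
    rw [mul_left_comm]
    rfl
  obtain ⟨Q', hQ'⟩ : ∃ Q' : E →L[ℝ] E [⋀^Fin (l + k)]→L[ℝ] ℝ, ∀ x, Q' x = wedgeAt (L x) ξ := by
    have hcongr : ∀ (m : ℕ) (hm : m = l + k) (Q : E →L[ℝ] E [⋀^Fin m]→L[ℝ] ℝ),
        ∃ Q' : E →L[ℝ] E [⋀^Fin (l + k)]→L[ℝ] ℝ, ∀ x w, Q' x w = Q x (w ∘ Fin.cast hm) := by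
      intro m hm Q; subst hm; exact ⟨Q, fun x w => rfl⟩
    obtain ⟨Q', h⟩ := hcongr _ hkl.symm (((-1 : ℝ) ^ (k * l)) • P)
    refine ⟨Q', fun x => ?_⟩
    ext w
    rw [h, wedgeAt_comm]
    simp only [_root_.smul_apply, ContinuousAlternatingMap.smul_apply, hP, smul_eq_mul]
    rw [Nat.mul_comm]
  rw [main _ hkl P Q' ((-1) ^ (k * l)) (fun x w => by rw [hP, hQ', wedgeAt_comm]) v,
    alternatize_wedge_left L ξ Q' hQ', wedgeAt_comm]
  have e : ((v ∘ Fin.cast (by omega : l + k + 1 = k + l + 1)) ∘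
      Fin.cast (Nat.add_right_comm l 1 k)) ∘ Fin.cast (Nat.add_comm k (l + 1)) = v := by
    ext i; rfl
  rw [e, ← mul_assoc, ← pow_add]
  congr 1
  rw [show k * l + (l + 1) * k = k + 2 * (k * l) by ring, pow_add, pow_mul]
  simp

end NormedWedge

section FormSpace

variable {E : Type*} [NormedAddCommGroup E] [NormedSpace ℝ E] [FiniteDimensional ℝ E]

instance finiteDimensional_forms (k : ℕ) : FiniteDimensional ℝ (E [⋀^Fin k]→L[ℝ] ℝ) := by
  let Φ : (E [⋀^Fin k]→L[ℝ] ℝ) →ₗ[ℝ] MultilinearMap ℝ (fun _ : Fin k => E) ℝ :=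
    { toFun := fun ζ => ζ.toMultilinearMap
      map_add' := fun _ _ => rfl
      map_smul' := fun _ _ => rfl }
  refine FiniteDimensional.of_injective Φ fun ζ η h => ?_
  ext v
  exact congrArg (fun m : MultilinearMap ℝ (fun _ : Fin k => E) ℝ => m v) h

/-- Evaluation of a form on vectors as a continuous linear map. -/
def evalForm {k : ℕ} (v : Fin k → E) : (E [⋀^Fin k]→L[ℝ] ℝ) →L[ℝ] ℝ :=
  LinearMap.toContinuousLinearMap
    { toFun := fun ζ => ζ v
      map_add' := fun _ _ => rfl
      map_smul' := fun _ _ => rfl }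

variable {F : Type*} [NormedAddCommGroup F] [NormedSpace ℝ F]

theorem exists_form_reconstruct (E : Type*) [NormedAddCommGroup E] [NormedSpace ℝ E]
    [FiniteDimensional ℝ E] (k : ℕ) :
    ∃ (ι : Type) (_ : Fintype ι) (w : ι → Fin k → E) (R : (ι → ℝ) →L[ℝ] (E [⋀^Fin k]→L[ℝ] ℝ)),
      ∀ ζ : E [⋀^Fin k]→L[ℝ] ℝ, R (fun i => ζ (w i)) = ζ := by
  let b := Module.finBasis ℝ E
  let Φ : (E [⋀^Fin k]→L[ℝ] ℝ) →ₗ[ℝ] ((Fin k → Fin (Module.finrank ℝ E)) → ℝ) :=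
    { toFun := fun ζ μ => ζ (fun i => b (μ i))
      map_add' := fun _ _ => rfl
      map_smul' := fun _ _ => rfl }
  have hΦ : LinearMap.ker Φ = ⊥ := by
    refine LinearMap.ker_eq_bot.2 fun ζ η h => ?_
    have : ζ.toMultilinearMap = η.toMultilinearMap :=
      Module.Basis.ext_multilinear (fun _ : Fin k => b) fun μ => congrFun h μ
    ext v
    exact congrArg (fun m : MultilinearMap ℝ (fun _ : Fin k => E) ℝ => m v) this
  obtain ⟨R, hR⟩ := LinearMap.exists_leftInverse_of_injective Φ hΦ
  refine ⟨Fin k → Fin (Module.finrank ℝ E), inferInstance, fun μ i => b (μ i),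
    LinearMap.toContinuousLinearMap R, fun ζ => ?_⟩
  exact LinearMap.congr_fun hR ζ

/-- A form-valued map is smooth if its evaluations on fixed vectors are. -/
theorem contDiffOn_form {k : ℕ} {n : WithTop ℕ∞} {ζ : F → E [⋀^Fin k]→L[ℝ] ℝ} {s : Set F}
    (h : ∀ v, ContDiffOn ℝ n (fun y => ζ y v) s) : ContDiffOn ℝ n ζ s := by
  obtain ⟨ι, _, w, R, hR⟩ := exists_form_reconstruct E k
  have : ζ = fun y => R (fun i => ζ y (w i)) := funext fun y => (hR (ζ y)).symm
  rw [this]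
  exact R.contDiff.comp_contDiffOn (contDiffOn_pi.2 fun i => h (w i))

theorem contDiffOn_form_apply {k : ℕ} {n : WithTop ℕ∞} {ζ : F → E [⋀^Fin k]→L[ℝ] ℝ} {s : Set F}
    (h : ContDiffOn ℝ n ζ s) (v : Fin k → E) : ContDiffOn ℝ n (fun y => ζ y v) s :=
  (evalForm v).contDiff.comp_contDiffOn h

theorem fderiv_form_apply {k : ℕ} {ζ : F → E [⋀^Fin k]→L[ℝ] ℝ} {y : F}
    (h : DifferentiableAt ℝ ζ y) (v : Fin k → E) (u : F) :
    fderiv ℝ (fun z => ζ z v) y u = fderiv ℝ ζ y u v := by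
  have := ((evalForm v).hasFDerivAt.comp y h.hasFDerivAt).fderiv
  exact DFunLike.congr_fun this u

/-- The wedge product as a continuous bilinear map. -/
def wedgeCLM (E : Type*) [NormedAddCommGroup E] [NormedSpace ℝ E] [FiniteDimensional ℝ E] (k l : ℕ) :
    (E [⋀^Fin k]→L[ℝ] ℝ) →L[ℝ] (E [⋀^Fin l]→L[ℝ] ℝ) →L[ℝ] (E [⋀^Fin (k + l)]→L[ℝ] ℝ) :=
  (wedgeLin E k l).toContinuousBilinearMap

theorem contDiffOn_wedgeAt {k l : ℕ} {n : WithTop ℕ∞} {ξ : F → E [⋀^Fin k]→L[ℝ] ℝ}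
    {η : F → E [⋀^Fin l]→L[ℝ] ℝ} {s : Set F} (hξ : ContDiffOn ℝ n ξ s) (hη : ContDiffOn ℝ n η s) :
    ContDiffOn ℝ n (fun y => wedgeAt (ξ y) (η y)) s := by
  refine contDiffOn_form fun v => ?_
  simp only [wedgeAt_apply]
  exact contDiffOn_const.mul (ContDiffOn.sum fun σ _ => contDiffOn_const.mul
    ((contDiffOn_form_apply hξ _).mul (contDiffOn_form_apply hη _)))

/-- The Leibniz rule for the exterior derivative. -/
theorem extDeriv_wedgeAt {k l : ℕ} {ξ : E → E [⋀^Fin k]→L[ℝ] ℝ} {η : E → E [⋀^Fin l]→L[ℝ] ℝ}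
    {y : E} (hξ : DifferentiableAt ℝ ξ y) (hη : DifferentiableAt ℝ η y) (v : Fin (k + l + 1) → E) :
    extDeriv (fun z => wedgeAt (ξ z) (η z)) y v
      = wedgeAt (extDeriv ξ y) (η y) (v ∘ Fin.cast (Nat.add_right_comm k 1 l))
        + (-1) ^ k * wedgeAt (ξ y) (extDeriv η y) v := by
  have h := (wedgeCLM E k l).hasFDerivAt_of_bilinear hξ.hasFDerivAt hη.hasFDerivAt
  have h' : fderiv ℝ (fun z => wedgeAt (ξ z) (η z)) y =
    (wedgeCLM E k l).flip (η y) ∘L fderiv ℝ ξ y + wedgeCLM E k l (ξ y) ∘L fderiv ℝ η y := by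
    refine h.fderiv.trans ?_
    ext x : 1
    exact add_comm _ _
  rw [extDeriv, h', ContinuousAlternatingMap.alternatizeUncurryFin_add,
    ContinuousAlternatingMap.add_apply]
  congr 1
  · exact alternatize_wedge_left _ _ _ (fun x => rfl) v
  · exact alternatize_wedge_right _ _ _ (fun x => rfl) v

theorem contDiffOn_extDeriv {k : ℕ} {ζ : E → E [⋀^Fin k]→L[ℝ] ℝ} {s : Set E} (hs : IsOpen s)
    (h : ContDiffOn ℝ ∞ ζ s) : ContDiffOn ℝ ∞ (extDeriv ζ) s := by
  have h1 : ContDiffOn ℝ ∞ (fderiv ℝ ζ) s := h.fderiv_of_isOpen hs (by simp)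
  exact (ContinuousAlternatingMap.alternatizeUncurryFinCLM ℝ E ℝ).contDiff.comp_contDiffOn h1

end FormSpace

/-! ### Contractions with a metric -/

section Contraction

variable {V : Type*} [AddCommGroup V] [Module ℝ V] {ι : Type*} [Fintype ι] [DecidableEq ι]

/-- The matrix `g(c_i, c_j)`. -/
def gramM (c : ι → V) (g : V → V → ℝ) : Matrix ι ι ℝ := Matrix.of fun i j => g (c i) (c j)

/-- The contraction `g^{ij} T(c_i, c_j)`. -/
def contr (c : ι → V) (g T : V → V → ℝ) : ℝ :=
  ∑ i, ∑ j, (gramM c g)⁻¹ i j * T (c i) (c j)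

theorem isBilinear_sum_left {T : V → V → ℝ} (hT : IsBilinearMap ℝ T) {κ : Type*} (s : Finset κ)
    (f : κ → ℝ) (x : κ → V) (y : V) : T (∑ a ∈ s, f a • x a) y = ∑ a ∈ s, f a * T (x a) y := by
  have : ∀ u v, T u v = hT.toLinearMap u v := fun _ _ => rfl
  simp only [this, map_sum, map_smul, LinearMap.sum_apply, LinearMap.smul_apply, smul_eq_mul]

theorem isBilinear_sum_right {T : V → V → ℝ} (hT : IsBilinearMap ℝ T) {κ : Type*} (s : Finset κ)
    (f : κ → ℝ) (x : κ → V) (y : V) : T y (∑ a ∈ s, f a • x a) = ∑ a ∈ s, f a * T y (x a) := by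
  have : ∀ u v, T u v = hT.toLinearMap u v := fun _ _ => rfl
  simp only [this, map_sum, map_smul, smul_eq_mul]

theorem gramM_change {g : V → V → ℝ} (hg : IsBilinearMap ℝ g) {ι' : Type*} [Fintype ι']
    [DecidableEq ι'] (c : Module.Basis ι ℝ V) (c' : Module.Basis ι' ℝ V) :
    gramM c' g = (c.toMatrix c').transpose * gramM c g * c.toMatrix c' := by
  ext a d
  have h : ∀ a, c' a = ∑ i, c.toMatrix c' i a • c i := fun a => (c.sum_toMatrix_smul_self c' a).symm
  simp only [gramM, Matrix.of_apply, Matrix.mul_apply, Matrix.transpose_apply]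
  rw [h a, h d, isBilinear_sum_left hg]
  simp only [isBilinear_sum_right hg, Finset.mul_sum, Finset.sum_mul]
  rw [Finset.sum_comm]
  exact Finset.sum_congr rfl fun i _ => Finset.sum_congr rfl fun j _ => by ring

theorem inv_gramM_change {g : V → V → ℝ} (hg : IsBilinearMap ℝ g) {ι' : Type*} [Fintype ι']
    [DecidableEq ι'] (c : Module.Basis ι ℝ V) (c' : Module.Basis ι' ℝ V)
    (hdet : IsUnit (gramM c g).det) :
    c.toMatrix c' * (gramM c' g)⁻¹ * (c.toMatrix c').transpose = (gramM c g)⁻¹ := by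
  have hPQ : c.toMatrix c' * c'.toMatrix c = 1 := c.toMatrix_mul_toMatrix_flip c'
  have hQP : c'.toMatrix c * c.toMatrix c' = 1 := c'.toMatrix_mul_toMatrix_flip c
  have hPt : (c'.toMatrix c).transpose * (c.toMatrix c').transpose = 1 := by
    rw [← Matrix.transpose_mul, hPQ, Matrix.transpose_one]
  have hQt : (c.toMatrix c').transpose * (c'.toMatrix c).transpose = 1 := by
    rw [← Matrix.transpose_mul, hQP, Matrix.transpose_one]
  have hinv : (gramM c' g)⁻¹ = c'.toMatrix c * (gramM c g)⁻¹ * (c'.toMatrix c).transpose := by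
    apply Matrix.inv_eq_right_inv
    rw [gramM_change hg c c']
    calc _ = (c.toMatrix c').transpose * gramM c g * (c.toMatrix c' * c'.toMatrix c) * (gramM c g)⁻¹
          * (c'.toMatrix c).transpose := by simp only [Matrix.mul_assoc]
      _ = _ := by
        rw [hPQ, Matrix.mul_one, Matrix.mul_assoc (c.toMatrix c').transpose,
          Matrix.mul_nonsing_inv _ hdet, Matrix.mul_one, hQt]
  rw [hinv]
  calc _ = (c.toMatrix c' * c'.toMatrix c) * (gramM c g)⁻¹ *
        ((c'.toMatrix c).transpose * (c.toMatrix c').transpose) := by simp only [Matrix.mul_assoc]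
    _ = _ := by rw [hPQ, hPt, Matrix.one_mul, Matrix.mul_one]

theorem det_gramM_change {g : V → V → ℝ} (hg : IsBilinearMap ℝ g) (c c' : Module.Basis ι ℝ V)
    (hdet : IsUnit (gramM c g).det) : IsUnit (gramM c' g).det := by
  rw [gramM_change hg c c', Matrix.det_mul, Matrix.det_mul, Matrix.det_transpose]
  have hP : IsUnit (c.toMatrix c').det := by
    have h := congrArg Matrix.det (c.toMatrix_mul_toMatrix_flip c')
    rw [Matrix.det_mul, Matrix.det_one] at h
    exact IsUnit.of_mul_eq_one _ h
  exact (hP.mul hdet).mul hP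

/-- Contractions do not depend on the basis. -/
theorem contr_basis {g T : V → V → ℝ} (hg : IsBilinearMap ℝ g) (hT : IsBilinearMap ℝ T)
    {ι' : Type*} [Fintype ι'] [DecidableEq ι'] (c : Module.Basis ι ℝ V) (c' : Module.Basis ι' ℝ V)
    (hdet : IsUnit (gramM c g).det) : contr c' g T = contr c g T := by
  have h : ∀ a, c' a = ∑ i, c.toMatrix c' i a • c i := fun a => (c.sum_toMatrix_smul_self c' a).symm
  unfold contr
  rw [← inv_gramM_change hg c c' hdet]
  have h1 : ∀ a d, T (c' a) (c' d) = ∑ i, ∑ j, c.toMatrix c' i a * c.toMatrix c' j d * T (c i) (c j) := by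
    intro a d
    rw [h a, h d, isBilinear_sum_left hT]
    simp only [isBilinear_sum_right hT, Finset.mul_sum]
    exact Finset.sum_congr rfl fun i _ => Finset.sum_congr rfl fun j _ => by ring
  simp only [h1, Matrix.mul_apply, Matrix.transpose_apply, Finset.mul_sum, Finset.sum_mul]
  calc _ = ∑ a, ∑ i, ∑ d, ∑ j, (gramM c' g)⁻¹ a d *
        (c.toMatrix c' i a * c.toMatrix c' j d * T (c i) (c j)) := by
        exact Finset.sum_congr rfl fun a _ => Finset.sum_comm
    _ = ∑ i, ∑ a, ∑ j, ∑ d, (gramM c' g)⁻¹ a d *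
        (c.toMatrix c' i a * c.toMatrix c' j d * T (c i) (c j)) := by
        rw [Finset.sum_comm]
        exact Finset.sum_congr rfl fun i _ => Finset.sum_congr rfl fun a _ => Finset.sum_comm
    _ = ∑ i, ∑ j, ∑ a, ∑ d, (gramM c' g)⁻¹ a d *
        (c.toMatrix c' i a * c.toMatrix c' j d * T (c i) (c j)) := by
        exact Finset.sum_congr rfl fun i _ => Finset.sum_comm
    _ = _ := by
        refine Finset.sum_congr rfl fun i _ => Finset.sum_congr rfl fun j _ => ?_
        rw [Finset.sum_comm]
        exact Finset.sum_congr rfl fun d _ => Finset.sum_congr rfl fun a _ => by ring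

theorem contr_add (c : ι → V) (g S T : V → V → ℝ) :
    contr c g (fun u v => S u v + T u v) = contr c g S + contr c g T := by
  simp only [contr, mul_add, Finset.sum_add_distrib]

theorem contr_metric_right {g : V → V → ℝ} (c : Module.Basis ι ℝ V) (hg : IsBilinearMap ℝ g)
    (hdet : IsUnit (gramM c g).det) (l : V →ₗ[ℝ] ℝ) (s : V) :
    contr c g (fun p q => l p * g q s) = l s := by
  have hs : s = ∑ k, c.repr s k • c k := (c.sum_repr s).symm
  have h1 : ∀ i, ∑ j, (gramM c g)⁻¹ i j * g (c j) s = c.repr s i := by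
    intro i
    have : ∀ j, g (c j) s = ∑ k, gramM c g j k * c.repr s k := by
      intro j
      conv_lhs => rw [hs]
      rw [isBilinear_sum_right hg]
      exact Finset.sum_congr rfl fun k _ => mul_comm _ _
    have h2 := congrFun (congrArg (fun M : Matrix ι ι ℝ => M.mulVec (c.repr s))
      (Matrix.nonsing_inv_mul _ hdet)) i
    simp only [Matrix.one_mulVec, ← Matrix.mulVec_mulVec] at h2
    rw [← h2]
    simp only [Matrix.mulVec, dotProduct, this]
  unfold contr
  conv_rhs => rw [hs, map_sum]
  refine Finset.sum_congr rfl fun i _ => ?_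
  rw [map_smul, smul_eq_mul, ← h1 i, Finset.sum_mul]
  exact Finset.sum_congr rfl fun j _ => by ring

theorem contr_swap {g : V → V → ℝ} (c : ι → V) (hg : ∀ u v, g u v = g v u) (T : V → V → ℝ) :
    contr c g (fun p q => T q p) = contr c g T := by
  have h : ((gramM c g)⁻¹).transpose = (gramM c g)⁻¹ := by
    rw [Matrix.transpose_nonsing_inv]
    congr 1
    ext i j
    exact hg _ _
  unfold contr
  rw [Finset.sum_comm]
  refine Finset.sum_congr rfl fun i _ => Finset.sum_congr rfl fun j _ => ?_
  conv_lhs => rw [← h, Matrix.transpose_apply]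

theorem contr_metric_left {g : V → V → ℝ} (c : Module.Basis ι ℝ V) (hg : IsBilinearMap ℝ g)
    (hsymm : ∀ u v, g u v = g v u)
    (hdet : IsUnit (gramM c g).det) (l : V →ₗ[ℝ] ℝ) (s : V) :
    contr c g (fun p q => g p s * l q) = l s := by
  rw [← contr_swap c hsymm]
  simp only [mul_comm (g _ _)]
  exact contr_metric_right c hg hdet l s

theorem contr_diagonal {c : ι → V} {g : V → V → ℝ} {d : ι → ℝ} (hd : ∀ i, d i ≠ 0)
    (hc : ∀ i j, g (c i) (c j) = if i = j then d i else 0) (T : V → V → ℝ) :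
    contr c g T = ∑ i, (d i)⁻¹ * T (c i) (c i) := by
  have h : gramM c g = Matrix.diagonal d := by
    ext i j; simp [gramM, hc, Matrix.diagonal_apply]
  have h' : (gramM c g)⁻¹ = Matrix.diagonal (fun i => (d i)⁻¹) := by
    rw [h]
    apply Matrix.inv_eq_right_inv
    rw [Matrix.diagonal_mul_diagonal]
    simp [hd]
  unfold contr
  rw [h']
  simp [Matrix.diagonal_apply]

theorem isUnit_det_diagonal {c : ι → V} {g : V → V → ℝ} {d : ι → ℝ} (hd : ∀ i, d i ≠ 0)
    (hc : ∀ i j, g (c i) (c j) = if i = j then d i else 0) : IsUnit (gramM c g).det := by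
  have h : gramM c g = Matrix.diagonal d := by
    ext i j; simp [gramM, hc, Matrix.diagonal_apply]
  rw [h, Matrix.det_diagonal, isUnit_iff_ne_zero]
  exact Finset.prod_ne_zero_iff.2 fun i _ => hd i

end Contraction

/-! ### Scalar curvature as a function of the `2`-jet of the metric -/

section Jet

variable {E : Type*} [NormedAddCommGroup E] [NormedSpace ℝ E] {ι : Type*} [Fintype ι] [DecidableEq ι]

/-- Christoffel symbols of the first kind. -/
def jetK (B1 : E →L[ℝ] E →L[ℝ] E →L[ℝ] ℝ) (u v w : E) : ℝ :=
  (1 / 2) * (B1 u v w + B1 v u w - B1 w u v)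

/-- Derivatives of the Christoffel symbols of the first kind. -/
def jetD (B2 : E →L[ℝ] E →L[ℝ] E →L[ℝ] E →L[ℝ] ℝ) (t u v w : E) : ℝ :=
  (1 / 2) * (B2 t u v w + B2 t v u w - B2 t w u v)

/-- The curvature tensor `g(R(u, v) w, z)` in terms of the `2`-jet of the metric. -/
def jetRiem (c : ι → E) (B0 : E →L[ℝ] E →L[ℝ] ℝ) (B1 : E →L[ℝ] E →L[ℝ] E →L[ℝ] ℝ)
    (B2 : E →L[ℝ] E →L[ℝ] E →L[ℝ] E →L[ℝ] ℝ) (u v w z : E) : ℝ :=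
  jetD B2 u v w z - jetD B2 v u w z
    - contr c (fun x y => B0 x y) (fun p q => jetK B1 u z p * jetK B1 v w q)
    + contr c (fun x y => B0 x y) (fun p q => jetK B1 v z p * jetK B1 u w q)

/-- The scalar curvature in terms of the `2`-jet of the metric. -/
def jetScal (c : ι → E) (B0 : E →L[ℝ] E →L[ℝ] ℝ) (B1 : E →L[ℝ] E →L[ℝ] E →L[ℝ] ℝ)
    (B2 : E →L[ℝ] E →L[ℝ] E →L[ℝ] E →L[ℝ] ℝ) : ℝ :=
  contr c (fun x y => B0 x y) fun v w => contr c (fun x y => B0 x y) fun u z =>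
    jetRiem c B0 B1 B2 u v w z

theorem isBilinearMap_clm (B0 : E →L[ℝ] E →L[ℝ] ℝ) : IsBilinearMap ℝ (fun x y => B0 x y) where
  add_left := by simp
  smul_left := by simp
  add_right := by simp
  smul_right := by simp

theorem jetK_add₁ (B1 : E →L[ℝ] E →L[ℝ] E →L[ℝ] ℝ) (u u' v w : E) :
    jetK B1 (u + u') v w = jetK B1 u v w + jetK B1 u' v w := by
  simp [jetK]; ring
theorem jetK_smul₁ (B1 : E →L[ℝ] E →L[ℝ] E →L[ℝ] ℝ) (a : ℝ) (u v w : E) :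
    jetK B1 (a • u) v w = a * jetK B1 u v w := by
  simp [jetK]; ring
theorem jetK_add₂ (B1 : E →L[ℝ] E →L[ℝ] E →L[ℝ] ℝ) (u v v' w : E) :
    jetK B1 u (v + v') w = jetK B1 u v w + jetK B1 u v' w := by
  simp [jetK]; ring
theorem jetK_smul₂ (B1 : E →L[ℝ] E →L[ℝ] E →L[ℝ] ℝ) (a : ℝ) (u v w : E) :
    jetK B1 u (a • v) w = a * jetK B1 u v w := by
  simp [jetK]; ring
theorem jetK_add₃ (B1 : E →L[ℝ] E →L[ℝ] E →L[ℝ] ℝ) (u v w w' : E) :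
    jetK B1 u v (w + w') = jetK B1 u v w + jetK B1 u v w' := by
  simp [jetK]; ring
theorem jetK_smul₃ (B1 : E →L[ℝ] E →L[ℝ] E →L[ℝ] ℝ) (a : ℝ) (u v w : E) :
    jetK B1 u v (a • w) = a * jetK B1 u v w := by
  simp [jetK]; ring

/-- `jetK` as a linear form in the last variable. -/
def jetKlin (B1 : E →L[ℝ] E →L[ℝ] E →L[ℝ] ℝ) (u v : E) : E →ₗ[ℝ] ℝ where
  toFun := jetK B1 u v
  map_add' := jetK_add₃ B1 u v
  map_smul' := fun a w => jetK_smul₃ B1 a u v w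

variable {ι' : Type*} [Fintype ι'] [DecidableEq ι']

theorem jetRiem_basis (c : Module.Basis ι ℝ E) (c' : Module.Basis ι' ℝ E) (B0 : E →L[ℝ] E →L[ℝ] ℝ)
    (B1 : E →L[ℝ] E →L[ℝ] E →L[ℝ] ℝ) (B2 : E →L[ℝ] E →L[ℝ] E →L[ℝ] E →L[ℝ] ℝ)
    (hdet : IsUnit (gramM c (fun x y => B0 x y)).det) (u v w z : E) :
    jetRiem c' B0 B1 B2 u v w z = jetRiem c B0 B1 B2 u v w z := by
  have h : ∀ x y x' y' : E, contr c' (fun x y => B0 x y) (fun p q => jetK B1 x y p * jetK B1 x' y' q)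
      = contr c (fun x y => B0 x y) (fun p q => jetK B1 x y p * jetK B1 x' y' q) := by
    intro x y x' y'
    refine contr_basis (isBilinearMap_clm B0) ⟨?_, ?_, ?_, ?_⟩ c c' hdet
    all_goals intros; simp only [jetK_add₃, jetK_smul₃, smul_eq_mul]; ring
  unfold jetRiem
  rw [h, h]

theorem isBilinear_sub {T S : E → E → ℝ} (hT : IsBilinearMap ℝ T) (hS : IsBilinearMap ℝ S) :
    IsBilinearMap ℝ (fun u v => T u v - S u v) where
  add_left x y z := by simp only [hT.add_left, hS.add_left]; ring
  smul_left a x y := by simp only [hT.smul_left, hS.smul_left, smul_eq_mul]; ring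
  add_right x y z := by simp only [hT.add_right, hS.add_right]; ring
  smul_right a x y := by simp only [hT.smul_right, hS.smul_right, smul_eq_mul]; ring

theorem isBilinear_add {T S : E → E → ℝ} (hT : IsBilinearMap ℝ T) (hS : IsBilinearMap ℝ S) :
    IsBilinearMap ℝ (fun u v => T u v + S u v) where
  add_left x y z := by simp only [hT.add_left, hS.add_left]; ring
  smul_left a x y := by simp only [hT.smul_left, hS.smul_left, smul_eq_mul]; ring
  add_right x y z := by simp only [hT.add_right, hS.add_right]; ring
  smul_right a x y := by simp only [hT.smul_right, hS.smul_right, smul_eq_mul]; ring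

theorem isBilinear_contr (c : ι → E) (g : E → E → ℝ) {T : E → E → E → E → ℝ}
    (hT : ∀ p q, IsBilinearMap ℝ (fun u v => T u v p q)) :
    IsBilinearMap ℝ (fun u v => contr c g (T u v)) where
  add_left x y z := by
    simp only [contr, ← Finset.sum_add_distrib, (hT _ _).add_left, mul_add]
  smul_left a x y := by
    simp only [contr, (hT _ _).smul_left, smul_eq_mul, Finset.mul_sum]
    exact Finset.sum_congr rfl fun i _ => Finset.sum_congr rfl fun j _ => by ring
  add_right x y z := by
    simp only [contr, ← Finset.sum_add_distrib, (hT _ _).add_right, mul_add]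
  smul_right a x y := by
    simp only [contr, (hT _ _).smul_right, smul_eq_mul, Finset.mul_sum]
    exact Finset.sum_congr rfl fun i _ => Finset.sum_congr rfl fun j _ => by ring

theorem jetRiem_bilinear₁₄ (c : ι → E) (B0 : E →L[ℝ] E →L[ℝ] ℝ)
    (B1 : E →L[ℝ] E →L[ℝ] E →L[ℝ] ℝ) (B2 : E →L[ℝ] E →L[ℝ] E →L[ℝ] E →L[ℝ] ℝ) (v w : E) :
    IsBilinearMap ℝ (fun u z => jetRiem c B0 B1 B2 u v w z) := by
  unfold jetRiem
  refine isBilinear_add (isBilinear_sub (isBilinear_sub ?_ ?_)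
    (isBilinear_contr c _ fun p q => ?_)) (isBilinear_contr c _ fun p q => ?_)
  all_goals
    constructor <;> intros <;>
    simp only [jetD, jetK_add₁, jetK_add₂, jetK_smul₁, jetK_smul₂, map_add, map_smul,
      _root_.add_apply, _root_.smul_apply, smul_eq_mul] <;> ring

theorem jetRiem_bilinear₂₃ (c : ι → E) (B0 : E →L[ℝ] E →L[ℝ] ℝ)
    (B1 : E →L[ℝ] E →L[ℝ] E →L[ℝ] ℝ) (B2 : E →L[ℝ] E →L[ℝ] E →L[ℝ] E →L[ℝ] ℝ) (u z : E) :
    IsBilinearMap ℝ (fun v w => jetRiem c B0 B1 B2 u v w z) := by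
  unfold jetRiem
  refine isBilinear_add (isBilinear_sub (isBilinear_sub ?_ ?_)
    (isBilinear_contr c _ fun p q => ?_)) (isBilinear_contr c _ fun p q => ?_)
  all_goals
    constructor <;> intros <;>
    simp only [jetD, jetK_add₁, jetK_add₂, jetK_smul₁, jetK_smul₂, map_add, map_smul,
      _root_.add_apply, _root_.smul_apply, smul_eq_mul] <;> ring

theorem jetScal_basis (c : Module.Basis ι ℝ E) (c' : Module.Basis ι' ℝ E) (B0 : E →L[ℝ] E →L[ℝ] ℝ)
    (B1 : E →L[ℝ] E →L[ℝ] E →L[ℝ] ℝ) (B2 : E →L[ℝ] E →L[ℝ] E →L[ℝ] E →L[ℝ] ℝ)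
    (hdet : IsUnit (gramM c (fun x y => B0 x y)).det) :
    jetScal c' B0 B1 B2 = jetScal c B0 B1 B2 := by
  unfold jetScal
  have h1 : (fun v w => contr c' (fun x y => B0 x y) fun u z => jetRiem c' B0 B1 B2 u v w z)
      = fun v w => contr c (fun x y => B0 x y) fun u z => jetRiem c B0 B1 B2 u v w z := by
    funext v w
    simp only [jetRiem_basis c c' B0 B1 B2 hdet]
    exact contr_basis (isBilinearMap_clm B0) (jetRiem_bilinear₁₄ c B0 B1 B2 v w) c c' hdet
  rw [h1]
  exact contr_basis (isBilinearMap_clm B0)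
    (isBilinear_contr c _ fun u z => jetRiem_bilinear₂₃ c B0 B1 B2 u z) c c' hdet

/-- The transformation of the scalar curvature under a change of coordinates, on the level of jets:
`F`, `S` and `T` are the first three derivatives of the coordinate change. -/
theorem jetScal_pullback {E' : Type*} [NormedAddCommGroup E'] [NormedSpace ℝ E']
    (c : Module.Basis ι ℝ E') (F : E' ≃L[ℝ] E) (S : E' → E' → E) (T : E' → E' → E' → E)
    (hS : ∀ u v, S u v = S v u) (hT : ∀ u v w, T u v w = T v u w) (hT' : ∀ u v w, T u v w = T u w v)
    (B0 : E →L[ℝ] E →L[ℝ] ℝ) (hB0 : ∀ u v, B0 u v = B0 v u)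
    (B1 : E →L[ℝ] E →L[ℝ] E →L[ℝ] ℝ) (hB1 : ∀ t u v, B1 t u v = B1 t v u)
    (B2 : E →L[ℝ] E →L[ℝ] E →L[ℝ] E →L[ℝ] ℝ)
    (hdet : IsUnit (gramM (c.map F.toLinearEquiv) (fun x y => B0 x y)).det)
    (B0' : E' →L[ℝ] E' →L[ℝ] ℝ) (hB0' : ∀ u v, B0' u v = B0 (F u) (F v))
    (B1' : E' →L[ℝ] E' →L[ℝ] E' →L[ℝ] ℝ)
    (hB1' : ∀ t u v, B1' t u v = B1 (F t) (F u) (F v) + B0 (S t u) (F v) + B0 (F u) (S t v))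
    (B2' : E' →L[ℝ] E' →L[ℝ] E' →L[ℝ] E' →L[ℝ] ℝ)
    (hB2' : ∀ s t u v, B2' s t u v = B2 (F s) (F t) (F u) (F v) + B1 (S s t) (F u) (F v)
      + B1 (F t) (S s u) (F v) + B1 (F t) (F u) (S s v)
      + B1 (F s) (S t u) (F v) + B0 (T s t u) (F v) + B0 (S t u) (S s v)
      + B1 (F s) (F u) (S t v) + B0 (S s u) (S t v) + B0 (F u) (T s t v)) :
    jetScal c B0' B1' B2' = jetScal (c.map F.toLinearEquiv) B0 B1 B2 := by
  have hK : ∀ u v w, jetK B1' u v w = jetK B1 (F u) (F v) (F w) + B0 (S u v) (F w) := by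
    intro u v w
    simp only [jetK, hB1']
    rw [hS v u, hS w u, hS w v, hB0 (F v) (S u w), hB0 (F u) (S v w)]
    ring
  have hcontr : ∀ R : E → E → ℝ, contr c (fun x y => B0' x y) (fun p q => R (F p) (F q))
      = contr (c.map F.toLinearEquiv) (fun x y => B0 x y) R := by
    intro R
    simp only [contr, gramM, hB0', Module.Basis.map_apply]
    rfl
  set C := c.map F.toLinearEquiv
  have hQ : ∀ a b a' b' : E', contr c (fun x y => B0' x y)
        (fun p q => jetK B1' a b p * jetK B1' a' b' q)
      = contr C (fun x y => B0 x y) (fun p q => jetK B1 (F a) (F b) p * jetK B1 (F a') (F b') q)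
        + jetK B1 (F a) (F b) (S a' b') + jetK B1 (F a') (F b') (S a b) + B0 (S a b) (S a' b') := by
    intro a b a' b'
    have h1 : contr c (fun x y => B0' x y) (fun p q => jetK B1' a b p * jetK B1' a' b' q)
      = contr C (fun x y => B0 x y) (fun p q => ((jetK B1 (F a) (F b) p * jetK B1 (F a') (F b') q
        + jetKlin B1 (F a) (F b) p * B0 q (S a' b')) + B0 p (S a b) * jetKlin B1 (F a') (F b') q)
        + (B0 (S a b) : E →ₗ[ℝ] ℝ) p * B0 q (S a' b')) := by
      rw [← hcontr]
      congr 1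
      funext p q
      simp only [hK, jetKlin, LinearMap.coe_mk, AddHom.coe_mk, ContinuousLinearMap.coe_coe]
      rw [hB0 (F q) (S a' b'), hB0 (F p) (S a b)]
      ring
    rw [h1, contr_add, contr_add, contr_add,
      contr_metric_right C (isBilinearMap_clm B0) hdet,
      contr_metric_left C (isBilinearMap_clm B0) hB0 hdet,
      contr_metric_right C (isBilinearMap_clm B0) hdet]
    rfl
  have hRiem : ∀ u v w z, jetRiem c B0' B1' B2' u v w z = jetRiem C B0 B1 B2 (F u) (F v) (F w) (F z) := by
    intro u v w z
    unfold jetRiem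
    rw [hQ, hQ]
    simp only [jetD, jetK, hB2']
    rw [hS v u, hS w u, hS w v, hS z u, hS z v, hS z w, hT v u w, hT v u z]
    have e1 : ∀ x y, B0 x (S u y) = B0 (S u y) x := fun x y => hB0 _ _
    have e2 : T v w u = T u v w := by rw [hT' v w u, hT v u w]
    have e3 : T u w v = T u v w := hT' _ _ _
    have e4 : T u z v = T u v z := hT' _ _ _
    have e5 : T v z u = T u v z := by rw [hT' v z u, hT v u z]
    have e6 : T u z w = T u w z := hT' _ _ _
    have e7 : T v z w = T v w z := hT' _ _ _
    simp only [e2, e3, e4, e5, e6, e7]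
    rw [hB0 (F w) (T u v z), hB0 (F v) (T u w z), hB0 (F u) (T v w z)]
    rw [hB0 (S v z) (S u w), hB0 (S v w) (S u z)]
    rw [hB1 (F u) (F w) (S v z), hB1 (F u) (F z) (S v w), hB1 (F v) (F z) (S u w),
      hB1 (F v) (F w) (S u z), hB1 (F w) (F u) (S v z), hB1 (F z) (F u) (S v w), hB1 (F w) (F v) (S u z),
      hB1 (F z) (F v) (S u w)]
    ring
  unfold jetScal
  simp only [hRiem]
  rw [← hcontr]
  congr 1
  funext v w
  rw [← hcontr]

end Jet

section SmoothMatrix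

variable {F : Type*} [NormedAddCommGroup F] [NormedSpace ℝ F] {ι : Type*} [Fintype ι] [DecidableEq ι]
  {s : Set F} {n : WithTop ℕ∞}

theorem contDiffOn_det {M : F → Matrix ι ι ℝ} (h : ∀ i j, ContDiffOn ℝ n (fun y => M y i j) s) :
    ContDiffOn ℝ n (fun y => (M y).det) s := by
  simp only [Matrix.det_apply, Units.smul_def, zsmul_eq_mul]
  exact ContDiffOn.sum fun σ _ => contDiffOn_const.mul (contDiffOn_prod fun i _ => h _ _)

theorem contDiffOn_matrix_inv {M : F → Matrix ι ι ℝ}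
    (h : ∀ i j, ContDiffOn ℝ n (fun y => M y i j) s) (hd : ∀ y ∈ s, IsUnit (M y).det) (i j : ι) :
    ContDiffOn ℝ n (fun y => (M y)⁻¹ i j) s := by
  simp only [Matrix.inv_def, Matrix.smul_apply, smul_eq_mul, Ring.inverse_eq_inv',
    Matrix.adjugate_apply]
  refine ((contDiffOn_det h).inv fun y hy => (hd y hy).ne_zero).mul (contDiffOn_det fun k l => ?_)
  by_cases hk : k = j
  · subst hk; simp only [Matrix.updateRow_self]; exact contDiffOn_const
  · simp only [Matrix.updateRow_ne hk]; exact h _ _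

end SmoothMatrix

section ScalarCurvature

variable {E : Type*} [NormedAddCommGroup E] [NormedSpace ℝ E]
  {E' : Type*} [NormedAddCommGroup E'] [NormedSpace ℝ E']

theorem differentiableAt_of_contDiffOn {g : E → E'} {U : Set E} (hg : ContDiffOn ℝ ∞ g U)
    (hU : IsOpen U) {z : E} (hz : z ∈ U) : DifferentiableAt ℝ g z :=
  (hg.contDiffAt (hU.mem_nhds hz)).differentiableAt (by simp)

theorem minSmoothness_two_le_infty : minSmoothness ℝ 2 ≤ (∞ : WithTop ℕ∞) := by
  rw [minSmoothness_of_isRCLikeNormedField]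
  exact WithTop.coe_le_coe.2 (le_top : (2 : ℕ∞) ≤ ⊤)

/-- The scalar curvature of a field of bilinear forms on a vector space. -/
def scalAt {ι : Type*} [Fintype ι] [DecidableEq ι] (c : ι → E) (B : E → E →L[ℝ] E →L[ℝ] ℝ) (y : E) : ℝ :=
  jetScal c (B y) (fderiv ℝ B y) (fderiv ℝ (fderiv ℝ B) y)

theorem fderiv_clm₂_apply {B : E' → E →L[ℝ] E →L[ℝ] ℝ} {y : E'} (h : DifferentiableAt ℝ B y)
    (u v : E) (t : E') : fderiv ℝ (fun z => B z u v) y t = fderiv ℝ B y t u v := by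
  have h1 := (h.hasFDerivAt.clm_apply (hasFDerivAt_const u y)).clm_apply (hasFDerivAt_const v y)
  rw [h1.fderiv]
  simp

theorem fderiv_clm₃_apply {B : E' → E' →L[ℝ] E →L[ℝ] E →L[ℝ] ℝ} {y : E'} (h : DifferentiableAt ℝ B y)
    (w : E') (u v : E) (t : E') : fderiv ℝ (fun z => B z w u v) y t = fderiv ℝ B y t w u v := by
  have h1 := ((h.hasFDerivAt.clm_apply (hasFDerivAt_const w y)).clm_apply
    (hasFDerivAt_const u y)).clm_apply (hasFDerivAt_const v y)
  rw [h1.fderiv]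
  simp

theorem fderiv_bilinear {Φ : E' → E →L[ℝ] E →L[ℝ] ℝ} {a b : E' → E} {y : E'}
    (hΦ : DifferentiableAt ℝ Φ y) (ha : DifferentiableAt ℝ a y) (hb : DifferentiableAt ℝ b y) (s : E') :
    fderiv ℝ (fun z => Φ z (a z) (b z)) y s =
      fderiv ℝ Φ y s (a y) (b y) + Φ y (fderiv ℝ a y s) (b y) + Φ y (a y) (fderiv ℝ b y s) := by
  have h1 := (hΦ.hasFDerivAt.clm_apply ha.hasFDerivAt).clm_apply hb.hasFDerivAt
  rw [h1.fderiv]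
  simp
  ring

/-- The scalar curvature is invariant under changes of coordinates. -/
theorem scalAt_pullback [FiniteDimensional ℝ E'] {ι : Type*} [Fintype ι] [DecidableEq ι]
    (c : Module.Basis ι ℝ E') {U' : Set E'} {U : Set E} (hU' : IsOpen U') (hU : IsOpen U)
    {f : E' → E} (hf : ContDiffOn ℝ ∞ f U') (hfU : Set.MapsTo f U' U)
    {B : E → E →L[ℝ] E →L[ℝ] ℝ} (hB : ContDiffOn ℝ ∞ B U)
    (hsymm : ∀ z ∈ U, ∀ u v, B z u v = B z v u)
    {B' : E' → E' →L[ℝ] E' →L[ℝ] ℝ}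
    (hB' : ∀ z ∈ U', ∀ u v, B' z u v = B (f z) (fderiv ℝ f z u) (fderiv ℝ f z v))
    {y : E'} (hy : y ∈ U') (F : E' ≃L[ℝ] E) (hF : (F : E' →L[ℝ] E) = fderiv ℝ f y)
    (hdet : IsUnit (gramM (c.map F.toLinearEquiv) (fun u v => B (f y) u v)).det) :
    scalAt c B' y = scalAt (c.map F.toLinearEquiv) B (f y) := by
  have hf1 : ContDiffOn ℝ ∞ (fderiv ℝ f) U' := hf.fderiv_of_isOpen hU' (by simp)
  have hf2 : ContDiffOn ℝ ∞ (fderiv ℝ (fderiv ℝ f)) U' := hf1.fderiv_of_isOpen hU' (by simp)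
  have hB1 : ContDiffOn ℝ ∞ (fderiv ℝ B) U := hB.fderiv_of_isOpen hU (by simp)
  have hBf : ContDiffOn ℝ ∞ (fun z => B (f z)) U' := hB.comp hf hfU
  have hB1f : ContDiffOn ℝ ∞ (fun z => fderiv ℝ B (f z)) U' := hB1.comp hf hfU
  have datB : ∀ z ∈ U', DifferentiableAt ℝ B (f z) := fun z hz =>
    (hB.contDiffAt (hU.mem_nhds (hfU hz))).differentiableAt (by simp)
  have datB1 : ∀ z ∈ U', DifferentiableAt ℝ (fderiv ℝ B) (f z) := fun z hz =>
    (hB1.contDiffAt (hU.mem_nhds (hfU hz))).differentiableAt (by simp)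
  have hB's : ContDiffOn ℝ ∞ B' U' := by
    refine contDiffOn_clm_apply.2 fun u => contDiffOn_clm_apply.2 fun v => ?_
    refine ContDiffOn.congr ?_ fun z hz => hB' z hz u v
    exact (hBf.clm_apply (hf1.clm_apply contDiffOn_const)).clm_apply (hf1.clm_apply contDiffOn_const)
  have hB'1 : ContDiffOn ℝ ∞ (fderiv ℝ B') U' := hB's.fderiv_of_isOpen hU' (by simp)
  have app : ∀ z ∈ U', ∀ u : E', DifferentiableAt ℝ (fun z => fderiv ℝ f z u) z := fun z hz u =>
    differentiableAt_of_contDiffOn (hf1.clm_apply contDiffOn_const) hU' hz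
  have app' : ∀ z ∈ U', ∀ u t : E', fderiv ℝ (fun z => fderiv ℝ f z u) z t
      = fderiv ℝ (fderiv ℝ f) z t u := by
    intro z hz u t
    rw [((differentiableAt_of_contDiffOn hf1 hU' hz).hasFDerivAt.clm_apply (hasFDerivAt_const u z)).fderiv]
    simp
  have app2 : ∀ z ∈ U', ∀ t u : E', DifferentiableAt ℝ (fun z => fderiv ℝ (fderiv ℝ f) z t u) z :=
    fun z hz t u => differentiableAt_of_contDiffOn ((hf2.clm_apply contDiffOn_const).clm_apply contDiffOn_const) hU' hz
  have app2' : ∀ z ∈ U', ∀ t u s : E', fderiv ℝ (fun z => fderiv ℝ (fderiv ℝ f) z t u) z s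
      = fderiv ℝ (fderiv ℝ (fderiv ℝ f)) z s t u := by
    intro z hz t u s
    rw [(((differentiableAt_of_contDiffOn hf2 hU' hz).hasFDerivAt.clm_apply (hasFDerivAt_const t z)).clm_apply
      (hasFDerivAt_const u z)).fderiv]
    simp
  have hchain : ∀ z ∈ U', ∀ s, fderiv ℝ (fun z => B (f z)) z s = fderiv ℝ B (f z) (fderiv ℝ f z s) := by
    intro z hz s
    change fderiv ℝ (B ∘ f) z s = _
    rw [((datB z hz).hasFDerivAt.comp z (differentiableAt_of_contDiffOn hf hU' hz).hasFDerivAt).fderiv]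
    rfl
  have hchain1 : ∀ z ∈ U', ∀ s, fderiv ℝ (fun z => fderiv ℝ B (f z)) z s
      = fderiv ℝ (fderiv ℝ B) (f z) (fderiv ℝ f z s) := by
    intro z hz s
    change fderiv ℝ (fderiv ℝ B ∘ f) z s = _
    rw [((datB1 z hz).hasFDerivAt.comp z (differentiableAt_of_contDiffOn hf hU' hz).hasFDerivAt).fderiv]
    rfl
  have first : ∀ z ∈ U', ∀ t u v, fderiv ℝ B' z t u v =
      fderiv ℝ B (f z) (fderiv ℝ f z t) (fderiv ℝ f z u) (fderiv ℝ f z v)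
      + B (f z) (fderiv ℝ (fderiv ℝ f) z t u) (fderiv ℝ f z v)
      + B (f z) (fderiv ℝ f z u) (fderiv ℝ (fderiv ℝ f) z t v) := by
    intro z hz t u v
    rw [← fderiv_clm₂_apply (differentiableAt_of_contDiffOn hB's hU' hz)]
    have he : (fun z => B' z u v) =ᶠ[nhds z] fun z => B (f z) (fderiv ℝ f z u) (fderiv ℝ f z v) := by
      filter_upwards [hU'.mem_nhds hz] with x hx using hB' x hx u v
    rw [he.fderiv_eq, fderiv_bilinear (differentiableAt_of_contDiffOn hBf hU' hz) (app z hz u) (app z hz v), hchain z hz,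
      app' z hz, app' z hz]
  have hcd : ContDiffAt ℝ ∞ f y := hf.contDiffAt (hU'.mem_nhds hy)
  have hcd1 : ContDiffAt ℝ ∞ (fderiv ℝ f) y := hf1.contDiffAt (hU'.mem_nhds hy)
  have symS : ∀ z ∈ U', ∀ u v, fderiv ℝ (fderiv ℝ f) z u v = fderiv ℝ (fderiv ℝ f) z v u :=
    fun z hz u v => ((hf.contDiffAt (hU'.mem_nhds hz)).isSymmSndFDerivAt minSmoothness_two_le_infty).eq u v
  have hFy : ∀ u, fderiv ℝ f y u = F u := fun u => by rw [← hF]; rfl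
  refine jetScal_pullback c F (fun u v => fderiv ℝ (fderiv ℝ f) y u v)
    (fun u v w => fderiv ℝ (fderiv ℝ (fderiv ℝ f)) y u v w) (symS y hy) ?_ ?_ (B (f y))
    (hsymm _ (hfU hy)) (fderiv ℝ B (f y)) ?_ (fderiv ℝ (fderiv ℝ B) (f y)) hdet (B' y) ?_
    (fderiv ℝ B' y) ?_ (fderiv ℝ (fderiv ℝ B') y) ?_
  · intro u v w
    exact congrArg (fun L : E' →L[ℝ] E => L w)
      ((hcd1.isSymmSndFDerivAt minSmoothness_two_le_infty).eq u v)
  · intro u v w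
    rw [← app2' y hy, ← app2' y hy]
    refine congrArg (fun L : E' →L[ℝ] E => L u) (Filter.EventuallyEq.fderiv_eq ?_)
    filter_upwards [hU'.mem_nhds hy] with z hz using symS z hz v w
  · intro t u v
    rw [← fderiv_clm₂_apply (datB y hy), ← fderiv_clm₂_apply (datB y hy)]
    refine congrArg (fun L : E →L[ℝ] ℝ => L t) (Filter.EventuallyEq.fderiv_eq ?_)
    filter_upwards [hU.mem_nhds (hfU hy)] with z hz using hsymm z hz u v
  · intro u v; rw [hB' y hy, hFy, hFy]
  · intro t u v; rw [first y hy, hFy, hFy, hFy]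
  · intro s t u v
    rw [← fderiv_clm₃_apply (differentiableAt_of_contDiffOn hB'1 hU' hy)]
    have he : (fun z => fderiv ℝ B' z t u v) =ᶠ[nhds y] fun z =>
      fderiv ℝ B (f z) (fderiv ℝ f z t) (fderiv ℝ f z u) (fderiv ℝ f z v)
      + B (f z) (fderiv ℝ (fderiv ℝ f) z t u) (fderiv ℝ f z v)
      + B (f z) (fderiv ℝ f z u) (fderiv ℝ (fderiv ℝ f) z t v) := by
      filter_upwards [hU'.mem_nhds hy] with x hx using first x hx t u v
    have hΦ : ContDiffOn ℝ ∞ (fun z => fderiv ℝ B (f z) (fderiv ℝ f z t)) U' :=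
      hB1f.clm_apply (hf1.clm_apply contDiffOn_const)
    have hΦ' : fderiv ℝ (fun z => fderiv ℝ B (f z) (fderiv ℝ f z t)) y s
        = fderiv ℝ (fderiv ℝ B) (f y) (F s) (F t) + fderiv ℝ B (f y) (fderiv ℝ (fderiv ℝ f) y s t) := by
      rw [((differentiableAt_of_contDiffOn hB1f hU' hy).hasFDerivAt.clm_apply (app y hy t).hasFDerivAt).fderiv]
      simp only [_root_.add_apply, ContinuousLinearMap.comp_apply,
        ContinuousLinearMap.flip_apply, app' y hy, hchain1 y hy, hFy]
      rw [add_comm]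
    have d1 : DifferentiableAt ℝ (fun z =>
        fderiv ℝ B (f z) (fderiv ℝ f z t) (fderiv ℝ f z u) (fderiv ℝ f z v)) y :=
      (((differentiableAt_of_contDiffOn hΦ hU' hy).clm_apply (app y hy u)).clm_apply (app y hy v))
    have d2 : DifferentiableAt ℝ (fun z =>
        B (f z) (fderiv ℝ (fderiv ℝ f) z t u) (fderiv ℝ f z v)) y :=
      (((differentiableAt_of_contDiffOn hBf hU' hy).clm_apply (app2 y hy t u)).clm_apply (app y hy v))
    have d3 : DifferentiableAt ℝ (fun z =>
        B (f z) (fderiv ℝ f z u) (fderiv ℝ (fderiv ℝ f) z t v)) y :=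
      (((differentiableAt_of_contDiffOn hBf hU' hy).clm_apply (app y hy u)).clm_apply (app2 y hy t v))
    rw [he.fderiv_eq, fderiv_fun_add (d1.fun_add d2) d3, fderiv_fun_add d1 d2, _root_.add_apply,
      _root_.add_apply, fderiv_bilinear (differentiableAt_of_contDiffOn hΦ hU' hy) (app y hy u) (app y hy v),
      fderiv_bilinear (differentiableAt_of_contDiffOn hBf hU' hy) (app2 y hy t u) (app y hy v),
      fderiv_bilinear (differentiableAt_of_contDiffOn hBf hU' hy) (app y hy u) (app2 y hy t v), hΦ']
    simp only [app' y hy, app2' y hy, hchain y hy, hFy, _root_.add_apply]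
    ring

theorem fderiv_jetK {B : E → E →L[ℝ] E →L[ℝ] ℝ} {y : E} (h : DifferentiableAt ℝ (fderiv ℝ B) y)
    (t u v w : E) : fderiv ℝ (fun z => jetK (fderiv ℝ B z) u v w) y t
      = jetD (fderiv ℝ (fderiv ℝ B) y) t u v w := by
  have d : ∀ u v w : E, DifferentiableAt ℝ (fun z => fderiv ℝ B z u v w) y := fun u v w =>
    ((h.clm_apply (differentiableAt_const u)).clm_apply (differentiableAt_const v)).clm_apply
      (differentiableAt_const w)
  unfold jetK jetD
  rw [fderiv_const_mul (((d _ _ _).fun_add (d _ _ _)).fun_sub (d _ _ _)), _root_.smul_apply,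
    fderiv_fun_sub ((d _ _ _).fun_add (d _ _ _)) (d _ _ _), fderiv_fun_add (d _ _ _) (d _ _ _)]
  simp only [_root_.sub_apply, _root_.add_apply, smul_eq_mul, fderiv_clm₃_apply h]

variable {n : ℕ} [FiniteDimensional ℝ E]

theorem contDiffOn_gramM {ι : Type*} {U : Set E'} {m : WithTop ℕ∞} {B : E' → E →L[ℝ] E →L[ℝ] ℝ}
    (hB : ContDiffOn ℝ m B U) (c : ι → E) (i j : ι) :
    ContDiffOn ℝ m (fun z => gramM c (fun u v => B z u v) i j) U :=
  (hB.clm_apply contDiffOn_const).clm_apply contDiffOn_const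

/-- The scalar curvature computed from the Christoffel symbols. -/
theorem sum_ricci_eq_scalAt (b : Module.Basis (Fin n) ℝ E) {U : Set E} (hU : IsOpen U)
    {B : E → E →L[ℝ] E →L[ℝ] ℝ} (hB : ContDiffOn ℝ ∞ B U)
    (hsymm : ∀ z ∈ U, ∀ u v, B z u v = B z v u)
    (hd : ∀ z ∈ U, IsUnit (gramM b (fun u v => B z u v)).det)
    {h : E → Matrix (Fin n) (Fin n) ℝ} (hh : ∀ z ∈ U, h z = gramM b (fun u v => B z u v))
    {y : E} (hy : y ∈ U) :
    ∑ j, ∑ k, (h y)⁻¹ j k * ricci b h j k y = scalAt b B y := by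
  have hB1 : ContDiffOn ℝ ∞ (fderiv ℝ B) U := hB.fderiv_of_isOpen hU (by simp)
  have hpd : ∀ z ∈ U, ∀ l i j, pd b l (fun z => h z i j) z = fderiv ℝ B z (b l) (b i) (b j) := by
    intro z hz l i j
    rw [← fderiv_clm₂_apply (differentiableAt_of_contDiffOn hB hU hz), pd]
    refine congrArg (fun L : E →L[ℝ] ℝ => L (b l)) (Filter.EventuallyEq.fderiv_eq ?_)
    filter_upwards [hU.mem_nhds hz] with x hx
    rw [hh x hx]; rfl
  have hK : ∀ z ∈ U, ∀ k i j, christoffel b h k i j z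
      = ∑ l, (h z)⁻¹ k l * jetK (fderiv ℝ B z) (b i) (b j) (b l) := by
    intro z hz k i j
    unfold christoffel
    rw [Finset.mul_sum]
    refine Finset.sum_congr rfl fun l _ => ?_
    rw [hpd z hz, hpd z hz, hpd z hz, jetK]
    ring
  have hKs : ∀ u v w, ContDiffOn ℝ ∞ (fun z => jetK (fderiv ℝ B z) u v w) U := by
    intro u v w
    have d : ∀ u v w : E, ContDiffOn ℝ ∞ (fun z => fderiv ℝ B z u v w) U := fun u v w =>
      ((hB1.clm_apply contDiffOn_const).clm_apply contDiffOn_const).clm_apply contDiffOn_const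
    exact contDiffOn_const.mul (((d _ _ _).add (d _ _ _)).sub (d _ _ _))
  have hhs : ∀ i j, ContDiffOn ℝ ∞ (fun z => h z i j) U := fun i j =>
    (contDiffOn_gramM hB b i j).congr fun z hz => by rw [hh z hz]
  have hdet : ∀ z ∈ U, IsUnit (h z).det := fun z hz => by rw [hh z hz]; exact hd z hz
  have hΓs : ∀ k i j, ContDiffOn ℝ ∞ (christoffel b h k i j) U := fun k i j =>
    ContDiffOn.congr (ContDiffOn.sum fun l _ =>
      (contDiffOn_matrix_inv hhs hdet k l).mul (hKs _ _ _)) fun z hz => hK z hz k i j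
  have lower : ∀ z ∈ U, ∀ m i j, ∑ l, h z m l * christoffel b h l i j z
      = jetK (fderiv ℝ B z) (b i) (b j) (b m) := by
    intro z hz m i j
    have h2 := congrFun (congrArg (fun M : Matrix (Fin n) (Fin n) ℝ => M.mulVec
      (fun l => jetK (fderiv ℝ B z) (b i) (b j) (b l)))
      (Matrix.mul_nonsing_inv _ (hdet z hz))) m
    simp only [Matrix.one_mulVec, ← Matrix.mulVec_mulVec] at h2
    rw [← h2]
    simp only [Matrix.mulVec, dotProduct, hK z hz]
  have dlower : ∀ i j k m, ∑ l, h y m l * pd b i (christoffel b h l j k) y =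
      jetD (fderiv ℝ (fderiv ℝ B) y) (b i) (b j) (b k) (b m)
      - ∑ l, fderiv ℝ B y (b i) (b m) (b l) * christoffel b h l j k y := by
    intro i j k m
    rw [← fderiv_jetK (differentiableAt_of_contDiffOn hB1 hU hy)]
    have he : (fun z => jetK (fderiv ℝ B z) (b j) (b k) (b m)) =ᶠ[nhds y]
        fun z => ∑ l, h z m l * christoffel b h l j k z := by
      filter_upwards [hU.mem_nhds hy] with z hz using (lower z hz m j k).symm
    rw [he.fderiv_eq, fderiv_fun_sum fun l _ => (differentiableAt_of_contDiffOn (hhs m l) hU hy).fun_mul (differentiableAt_of_contDiffOn (hΓs l j k) hU hy),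
      _root_.sum_apply, ← Finset.sum_sub_distrib]
    refine Finset.sum_congr rfl fun l _ => ?_
    rw [fderiv_fun_mul (differentiableAt_of_contDiffOn (hhs m l) hU hy) (differentiableAt_of_contDiffOn (hΓs l j k) hU hy)]
    simp only [_root_.add_apply, _root_.smul_apply, smul_eq_mul]
    have := hpd y hy i m l
    unfold pd at this ⊢
    rw [this]
    ring
  have hB1s : ∀ t u v, fderiv ℝ B y t u v = fderiv ℝ B y t v u := by
    intro t u v
    rw [← fderiv_clm₂_apply (differentiableAt_of_contDiffOn hB hU hy), ← fderiv_clm₂_apply (differentiableAt_of_contDiffOn hB hU hy)]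
    refine congrArg (fun L : E →L[ℝ] ℝ => L t) (Filter.EventuallyEq.fderiv_eq ?_)
    filter_upwards [hU.mem_nhds hy] with z hz using hsymm z hz u v
  have hcontr : ∀ a b' a' b'' : E, contr b (fun x z => B y x z)
      (fun p q => jetK (fderiv ℝ B y) a b' p * jetK (fderiv ℝ B y) a' b'' q)
      = ∑ p, jetK (fderiv ℝ B y) a b' (b p) *
        ∑ q, (h y)⁻¹ p q * jetK (fderiv ℝ B y) a' b'' (b q) := by
    intro a b' a' b''
    unfold contr
    rw [← hh y hy]
    refine Finset.sum_congr rfl fun p _ => ?_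
    rw [Finset.mul_sum]
    exact Finset.sum_congr rfl fun q _ => by ring
  have lowR : ∀ i j k m, ∑ l, h y m l * riemann b h l i j k y
      = jetRiem b (B y) (fderiv ℝ B y) (fderiv ℝ (fderiv ℝ B) y) (b i) (b j) (b k) (b m) := by
    intro i j k m
    unfold riemann jetRiem
    rw [hcontr, hcontr]
    simp only [← hK y hy]
    have e1 : ∀ i j k, ∑ l, h y m l * ∑ p, christoffel b h l i p y * christoffel b h p j k y
        = ∑ p, jetK (fderiv ℝ B y) (b i) (b p) (b m) * christoffel b h p j k y := by
      intro i j k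
      simp only [Finset.mul_sum, ← lower y hy, Finset.sum_mul]
      rw [Finset.sum_comm]
      exact Finset.sum_congr rfl fun p _ => Finset.sum_congr rfl fun l _ => by ring
    simp only [mul_add, mul_sub, Finset.sum_add_distrib, Finset.sum_sub_distrib, e1, dlower]
    have e2 : ∀ i j k, ∑ l, fderiv ℝ B y (b i) (b m) (b l) * christoffel b h l j k y
        = ∑ l, jetK (fderiv ℝ B y) (b i) (b m) (b l) * christoffel b h l j k y
          + ∑ l, jetK (fderiv ℝ B y) (b i) (b l) (b m) * christoffel b h l j k y := by
      intro i j k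
      rw [← Finset.sum_add_distrib]
      refine Finset.sum_congr rfl fun l _ => ?_
      rw [← add_mul]
      congr 1
      simp only [jetK]
      rw [hB1s (b i) (b l) (b m)]
      ring
    rw [e2, e2]
    ring
  have raise : ∀ i j k l, riemann b h l i j k y = ∑ m, (h y)⁻¹ l m *
      jetRiem b (B y) (fderiv ℝ B y) (fderiv ℝ (fderiv ℝ B) y) (b i) (b j) (b k) (b m) := by
    intro i j k l
    have h2 := congrFun (congrArg (fun M : Matrix (Fin n) (Fin n) ℝ => M.mulVec
      (fun l => riemann b h l i j k y))
      (Matrix.nonsing_inv_mul _ (hdet y hy))) l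
    simp only [Matrix.one_mulVec, ← Matrix.mulVec_mulVec] at h2
    rw [← h2]
    simp only [Matrix.mulVec, dotProduct, lowR]
  unfold ricci scalAt jetScal
  simp only [raise]
  unfold contr
  rw [← hh y hy]

theorem scalAt_basis {ι ι' : Type*} [Fintype ι] [DecidableEq ι] [Fintype ι'] [DecidableEq ι']
    (c : Module.Basis ι ℝ E) (c' : Module.Basis ι' ℝ E) (B : E → E →L[ℝ] E →L[ℝ] ℝ) (y : E)
    (hdet : IsUnit (gramM c (fun u v => B y u v)).det) : scalAt c' B y = scalAt c B y :=
  jetScal_basis c c' _ _ _ hdet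

theorem continuousOn_contr {ι : Type*} [Fintype ι] [DecidableEq ι] (c : ι → E) {U : Set E'}
    {B : E' → E →L[ℝ] E →L[ℝ] ℝ} (hB : ContDiffOn ℝ ∞ B U)
    (hd : ∀ z ∈ U, IsUnit (gramM c (fun u v => B z u v)).det) {T : E' → E → E → ℝ}
    (hT : ∀ u v, ContinuousOn (fun z => T z u v) U) :
    ContinuousOn (fun z => contr c (fun u v => B z u v) (T z)) U := by
  have hinv : ∀ i j, ContinuousOn (fun z => (gramM c (fun u v => B z u v))⁻¹ i j) U := fun i j =>
    (contDiffOn_matrix_inv (contDiffOn_gramM hB c) hd i j).continuousOn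
  unfold contr
  exact continuousOn_finsetSum _ fun i _ => continuousOn_finsetSum _ fun j _ => (hinv i j).mul (hT _ _)

theorem continuousOn_jetK {U : Set E} {B1 : E → E →L[ℝ] E →L[ℝ] E →L[ℝ] ℝ} (h : ContinuousOn B1 U)
    (u v w : E) : ContinuousOn (fun z => jetK (B1 z) u v w) U := by
  have h1 : ∀ u v w, ContinuousOn (fun z => B1 z u v w) U := fun u v w =>
    ((h.clm_apply continuousOn_const).clm_apply continuousOn_const).clm_apply continuousOn_const
  unfold jetK
  exact continuousOn_const.mul (((h1 _ _ _).add (h1 _ _ _)).sub (h1 _ _ _))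

theorem continuousOn_jetD {U : Set E} {B2 : E → E →L[ℝ] E →L[ℝ] E →L[ℝ] E →L[ℝ] ℝ}
    (h : ContinuousOn B2 U) (t u v w : E) : ContinuousOn (fun z => jetD (B2 z) t u v w) U := by
  have h1 : ∀ t u v w, ContinuousOn (fun z => B2 z t u v w) U := fun t u v w =>
    (((h.clm_apply continuousOn_const).clm_apply continuousOn_const).clm_apply
      continuousOn_const).clm_apply continuousOn_const
  unfold jetD
  exact continuousOn_const.mul (((h1 _ _ _ _).add (h1 _ _ _ _)).sub (h1 _ _ _ _))

theorem continuousOn_jetRiem {ι : Type*} [Fintype ι] [DecidableEq ι] (c : ι → E) {U : Set E}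
    {B : E → E →L[ℝ] E →L[ℝ] ℝ} (hB : ContDiffOn ℝ ∞ B U)
    (hd : ∀ z ∈ U, IsUnit (gramM c (fun u v => B z u v)).det)
    {B1 : E → E →L[ℝ] E →L[ℝ] E →L[ℝ] ℝ} (hB1 : ContinuousOn B1 U)
    {B2 : E → E →L[ℝ] E →L[ℝ] E →L[ℝ] E →L[ℝ] ℝ} (hB2 : ContinuousOn B2 U) (u v w x : E) :
    ContinuousOn (fun z => jetRiem c (B z) (B1 z) (B2 z) u v w x) U := by
  have hQ : ∀ a b a' b' : E, ContinuousOn (fun z => contr c (fun u v => B z u v)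
      (fun p q => jetK (B1 z) a b p * jetK (B1 z) a' b' q)) U := fun a b a' b' =>
    continuousOn_contr c hB hd fun p q =>
      (continuousOn_jetK hB1 _ _ _).mul (continuousOn_jetK hB1 _ _ _)
  have h1 := continuousOn_jetD hB2 u v w x
  have h2 := continuousOn_jetD hB2 v u w x
  have h3 := ((h1.sub h2).sub (hQ u x v w)).add (hQ v x u w)
  exact h3

theorem continuousOn_jetScal {ι : Type*} [Fintype ι] [DecidableEq ι] (c : ι → E) {U : Set E}
    {B : E → E →L[ℝ] E →L[ℝ] ℝ} (hB : ContDiffOn ℝ ∞ B U)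
    (hd : ∀ z ∈ U, IsUnit (gramM c (fun u v => B z u v)).det)
    {B1 : E → E →L[ℝ] E →L[ℝ] E →L[ℝ] ℝ} (hB1 : ContinuousOn B1 U)
    {B2 : E → E →L[ℝ] E →L[ℝ] E →L[ℝ] E →L[ℝ] ℝ} (hB2 : ContinuousOn B2 U) :
    ContinuousOn (fun z => jetScal c (B z) (B1 z) (B2 z)) U := by
  unfold jetScal
  exact continuousOn_contr c hB hd fun v w => continuousOn_contr c hB hd fun u x =>
    continuousOn_jetRiem c hB hd hB1 hB2 u v w x

theorem continuousOn_scalAt {ι : Type*} [Fintype ι] [DecidableEq ι] (c : ι → E) {U : Set E}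
    (hU : IsOpen U) {B : E → E →L[ℝ] E →L[ℝ] ℝ} (hB : ContDiffOn ℝ ∞ B U)
    (hd : ∀ z ∈ U, IsUnit (gramM c (fun u v => B z u v)).det) : ContinuousOn (scalAt c B) U := by
  have hB1 : ContDiffOn ℝ ∞ (fderiv ℝ B) U := hB.fderiv_of_isOpen hU (by simp)
  have hB2 : ContDiffOn ℝ ∞ (fderiv ℝ (fderiv ℝ B)) U := hB1.fderiv_of_isOpen hU (by simp)
  exact continuousOn_jetScal c hB hd hB1.continuousOn hB2.continuousOn

end ScalarCurvature

section KaluzaKleinJet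

variable {E : Type*} [NormedAddCommGroup E] [NormedSpace ℝ E] {ι : Type*} [Fintype ι] [DecidableEq ι]

theorem jetScal_diagonal {c : ι → E} {B0 : E →L[ℝ] E →L[ℝ] ℝ} {d : ι → ℝ} (hd : ∀ i, d i ≠ 0)
    (hc : ∀ i j, B0 (c i) (c j) = if i = j then d i else 0)
    (B1 : E →L[ℝ] E →L[ℝ] E →L[ℝ] ℝ) (B2 : E →L[ℝ] E →L[ℝ] E →L[ℝ] E →L[ℝ] ℝ) :
    jetScal c B0 B1 B2 = ∑ v, (d v)⁻¹ * ∑ u, (d u)⁻¹ *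
      (jetD B2 (c u) (c v) (c v) (c u) - jetD B2 (c v) (c u) (c v) (c u)
        - ∑ p, (d p)⁻¹ * (jetK B1 (c u) (c u) (c p) * jetK B1 (c v) (c v) (c p))
        + ∑ p, (d p)⁻¹ * (jetK B1 (c v) (c u) (c p) * jetK B1 (c u) (c v) (c p))) := by
  unfold jetScal jetRiem
  simp only [contr_diagonal (g := fun x y => B0 x y) hd hc]

theorem sum_gradient_sq {ε p : ι → ℝ} (hε : ∀ i, ε i * ε i = 1) :
    ∑ j, ε j * ∑ i, ε i * ∑ k, ε k * ((p i * (if j = k then ε j else 0) + p j * (if i = k then ε i else 0)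
      - p k * (if i = j then ε i else 0)) * (p i * (if j = k then ε j else 0)
        + p j * (if i = k then ε i else 0) - p k * (if i = j then ε i else 0)))
      = (3 * Fintype.card ι - 2) * ∑ i, ε i * p i ^ 2 := by
  have h : ∀ i j k : ι, ε k * ((p i * (if j = k then ε j else 0) + p j * (if i = k then ε i else 0)
      - p k * (if i = j then ε i else 0)) * (p i * (if j = k then ε j else 0)
        + p j * (if i = k then ε i else 0) - p k * (if i = j then ε i else 0)))
      = (if j = k then ε k * p i ^ 2 else 0)
        + (if i = k then ε k * (p j ^ 2 - (if i = j then 2 * p j ^ 2 else 0)) else 0)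
        + (if i = j then ε k * p k ^ 2 else 0) := by
    intro i j k
    by_cases h1 : j = k
    · by_cases h2 : i = k
      · subst h1; subst h2
        simp only [if_true]
        linear_combination (ε i * p i ^ 2) * hε i
      · have h3 : ¬ i = j := fun h => h2 (h.trans h1)
        subst h1
        simp only [h2, if_true, if_false]
        linear_combination (ε j * p i ^ 2) * hε j
    · by_cases h2 : i = k
      · have h3 : ¬ i = j := fun h => h1 (h.symm.trans h2)
        subst h2
        simp only [h1, h3, if_true, if_false]
        linear_combination (ε i * p j ^ 2) * hε i
      · by_cases h3 : i = j
        · subst h3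
          simp only [h1, if_true, if_false]
          linear_combination (ε k * p k ^ 2) * hε i
        · simp only [h1, h2, h3, if_false]
          ring
  simp only [h]
  simp only [Finset.sum_add_distrib, Finset.sum_ite_eq, Finset.sum_ite_irrel, Finset.mem_univ, if_true,
    Finset.sum_const_zero, mul_add]
  have e1 : ∑ j, ε j * ∑ i, ε i * (ε j * p i ^ 2) = Fintype.card ι * ∑ i, ε i * p i ^ 2 := by
    have : ∀ j, ε j * ∑ i, ε i * (ε j * p i ^ 2) = ∑ i, ε i * p i ^ 2 := by
      intro j
      rw [Finset.mul_sum]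
      refine Finset.sum_congr rfl fun i _ => ?_
      linear_combination (ε i * p i ^ 2) * hε j
    simp [this]
  have e2 : ∑ j, ε j * ∑ i, ε i * (ε i * (p j ^ 2 - if i = j then 2 * p j ^ 2 else 0))
      = (Fintype.card ι - 2) * ∑ i, ε i * p i ^ 2 := by
    rw [Finset.mul_sum]
    refine Finset.sum_congr rfl fun j _ => ?_
    have : ∀ i, ε i * (ε i * (p j ^ 2 - if i = j then 2 * p j ^ 2 else 0))
        = p j ^ 2 - if i = j then 2 * p j ^ 2 else 0 := by
      intro i; rw [← mul_assoc, hε, one_mul]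
    simp only [this, Finset.sum_sub_distrib, Finset.sum_const, Finset.card_univ, nsmul_eq_mul,
      Finset.sum_ite_eq', Finset.mem_univ, if_true]
    ring
  have e3 : ∑ j, ε j * ∑ i, ε i * (if i = j then ∑ k, ε k * p k ^ 2 else 0)
      = Fintype.card ι * ∑ i, ε i * p i ^ 2 := by
    have : ∀ j, ε j * ∑ i, ε i * (if i = j then ∑ k, ε k * p k ^ 2 else 0) = ∑ k, ε k * p k ^ 2 := by
      intro j
      simp only [mul_ite, mul_zero, Finset.sum_ite_eq', Finset.mem_univ, if_true]
      rw [← mul_assoc, hε, one_mul]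
    rw [Finset.sum_congr rfl fun j _ => this j]
    simp
  rw [e1, e2, e3]
  ring

/-- The scalar curvature of `e^{aφ} g + e^{bφ} (A - dt)²` at a point at which the first derivatives
of `g` vanish, `A` vanishes and the derivative of `A` is skew-symmetric. -/
theorem jetScal_kaluzaKlein {ε : ι → ℝ} (hε : ∀ i, ε i * ε i = 1) {c : ι ⊕ Unit → E} {a b e₁ e₂ : ℝ}
    (he₁ : e₁ ≠ 0) (he₂ : e₂ ≠ 0) (p : ι → ℝ) (q A : ι → ι → ℝ)
    (hA : ∀ i j, A i j = - A j i) (Q : ι → ι → ι → ι → ℝ)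
    (hQ : ∀ i j k l, Q i j k l = Q j i k l) (hQ' : ∀ i j k l, Q i j k l = Q i j l k)
    (B0 : E →L[ℝ] E →L[ℝ] ℝ) (B1 : E →L[ℝ] E →L[ℝ] E →L[ℝ] ℝ)
    (B2 : E →L[ℝ] E →L[ℝ] E →L[ℝ] E →L[ℝ] ℝ)
    (hB0 : ∀ u v, B0 (c u) (c v) = if u = v then Sum.elim (fun i => e₁ * ε i) (fun _ => e₂) u else 0)
    (hB1s : ∀ u v w, B1 u v w = B1 u w v)
    (hB1 : ∀ v w, B1 (c (.inr ())) v w = 0)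
    (hB1h : ∀ i j k, B1 (c (.inl i)) (c (.inl j)) (c (.inl k)) = a * p i * e₁ * if j = k then ε j else 0)
    (hB1m : ∀ i j, B1 (c (.inl i)) (c (.inl j)) (c (.inr ())) = - e₂ * A i j)
    (hB1v : ∀ i, B1 (c (.inl i)) (c (.inr ())) (c (.inr ())) = b * p i * e₂)
    (hB2v : ∀ u v w, B2 (c (.inr ())) u v w = 0) (hB2v' : ∀ u v w, B2 u (c (.inr ())) v w = 0)
    (hB2h : ∀ i j k l, B2 (c (.inl i)) (c (.inl j)) (c (.inl k)) (c (.inl l)) =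
      e₁ * ((a * q i j + a ^ 2 * p i * p j) * (if k = l then ε k else 0) + Q i j k l)
        + e₂ * (A j k * A i l + A i k * A j l))
    (hB2m : ∀ i, B2 (c (.inl i)) (c (.inl i)) (c (.inr ())) (c (.inr ())) =
      e₂ * (b * q i i + b ^ 2 * p i * p i)) (hq : ∀ i j, q i j = q j i) :
    jetScal c B0 B1 B2 = e₁⁻¹ * ((∑ j, ε j * ∑ i, ε i * (Q i j j i - (1 / 2) * Q i i j j - (1 / 2) * Q j j i i))
      - ((Fintype.card ι - 1) * a + b) * ∑ i, ε i * q i i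
      - ((1 / 4) * a ^ 2 * (Fintype.card ι - 1) * (Fintype.card ι - 2) + (1 / 2) * b ^ 2
        + (1 / 2) * a * b * (Fintype.card ι - 2)) * ∑ i, ε i * p i ^ 2)
      - e₂ * (e₁ ^ 2)⁻¹ * ∑ j, ε j * ∑ i, ε i * A i j ^ 2 := by
  have hε0 : ∀ i, ε i ≠ 0 := fun i h => by simpa [h] using hε i
  have hεi : ∀ i, (ε i)⁻¹ = ε i := fun i => by
    rw [inv_eq_iff_eq_inv, eq_comm, inv_eq_of_mul_eq_one_right (hε i)]
  have hd : ∀ u, Sum.elim (fun i => e₁ * ε i) (fun _ : Unit => e₂) u ≠ 0 := by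
    rintro (i | u)
    · exact mul_ne_zero he₁ (hε0 i)
    · exact he₂
  rw [jetScal_diagonal hd hB0]
  have hB1m' : ∀ i j, B1 (c (.inl i)) (c (.inr ())) (c (.inl j)) = - e₂ * A i j := fun i j => by
    rw [hB1s, hB1m]
  have Khhh : ∀ i j k, jetK B1 (c (.inl i)) (c (.inl j)) (c (.inl k)) = (1 / 2) * a * e₁ *
      (p i * (if j = k then ε j else 0) + p j * (if i = k then ε i else 0)
        - p k * (if i = j then ε i else 0)) := by
    intro i j k; simp only [jetK, hB1h]; ring
  have Khhv : ∀ i j, jetK B1 (c (.inl i)) (c (.inl j)) (c (.inr ())) = 0 := by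
    intro i j; simp only [jetK, hB1m, hB1, hA i j]; ring
  have Khvh : ∀ i k, jetK B1 (c (.inl i)) (c (.inr ())) (c (.inl k)) = - e₂ * A i k := by
    intro i k; simp only [jetK, hB1m, hB1, hB1m', hA k i]; ring
  have Kvhh : ∀ i k, jetK B1 (c (.inr ())) (c (.inl i)) (c (.inl k)) = - e₂ * A i k := by
    intro i k; simp only [jetK, hB1m, hB1, hB1m', hA k i]; ring
  have Khvv : ∀ i, jetK B1 (c (.inl i)) (c (.inr ())) (c (.inr ())) = (1 / 2) * b * p i * e₂ := by
    intro i; simp only [jetK, hB1v, hB1]; ring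
  have Kvhv : ∀ i, jetK B1 (c (.inr ())) (c (.inl i)) (c (.inr ())) = (1 / 2) * b * p i * e₂ := by
    intro i; simp only [jetK, hB1v, hB1]; ring
  have Kvvh : ∀ i, jetK B1 (c (.inr ())) (c (.inr ())) (c (.inl i)) = - (1 / 2) * b * p i * e₂ := by
    intro i; simp only [jetK, hB1v, hB1]; ring
  have Kvvv : jetK B1 (c (.inr ())) (c (.inr ())) (c (.inr ())) = 0 := by
    simp only [jetK, hB1]; ring
  simp only [Fintype.sum_sum_type, Finset.univ_unique, PUnit.default_eq_unit, Finset.sum_singleton,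
    Sum.elim_inl, Sum.elim_inr, Khhh, Khhv, Khvh, Kvhh, Khvv, Kvhv, Kvvh, Kvvv, mul_zero, zero_mul,
    add_zero, zero_add, mul_inv, hεi]
  have Dhh : ∀ i j, jetD B2 (c (.inl i)) (c (.inl j)) (c (.inl j)) (c (.inl i))
      - jetD B2 (c (.inl j)) (c (.inl i)) (c (.inl j)) (c (.inl i))
      = e₁ * ((if i = j then ε i * (a * q i i + a ^ 2 * p i ^ 2) else 0)
        - (1 / 2) * (a * q i i + a ^ 2 * p i ^ 2) * ε j - (1 / 2) * (a * q j j + a ^ 2 * p j ^ 2) * ε i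
        + (Q i j j i - (1 / 2) * Q i i j j - (1 / 2) * Q j j i i)) - 3 * e₂ * A i j ^ 2 := by
    intro i j
    simp only [jetD, hB2h, if_true]
    rw [hQ j i, hQ j i, hQ' i j i j, hA j i]
    by_cases h : i = j
    · subst h
      have : A i i = 0 := by have := hA i i; linarith
      simp only [this, if_true]
      ring
    · simp only [h, Ne.symm h, if_false]
      have h1 : A i i = 0 := by have := hA i i; linarith
      have h2 : A j j = 0 := by have := hA j j; linarith
      rw [h1, h2]
      ring
  have Dvv : jetD B2 (c (.inr ())) (c (.inr ())) (c (.inr ())) (c (.inr ())) = 0 := by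
    simp only [jetD, hB2v]; ring
  have Dhv : ∀ i, jetD B2 (c (.inl i)) (c (.inr ())) (c (.inr ())) (c (.inl i))
      = - (1 / 2) * (e₂ * (b * q i i + b ^ 2 * p i ^ 2)) := by
    intro i; simp only [jetD, hB2v', hB2m]; ring
  have Dhv' : ∀ i, jetD B2 (c (.inl i)) (c (.inr ())) (c (.inl i)) (c (.inr ()))
      = (1 / 2) * (e₂ * (b * q i i + b ^ 2 * p i ^ 2)) := by
    intro i; simp only [jetD, hB2v', hB2m]; ring
  have Dvh : ∀ i u v, jetD B2 (c (.inr ())) i u v = 0 := by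
    intro i u v; simp only [jetD, hB2v]; ring
  simp only [Dhh, Dvv, Dhv, Dhv', Dvh]
  set P := ∑ i, ε i * p i ^ 2 with hP
  have hmix : ∀ i, ∑ k, ε k * (p k * ((p i * (if i = k then ε i else 0)
      + p i * (if i = k then ε i else 0)) - p k * ε i)) = 2 * p i ^ 2 - ε i * P := by
    intro i
    have : ∀ k, ε k * (p k * ((p i * (if i = k then ε i else 0)
      + p i * (if i = k then ε i else 0)) - p k * ε i))
      = (if i = k then 2 * p i ^ 2 else 0) - ε i * (ε k * p k ^ 2) := by
      intro k
      split_ifs with h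
      · subst h; linear_combination (2 * p i ^ 2) * hε i
      · ring
    simp only [this, Finset.sum_sub_distrib, Finset.sum_ite_eq, Finset.mem_univ, if_true,
      ← Finset.mul_sum, hP]
  have htr : ∀ i j, ∑ k, ε k * (((p i * (if i = k then ε i else 0)
      + p i * (if i = k then ε i else 0)) - p k * ε i) * ((p j * (if j = k then ε j else 0)
      + p j * (if j = k then ε j else 0)) - p k * ε j))
      = (if i = j then 4 * p i ^ 2 * ε i else 0) - 2 * p i ^ 2 * ε j - 2 * p j ^ 2 * ε i
        + ε i * ε j * P := by
    intro i j
    have : ∀ k, ε k * (((p i * (if i = k then ε i else 0)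
      + p i * (if i = k then ε i else 0)) - p k * ε i) * ((p j * (if j = k then ε j else 0)
      + p j * (if j = k then ε j else 0)) - p k * ε j))
      = (if i = k then (if i = j then 4 * p i ^ 2 * ε i else 0) - 2 * p i ^ 2 * ε j else 0)
        - (if j = k then 2 * p j ^ 2 * ε i else 0) + ε i * ε j * (ε k * p k ^ 2) := by
      intro k
      by_cases h1 : i = k
      · subst h1
        by_cases h2 : j = i
        · subst h2
          simp only [if_true]
          linear_combination (4 * ε j * p j ^ 2 - 4 * ε j * p j ^ 2) * hε j
        · simp only [h2, Ne.symm h2, if_true, if_false]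
          linear_combination (- 2 * p i ^ 2 * ε j) * hε i
      · by_cases h2 : j = k
        · subst h2
          simp only [h1, if_true, if_false]
          linear_combination (- 2 * p j ^ 2 * ε i) * hε j
        · simp only [h1, h2, if_false]
          ring
    simp only [this, Finset.sum_add_distrib, Finset.sum_sub_distrib, Finset.sum_ite_eq,
      Finset.mem_univ, if_true, ← Finset.mul_sum, hP]
  have hmA : ∀ i, ∑ k, e₁⁻¹ * ε k * (-e₂ * A i k * (-e₂ * A i k))
      = e₁⁻¹ * e₂ ^ 2 * ∑ k, ε k * A i k ^ 2 := by
    intro i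
    rw [Finset.mul_sum]
    exact Finset.sum_congr rfl fun k _ => by ring
  have hmix' : ∀ i, ∑ k, e₁⁻¹ * ε k * (-(1 / 2) * b * p k * e₂ * (1 / 2 * a * e₁ *
      ((p i * (if i = k then ε i else 0) + p i * (if i = k then ε i else 0)) - p k * ε i)))
      = - (1 / 4) * a * b * e₂ * (2 * p i ^ 2 - ε i * P) := by
    intro i
    rw [← hmix, Finset.mul_sum]
    refine Finset.sum_congr rfl fun k _ => ?_
    field_simp
    ring
  have hmix'' : ∀ i, ∑ k, e₁⁻¹ * ε k * (1 / 2 * a * e₁ *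
      ((p i * (if i = k then ε i else 0) + p i * (if i = k then ε i else 0)) - p k * ε i)
        * (-(1 / 2) * b * p k * e₂)) = - (1 / 4) * a * b * e₂ * (2 * p i ^ 2 - ε i * P) := by
    intro i
    rw [← hmix']
    exact Finset.sum_congr rfl fun k _ => by ring
  have htr' : ∀ i j, ∑ k, e₁⁻¹ * ε k * (1 / 2 * a * e₁ * ((p i * (if i = k then ε i else 0)
      + p i * (if i = k then ε i else 0)) - p k * ε i) * (1 / 2 * a * e₁ *
      ((p j * (if j = k then ε j else 0) + p j * (if j = k then ε j else 0)) - p k * ε j)))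
      = (1 / 4) * a ^ 2 * e₁ * ((if i = j then 4 * p i ^ 2 * ε i else 0) - 2 * p i ^ 2 * ε j
        - 2 * p j ^ 2 * ε i + ε i * ε j * P) := by
    intro i j
    rw [← htr, Finset.mul_sum]
    exact Finset.sum_congr rfl fun k _ => by field_simp; ring
  have hgr : ∀ i j, ∑ k, e₁⁻¹ * ε k * (1 / 2 * a * e₁ * (((p j * if i = k then ε i else 0)
      + p i * if j = k then ε j else 0) - p k * if j = i then ε j else 0) * (1 / 2 * a * e₁ *
        (((p i * if j = k then ε j else 0) + p j * if i = k then ε i else 0)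
          - p k * if i = j then ε i else 0)))
      = (1 / 4) * a ^ 2 * e₁ * ∑ k, ε k * ((p i * (if j = k then ε j else 0)
        + p j * (if i = k then ε i else 0) - p k * (if i = j then ε i else 0)) *
          (p i * (if j = k then ε j else 0) + p j * (if i = k then ε i else 0)
            - p k * (if i = j then ε i else 0))) := by
    intro i j
    rw [Finset.mul_sum]
    refine Finset.sum_congr rfl fun k _ => ?_
    have : (if j = i then ε j else 0) = if i = j then ε i else 0 := by
      by_cases h : i = j
      · subst h; rfl
      · rw [if_neg h, if_neg (Ne.symm h)]
    rw [this]
    field_simp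
    ring
  simp only [if_true, hmA, hmix', hmix'', htr', hgr]
  let D : (ι → ι → ℝ) → ℝ := fun f => ∑ j, ε j * ∑ i, ε i * f i j
  have Dadd : ∀ f g, D (fun i j => f i j + g i j) = D f + D g := fun f g => by
    simp only [D, mul_add, Finset.sum_add_distrib]
  have Dmul : ∀ (r : ℝ) f, D (fun i j => r * f i j) = r * D f := fun r f => by
    simp only [D, Finset.mul_sum]
    exact Finset.sum_congr rfl fun j _ => Finset.sum_congr rfl fun i _ => by ring
  have Ddiag : ∀ f : ι → ℝ, D (fun i j => if i = j then ε i * f i else 0) = ∑ i, ε i * f i := by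
    intro f
    simp only [D, mul_ite, mul_zero, Finset.sum_ite_eq', Finset.mem_univ, if_true]
    exact Finset.sum_congr rfl fun j _ => by linear_combination (ε j * f j) * hε j
  have Dl : ∀ f : ι → ℝ, D (fun i j => ε j * f i) = Fintype.card ι * ∑ i, ε i * f i := by
    intro f
    have : ∀ j, ε j * ∑ i, ε i * (ε j * f i) = ∑ i, ε i * f i := fun j => by
      rw [Finset.mul_sum]
      exact Finset.sum_congr rfl fun i _ => by linear_combination (ε i * f i) * hε j
    simp only [D, this, Finset.sum_const, Finset.card_univ, nsmul_eq_mul]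
  have Dr : ∀ f : ι → ℝ, D (fun i j => ε i * f j) = Fintype.card ι * ∑ i, ε i * f i := by
    intro f
    have : ∀ j, ∑ i, ε i * (ε i * f j) = Fintype.card ι * f j := fun j => by
      simp only [← mul_assoc, hε, one_mul, Finset.sum_const, Finset.card_univ, nsmul_eq_mul]
    simp only [D, this]
    rw [Finset.mul_sum]
    exact Finset.sum_congr rfl fun j _ => by ring
  have hεε : ∑ i, ε i * ε i = Fintype.card ι := by
    simp only [hε, Finset.sum_const, Finset.card_univ, nsmul_eq_mul, mul_one]
  have Dg := sum_gradient_sq (p := p) hε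
  set S := ∑ i, ε i * q i i with hS
  have hS' : ∑ i, ε i * (a * q i i + a ^ 2 * p i ^ 2) = a * S + a ^ 2 * P := by
    rw [hS, hP, Finset.mul_sum, Finset.mul_sum, ← Finset.sum_add_distrib]
    exact Finset.sum_congr rfl fun i _ => by ring
  have hA2 : ∑ j, ε j * ∑ k, ε k * A j k ^ 2 = D (fun i j => A i j ^ 2) := by
    simp only [D]
    refine Finset.sum_congr rfl fun j _ => ?_
    congr 1
    refine Finset.sum_congr rfl fun i _ => ?_
    rw [hA j i]; ring
  have main : ∑ j, e₁⁻¹ * ε j * ∑ i, e₁⁻¹ * ε i *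
      (e₁ * ((if i = j then ε i * (a * q i i + a ^ 2 * p i ^ 2) else 0)
        - (1 / 2) * (a * q i i + a ^ 2 * p i ^ 2) * ε j - (1 / 2) * (a * q j j + a ^ 2 * p j ^ 2) * ε i
        + (Q i j j i - (1 / 2) * Q i i j j - (1 / 2) * Q j j i i)) - 3 * e₂ * A i j ^ 2
        - (1 / 4) * a ^ 2 * e₁ * ((if i = j then 4 * p i ^ 2 * ε i else 0) - 2 * p i ^ 2 * ε j
        - 2 * p j ^ 2 * ε i + ε i * ε j * P)
        + (1 / 4) * a ^ 2 * e₁ * ∑ k, ε k * ((p i * (if j = k then ε j else 0)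
        + p j * (if i = k then ε i else 0) - p k * (if i = j then ε i else 0)) *
          (p i * (if j = k then ε j else 0) + p j * (if i = k then ε i else 0)
            - p k * (if i = j then ε i else 0))))
      = (e₁ ^ 2)⁻¹ * (e₁ * ((1 - Fintype.card ι) * (a * S + a ^ 2 * P)
          + D (fun i j => Q i j j i - (1 / 2) * Q i i j j - (1 / 2) * Q j j i i))
        - 3 * e₂ * D (fun i j => A i j ^ 2)
        - (1 / 4) * a ^ 2 * e₁ * ((4 - 4 * Fintype.card ι + (Fintype.card ι) ^ 2) * P)
        + (1 / 4) * a ^ 2 * e₁ * ((3 * Fintype.card ι - 2) * P)) := by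
    have e : ∀ f : ι → ι → ℝ, ∑ j, e₁⁻¹ * ε j * ∑ i, e₁⁻¹ * ε i * f i j = (e₁ ^ 2)⁻¹ * D f := by
      intro f
      simp only [D, Finset.mul_sum]
      exact Finset.sum_congr rfl fun j _ => Finset.sum_congr rfl fun i _ => by ring
    rw [e (fun i j => _)]
    congr 1
    have hp4 : ∑ i, ε i * (4 * p i ^ 2) = 4 * P := by
      rw [hP, Finset.mul_sum]; exact Finset.sum_congr rfl fun i _ => by ring
    calc _ = D (fun i j => (((((e₁ * (if i = j then ε i * (a * q i i + a ^ 2 * p i ^ 2) else 0)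
        + (-(1 / 2) * e₁) * (ε j * (a * q i i + a ^ 2 * p i ^ 2)))
        + (-(1 / 2) * e₁) * (ε i * (a * q j j + a ^ 2 * p j ^ 2)))
        + e₁ * (Q i j j i - (1 / 2) * Q i i j j - (1 / 2) * Q j j i i))
        + (-3 * e₂) * (A i j ^ 2))
        + (-(1 / 4) * a ^ 2 * e₁) * ((((if i = j then ε i * (4 * p i ^ 2) else 0)
          + (-2) * (ε j * p i ^ 2)) + (-2) * (ε i * p j ^ 2)) + P * (ε i * ε j)))
        + (1 / 4) * a ^ 2 * e₁ * ∑ k, ε k * ((p i * (if j = k then ε j else 0)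
        + p j * (if i = k then ε i else 0) - p k * (if i = j then ε i else 0)) *
          (p i * (if j = k then ε j else 0) + p j * (if i = k then ε i else 0)
            - p k * (if i = j then ε i else 0)))) := by
          congr 1; funext i j
          have : (if i = j then 4 * p i ^ 2 * ε i else 0) = if i = j then ε i * (4 * p i ^ 2) else 0 := by
            split_ifs <;> ring
          rw [this]
          ring
      _ = _ := by
          simp only [Dadd, Dmul, Ddiag, Dl, Dr, hεε, hS', hp4]
          rw [show D (fun i j => ∑ k, ε k * ((p i * (if j = k then ε j else 0)
            + p j * (if i = k then ε i else 0) - p k * (if i = j then ε i else 0)) *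
            (p i * (if j = k then ε j else 0) + p j * (if i = k then ε i else 0)
            - p k * (if i = j then ε i else 0)))) = _ from Dg]
          rw [← hP]
          ring
  have mixed : ∑ i, e₁⁻¹ * ε i * (-(1 / 2) * (e₂ * (b * q i i + b ^ 2 * p i ^ 2))
        - - (1 / 4) * a * b * e₂ * (2 * p i ^ 2 - ε i * P)
        + (e₁⁻¹ * e₂ ^ 2 * ∑ k, ε k * A i k ^ 2 + e₂⁻¹ * (1 / 2 * b * p i * e₂ * (1 / 2 * b * p i * e₂))))
      = e₁⁻¹ * (-(1 / 2) * e₂ * (b * S + b ^ 2 * P) + (1 / 4) * a * b * e₂ * (2 - Fintype.card ι) * P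
        + e₁⁻¹ * e₂ ^ 2 * D (fun i j => A i j ^ 2) + (1 / 4) * b ^ 2 * e₂ * P) := by
    have hcP : ∑ i : ι, ε i * (ε i * P) = Fintype.card ι * P := by
      simp only [← mul_assoc, hε, one_mul, Finset.sum_const, Finset.card_univ, nsmul_eq_mul]
    calc _ = ∑ i, (e₁⁻¹ * (-(1 / 2) * e₂ * b) * (ε i * q i i)
          + e₁⁻¹ * (-(1 / 2) * e₂ * b ^ 2 + (1 / 2) * a * b * e₂ + (1 / 4) * b ^ 2 * e₂) * (ε i * p i ^ 2)
          + e₁⁻¹ * (-(1 / 4) * a * b * e₂) * (ε i * (ε i * P))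
          + e₁⁻¹ * (e₁⁻¹ * e₂ ^ 2) * (ε i * ∑ k, ε k * A i k ^ 2)) := by
          refine Finset.sum_congr rfl fun i _ => ?_
          generalize ∑ k, ε k * A i k ^ 2 = Z
          field_simp
          ring
      _ = _ := by
          simp only [Finset.sum_add_distrib, ← Finset.mul_sum]
          rw [hcP, hA2, ← hP, ← hS]
          ring
  have split : ∀ (X Y : ι → ℝ), ∑ j, e₁⁻¹ * ε j * (X j + e₂⁻¹ * Y j)
      = ∑ j, e₁⁻¹ * ε j * X j + e₂⁻¹ * ∑ j, e₁⁻¹ * ε j * Y j := fun X Y => by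
    rw [Finset.mul_sum, ← Finset.sum_add_distrib]
    exact Finset.sum_congr rfl fun j _ => by ring
  rw [split, main]
  have fix1 : ∀ x : ℝ, 0 - 1 / 2 * x = -(1 / 2) * x := fun x => by ring
  simp only [fix1, sub_zero, zero_sub, neg_add_cancel, mul_zero, add_zero]
  rw [mixed]
  change _ = e₁⁻¹ * (D (fun i j => Q i j j i - (1 / 2) * Q i i j j - (1 / 2) * Q j j i i) - _ - _)
    - e₂ * (e₁ ^ 2)⁻¹ * D (fun i j => A i j ^ 2)
  field_simp
  ring

end KaluzaKleinJet

section SecondDerivative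

variable {E : Type*} [NormedAddCommGroup E] [NormedSpace ℝ E] {U : Set E}

/-- The second derivative `D_s D_t f`. -/
def hessAt (f : E → ℝ) (y s t : E) : ℝ := fderiv ℝ (fun z => fderiv ℝ f z t) y s

theorem differentiableAt_fderiv_apply {f : E → ℝ} (hU : IsOpen U) (hf : ContDiffOn ℝ ∞ f U) {y : E}
    (hy : y ∈ U) (t : E) : DifferentiableAt ℝ (fun z => fderiv ℝ f z t) y :=
  (differentiableAt_of_contDiffOn (hf.fderiv_of_isOpen (m := ∞) hU (by simp)) hU hy).clm_apply
    (differentiableAt_const t)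

theorem hessAt_add {f h : E → ℝ} (hU : IsOpen U) (hf : ContDiffOn ℝ ∞ f U) (hh : ContDiffOn ℝ ∞ h U)
    {y : E} (hy : y ∈ U) (s t : E) :
    hessAt (fun z => f z + h z) y s t = hessAt f y s t + hessAt h y s t := by
  have e : (fun z => fderiv ℝ (fun z => f z + h z) z t) =ᶠ[nhds y]
      fun z => fderiv ℝ f z t + fderiv ℝ h z t := by
    filter_upwards [hU.mem_nhds hy] with z hz
    rw [fderiv_fun_add (differentiableAt_of_contDiffOn hf hU hz) (differentiableAt_of_contDiffOn hh hU hz)]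
    rfl
  unfold hessAt
  rw [e.fderiv_eq, fderiv_fun_add (differentiableAt_fderiv_apply hU hf hy t)
    (differentiableAt_fderiv_apply hU hh hy t)]
  rfl

theorem hessAt_mul {f h : E → ℝ} (hU : IsOpen U) (hf : ContDiffOn ℝ ∞ f U) (hh : ContDiffOn ℝ ∞ h U)
    {y : E} (hy : y ∈ U) (s t : E) :
    hessAt (fun z => f z * h z) y s t = hessAt f y s t * h y + fderiv ℝ f y t * fderiv ℝ h y s
      + fderiv ℝ f y s * fderiv ℝ h y t + f y * hessAt h y s t := by
  have e : (fun z => fderiv ℝ (fun z => f z * h z) z t) =ᶠ[nhds y]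
      fun z => f z * fderiv ℝ h z t + h z * fderiv ℝ f z t := by
    filter_upwards [hU.mem_nhds hy] with z hz
    rw [fderiv_fun_mul (differentiableAt_of_contDiffOn hf hU hz) (differentiableAt_of_contDiffOn hh hU hz)]
    simp
  have hf' := differentiableAt_of_contDiffOn hf hU hy
  have hh' := differentiableAt_of_contDiffOn hh hU hy
  have hf'' := differentiableAt_fderiv_apply hU hf hy t
  have hh'' := differentiableAt_fderiv_apply hU hh hy t
  unfold hessAt
  rw [e.fderiv_eq, fderiv_fun_add (hf'.fun_mul hh'') (hh'.fun_mul hf''), fderiv_fun_mul hf' hh'',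
    fderiv_fun_mul hh' hf'']
  simp
  ring

theorem fderiv_exp_mul {φ : E → ℝ} {y : E} (h : DifferentiableAt ℝ φ y) (a : ℝ) (t : E) :
    fderiv ℝ (fun z => Real.exp (a * φ z)) y t = Real.exp (a * φ y) * (a * fderiv ℝ φ y t) := by
  rw [((h.hasFDerivAt.const_mul a).exp).fderiv]
  simp

theorem contDiffOn_exp_mul {φ : E → ℝ} (h : ContDiffOn ℝ ∞ φ U) (a : ℝ) :
    ContDiffOn ℝ ∞ (fun z => Real.exp (a * φ z)) U := (contDiffOn_const.mul h).exp

theorem hessAt_exp {φ : E → ℝ} (hU : IsOpen U) (hφ : ContDiffOn ℝ ∞ φ U) (a : ℝ)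
    {y : E} (hy : y ∈ U) (s t : E) : hessAt (fun z => Real.exp (a * φ z)) y s t
      = Real.exp (a * φ y) * (a * hessAt φ y s t + a ^ 2 * fderiv ℝ φ y s * fderiv ℝ φ y t) := by
  have e : (fun z => fderiv ℝ (fun z => Real.exp (a * φ z)) z t) =ᶠ[nhds y]
      fun z => Real.exp (a * φ z) * (a * fderiv ℝ φ z t) := by
    filter_upwards [hU.mem_nhds hy] with z hz
    exact fderiv_exp_mul (differentiableAt_of_contDiffOn hφ hU hz) a t
  have h2 := differentiableAt_fderiv_apply hU hφ hy t
  unfold hessAt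
  rw [e.fderiv_eq, fderiv_fun_mul (differentiableAt_of_contDiffOn (contDiffOn_exp_mul hφ a) hU hy)
    (h2.const_mul a), fderiv_const_mul h2, _root_.add_apply, _root_.smul_apply, _root_.smul_apply,
    _root_.smul_apply, fderiv_exp_mul (differentiableAt_of_contDiffOn hφ hU hy)]
  simp
  ring

theorem hessAt_comm {f : E → ℝ} (hU : IsOpen U) (hf : ContDiffOn ℝ ∞ f U) {y : E} (hy : y ∈ U)
    (s t : E) : hessAt f y s t = hessAt f y t s := by
  have h : IsSymmSndFDerivAt ℝ f y := (hf.contDiffAt (hU.mem_nhds hy)).isSymmSndFDerivAt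
    (by simpa using minSmoothness_two_le_infty)
  have hd := differentiableAt_of_contDiffOn (hf.fderiv_of_isOpen (m := ∞) hU (by simp)) hU hy
  have : ∀ s t, hessAt f y s t = fderiv ℝ (fderiv ℝ f) y s t := fun s t => by
    unfold hessAt
    rw [fderiv_clm_apply hd (differentiableAt_const t)]
    simp
  rw [this, this]
  exact h s t

end SecondDerivative

section KaluzaKleinMetric

variable {E : Type*} [NormedAddCommGroup E] [NormedSpace ℝ E]

/-- The metric `e^{aφ} g + e^{bφ} (A - dt)²` on `E × ℝ`. -/
def kkMetric (a b : ℝ) (g : E → E →L[ℝ] E →L[ℝ] ℝ) (φ : E → ℝ) (A : E → E →L[ℝ] ℝ) (z : E × ℝ) :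
    E × ℝ →L[ℝ] E × ℝ →L[ℝ] ℝ :=
  Real.exp (a * φ z.1) • (g z.1).bilinearComp (.fst ℝ E ℝ) (.fst ℝ E ℝ)
    + Real.exp (b * φ z.1) • ((A z.1).comp (.fst ℝ E ℝ) - .snd ℝ E ℝ).smulRight
      ((A z.1).comp (.fst ℝ E ℝ) - .snd ℝ E ℝ)

variable {a b : ℝ} {g : E → E →L[ℝ] E →L[ℝ] ℝ} {φ : E → ℝ} {A : E → E →L[ℝ] ℝ} {U : Set E}

/-- The components of `kkMetric`. -/
def kkComp (a b : ℝ) (g : E → E →L[ℝ] E →L[ℝ] ℝ) (φ : E → ℝ) (A : E → E →L[ℝ] ℝ) (u v : E × ℝ) (y : E) : ℝ :=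
  Real.exp (a * φ y) * g y u.1 v.1 + Real.exp (b * φ y) * ((A y u.1 - u.2) * (A y v.1 - v.2))

theorem kkMetric_apply (z u v : E × ℝ) : kkMetric a b g φ A z u v = kkComp a b g φ A u v z.1 := by
  simp [kkMetric, kkComp]

theorem contDiffOn_kkComp (hg : ContDiffOn ℝ ∞ g U) (hφ : ContDiffOn ℝ ∞ φ U) (hA : ContDiffOn ℝ ∞ A U)
    (u v : E × ℝ) : ContDiffOn ℝ ∞ (kkComp a b g φ A u v) U :=
  ((contDiffOn_exp_mul hφ a).mul ((hg.clm_apply contDiffOn_const).clm_apply contDiffOn_const)).add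
    ((contDiffOn_exp_mul hφ b).mul (((hA.clm_apply contDiffOn_const).sub contDiffOn_const).mul
      ((hA.clm_apply contDiffOn_const).sub contDiffOn_const)))

theorem contDiffOn_kkMetric [FiniteDimensional ℝ E] (hg : ContDiffOn ℝ ∞ g U) (hφ : ContDiffOn ℝ ∞ φ U)
    (hA : ContDiffOn ℝ ∞ A U) : ContDiffOn ℝ ∞ (kkMetric a b g φ A) (U ×ˢ Set.univ) := by
  refine contDiffOn_clm_apply.2 fun u => contDiffOn_clm_apply.2 fun v => ?_
  simp only [kkMetric_apply]
  exact (contDiffOn_kkComp hg hφ hA u v).comp contDiffOn_fst fun z hz => hz.1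

theorem fderiv_kkMetric [FiniteDimensional ℝ E] (hU : IsOpen U) (hg : ContDiffOn ℝ ∞ g U)
    (hφ : ContDiffOn ℝ ∞ φ U) (hA : ContDiffOn ℝ ∞ A U) {z : E × ℝ} (hz : z.1 ∈ U) (s u v : E × ℝ) :
    fderiv ℝ (kkMetric a b g φ A) z s u v = fderiv ℝ (kkComp a b g φ A u v) z.1 s.1 := by
  rw [← fderiv_clm₂_apply (differentiableAt_of_contDiffOn (contDiffOn_kkMetric hg hφ hA)
    (hU.prod isOpen_univ) ⟨hz, trivial⟩)]
  simp only [kkMetric_apply]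
  have := ((differentiableAt_of_contDiffOn (contDiffOn_kkComp (a := a) (b := b) hg hφ hA u v) hU
    hz).hasFDerivAt.comp z hasFDerivAt_fst).fderiv
  simp only [Function.comp_def] at this
  rw [this]
  rfl

theorem fderiv_fderiv_kkMetric [FiniteDimensional ℝ E] (hU : IsOpen U) (hg : ContDiffOn ℝ ∞ g U)
    (hφ : ContDiffOn ℝ ∞ φ U) (hA : ContDiffOn ℝ ∞ A U) {z : E × ℝ} (hz : z.1 ∈ U) (s t u v : E × ℝ) :
    fderiv ℝ (fderiv ℝ (kkMetric a b g φ A)) z s t u v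
      = hessAt (kkComp a b g φ A u v) z.1 s.1 t.1 := by
  have hW := hU.prod (isOpen_univ (X := ℝ))
  have h1 : ContDiffOn ℝ ∞ (fderiv ℝ (kkMetric a b g φ A)) (U ×ˢ Set.univ) :=
    (contDiffOn_kkMetric hg hφ hA).fderiv_of_isOpen hW (by simp)
  rw [← fderiv_clm₃_apply (differentiableAt_of_contDiffOn h1 hW ⟨hz, trivial⟩)]
  have e : (fun w => fderiv ℝ (kkMetric a b g φ A) w t u v) =ᶠ[nhds z]
      fun w => fderiv ℝ (kkComp a b g φ A u v) w.1 t.1 := by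
    filter_upwards [hW.mem_nhds ⟨hz, trivial⟩] with w hw
    exact fderiv_kkMetric hU hg hφ hA hw.1 t u v
  rw [e.fderiv_eq]
  have := ((differentiableAt_fderiv_apply hU (contDiffOn_kkComp (a := a) (b := b) hg hφ hA u v)
    hz t.1).hasFDerivAt.comp z hasFDerivAt_fst).fderiv
  simp only [Function.comp_def] at this
  rw [this]
  rfl

theorem fderiv_kkComp (hU : IsOpen U) (hg : ContDiffOn ℝ ∞ g U)
    (hφ : ContDiffOn ℝ ∞ φ U) (hA : ContDiffOn ℝ ∞ A U) {y : E} (hy : y ∈ U) (hg0 : fderiv ℝ g y = 0)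
    (hA0 : A y = 0) (u v : E × ℝ) (s : E) : fderiv ℝ (kkComp a b g φ A u v) y s =
      Real.exp (a * φ y) * (a * fderiv ℝ φ y s) * g y u.1 v.1 + Real.exp (b * φ y) *
        (b * fderiv ℝ φ y s * (u.2 * v.2) - fderiv ℝ A y s u.1 * v.2 - fderiv ℝ A y s v.1 * u.2) := by
  have dφ := differentiableAt_of_contDiffOn hφ hU hy
  have dA := differentiableAt_of_contDiffOn hA hU hy
  have dg := differentiableAt_of_contDiffOn hg hU hy
  have d1 : ∀ a, DifferentiableAt ℝ (fun z => Real.exp (a * φ z)) y := fun a => (dφ.const_mul a).exp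
  have d2 : DifferentiableAt ℝ (fun z => g z u.1 v.1) y :=
    (dg.clm_apply (differentiableAt_const _)).clm_apply (differentiableAt_const _)
  have d3 : ∀ w : E × ℝ, HasFDerivAt (fun z => A z w.1 - w.2) ((fderiv ℝ A y).flip w.1) y := fun w => by
    have := (dA.hasFDerivAt.clm_apply (hasFDerivAt_const w.1 y)).sub_const w.2
    simpa using this
  have h := ((d1 a).hasFDerivAt.mul d2.hasFDerivAt).add ((d1 b).hasFDerivAt.mul ((d3 u).mul (d3 v)))
  have e : kkComp a b g φ A u v = (fun z => Real.exp (a * φ z)) * (fun z => g z u.1 v.1)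
    + (fun z => Real.exp (b * φ z)) * ((fun z => A z u.1 - u.2) * fun z => A z v.1 - v.2) := rfl
  rw [e, h.fderiv]
  simp only [_root_.add_apply, _root_.smul_apply, smul_eq_mul, Pi.mul_apply,
    fderiv_exp_mul dφ, fderiv_clm₂_apply dg, hg0, hA0, ContinuousLinearMap.flip_apply]
  simp
  ring

theorem hessAt_kkComp (hU : IsOpen U) (hg : ContDiffOn ℝ ∞ g U)
    (hφ : ContDiffOn ℝ ∞ φ U) (hA : ContDiffOn ℝ ∞ A U) {y : E} (hy : y ∈ U) (hg0 : fderiv ℝ g y = 0)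
    (hA0 : A y = 0) (u v : E × ℝ) (s t : E) : hessAt (kkComp a b g φ A u v) y s t =
      Real.exp (a * φ y) * ((a * hessAt φ y s t + a ^ 2 * fderiv ℝ φ y s * fderiv ℝ φ y t) * g y u.1 v.1
        + fderiv ℝ (fderiv ℝ g) y s t u.1 v.1) + Real.exp (b * φ y) *
        ((b * hessAt φ y s t + b ^ 2 * fderiv ℝ φ y s * fderiv ℝ φ y t) * (u.2 * v.2)
          - b * fderiv ℝ φ y s * (fderiv ℝ A y t u.1 * v.2 + fderiv ℝ A y t v.1 * u.2)
          - b * fderiv ℝ φ y t * (fderiv ℝ A y s u.1 * v.2 + fderiv ℝ A y s v.1 * u.2)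
          + fderiv ℝ A y s u.1 * fderiv ℝ A y t v.1 + fderiv ℝ A y t u.1 * fderiv ℝ A y s v.1
          - hessAt (fun z => A z u.1) y s t * v.2 - hessAt (fun z => A z v.1) y s t * u.2) := by
  have dφ := differentiableAt_of_contDiffOn hφ hU hy
  have cg : ContDiffOn ℝ ∞ (fun z => g z u.1 v.1) U :=
    (hg.clm_apply contDiffOn_const).clm_apply contDiffOn_const
  have cA : ∀ w : E, ContDiffOn ℝ ∞ (fun z => A z w) U := fun w => hA.clm_apply contDiffOn_const
  have cA' : ∀ w : E × ℝ, ContDiffOn ℝ ∞ (fun z => A z w.1 - w.2) U := fun w =>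
    (cA w.1).sub contDiffOn_const
  have fA : ∀ w : E × ℝ, ∀ z ∈ U, ∀ r, fderiv ℝ (fun z => A z w.1 - w.2) z r = fderiv ℝ A z r w.1 := by
    intro w z hz r
    have := ((differentiableAt_of_contDiffOn hA hU hz).hasFDerivAt.clm_apply
      (hasFDerivAt_const w.1 z)).sub_const w.2
    rw [this.fderiv]; simp
  have hAh : ∀ w : E × ℝ, hessAt (fun z => A z w.1 - w.2) y s t = hessAt (fun z => A z w.1) y s t := by
    intro w
    unfold hessAt
    simp only [fderiv_sub_const]
  have hgh : hessAt (fun z => g z u.1 v.1) y s t = fderiv ℝ (fderiv ℝ g) y s t u.1 v.1 := by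
    have e : (fun z => fderiv ℝ (fun z => g z u.1 v.1) z t) =ᶠ[nhds y] fun z => fderiv ℝ g z t u.1 v.1 := by
      filter_upwards [hU.mem_nhds hy] with z hz
      exact fderiv_clm₂_apply (differentiableAt_of_contDiffOn hg hU hz) _ _ _
    unfold hessAt
    rw [e.fderiv_eq, fderiv_clm₃_apply (differentiableAt_of_contDiffOn
      (hg.fderiv_of_isOpen (m := ∞) hU (by simp)) hU hy)]
  unfold kkComp
  rw [hessAt_add hU ((contDiffOn_exp_mul hφ a).mul cg)
      ((contDiffOn_exp_mul hφ b).mul ((cA' u).mul (cA' v))) hy,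
    hessAt_mul hU (contDiffOn_exp_mul hφ a) cg hy,
    hessAt_mul hU (contDiffOn_exp_mul hφ b) ((cA' u).mul (cA' v)) hy,
    hessAt_mul hU (cA' u) (cA' v) hy, hessAt_exp hU hφ a hy, hessAt_exp hU hφ b hy, hgh, hAh, hAh]
  have hm : ∀ r, fderiv ℝ (fun z => (A z u.1 - u.2) * (A z v.1 - v.2)) y r
      = - fderiv ℝ A y r u.1 * v.2 - fderiv ℝ A y r v.1 * u.2 := by
    intro r
    rw [fderiv_fun_mul (differentiableAt_of_contDiffOn (cA' u) hU hy)
      (differentiableAt_of_contDiffOn (cA' v) hU hy)]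
    simp only [_root_.add_apply, _root_.smul_apply, smul_eq_mul, fA _ y hy, hA0]
    simp
    ring
  simp only [hm, fA _ y hy, fderiv_exp_mul dφ, fderiv_clm₂_apply (differentiableAt_of_contDiffOn hg hU hy),
    hg0, hA0]
  simp
  ring

end KaluzaKleinMetric

section KaluzaKleinCurvature

variable {E : Type*} [NormedAddCommGroup E] [NormedSpace ℝ E] [FiniteDimensional ℝ E]
  {ι : Type*} [Fintype ι] [DecidableEq ι]
  {a b : ℝ} {g : E → E →L[ℝ] E →L[ℝ] ℝ} {φ : E → ℝ} {A : E → E →L[ℝ] ℝ} {U : Set E}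

/-- The basis of `E × ℝ` extending a basis of `E`. -/
def kkBasis (c : Module.Basis ι ℝ E) : Module.Basis (ι ⊕ Unit) ℝ (E × ℝ) :=
  c.prod (Module.Basis.singleton Unit ℝ)

theorem kkBasis_inl (c : Module.Basis ι ℝ E) (i : ι) : kkBasis c (.inl i) = (c i, 0) := by
  simp [kkBasis]

theorem kkBasis_inr (c : Module.Basis ι ℝ E) (u : Unit) : kkBasis c (.inr u) = (0, 1) := by
  simp [kkBasis]

theorem fderiv_symm_apply (hU : IsOpen U) (hg : ContDiffOn ℝ ∞ g U)
    (hgs : ∀ z ∈ U, ∀ u v, g z u v = g z v u) {y : E} (hy : y ∈ U) (s u v : E) :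
    fderiv ℝ g y s u v = fderiv ℝ g y s v u := by
  have dg := differentiableAt_of_contDiffOn hg hU hy
  rw [← fderiv_clm₂_apply dg, ← fderiv_clm₂_apply dg]
  have : (fun z => g z u v) =ᶠ[nhds y] fun z => g z v u := by
    filter_upwards [hU.mem_nhds hy] with z hz using hgs z hz u v
  rw [this.fderiv_eq]

theorem fderiv_fderiv_symm_apply (hU : IsOpen U) (hg : ContDiffOn ℝ ∞ g U)
    (hgs : ∀ z ∈ U, ∀ u v, g z u v = g z v u) {y : E} (hy : y ∈ U) (s t u v : E) :
    fderiv ℝ (fderiv ℝ g) y s t u v = fderiv ℝ (fderiv ℝ g) y s t v u := by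
  have dg := differentiableAt_of_contDiffOn (hg.fderiv_of_isOpen (m := ∞) hU (by simp)) hU hy
  rw [← fderiv_clm₃_apply dg, ← fderiv_clm₃_apply dg]
  have : (fun z => fderiv ℝ g z t u v) =ᶠ[nhds y] fun z => fderiv ℝ g z t v u := by
    filter_upwards [hU.mem_nhds hy] with z hz using fderiv_symm_apply hU hg hgs hz t u v
  rw [this.fderiv_eq]

theorem gram_kkBasis {ε : ι → ℝ} (c : Module.Basis ι ℝ E) {y : E}
    (hc : ∀ i j, g y (c i) (c j) = if i = j then ε i else 0) (hA0 : A y = 0) (t : ℝ) (u v : ι ⊕ Unit) :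
    kkMetric a b g φ A (y, t) (kkBasis c u) (kkBasis c v) = if u = v then
      Sum.elim (fun i => Real.exp (a * φ y) * ε i) (fun _ => Real.exp (b * φ y)) u else 0 := by
  rw [kkMetric_apply, kkComp, hA0]
  rcases u with i | u <;> rcases v with j | v
  · simp [kkBasis_inl, hc]
  · simp [kkBasis_inl, kkBasis_inr]
  · simp [kkBasis_inl, kkBasis_inr]
  · simp [kkBasis_inr]

theorem scalAt_kkMetric_of_normal {ε : ι → ℝ} (hε : ∀ i, ε i * ε i = 1) (hU : IsOpen U)
    (hg : ContDiffOn ℝ ∞ g U) (hgs : ∀ z ∈ U, ∀ u v, g z u v = g z v u)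
    (hφ : ContDiffOn ℝ ∞ φ U) (hA : ContDiffOn ℝ ∞ A U) {y : E} (hy : y ∈ U) (hg0 : fderiv ℝ g y = 0)
    (hA0 : A y = 0) (hA1 : ∀ s t, fderiv ℝ A y s t = - fderiv ℝ A y t s) (c : Module.Basis ι ℝ E)
    (hc : ∀ i j, g y (c i) (c j) = if i = j then ε i else 0) (t : ℝ) :
    scalAt (kkBasis c) (kkMetric a b g φ A) (y, t) = (Real.exp (a * φ y))⁻¹ * (scalAt c g y
      - ((Fintype.card ι - 1) * a + b) * ∑ i, ε i * hessAt φ y (c i) (c i)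
      - ((1 / 4) * a ^ 2 * (Fintype.card ι - 1) * (Fintype.card ι - 2) + (1 / 2) * b ^ 2
        + (1 / 2) * a * b * (Fintype.card ι - 2)) * ∑ i, ε i * fderiv ℝ φ y (c i) ^ 2)
      - Real.exp (b * φ y) * (Real.exp (a * φ y) ^ 2)⁻¹ *
        ∑ j, ε j * ∑ i, ε i * fderiv ℝ A y (c i) (c j) ^ 2 := by
  have hε0 : ∀ i, ε i ≠ 0 := fun i h => by simpa [h] using hε i
  have hεi : ∀ i, (ε i)⁻¹ = ε i := fun i => by
    rw [inv_eq_iff_eq_inv, eq_comm, inv_eq_of_mul_eq_one_right (hε i)]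
  have hQ' := fderiv_fderiv_symm_apply hU hg hgs hy
  have hQ : ∀ s t u v, fderiv ℝ (fderiv ℝ g) y s t u v = fderiv ℝ (fderiv ℝ g) y t s u v := by
    intro s t u v
    have h : IsSymmSndFDerivAt ℝ g y := (hg.contDiffAt (hU.mem_nhds hy)).isSymmSndFDerivAt
      (by simpa using minSmoothness_two_le_infty)
    rw [h s t]
  have hs : scalAt c g y = ∑ j, ε j * ∑ i, ε i * (fderiv ℝ (fderiv ℝ g) y (c i) (c j) (c j) (c i)
      - (1 / 2) * fderiv ℝ (fderiv ℝ g) y (c i) (c i) (c j) (c j)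
      - (1 / 2) * fderiv ℝ (fderiv ℝ g) y (c j) (c j) (c i) (c i)) := by
    unfold scalAt
    rw [jetScal_diagonal hε0 hc, hg0]
    simp only [hεi]
    refine Finset.sum_congr rfl fun j _ => ?_
    congr 1
    refine Finset.sum_congr rfl fun i _ => ?_
    simp only [jetD, jetK, _root_.zero_apply]
    rw [hQ (c j) (c i) (c j) (c i), hQ (c j) (c i) (c i) (c j), hQ' (c i) (c j) (c i) (c j)]
    simp only [add_zero, sub_zero, mul_zero, Finset.sum_const_zero]
    ring
  rw [hs]
  unfold scalAt
  refine jetScal_kaluzaKlein hε (Real.exp_ne_zero _) (Real.exp_ne_zero _)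
    (fun i => fderiv ℝ φ y (c i)) (fun i j => hessAt φ y (c i) (c j))
    (fun i j => fderiv ℝ A y (c i) (c j)) (fun i j => hA1 _ _)
    (fun i j k l => fderiv ℝ (fderiv ℝ g) y (c i) (c j) (c k) (c l)) (fun i j k l => hQ _ _ _ _)
    (fun i j k l => hQ' _ _ _ _) _ _ _ (fun u v => gram_kkBasis c hc hA0 t u v) ?_ ?_ ?_ ?_ ?_ ?_ ?_ ?_ ?_ ?_
  · intro u v w
    rw [fderiv_kkMetric hU hg hφ hA hy, fderiv_kkMetric hU hg hφ hA hy,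
      fderiv_kkComp hU hg hφ hA hy hg0 hA0, fderiv_kkComp hU hg hφ hA hy hg0 hA0, hgs y hy v.1 w.1]
    ring
  · intro v w
    rw [fderiv_kkMetric hU hg hφ hA hy, kkBasis_inr]
    simp
  · intro i j k
    rw [fderiv_kkMetric hU hg hφ hA hy, fderiv_kkComp hU hg hφ hA hy hg0 hA0]
    simp only [kkBasis_inl, hc]
    ring
  · intro i j
    rw [fderiv_kkMetric hU hg hφ hA hy, fderiv_kkComp hU hg hφ hA hy hg0 hA0]
    simp [kkBasis_inl, kkBasis_inr]
  · intro i
    rw [fderiv_kkMetric hU hg hφ hA hy, fderiv_kkComp hU hg hφ hA hy hg0 hA0]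
    simp [kkBasis_inl, kkBasis_inr]
    ring
  · intro u v w
    rw [fderiv_fderiv_kkMetric hU hg hφ hA hy, kkBasis_inr]
    simp [hessAt]
  · intro u v w
    rw [fderiv_fderiv_kkMetric hU hg hφ hA hy, kkBasis_inr]
    simp [hessAt]
  · intro i j k l
    rw [fderiv_fderiv_kkMetric hU hg hφ hA hy, hessAt_kkComp hU hg hφ hA hy hg0 hA0]
    simp only [kkBasis_inl, hc]
    ring
  · intro i
    have h : fderiv ℝ A y (c i) 0 = 0 := by simp
    have h' : hessAt (fun z => A z 0) y (c i) (c i) = 0 := by simp [hessAt]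
    rw [fderiv_fderiv_kkMetric hU hg hφ hA hy, hessAt_kkComp hU hg hφ hA hy hg0 hA0]
    simp only [kkBasis_inl, kkBasis_inr, h, h']
    simp
  · intro i j
    exact hessAt_comm hU hφ hy _ _

/-- Coordinates with `y₀ + v - ½ Γ(v, v)` as the point with coordinates `v`. -/
def normalMap (y₀ : E) (Γ : E →L[ℝ] E →L[ℝ] E) (v : E) : E := y₀ + v - (1 / 2 : ℝ) • Γ v v

variable {y₀ : E} {Γ : E →L[ℝ] E →L[ℝ] E}

theorem hasFDerivAt_normalMap (hΓ : ∀ u v, Γ u v = Γ v u) (v : E) :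
    HasFDerivAt (normalMap y₀ Γ) (ContinuousLinearMap.id ℝ E - Γ v) v := by
  have h := ((hasFDerivAt_id v).const_add y₀).sub
    ((Γ.hasFDerivAt (x := v)).clm_apply (hasFDerivAt_id v) |>.const_smul (1 / 2 : ℝ))
  refine HasFDerivAt.congr_fderiv h ?_
  ext u
  simp only [id_eq, _root_.sub_apply, _root_.smul_apply, _root_.add_apply,
    ContinuousLinearMap.comp_apply, ContinuousLinearMap.flip_apply, ContinuousLinearMap.id_apply]
  rw [hΓ u v]
  module

theorem fderiv_normalMap (hΓ : ∀ u v, Γ u v = Γ v u) (v : E) :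
    fderiv ℝ (normalMap y₀ Γ) v = ContinuousLinearMap.id ℝ E - Γ v := (hasFDerivAt_normalMap hΓ v).fderiv

theorem contDiff_normalMap : ContDiff ℝ ∞ (normalMap y₀ Γ) :=
  (contDiff_const.add contDiff_id).sub (contDiff_const.smul (Γ.contDiff.clm_apply contDiff_id))

theorem normalMap_zero : normalMap y₀ Γ 0 = y₀ := by simp [normalMap]

theorem fderiv_comp_normalMap (hΓ : ∀ u v, Γ u v = Γ v u) {f : E → ℝ} {v : E}
    (hf : DifferentiableAt ℝ f (normalMap y₀ Γ v)) (u : E) :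
    fderiv ℝ (fun z => f (normalMap y₀ Γ z)) v u = fderiv ℝ f (normalMap y₀ Γ v) (u - Γ v u) := by
  have := (hf.hasFDerivAt.comp v (hasFDerivAt_normalMap hΓ v)).fderiv
  simp only [Function.comp_def] at this
  rw [this]
  simp

theorem hessAt_comp_normalMap (hU : IsOpen U) (hφ : ContDiffOn ℝ ∞ φ U) (hy : y₀ ∈ U)
    (hΓ : ∀ u v, Γ u v = Γ v u) (s t : E) :
    hessAt (fun z => φ (normalMap y₀ Γ z)) 0 s t = hessAt φ y₀ s t - fderiv ℝ φ y₀ (Γ s t) := by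
  have hc : Continuous (normalMap y₀ Γ) := contDiff_normalMap.continuous
  have hV : IsOpen (normalMap y₀ Γ ⁻¹' U) := hU.preimage hc
  have h0 : (0 : E) ∈ normalMap y₀ Γ ⁻¹' U := by simpa [normalMap_zero] using hy
  have e : (fun z => fderiv ℝ (fun z => φ (normalMap y₀ Γ z)) z t) =ᶠ[nhds 0]
      fun z => fderiv ℝ φ (normalMap y₀ Γ z) (t - Γ z t) := by
    filter_upwards [hV.mem_nhds h0] with z hz
    exact fderiv_comp_normalMap hΓ (differentiableAt_of_contDiffOn hφ hU hz) t
  have dφ := differentiableAt_of_contDiffOn (hφ.fderiv_of_isOpen (m := ∞) hU (by simp)) hU hy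
  have dφ' : DifferentiableAt ℝ (fderiv ℝ φ) (normalMap y₀ Γ 0) := by rwa [normalMap_zero]
  have h1 := (dφ'.hasFDerivAt.comp (0 : E) (hasFDerivAt_normalMap hΓ 0)).clm_apply
    ((hasFDerivAt_const t (0 : E)).sub ((Γ.hasFDerivAt (x := (0 : E))).clm_apply (hasFDerivAt_const t 0)))
  have h2 := h1.fderiv
  simp only [Function.comp_def] at h2
  unfold hessAt
  rw [e.fderiv_eq]
  change fderiv ℝ (fun z => (fderiv ℝ φ (normalMap y₀ Γ z)) (t - Γ z t)) 0 s = _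
  have h3 : fderiv ℝ (fun z => (fderiv ℝ φ (normalMap y₀ Γ z)) (t - Γ z t)) 0 = _ := h2
  rw [h3]
  have h4 : fderiv ℝ (fun z => fderiv ℝ φ z t) y₀ s = fderiv ℝ (fderiv ℝ φ) y₀ s t := by
    rw [fderiv_clm_apply dφ (differentiableAt_const t)]; simp
  rw [h4]
  simp [normalMap_zero]
  abel

/-- The metric `g` in the coordinates `normalMap`. -/
def normalMetric (g : E → E →L[ℝ] E →L[ℝ] ℝ) (y₀ : E) (Γ : E →L[ℝ] E →L[ℝ] E) (v : E) : E →L[ℝ] E →L[ℝ] ℝ :=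
  (g (normalMap y₀ Γ v)).bilinearComp (.id ℝ E - Γ v) (.id ℝ E - Γ v)

theorem normalMetric_apply (v s t : E) :
    normalMetric g y₀ Γ v s t = g (normalMap y₀ Γ v) (s - Γ v s) (t - Γ v t) := by
  simp [normalMetric]

theorem contDiffOn_normalMetric (hg : ContDiffOn ℝ ∞ g U) :
    ContDiffOn ℝ ∞ (normalMetric g y₀ Γ) (normalMap y₀ Γ ⁻¹' U) := by
  have hΓs : ∀ s : E, ContDiffOn ℝ ∞ (fun v => s - Γ v s) (normalMap y₀ Γ ⁻¹' U) := fun s =>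
    contDiffOn_const.sub (Γ.contDiff.clm_apply contDiff_const).contDiffOn
  refine contDiffOn_clm_apply.2 fun s => contDiffOn_clm_apply.2 fun t => ?_
  simp only [normalMetric_apply]
  exact ((hg.comp contDiff_normalMap.contDiffOn fun v hv => hv).clm_apply (hΓs s)).clm_apply (hΓs t)

theorem fderiv_normalMetric (hU : IsOpen U) (hg : ContDiffOn ℝ ∞ g U)
    (hgs : ∀ z ∈ U, ∀ u v, g z u v = g z v u) (hy : y₀ ∈ U) (hΓ : ∀ u v, Γ u v = Γ v u)
    (hK : ∀ u v w, g y₀ (Γ u v) w = jetK (fderiv ℝ g y₀) u v w) :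
    fderiv ℝ (normalMetric g y₀ Γ) 0 = 0 := by
  have hV : IsOpen (normalMap y₀ Γ ⁻¹' U) := hU.preimage contDiff_normalMap.continuous
  have h0 : (0 : E) ∈ normalMap y₀ Γ ⁻¹' U := by simpa [normalMap_zero] using hy
  have dG := differentiableAt_of_contDiffOn (contDiffOn_normalMetric (Γ := Γ) hg) hV h0
  have dg : DifferentiableAt ℝ g (normalMap y₀ Γ 0) := by
    rw [normalMap_zero]; exact differentiableAt_of_contDiffOn hg hU hy
  ext s u w
  rw [← fderiv_clm₂_apply dG]
  simp only [normalMetric_apply]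
  have hΓd : ∀ s : E, HasFDerivAt (fun v => s - Γ v s) (-Γ.flip s) 0 := fun s => by
    refine ((hasFDerivAt_const s (0 : E)).sub ((Γ.hasFDerivAt (x := (0 : E))).clm_apply
      (hasFDerivAt_const s 0))).congr_fderiv ?_
    ext; simp
  have hgd := dg.hasFDerivAt.comp (0 : E) (hasFDerivAt_normalMap hΓ 0)
  have h := fderiv_bilinear hgd.differentiableAt (hΓd u).differentiableAt (hΓd w).differentiableAt s
  simp only [Function.comp_def] at h hgd
  rw [h, (hΓd u).fderiv, (hΓd w).fderiv, hgd.fderiv]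
  have h1 := hgs y₀ hy u (Γ s w)
  have h2 := fderiv_symm_apply hU hg hgs hy
  simp only [normalMap_zero, map_zero, _root_.zero_apply, sub_zero, _root_.neg_apply,
    ContinuousLinearMap.flip_apply, map_neg, ContinuousLinearMap.comp_id, h1, hK, jetK]
  rw [h2 s u w]
  ring

theorem scalAt_normalMetric {ε : ι → ℝ} (hε0 : ∀ i, ε i ≠ 0) (hU : IsOpen U) (hg : ContDiffOn ℝ ∞ g U)
    (hgs : ∀ z ∈ U, ∀ u v, g z u v = g z v u) (hy : y₀ ∈ U) (hΓ : ∀ u v, Γ u v = Γ v u)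
    (c : Module.Basis ι ℝ E) (hc : ∀ i j, g y₀ (c i) (c j) = if i = j then ε i else 0) :
    scalAt c (normalMetric g y₀ Γ) 0 = scalAt c g y₀ := by
  have hV : IsOpen (normalMap y₀ Γ ⁻¹' U) := hU.preimage contDiff_normalMap.continuous
  have h0 : (0 : E) ∈ normalMap y₀ Γ ⁻¹' U := by simpa [normalMap_zero] using hy
  have hm : c.map (ContinuousLinearEquiv.refl ℝ E).toLinearEquiv = c := by ext; simp
  have := scalAt_pullback c hV hU (f := normalMap y₀ Γ) contDiff_normalMap.contDiffOn (fun v hv => hv)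
    hg hgs (B' := normalMetric g y₀ Γ)
    (fun z hz u v => by rw [normalMetric_apply, fderiv_normalMap hΓ]; simp) h0
    (.refl ℝ E) (by rw [fderiv_normalMap hΓ]; ext; simp)
    (by rw [hm, normalMap_zero]; exact isUnit_det_diagonal hε0 hc)
  rwa [hm, normalMap_zero] at this

/-- The gauge transformation which makes a `1`-form vanish at a point, with skew derivative. -/
def gaugeFun (l : E →L[ℝ] ℝ) (D : E →L[ℝ] E →L[ℝ] ℝ) (x : E) : ℝ := l x + (1 / 2) * D x x

theorem hasFDerivAt_gaugeFun (l : E →L[ℝ] ℝ) (D : E →L[ℝ] E →L[ℝ] ℝ) (x : E) :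
    HasFDerivAt (gaugeFun l D) (l + (1 / 2 : ℝ) • (D x + D.flip x)) x := by
  refine ((l.hasFDerivAt).add (((D.hasFDerivAt (x := x)).clm_apply (hasFDerivAt_id x)).const_mul
    (1 / 2 : ℝ))).congr_fderiv ?_
  ext u
  simp

/-- The `1`-form `A` in the coordinates `normalMap` after the gauge transformation `gaugeFun`. -/
def normalForm (A : E → E →L[ℝ] ℝ) (y₀ : E) (Γ : E →L[ℝ] E →L[ℝ] E) (D : E →L[ℝ] E →L[ℝ] ℝ)
    (v : E) : E →L[ℝ] ℝ :=
  (A (normalMap y₀ Γ v)).comp (.id ℝ E - Γ v) - (A y₀ + (1 / 2 : ℝ) • (D v + D.flip v))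

theorem contDiffOn_normalForm (hA : ContDiffOn ℝ ∞ A U) (D : E →L[ℝ] E →L[ℝ] ℝ) :
    ContDiffOn ℝ ∞ (normalForm A y₀ Γ D) (normalMap y₀ Γ ⁻¹' U) := by
  refine ContDiffOn.sub ((hA.comp contDiff_normalMap.contDiffOn fun v hv => hv).clm_comp
    (contDiffOn_const.sub Γ.contDiff.contDiffOn)) (contDiffOn_const.add (ContDiffOn.const_smul _
      (D.contDiff.contDiffOn.add D.flip.contDiff.contDiffOn)))

theorem normalForm_zero (D : E →L[ℝ] E →L[ℝ] ℝ) : normalForm A y₀ Γ D 0 = 0 := by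
  simp [normalForm, normalMap_zero]

theorem fderiv_normalForm (hU : IsOpen U) (hA : ContDiffOn ℝ ∞ A U) (hy : y₀ ∈ U)
    (hΓ : ∀ u v, Γ u v = Γ v u) {D : E →L[ℝ] E →L[ℝ] ℝ}
    (hD : ∀ s t, D s t = fderiv ℝ A y₀ s t - A y₀ (Γ s t)) (s t : E) :
    fderiv ℝ (normalForm A y₀ Γ D) 0 s t = (1 / 2) * (fderiv ℝ A y₀ s t - fderiv ℝ A y₀ t s) := by
  have dA : DifferentiableAt ℝ A (normalMap y₀ Γ 0) := by
    rw [normalMap_zero]; exact differentiableAt_of_contDiffOn hA hU hy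
  have h1 : HasFDerivAt (fun v => ContinuousLinearMap.id ℝ E - Γ v) (-Γ) 0 := by
    simpa using (Γ.hasFDerivAt (x := (0 : E))).const_sub (ContinuousLinearMap.id ℝ E)
  have h := ((dA.hasFDerivAt.comp (0 : E) (hasFDerivAt_normalMap hΓ 0)).clm_comp h1).sub
    (((D.hasFDerivAt (x := (0 : E))).add (D.flip.hasFDerivAt (x := (0 : E)))).const_smul (1 / 2 : ℝ)
      |>.const_add (A y₀))
  have e : normalForm A y₀ Γ D = (fun v => (A (normalMap y₀ Γ v)).comp (.id ℝ E - Γ v)) -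
    fun v => A y₀ + (1 / 2 : ℝ) • (D v + D.flip v) := rfl
  have h' := h.fderiv
  simp only [Function.comp_def] at h'
  have h'' : fderiv ℝ (normalForm A y₀ Γ D) 0 = _ := h'
  rw [h'']
  simp [normalMap_zero, hD, hΓ t s]
  ring

/-- The scalar curvature of the Kaluza-Klein metric. -/
theorem scalAt_kkMetric {ε : ι → ℝ} (hε : ∀ i, ε i * ε i = 1) (hU : IsOpen U)
    (hg : ContDiffOn ℝ ∞ g U) (hgs : ∀ z ∈ U, ∀ u v, g z u v = g z v u)
    (hφ : ContDiffOn ℝ ∞ φ U) (hA : ContDiffOn ℝ ∞ A U) (hy : y₀ ∈ U)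
    (c : Module.Basis ι ℝ E) (hc : ∀ i j, g y₀ (c i) (c j) = if i = j then ε i else 0) (t : ℝ)
    (hΓ : ∀ u v, Γ u v = Γ v u) (hK : ∀ u v w, g y₀ (Γ u v) w = jetK (fderiv ℝ g y₀) u v w)
    {κ : Type*} [Fintype κ] [DecidableEq κ] (c' : Module.Basis κ ℝ (E × ℝ)) :
    scalAt c' (kkMetric a b g φ A) (y₀, t) = (Real.exp (a * φ y₀))⁻¹ * (scalAt c g y₀
      - ((Fintype.card ι - 1) * a + b) *
        ∑ i, ε i * (hessAt φ y₀ (c i) (c i) - fderiv ℝ φ y₀ (Γ (c i) (c i)))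
      - ((1 / 4) * a ^ 2 * (Fintype.card ι - 1) * (Fintype.card ι - 2) + (1 / 2) * b ^ 2
        + (1 / 2) * a * b * (Fintype.card ι - 2)) * ∑ i, ε i * fderiv ℝ φ y₀ (c i) ^ 2)
      - Real.exp (b * φ y₀) * (Real.exp (a * φ y₀) ^ 2)⁻¹ * ∑ j, ε j * ∑ i, ε i *
        ((1 / 2) * (fderiv ℝ A y₀ (c i) (c j) - fderiv ℝ A y₀ (c j) (c i))) ^ 2 := by
  have hε0 : ∀ i, ε i ≠ 0 := fun i h => by simpa [h] using hε i
  let D : E →L[ℝ] E →L[ℝ] ℝ := fderiv ℝ A y₀ - (ContinuousLinearMap.compL ℝ E E ℝ (A y₀)).comp Γ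
  have hD : ∀ s t, D s t = fderiv ℝ A y₀ s t - A y₀ (Γ s t) := fun s t => by simp [D]
  have hcont : Continuous (normalMap y₀ Γ) := contDiff_normalMap.continuous
  set V := normalMap y₀ Γ ⁻¹' U with hVdef
  have hV : IsOpen V := hU.preimage hcont
  have h0 : (0 : E) ∈ V := by simpa [V, normalMap_zero] using hy
  let f : E × ℝ → E × ℝ := fun z => (normalMap y₀ Γ z.1, z.2 + gaugeFun (A y₀) D z.1)
  have hfd : ∀ z, HasFDerivAt f ((((ContinuousLinearMap.id ℝ E - Γ z.1)).comp (.fst ℝ E ℝ)).prod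
      (.snd ℝ E ℝ + (A y₀ + (1 / 2 : ℝ) • (D z.1 + D.flip z.1)).comp (.fst ℝ E ℝ))) z := fun z =>
    ((hasFDerivAt_normalMap hΓ z.1).comp z hasFDerivAt_fst).prodMk
      (hasFDerivAt_snd.add ((hasFDerivAt_gaugeFun (A y₀) D z.1).comp z hasFDerivAt_fst))
  have hfc : ContDiff ℝ ∞ f := (contDiff_normalMap.comp contDiff_fst).prodMk
    (contDiff_snd.add (((A y₀).contDiff.add (contDiff_const.mul
      (D.contDiff.clm_apply contDiff_id))).comp contDiff_fst))
  let F : (E × ℝ) ≃L[ℝ] (E × ℝ) := ContinuousLinearEquiv.equivOfInverse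
    ((ContinuousLinearMap.fst ℝ E ℝ).prod (.snd ℝ E ℝ + (A y₀).comp (.fst ℝ E ℝ)))
    ((ContinuousLinearMap.fst ℝ E ℝ).prod (.snd ℝ E ℝ - (A y₀).comp (.fst ℝ E ℝ)))
    (fun z => by simp) (fun z => by simp)
  have hF : (F : E × ℝ →L[ℝ] E × ℝ) = fderiv ℝ f (0, t) := by
    rw [(hfd _).fderiv]
    ext u <;> simp [F]
  have hf0 : f (0, t) = (y₀, t) := by simp [f, normalMap_zero, gaugeFun]
  have hg0 := fderiv_normalMetric hU hg hgs hy hΓ hK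
  have hc0 : ∀ i j, normalMetric g y₀ Γ 0 (c i) (c j) = if i = j then ε i else 0 := fun i j => by
    rw [normalMetric_apply, normalMap_zero]; simpa using hc i j
  have hpull : ∀ z u v, kkMetric a b (normalMetric g y₀ Γ) (fun x => φ (normalMap y₀ Γ x))
      (normalForm A y₀ Γ D) z u v = kkMetric a b g φ A (f z) (fderiv ℝ f z u) (fderiv ℝ f z v) := by
    intro z u v
    rw [(hfd z).fderiv, kkMetric_apply, kkMetric_apply, kkComp, kkComp, normalMetric_apply]
    simp only [f, normalForm, ContinuousLinearMap.prod_apply, ContinuousLinearMap.comp_apply,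
      _root_.add_apply, _root_.sub_apply, ContinuousLinearMap.coe_fst',
      ContinuousLinearMap.coe_snd', ContinuousLinearMap.id_apply]
    ring
  have hdet1 : IsUnit (gramM (kkBasis c) (fun u v => kkMetric a b (normalMetric g y₀ Γ)
      (fun x => φ (normalMap y₀ Γ x)) (normalForm A y₀ Γ D) (0, t) u v)).det := by
    refine isUnit_det_diagonal (d := Sum.elim (fun i => Real.exp (a * φ (normalMap y₀ Γ 0)) * ε i)
      (fun _ => Real.exp (b * φ (normalMap y₀ Γ 0)))) ?_
      (gram_kkBasis c hc0 (normalForm_zero D) t)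
    rintro (i | _)
    · exact mul_ne_zero (Real.exp_ne_zero _) (hε0 i)
    · exact Real.exp_ne_zero _
  have hdet2 : IsUnit (gramM ((kkBasis c).map F.toLinearEquiv)
      (fun u v => kkMetric a b g φ A (f (0, t)) u v)).det := by
    have : gramM ((kkBasis c).map F.toLinearEquiv) (fun u v => kkMetric a b g φ A (f (0, t)) u v)
        = gramM (kkBasis c) (fun u v => kkMetric a b (normalMetric g y₀ Γ)
      (fun x => φ (normalMap y₀ Γ x)) (normalForm A y₀ Γ D) (0, t) u v) := by
      ext i j
      simp only [gramM, Matrix.of_apply, Module.Basis.map_apply]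
      rw [hpull, ← hF]
      rfl
    rw [this]; exact hdet1
  have hp := scalAt_pullback (kkBasis c) (hV.prod isOpen_univ) (hU.prod isOpen_univ) (f := f)
    hfc.contDiffOn (U := U ×ˢ Set.univ) (fun z hz => ⟨hz.1, trivial⟩) (contDiffOn_kkMetric (a := a) (b := b) hg hφ hA)
    (fun z hz u v => by
      rw [kkMetric_apply, kkMetric_apply, kkComp, kkComp, hgs z.1 hz.1 u.1 v.1]; ring)
    (fun z hz => hpull z) (y := (0, t)) (show ((0 : E), t) ∈ V ×ˢ Set.univ from ⟨h0, trivial⟩) F hF hdet2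
  rw [hf0] at hp hdet2
  rw [scalAt_basis _ c' _ _ hdet2, ← hp, scalAt_kkMetric_of_normal (φ := fun x => φ (normalMap y₀ Γ x)) hε hV (contDiffOn_normalMetric hg)
    (fun z hz u v => by rw [normalMetric_apply, normalMetric_apply, hgs _ hz])
    (hφ.comp contDiff_normalMap.contDiffOn fun v hv => hv) (contDiffOn_normalForm hA D) h0 hg0
    (normalForm_zero D) (fun s t => by
      rw [fderiv_normalForm hU hA hy hΓ hD, fderiv_normalForm hU hA hy hΓ hD]; ring) c hc0,
    scalAt_normalMetric hε0 hU hg hgs hy hΓ c hc]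
  have hφ1 : ∀ u, fderiv ℝ (fun x => φ (normalMap y₀ Γ x)) 0 u = fderiv ℝ φ y₀ u := fun u => by
    rw [fderiv_comp_normalMap hΓ (by rw [normalMap_zero]; exact differentiableAt_of_contDiffOn hφ hU hy),
      normalMap_zero]
    simp
  simp only [fderiv_normalForm hU hA hy hΓ hD, hφ1, hessAt_comp_normalMap hU hφ hy hΓ, normalMap_zero]

end KaluzaKleinCurvature

section Christoffel

variable {E : Type*} [NormedAddCommGroup E] [NormedSpace ℝ E]
  {ι : Type*} [Fintype ι] [DecidableEq ι]

/-- The Christoffel symbols with respect to an orthonormal basis. -/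
def christoffelMap (ε : ι → ℝ) (c : ι → E) (B1 : E →L[ℝ] E →L[ℝ] E →L[ℝ] ℝ) : E →L[ℝ] E →L[ℝ] E :=
  ∑ k, ε k • ((ContinuousLinearMap.smulRightL ℝ E E).flip (c k)).comp ((1 / 2 : ℝ) •
    ((ContinuousLinearMap.compL ℝ E (E →L[ℝ] ℝ) ℝ (ContinuousLinearMap.apply ℝ ℝ (c k))).comp B1
      + ((ContinuousLinearMap.compL ℝ E (E →L[ℝ] ℝ) ℝ (ContinuousLinearMap.apply ℝ ℝ (c k))).comp B1).flip
      - B1 (c k)))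

theorem christoffelMap_apply (ε : ι → ℝ) (c : ι → E) (B1 : E →L[ℝ] E →L[ℝ] E →L[ℝ] ℝ) (u v : E) :
    christoffelMap ε c B1 u v = ∑ k, (ε k * jetK B1 u v (c k)) • c k := by
  simp only [christoffelMap, _root_.sum_apply, _root_.smul_apply]
  refine Finset.sum_congr rfl fun k _ => ?_
  simp [jetK, mul_smul]
  module

theorem christoffelMap_symm {ε : ι → ℝ} {c : ι → E} {B1 : E →L[ℝ] E →L[ℝ] E →L[ℝ] ℝ}
    (h : ∀ s u v, B1 s u v = B1 s v u) (u v : E) :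
    christoffelMap ε c B1 u v = christoffelMap ε c B1 v u := by
  simp only [christoffelMap_apply, jetK]
  refine Finset.sum_congr rfl fun k _ => ?_
  rw [h (c k) u v, add_comm]

theorem apply_christoffelMap {ε : ι → ℝ} (hε : ∀ i, ε i * ε i = 1) (c : Module.Basis ι ℝ E)
    {B0 : E →L[ℝ] E →L[ℝ] ℝ} (hc : ∀ i j, B0 (c i) (c j) = if i = j then ε i else 0)
    (B1 : E →L[ℝ] E →L[ℝ] E →L[ℝ] ℝ) (u v w : E) :
    B0 (christoffelMap ε c B1 u v) w = jetK B1 u v w := by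
  have h : ((B0 (christoffelMap ε c B1 u v) : E →L[ℝ] ℝ) : E →ₗ[ℝ] ℝ) = jetKlin B1 u v := by
    refine c.ext fun j => ?_
    change B0 (christoffelMap ε c B1 u v) (c j) = jetK B1 u v (c j)
    rw [christoffelMap_apply]
    simp only [map_sum, map_smul, _root_.sum_apply, _root_.smul_apply, hc, smul_eq_mul, mul_ite, mul_zero,
      Finset.sum_ite_eq', Finset.mem_univ, if_true]
    linear_combination (jetK B1 u v (c j)) * hε j
  exact congrArg (fun l : E →ₗ[ℝ] ℝ => l w) h

end Christoffel

section DetDerivative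

variable {E : Type*} [NormedAddCommGroup E] [NormedSpace ℝ E] {U : Set E}
  {ι : Type*} [Fintype ι] [DecidableEq ι]

theorem fderiv_det_one {M : E → Matrix ι ι ℝ} (hU : IsOpen U)
    (h : ∀ i j, ContDiffOn ℝ ∞ (fun y => M y i j) U) {y : E} (hy : y ∈ U) (hM : M y = 1) (t : E) :
    fderiv ℝ (fun z => (M z).det) y t = ∑ i, fderiv ℝ (fun z => M z i i) y t := by
  have hd : ∀ i j, HasFDerivAt (fun y => M y i j) (fderiv ℝ (fun y => M y i j) y) y := fun i j =>
    (differentiableAt_of_contDiffOn (h i j) hU hy).hasFDerivAt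
  have h1 : HasFDerivAt (fun z => (M z).det) (∑ σ : Equiv.Perm ι, ((Equiv.Perm.sign σ : ℤ) : ℝ) •
      ∑ i, (∏ j ∈ Finset.univ.erase i, M y (σ j) j) • fderiv ℝ (fun y => M y (σ i) i) y) y := by
    simp only [Matrix.det_apply, Units.smul_def, zsmul_eq_mul]
    exact HasFDerivAt.fun_sum fun σ _ => (HasFDerivAt.finset_prod fun i _ => hd (σ i) i).const_mul _
  rw [h1.fderiv, _root_.sum_apply, Finset.sum_eq_single 1]
  · simp [hM]
  · intro σ _ hσ
    rw [_root_.smul_apply, _root_.sum_apply, Finset.sum_eq_zero, smul_zero]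
    intro i _
    obtain ⟨j, hj, hji⟩ : ∃ j, σ j ≠ j ∧ j ≠ i := by
      obtain ⟨k, hk⟩ : ∃ k, σ k ≠ k := by
        by_contra! hcon
        exact hσ (Equiv.ext hcon)
      by_cases hki : k = i
      · exact ⟨σ k, fun h' => hk (σ.injective h'), fun h' => hk (h'.trans hki.symm)⟩
      · exact ⟨k, hk, hki⟩
    rw [Finset.prod_eq_zero (Finset.mem_erase.2 ⟨hji, Finset.mem_univ j⟩) (by simp [hM, Matrix.one_apply, hj])]
    simp
  · simp

theorem fderiv_sqrt_det {ε : ι → ℝ} (hε : ∀ i, ε i * ε i = 1) {M : E → Matrix ι ι ℝ} (hU : IsOpen U)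
    (h : ∀ i j, ContDiffOn ℝ ∞ (fun y => M y i j) U) {y : E} (hy : y ∈ U)
    (hM : M y = Matrix.diagonal ε) (t : E) :
    HasFDerivAt (fun z => Real.sqrt |(M z).det|) (fderiv ℝ (fun z => Real.sqrt |(M z).det|) y) y ∧
      fderiv ℝ (fun z => Real.sqrt |(M z).det|) y t = (1 / 2) * ∑ i, ε i * fderiv ℝ (fun z => M z i i) y t := by
  have hε' : ∀ i, |ε i| = 1 := fun i => by
    have h1 : |ε i| * |ε i| = 1 := by rw [← abs_mul, hε, abs_one]
    nlinarith [abs_nonneg (ε i)]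
  have hMd : ∀ z, |(M z).det| = |(Matrix.diagonal ε * M z).det| := fun z => by
    rw [Matrix.det_mul, abs_mul, Matrix.det_diagonal, Finset.abs_prod]
    simp [hε']
  have h2 : ∀ i j, ContDiffOn ℝ ∞ (fun y => (Matrix.diagonal ε * M y) i j) U := fun i j => by
    simp only [Matrix.diagonal_mul]
    exact contDiffOn_const.mul (h i j)
  have h3 : Matrix.diagonal ε * M y = 1 := by
    rw [hM, Matrix.diagonal_mul_diagonal]
    simp [hε]
  have hdd := differentiableAt_of_contDiffOn (contDiffOn_det h2) hU hy
  have hpos : ∀ᶠ z in nhds y, 0 < (Matrix.diagonal ε * M z).det :=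
    hdd.continuousAt.eventually (lt_mem_nhds (by
      change (0 : ℝ) < (Matrix.diagonal ε * M y).det
      rw [h3, Matrix.det_one]; exact one_pos))
  have he : (fun z => Real.sqrt |(M z).det|) =ᶠ[nhds y]
      fun z => Real.sqrt (Matrix.diagonal ε * M z).det := by
    filter_upwards [hpos] with z hz
    rw [hMd, abs_of_pos hz]
  have hs := hdd.hasFDerivAt.sqrt (by rw [h3, Matrix.det_one]; exact one_ne_zero)
  refine ⟨(hs.differentiableAt.congr_of_eventuallyEq he).hasFDerivAt, ?_⟩
  rw [he.fderiv_eq, hs.fderiv, _root_.smul_apply, fderiv_det_one hU h2 hy h3, h3]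
  simp only [Matrix.diagonal_mul, Matrix.det_one, Real.sqrt_one, smul_eq_mul, mul_one]
  congr 1
  refine Finset.sum_congr rfl fun i _ => ?_
  rw [fderiv_const_mul (differentiableAt_of_contDiffOn (h i i) hU hy)]
  rfl

theorem fderiv_matrix_inv {ε : ι → ℝ} (hε : ∀ i, ε i * ε i = 1) {M : E → Matrix ι ι ℝ} (hU : IsOpen U)
    (h : ∀ i j, ContDiffOn ℝ ∞ (fun y => M y i j) U) (hd : ∀ z ∈ U, IsUnit (M z).det) {y : E} (hy : y ∈ U)
    (hM : M y = Matrix.diagonal ε) (i j : ι) (t : E) :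
    fderiv ℝ (fun z => (M z)⁻¹ i j) y t = - ε i * ε j * fderiv ℝ (fun z => M z i j) y t := by
  have hi : (Matrix.diagonal ε)⁻¹ = Matrix.diagonal ε := by
    refine Matrix.inv_eq_left_inv ?_
    rw [Matrix.diagonal_mul_diagonal]
    simp [hε]
  have d1 := fun i j => differentiableAt_of_contDiffOn (contDiffOn_matrix_inv h hd i j) hU hy
  have d2 := fun i j => differentiableAt_of_contDiffOn (h i j) hU hy
  have e : (fun z => ∑ k, (M z)⁻¹ i k * M z k j) =ᶠ[nhds y] fun _ => (1 : Matrix ι ι ℝ) i j := by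
    filter_upwards [hU.mem_nhds hy] with z hz
    rw [← Matrix.nonsing_inv_mul _ (hd z hz), Matrix.mul_apply]
  have e1 := e.fderiv_eq (𝕜 := ℝ)
  rw [fderiv_fun_sum fun k _ => (d1 i k).fun_mul (d2 k j)] at e1
  have e2 := congrArg (fun l : E →L[ℝ] ℝ => l t) e1
  simp only [_root_.sum_apply, fderiv_fun_mul (d1 _ _) (d2 _ _), _root_.add_apply, _root_.smul_apply,
    hi, hM, Matrix.diagonal_apply, smul_eq_mul, ite_mul, zero_mul, Finset.sum_add_distrib,
    Finset.sum_ite_eq, Finset.sum_ite_eq', Finset.mem_univ, if_true] at e2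
  simp at e2
  linear_combination (ε j) * e2 - fderiv ℝ (fun z => (M z)⁻¹ i j) y t * hε j

end DetDerivative

section PointwiseNaturality

variable {V : Type*} [AddCommGroup V] [Module ℝ V] [TopologicalSpace V] {n : ℕ}

theorem gram_eq_gramM (b : Module.Basis (Fin n) ℝ V) (g : LinearMap.BilinForm ℝ V) :
    gram b g = gramM b (fun u v => g u v) := rfl

theorem isBilinearMap_form (g : LinearMap.BilinForm ℝ V) : IsBilinearMap ℝ (fun u v => g u v) where
  add_left := by simp
  smul_left := by simp
  add_right := by simp
  smul_right := by simp

theorem innerAt_succ (b : Module.Basis (Fin n) ℝ V) (g : LinearMap.BilinForm ℝ V) {k : ℕ}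
    (F G : V [⋀^Fin (k + 1)]→L[ℝ] ℝ) : innerAt b g F G = ((k + 1 : ℕ) : ℝ)⁻¹ *
      contr b (fun u v => g u v) (fun X Y => innerAt b g (interiorAt X F) (interiorAt Y G)) := by
  unfold innerAt contr
  rw [Nat.factorial_succ, ← (Fin.consEquiv fun _ : Fin (k + 1) => Fin n).sum_comp, Fintype.sum_prod_type]
  simp only [← (Fin.consEquiv fun _ : Fin (k + 1) => Fin n).sum_comp, Fintype.sum_prod_type]
  push_cast
  rw [mul_inv, mul_assoc]
  congr 1
  rw [Finset.mul_sum]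
  refine Finset.sum_congr rfl fun i _ => ?_
  rw [Finset.sum_comm, Finset.mul_sum]
  refine Finset.sum_congr rfl fun j _ => ?_
  rw [← gram_eq_gramM]
  rw [← mul_assoc ((gram b g)⁻¹ i j), mul_comm ((gram b g)⁻¹ i j), mul_assoc]
  congr 1
  rw [Finset.mul_sum]
  refine Finset.sum_congr rfl fun μ _ => ?_
  rw [Finset.mul_sum]
  refine Finset.sum_congr rfl fun ν _ => ?_
  have hF : ∀ (H : V [⋀^Fin (k + 1)]→L[ℝ] ℝ) (i : Fin n) (μ : Fin k → Fin n),
      H (fun l => b ((Fin.consEquiv fun _ : Fin (k + 1) => Fin n) (i, μ) l))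
        = interiorAt (b i) H (fun l => b (μ l)) := by
    intro H i μ
    change _ = H (Matrix.vecCons (b i) fun l => b (μ l))
    congr 1
    ext l
    refine Fin.cases ?_ (fun l => ?_) l <;> rfl
  rw [hF, hF, Fin.prod_univ_succ]
  simp only [Fin.consEquiv, Equiv.coe_fn_mk, Fin.cons_zero, Fin.cons_succ]
  ring

theorem interiorAt_apply {k : ℕ} (X : V) (ξ : V [⋀^Fin (k + 1)]→L[ℝ] ℝ) (v : Fin k → V) :
    interiorAt X ξ v = ξ (Matrix.vecCons X v) := rfl

theorem interiorAt_add {k : ℕ} (X Y : V) (ξ : V [⋀^Fin (k + 1)]→L[ℝ] ℝ) :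
    interiorAt (X + Y) ξ = interiorAt X ξ + interiorAt Y ξ := by
  ext v
  exact congrArg (fun f => f v) (map_add (AlternatingMap.curryLeft ξ.toAlternatingMap) X Y)

theorem interiorAt_smul {k : ℕ} (a : ℝ) (X : V) (ξ : V [⋀^Fin (k + 1)]→L[ℝ] ℝ) :
    interiorAt (a • X) ξ = a • interiorAt X ξ := by
  ext v
  exact congrArg (fun f => f v) (map_smul (AlternatingMap.curryLeft ξ.toAlternatingMap) a X)

theorem innerAt_add_left (b : Module.Basis (Fin n) ℝ V) (g : LinearMap.BilinForm ℝ V) {k : ℕ}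
    (F F' G : V [⋀^Fin k]→L[ℝ] ℝ) : innerAt b g (F + F') G = innerAt b g F G + innerAt b g F' G := by
  simp only [innerAt, ContinuousAlternatingMap.add_apply, mul_add, add_mul, Finset.sum_add_distrib]

theorem innerAt_add_right (b : Module.Basis (Fin n) ℝ V) (g : LinearMap.BilinForm ℝ V) {k : ℕ}
    (F G G' : V [⋀^Fin k]→L[ℝ] ℝ) : innerAt b g F (G + G') = innerAt b g F G + innerAt b g F G' := by
  simp only [innerAt, ContinuousAlternatingMap.add_apply, mul_add, Finset.sum_add_distrib]

theorem innerAt_smul_left (b : Module.Basis (Fin n) ℝ V) (g : LinearMap.BilinForm ℝ V) {k : ℕ} (a : ℝ)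
    (F G : V [⋀^Fin k]→L[ℝ] ℝ) : innerAt b g (a • F) G = a * innerAt b g F G := by
  simp only [innerAt, ContinuousAlternatingMap.smul_apply, smul_eq_mul, Finset.mul_sum]
  exact Finset.sum_congr rfl fun _ _ => Finset.sum_congr rfl fun _ _ => by ring

theorem innerAt_smul_right (b : Module.Basis (Fin n) ℝ V) (g : LinearMap.BilinForm ℝ V) {k : ℕ} (a : ℝ)
    (F G : V [⋀^Fin k]→L[ℝ] ℝ) : innerAt b g F (a • G) = a * innerAt b g F G := by
  simp only [innerAt, ContinuousAlternatingMap.smul_apply, smul_eq_mul, Finset.mul_sum]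
  exact Finset.sum_congr rfl fun _ _ => Finset.sum_congr rfl fun _ _ => by ring

theorem isBilinear_innerAt_interiorAt (b : Module.Basis (Fin n) ℝ V) (g : LinearMap.BilinForm ℝ V) {k : ℕ}
    (F G : V [⋀^Fin (k + 1)]→L[ℝ] ℝ) :
    IsBilinearMap ℝ (fun X Y => innerAt b g (interiorAt X F) (interiorAt Y G)) where
  add_left X X' Y := by rw [interiorAt_add, innerAt_add_left]
  smul_left a X Y := by rw [interiorAt_smul, innerAt_smul_left]; rfl
  add_right X Y Y' := by rw [interiorAt_add, innerAt_add_right]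
  smul_right a X Y := by rw [interiorAt_smul, innerAt_smul_right]; rfl

theorem innerAt_basis (b b' : Module.Basis (Fin n) ℝ V) (g : LinearMap.BilinForm ℝ V)
    (hdet : IsUnit (gram b g).det) {k : ℕ} (F G : V [⋀^Fin k]→L[ℝ] ℝ) :
    innerAt b' g F G = innerAt b g F G := by
  induction k with
  | zero =>
    have h : ∀ (H : V [⋀^Fin 0]→L[ℝ] ℝ) (v w : Fin 0 → V), H v = H w := fun H v w => by
      rw [Subsingleton.elim v w]
    simp only [innerAt, Finset.univ_unique, Finset.sum_singleton, Finset.univ_eq_empty, Finset.prod_empty]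
    rw [h F _ (fun i => b ((default : Fin 0 → Fin n) i)), h G _ (fun i => b ((default : Fin 0 → Fin n) i))]
  | succ k ih =>
    rw [innerAt_succ, innerAt_succ]
    simp only [ih]
    rw [contr_basis (isBilinearMap_form g) (isBilinear_innerAt_interiorAt b g F G) b b' hdet]

theorem sharpAt_linear (b : Module.Basis (Fin n) ℝ V) (g : LinearMap.BilinForm ℝ V)
    (α : V [⋀^Fin 1]→L[ℝ] ℝ) (l : V →ₗ[ℝ] ℝ) :
    l (sharpAt b g α) = contr b (fun u v => g u v) (fun u v => l u * asLinear α v) := by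
  simp only [sharpAt, map_sum, map_smul, smul_eq_mul, contr, asLinear_apply, ← gram_eq_gramM]
  exact Finset.sum_congr rfl fun i _ => Finset.sum_congr rfl fun j _ => by ring

theorem sharpAt_basis (b b' : Module.Basis (Fin n) ℝ V) (g : LinearMap.BilinForm ℝ V)
    (hdet : IsUnit (gram b g).det) (α : V [⋀^Fin 1]→L[ℝ] ℝ) : sharpAt b' g α = sharpAt b g α := by
  refine b.ext_elem fun i => ?_
  change b.coord i (sharpAt b' g α) = b.coord i (sharpAt b g α)
  rw [sharpAt_linear, sharpAt_linear]
  refine contr_basis (isBilinearMap_form g) ?_ b b' hdet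
  constructor <;> intros <;> simp <;> ring

/-- The volume form of a metric at a point, oriented by `τ`. -/
def volAt (b : Module.Basis (Fin n) ℝ V) (g : LinearMap.BilinForm ℝ V) (τ : V [⋀^Fin n]→L[ℝ] ℝ) :
    V [⋀^Fin n]→L[ℝ] ℝ :=
  (Real.sqrt |(gram b g).det| / |τ b|) • τ

theorem topForm_basis (b b' : Module.Basis (Fin n) ℝ V) (τ : V [⋀^Fin n]→L[ℝ] ℝ) :
    τ b' = b.det b' * τ b := by
  have := congrArg (fun f : V [⋀^Fin n]→ₗ[ℝ] ℝ => f b') (τ.toAlternatingMap.eq_smul_basis_det b)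
  change τ b' = τ b * b.det b' at this
  rw [this, mul_comm]

theorem volAt_basis (b b' : Module.Basis (Fin n) ℝ V) (g : LinearMap.BilinForm ℝ V)
    (τ : V [⋀^Fin n]→L[ℝ] ℝ) : volAt b' g τ = volAt b g τ := by
  have hP : b.det b' ≠ 0 := (b.isUnit_det b').ne_zero
  have hg : (gram b' g).det = b.det b' ^ 2 * (gram b g).det := by
    rw [gram_eq_gramM, gramM_change (isBilinearMap_form g) b b', Matrix.det_mul, Matrix.det_mul,
      Matrix.det_transpose, ← gram_eq_gramM, Module.Basis.det_apply]
    ring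
  unfold volAt
  rw [hg, topForm_basis b b' τ, abs_mul, abs_mul, abs_pow, Real.sqrt_mul (by positivity),
    Real.sqrt_sq (abs_nonneg _), mul_div_mul_left _ _ (abs_ne_zero.2 hP)]

variable {V' : Type*} [AddCommGroup V'] [Module ℝ V'] [TopologicalSpace V']

theorem innerAt_comp (b : Module.Basis (Fin n) ℝ V) (b' : Module.Basis (Fin n) ℝ V')
    (g : LinearMap.BilinForm ℝ V) (L : V' ≃L[ℝ] V) (hdet : IsUnit (gram b g).det) {k : ℕ}
    (F G : V [⋀^Fin k]→L[ℝ] ℝ) :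
    innerAt b' (g.comp (L : V' →ₗ[ℝ] V) (L : V' →ₗ[ℝ] V)) (F.compContinuousLinearMap (L : V' →L[ℝ] V))
      (G.compContinuousLinearMap (L : V' →L[ℝ] V)) = innerAt b g F G := by
  rw [← innerAt_basis b (b'.map L.toLinearEquiv) g hdet]
  have hg : gram b' (g.comp (L : V' →ₗ[ℝ] V) (L : V' →ₗ[ℝ] V)) = gram (b'.map L.toLinearEquiv) g := by
    ext i j; simp [gram]
  simp only [innerAt, hg]
  rfl

theorem volAt_comp (b : Module.Basis (Fin n) ℝ V) (b' : Module.Basis (Fin n) ℝ V')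
    (g : LinearMap.BilinForm ℝ V) (L : V' ≃L[ℝ] V) (τ : V [⋀^Fin n]→L[ℝ] ℝ) :
    volAt b' (g.comp (L : V' →ₗ[ℝ] V) (L : V' →ₗ[ℝ] V)) (τ.compContinuousLinearMap (L : V' →L[ℝ] V))
      = (volAt b g τ).compContinuousLinearMap (L : V' →L[ℝ] V) := by
  rw [← volAt_basis b (b'.map L.toLinearEquiv) g]
  have hg : gram b' (g.comp (L : V' →ₗ[ℝ] V) (L : V' →ₗ[ℝ] V)) = gram (b'.map L.toLinearEquiv) g := by
    ext i j; simp [gram]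
  simp only [volAt, hg]
  rfl

theorem sharpAt_comp (b : Module.Basis (Fin n) ℝ V) (b' : Module.Basis (Fin n) ℝ V')
    (g : LinearMap.BilinForm ℝ V) (L : V' ≃L[ℝ] V) (hdet : IsUnit (gram b g).det)
    (α : V [⋀^Fin 1]→L[ℝ] ℝ) :
    L (sharpAt b' (g.comp (L : V' →ₗ[ℝ] V) (L : V' →ₗ[ℝ] V)) (α.compContinuousLinearMap (L : V' →L[ℝ] V)))
      = sharpAt b g α := by
  rw [← sharpAt_basis b (b'.map L.toLinearEquiv) g hdet]
  have hg : gram b' (g.comp (L : V' →ₗ[ℝ] V) (L : V' →ₗ[ℝ] V)) = gram (b'.map L.toLinearEquiv) g := by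
    ext i j; simp [gram]
  simp only [sharpAt, hg, map_sum, map_smul]
  rfl

theorem interiorAt_comp {k : ℕ} (L : V' →L[ℝ] V) (X : V') (ξ : V [⋀^Fin (k + 1)]→L[ℝ] ℝ) :
    interiorAt X (ξ.compContinuousLinearMap L) = (interiorAt (L X) ξ).compContinuousLinearMap L := by
  ext v
  change ξ (L ∘ Matrix.vecCons X v) = ξ (Matrix.vecCons (L X) (L ∘ v))
  congr 1
  ext i
  refine Fin.cases ?_ (fun i => ?_) i <;> rfl

end PointwiseNaturality

section Flux

variable {E : Type*} [NormedAddCommGroup E] [NormedSpace ℝ E]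

/-- A continuous bilinear form as a bilinear form. -/
def bilinOf (B : E →L[ℝ] E →L[ℝ] ℝ) : LinearMap.BilinForm ℝ E :=
  LinearMap.mk₂ ℝ (fun u v => B u v) (by simp) (by simp) (by simp) (by simp)

@[simp] theorem bilinOf_apply (B : E →L[ℝ] E →L[ℝ] ℝ) (u v : E) : bilinOf B u v = B u v := rfl

/-- The differential of a function on a vector space as a `1`-form. -/
def gradForm (φ : E → ℝ) (y : E) : E [⋀^Fin 1]→L[ℝ] ℝ :=
  ContinuousAlternatingMap.ofSubsingleton ℝ E ℝ (0 : Fin 1) (fderiv ℝ φ y)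

theorem gradForm_apply (φ : E → ℝ) (y : E) (v : Fin 1 → E) : gradForm φ y v = fderiv ℝ φ y (v 0) := rfl

/-- The form `e^{-2φ} i_{grad φ} dvol` on a vector space. -/
def fluxField {m : ℕ} (b : Module.Basis (Fin (m + 1)) ℝ E) (B : E → E →L[ℝ] E →L[ℝ] ℝ) (φ : E → ℝ)
    (τ : E → E [⋀^Fin (m + 1)]→L[ℝ] ℝ) (y : E) : E [⋀^Fin m]→L[ℝ] ℝ :=
  Real.exp (-2 * φ y) • interiorAt (sharpAt b (bilinOf (B y)) (gradForm φ y))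
    (volAt b (bilinOf (B y)) (τ y))

variable {n : ℕ} {U : Set E} {B : E → E →L[ℝ] E →L[ℝ] ℝ}

theorem contDiffOn_abs {E' : Type*} [NormedAddCommGroup E'] [NormedSpace ℝ E'] {U : Set E'} {f : E' → ℝ}
    (hf : ContDiffOn ℝ ∞ f U) (h0 : ∀ y ∈ U, f y ≠ 0) : ContDiffOn ℝ ∞ (fun y => |f y|) U :=
  fun y hy => (contDiffAt_abs (h0 y hy)).comp_contDiffWithinAt y (hf y hy)

theorem contDiffOn_volAt [FiniteDimensional ℝ E] (b : Module.Basis (Fin n) ℝ E) (hB : ContDiffOn ℝ ∞ B U)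
    (hd : ∀ y ∈ U, (gram b (bilinOf (B y))).det ≠ 0) {τ : E → E [⋀^Fin n]→L[ℝ] ℝ}
    (hτ : ContDiffOn ℝ ∞ τ U) (hτ0 : ∀ y ∈ U, τ y b ≠ 0) :
    ContDiffOn ℝ ∞ (fun y => volAt b (bilinOf (B y)) (τ y)) U := by
  unfold volAt
  have h1 : ContDiffOn ℝ ∞ (fun y => (gram b (bilinOf (B y))).det) U :=
    contDiffOn_det fun i j => contDiffOn_gramM hB b i j
  refine ContDiffOn.smul (ContDiffOn.div ((contDiffOn_abs h1 hd).sqrt fun y hy => abs_ne_zero.2 (hd y hy))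
    (contDiffOn_abs (contDiffOn_form_apply hτ b) hτ0) fun y hy => abs_ne_zero.2 (hτ0 y hy)) hτ

theorem contDiffOn_fluxField [FiniteDimensional ℝ E] {m : ℕ} (b : Module.Basis (Fin (m + 1)) ℝ E)
    (hU : IsOpen U) (hB : ContDiffOn ℝ ∞ B U)
    (hd : ∀ y ∈ U, (gram b (bilinOf (B y))).det ≠ 0) {τ : E → E [⋀^Fin (m + 1)]→L[ℝ] ℝ}
    (hτ : ContDiffOn ℝ ∞ τ U) (hτ0 : ∀ y ∈ U, τ y b ≠ 0) {φ : E → ℝ} (hφ : ContDiffOn ℝ ∞ φ U) :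
    ContDiffOn ℝ ∞ (fluxField b B φ τ) U := by
  refine contDiffOn_form fun v => ?_
  have h : ∀ y, fluxField b B φ τ y v = Real.exp (-2 * φ y) * ∑ i, ∑ j,
      ((gram b (bilinOf (B y)))⁻¹ i j * fderiv ℝ φ y (b j)) *
        volAt b (bilinOf (B y)) (τ y) (Matrix.vecCons (b i) v) := by
    intro y
    set ω' := volAt b (bilinOf (B y)) (τ y)
    let l : E →ₗ[ℝ] ℝ :=
      { toFun := fun X => interiorAt X ω' v
        map_add' := fun X Y => by rw [interiorAt_add]; rfl
        map_smul' := fun a X => by rw [interiorAt_smul]; rfl }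
    change Real.exp (-2 * φ y) * l (sharpAt b (bilinOf (B y)) (gradForm φ y)) = _
    rw [sharpAt_linear]
    congr 1
    refine Finset.sum_congr rfl fun i _ => Finset.sum_congr rfl fun j _ => ?_
    change (gram b (bilinOf (B y)))⁻¹ i j * (l (b i) * fderiv ℝ φ y (b j))
      = (gram b (bilinOf (B y)))⁻¹ i j * fderiv ℝ φ y (b j) * l (b i)
    ring
  simp only [h]
  have hφ1 : ContDiffOn ℝ ∞ (fderiv ℝ φ) U := hφ.fderiv_of_isOpen hU (by simp)
  exact (contDiffOn_exp_mul hφ (-2)).mul (ContDiffOn.sum fun i _ => ContDiffOn.sum fun j _ =>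
    ((contDiffOn_matrix_inv (fun i j => contDiffOn_gramM hB b i j) (fun y hy => (hd y hy).isUnit) i j).mul
      (hφ1.clm_apply contDiffOn_const)).mul (contDiffOn_form_apply (contDiffOn_volAt b hB hd hτ hτ0) _))

theorem apply_vecCons_removeNth {m : ℕ} (c : Module.Basis (Fin (m + 1)) ℝ E)
    (f : E [⋀^Fin (m + 1)]→L[ℝ] ℝ) (X : E) (k : Fin (m + 1)) :
    f (Matrix.vecCons X (k.removeNth c)) = (-1) ^ (k : ℕ) * c.repr X k * f c := by
  have h1 : ∀ Y, f (k.insertNth Y (k.removeNth c)) = (-1) ^ (k : ℕ) * f (Matrix.vecCons Y (k.removeNth c)) := by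
    intro Y
    have := f.map_insertNth k Y (k.removeNth c)
    simpa using this
  have h2 : ∀ i, f (k.insertNth (c i) (k.removeNth c)) = if i = k then f c else 0 := by
    intro i
    split_ifs with h
    · subst h
      rw [Fin.insertNth_self_removeNth]
    · obtain ⟨j, hj⟩ := Fin.exists_succAbove_eq h
      refine f.map_eq_zero_of_eq _ (i := k) (j := k.succAbove j) ?_ (Fin.succAbove_ne k j).symm
      rw [Fin.insertNth_apply_same, Fin.insertNth_apply_succAbove, Fin.removeNth, hj]
  have h3 : f (k.insertNth X (k.removeNth c)) = c.repr X k * f c := by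
    have h4 : ∀ Y, f (k.insertNth Y (k.removeNth c))
        = f.toMultilinearMap.toLinearMap (k.insertNth 0 (k.removeNth c)) k Y := by
      intro Y
      simp [MultilinearMap.toLinearMap]
    rw [h4]
    conv_lhs => rw [← c.sum_repr X]
    rw [map_sum]
    simp only [map_smul]
    simp only [← h4, h2, smul_eq_mul, mul_ite, mul_zero, Finset.sum_ite_eq',
      Finset.mem_univ, if_true]
  rw [mul_assoc, ← h3, h1, ← mul_assoc, ← pow_add, ← two_mul, pow_mul]
  simp

theorem topForm_eq_zero {f : E [⋀^Fin n]→L[ℝ] ℝ} (b : Module.Basis (Fin n) ℝ E) (h : f b = 0) : f = 0 := by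
  ext v
  have := congrArg (fun l : E [⋀^Fin n]→ₗ[ℝ] ℝ => l v) (f.toAlternatingMap.eq_smul_basis_det b)
  change f v = f b * b.det v at this
  rw [this, h, zero_mul]
  rfl

theorem extDeriv_fluxField [FiniteDimensional ℝ E] {m : ℕ} {ε : Fin (m + 1) → ℝ} (hε : ∀ i, ε i * ε i = 1)
    (b c : Module.Basis (Fin (m + 1)) ℝ E)
    (hU : IsOpen U) (hB : ContDiffOn ℝ ∞ B U) (hBs : ∀ z ∈ U, ∀ u v, B z u v = B z v u)
    (hd : ∀ y ∈ U, (gram b (bilinOf (B y))).det ≠ 0) {τ : E → E [⋀^Fin (m + 1)]→L[ℝ] ℝ}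
    (hτ : ContDiffOn ℝ ∞ τ U) (hτ0 : ∀ y ∈ U, τ y ≠ 0) {φ : E → ℝ} (hφ : ContDiffOn ℝ ∞ φ U)
    {y : E} (hy : y ∈ U) (hc : ∀ i j, B y (c i) (c j) = if i = j then ε i else 0) :
    extDeriv (fluxField b B φ τ) y = (Real.exp (-2 * φ y) *
      (∑ i, ε i * (hessAt φ y (c i) (c i) - fderiv ℝ φ y (christoffelMap ε c (fderiv ℝ B y) (c i) (c i)))
        - 2 * ∑ i, ε i * fderiv ℝ φ y (c i) ^ 2)) • volAt b (bilinOf (B y)) (τ y) := by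
  have hτb : ∀ (b : Module.Basis (Fin (m + 1)) ℝ E), ∀ y ∈ U, τ y b ≠ 0 := fun b y hy h =>
    hτ0 y hy (topForm_eq_zero b h)
  have hdet : ∀ y ∈ U, IsUnit (gramM c (fun u v => B y u v)).det := fun y hy =>
    det_gramM_change (isBilinearMap_clm (B y)) b c (hd y hy).isUnit
  have hbc : ∀ y ∈ U, fluxField b B φ τ y = fluxField c B φ τ y := by
    intro y hy
    unfold fluxField
    rw [sharpAt_basis b c _ (hd y hy).isUnit, volAt_basis b c]
  have hfl : ContDiffOn ℝ ∞ (fluxField b B φ τ) U := contDiffOn_fluxField b hU hB hd hτ (hτb b) hφ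
  refine sub_eq_zero.1 (topForm_eq_zero c ?_)
  rw [ContinuousAlternatingMap.sub_apply, ContinuousAlternatingMap.smul_apply, smul_eq_mul, sub_eq_zero,
    extDeriv_apply (differentiableAt_of_contDiffOn hfl hU hy), ← volAt_basis b c]
  set ρ : E → ℝ := fun z => Real.sqrt |(gramM c (fun u v => B z u v)).det| with hρ
  set s : ℝ := τ y c / |τ y c| with hs
  have hsgn : ∀ᶠ z in nhds y, τ z c / |τ z c| = s := by
    have hcont : ContinuousAt (fun z => τ z c * τ y c) y :=
      ((differentiableAt_of_contDiffOn (contDiffOn_form_apply hτ c) hU hy).continuousAt).mul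
        continuousAt_const
    have hpos : 0 < τ y c * τ y c := mul_self_pos.2 (hτb c y hy)
    filter_upwards [hcont.eventually (lt_mem_nhds hpos)] with z hz
    rw [hs]
    rcases lt_or_gt_of_ne (hτb c y hy) with h | h
    · have hz' : τ z c < 0 := by nlinarith
      rw [abs_of_neg h, abs_of_neg hz', div_neg, div_neg, div_self hz'.ne, div_self h.ne]
    · have hz' : 0 < τ z c := by nlinarith
      rw [abs_of_pos h, abs_of_pos hz', div_self hz'.ne', div_self h.ne']
  have hG : gramM c (fun u v => B y u v) = Matrix.diagonal ε := by
    ext i j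
    simp [gramM, hc, Matrix.diagonal_apply]
  have hvol : ∀ z, volAt c (bilinOf (B z)) (τ z) c = ρ z * (τ z c / |τ z c|) := by
    intro z
    simp only [volAt, gram_eq_gramM, ContinuousAlternatingMap.smul_apply, smul_eq_mul, bilinOf_apply, hρ]
    ring
  have hρy : ρ y = 1 := by
    have hε' : ∀ i, |ε i| = 1 := fun i => by
      have h1 : |ε i| * |ε i| = 1 := by rw [← abs_mul, hε, abs_one]
      nlinarith [abs_nonneg (ε i)]
    simp only [hρ, hG, Matrix.det_diagonal, Finset.abs_prod, hε', Finset.prod_const_one, Real.sqrt_one]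
  let Hk : Fin (m + 1) → E → ℝ := fun k z => s * (Real.exp (-2 * φ z) * (ρ z *
    ∑ j, (gramM c (fun u v => B z u v))⁻¹ k j * fderiv ℝ φ z (c j)))
  have hk : ∀ k : Fin (m + 1), (fun z => fluxField b B φ τ z (k.removeNth c)) =ᶠ[nhds y] fun z => (-1) ^ (k : ℕ) * Hk k z := by
    intro k
    filter_upwards [hU.mem_nhds hy, hsgn] with z hz hzs
    rw [hbc z hz]
    change Real.exp (-2 * φ z) * volAt c (bilinOf (B z)) (τ z)
      (Matrix.vecCons (sharpAt c (bilinOf (B z)) (gradForm φ z)) (k.removeNth c)) = _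
    rw [apply_vecCons_removeNth, hvol, hzs]
    have : c.repr (sharpAt c (bilinOf (B z)) (gradForm φ z)) k
        = ∑ j, (gramM c (fun u v => B z u v))⁻¹ k j * fderiv ℝ φ z (c j) := by
      simp only [sharpAt, map_sum, map_smul, Finsupp.coe_finset_sum, Finset.sum_apply, Finsupp.smul_apply,
        Module.Basis.repr_self, smul_eq_mul]
      simp only [Finsupp.single_apply, mul_ite, mul_one, mul_zero]
      rw [Finset.sum_comm]
      simp only [Finset.sum_ite_eq', Finset.mem_univ, if_true]
      rfl
    rw [this]
    simp only [Hk]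
    ring
  have hGc : ∀ i j, ContDiffOn ℝ ∞ (fun z => gramM c (fun u v => B z u v) i j) U := fun i j =>
    contDiffOn_gramM hB c i j
  have hGd : ∀ i j t, fderiv ℝ (fun z => gramM c (fun u v => B z u v) i j) y t = fderiv ℝ B y t (c i) (c j) :=
    fun i j t => fderiv_clm₂_apply (differentiableAt_of_contDiffOn hB hU hy) _ _ _
  have hinv : ∀ i j, DifferentiableAt ℝ (fun z => (gramM c (fun u v => B z u v))⁻¹ i j) y := fun i j =>
    differentiableAt_of_contDiffOn (contDiffOn_matrix_inv hGc hdet i j) hU hy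
  have hφd : ∀ j, DifferentiableAt ℝ (fun z => fderiv ℝ φ z (c j)) y := fun j =>
    differentiableAt_fderiv_apply hU hφ hy _
  have hρd := fun t => fderiv_sqrt_det hε hU hGc hy hG t
  have hed := differentiableAt_of_contDiffOn (contDiffOn_exp_mul hφ (-2)) hU hy
  have hGi : (Matrix.diagonal ε)⁻¹ = Matrix.diagonal ε := by
    refine Matrix.inv_eq_left_inv ?_
    rw [Matrix.diagonal_mul_diagonal]
    simp [hε]
  have hsumd : ∀ k, DifferentiableAt ℝ (fun z => ∑ j, (gramM c (fun u v => B z u v))⁻¹ k j * fderiv ℝ φ z (c j)) y :=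
    fun k => DifferentiableAt.fun_sum fun j _ => (hinv k j).fun_mul (hφd j)
  have hHk : ∀ (k : Fin (m + 1)) (t : E), fderiv ℝ (fun z => (-1) ^ (k : ℕ) * Hk k z) y t = (-1) ^ (k : ℕ) * (s * Real.exp (-2 * φ y) * (
      (-2 * fderiv ℝ φ y t + (1 / 2) * ∑ i, ε i * fderiv ℝ B y t (c i) (c i)) * (ε k * fderiv ℝ φ y (c k))
      + ε k * hessAt φ y t (c k) - ε k * ∑ j, ε j * (fderiv ℝ B y t (c k) (c j) * fderiv ℝ φ y (c j)))) := by
    intro k t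
    have hd3 := (hρd t).1.differentiableAt.fun_mul (hsumd k)
    simp only [Hk]
    rw [fderiv_const_mul ((hed.fun_mul hd3).const_mul s), fderiv_const_mul (hed.fun_mul hd3),
      fderiv_fun_mul hed hd3, fderiv_fun_mul (hρd t).1.differentiableAt (hsumd k),
      fderiv_fun_sum fun j _ => (hinv k j).fun_mul (hφd j)]
    simp only [_root_.smul_apply, _root_.add_apply, smul_eq_mul, _root_.sum_apply,
      fderiv_fun_mul (hinv _ _) (hφd _), fderiv_matrix_inv hε hU hGc hdet hy hG, hGd, hG, hGi]
    rw [fderiv_exp_mul (differentiableAt_of_contDiffOn hφ hU hy)]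
    rw [show fderiv ℝ ρ y t = _ from (hρd t).2, show √|(Matrix.diagonal ε).det| = 1 by rw [← hG]; exact hρy]
    simp only [hGd, Matrix.diagonal_apply, ite_mul, zero_mul, Finset.sum_add_distrib, Finset.sum_ite_eq,
      Finset.mem_univ, if_true]
    have hneg : ∑ j, fderiv ℝ φ y (c j) * (-ε k * ε j * fderiv ℝ B y t (c k) (c j))
        = - (ε k * ∑ j, ε j * (fderiv ℝ B y t (c k) (c j) * fderiv ℝ φ y (c j))) := by
      rw [Finset.mul_sum, ← Finset.sum_neg_distrib]
      exact Finset.sum_congr rfl fun j _ => by ring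
    rw [hneg]
    unfold hessAt
    ring
  have hfin : ∀ k : Fin (m + 1), (-1 : ℤ) ^ (k : ℕ) • fderiv ℝ (fun z => fluxField b B φ τ z (k.removeNth c)) y (c k)
      = s * Real.exp (-2 * φ y) * (ε k * hessAt φ y (c k) (c k) - 2 * (ε k * fderiv ℝ φ y (c k) ^ 2)
        + ((1 / 2) * (∑ i, ε i * fderiv ℝ B y (c k) (c i) (c i)) * (ε k * fderiv ℝ φ y (c k))
        - ε k * ∑ j, ε j * (fderiv ℝ B y (c k) (c k) (c j) * fderiv ℝ φ y (c j)))) := by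
    intro k
    rw [(hk k).fderiv_eq, hHk, zsmul_eq_mul]
    push_cast
    rw [← mul_assoc, ← pow_add, ← two_mul, pow_mul]
    simp only [even_two, Even.neg_pow, one_pow, one_mul]
    ring
  have hΓ : ∑ i, ε i * fderiv ℝ φ y (christoffelMap ε c (fderiv ℝ B y) (c i) (c i))
      = ∑ k, (ε k * ∑ j, ε j * (fderiv ℝ B y (c k) (c k) (c j) * fderiv ℝ φ y (c j))
        - (1 / 2) * (∑ i, ε i * fderiv ℝ B y (c k) (c i) (c i)) * (ε k * fderiv ℝ φ y (c k))) := by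
    simp only [christoffelMap_apply, map_sum, map_smul, smul_eq_mul, jetK, Finset.sum_sub_distrib,
      Finset.mul_sum, Finset.sum_mul]
    rw [Finset.sum_comm (f := fun k i => 1 / 2 * (ε i * fderiv ℝ B y (c k) (c i) (c i)) *
      (ε k * fderiv ℝ φ y (c k))), ← Finset.sum_sub_distrib]
    refine Finset.sum_congr rfl fun i _ => ?_
    rw [← Finset.sum_sub_distrib]
    exact Finset.sum_congr rfl fun j _ => by ring
  simp only [hfin]
  rw [← Finset.mul_sum, hvol, hρy, one_mul, ← hs]
  have h1 : ∀ p q r r' : Fin (m + 1) → ℝ, ∑ k, (p k - 2 * q k + (r k - r' k))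
      = ∑ k, p k - 2 * ∑ k, q k - ∑ k, (r' k - r k) := fun p q r r' => by
    rw [Finset.mul_sum, ← Finset.sum_sub_distrib, ← Finset.sum_sub_distrib]
    exact Finset.sum_congr rfl fun k _ => by ring
  have h2 : ∀ p q : Fin (m + 1) → ℝ, ∑ k, ε k * (p k - q k) = ∑ k, ε k * p k - ∑ k, ε k * q k :=
    fun p q => by
      rw [← Finset.sum_sub_distrib]
      exact Finset.sum_congr rfl fun k _ => by ring
  rw [h1, h2, hΓ]
  ring

end Flux

section Charts

variable {E : Type*} [NormedAddCommGroup E] [NormedSpace ℝ E]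
  {H : Type*} [TopologicalSpace H] (I : ModelWithCorners ℝ E H) [I.Boundaryless]
  {M : Type*} [TopologicalSpace M] [ChartedSpace H M] [IsManifold I ∞ M]

/-- The derivative of the inverse of the chart at `x₀`. -/
def chartInv (x₀ : M) (y : E) : E →L[ℝ] E := mfderiv 𝓘(ℝ, E) I (extChartAt I x₀).symm y

/-- The derivative of the chart at `x₀`. -/
def chartFwd (x₀ z : M) : E →L[ℝ] E := mfderiv I 𝓘(ℝ, E) (extChartAt I x₀) z

theorem isManifold_one : IsManifold I 1 M := IsManifold.of_le (n := ∞) (by simp)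

theorem chartFwd_self (x : M) : chartFwd I x x = .id ℝ E :=
  haveI : IsManifold I 1 M := isManifold_one I
  mfderiv_extChartAt_self

theorem chartInv_self (x : M) : chartInv I x (extChartAt I x x) = .id ℝ E := by
  haveI : IsManifold I 1 M := isManifold_one I
  have := mfderivWithin_range_extChartAt_symm (I := I) (x := x)
  rw [I.range_eq_univ, mfderivWithin_univ] at this
  exact this

theorem chartFwd_comp_chartInv {x₀ : M} {y : E} (hy : y ∈ (extChartAt I x₀).target) :
    (chartFwd I x₀ ((extChartAt I x₀).symm y)).comp (chartInv I x₀ y) = .id ℝ E := by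
  haveI : IsManifold I 1 M := isManifold_one I
  have := mfderiv_extChartAt_comp_mfderivWithin_extChartAt_symm (I := I) hy
  rw [I.range_eq_univ, mfderivWithin_univ] at this
  exact this

theorem chartInv_comp_chartFwd {x₀ : M} {y : E} (hy : y ∈ (extChartAt I x₀).target) :
    (chartInv I x₀ y).comp (chartFwd I x₀ ((extChartAt I x₀).symm y)) = .id ℝ E := by
  haveI : IsManifold I 1 M := isManifold_one I
  have := mfderivWithin_extChartAt_symm_comp_mfderiv_extChartAt (I := I) hy
  rw [I.range_eq_univ, mfderivWithin_univ] at this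
  exact this

/-- The derivative of the inverse of a chart as an equivalence. -/
def chartEquiv (x₀ : M) (y : E) (hy : y ∈ (extChartAt I x₀).target) : E ≃L[ℝ] E :=
  ContinuousLinearEquiv.equivOfInverse (chartInv I x₀ y) (chartFwd I x₀ ((extChartAt I x₀).symm y))
    (fun v => DFunLike.congr_fun (chartFwd_comp_chartInv I hy) v)
    (fun v => DFunLike.congr_fun (chartInv_comp_chartFwd I hy) v)

theorem coe_chartEquiv {x₀ : M} {y : E} (hy : y ∈ (extChartAt I x₀).target) :
    (chartEquiv I x₀ y hy : E →L[ℝ] E) = chartInv I x₀ y := rfl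

/-- The coordinate change between two charts. -/
def transMap (x₀ x₁ : M) (y : E) : E := extChartAt I x₁ ((extChartAt I x₀).symm y)

/-- The domain of the coordinate change. -/
def transDomain (x₀ x₁ : M) : Set E :=
  (extChartAt I x₀).target ∩ (extChartAt I x₀).symm ⁻¹' (extChartAt I x₁).source

variable {I}

theorem isOpen_transDomain (x₀ x₁ : M) : IsOpen (transDomain I x₀ x₁) :=
  (continuousOn_extChartAt_symm x₀).isOpen_inter_preimage (isOpen_extChartAt_target x₀)
    (isOpen_extChartAt_source x₁)

theorem contDiffOn_transMap (x₀ x₁ : M) : ContDiffOn ℝ ∞ (transMap I x₀ x₁) (transDomain I x₀ x₁) :=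
  contDiffOn_ext_coord_change x₁ x₀

theorem transMap_mem {x₀ x₁ : M} {y : E} (hy : y ∈ transDomain I x₀ x₁) :
    transMap I x₀ x₁ y ∈ (extChartAt I x₁).target := (extChartAt I x₁).map_source hy.2

theorem symm_transMap {x₀ x₁ : M} {y : E} (hy : y ∈ transDomain I x₀ x₁) :
    (extChartAt I x₁).symm (transMap I x₀ x₁ y) = (extChartAt I x₀).symm y :=
  (extChartAt I x₁).left_inv hy.2

theorem mdifferentiableAt_symm {x₀ : M} {y : E} (hy : y ∈ (extChartAt I x₀).target) :
    MDifferentiableAt 𝓘(ℝ, E) I (extChartAt I x₀).symm y := by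
  haveI : IsManifold I 1 M := isManifold_one I
  have := mdifferentiableWithinAt_extChartAt_symm (I := I) hy
  rwa [I.range_eq_univ, mdifferentiableWithinAt_univ] at this

theorem fderiv_transMap {x₀ x₁ : M} {y : E} (hy : y ∈ transDomain I x₀ x₁) :
    fderiv ℝ (transMap I x₀ x₁) y
      = (chartFwd I x₁ ((extChartAt I x₀).symm y)).comp (chartInv I x₀ y) := by
  haveI : IsManifold I 1 M := isManifold_one I
  have h1 : MDifferentiableAt I 𝓘(ℝ, E) (extChartAt I x₁) ((extChartAt I x₀).symm y) :=
    mdifferentiableAt_extChartAt (by simpa using hy.2)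
  have h := mfderiv_comp y h1 (mdifferentiableAt_symm hy.1)
  rw [← mfderiv_eq_fderiv]
  exact h

theorem chartInv_transMap {x₀ x₁ : M} {y : E} (hy : y ∈ transDomain I x₀ x₁) :
    chartInv I x₀ y = (chartInv I x₁ (transMap I x₀ x₁ y)).comp (fderiv ℝ (transMap I x₀ x₁) y) := by
  have h := chartInv_comp_chartFwd I (transMap_mem hy)
  rw [symm_transMap hy] at h
  rw [fderiv_transMap hy, ← ContinuousLinearMap.comp_assoc, h, ContinuousLinearMap.id_comp]

theorem mem_transDomain_self (x₀ : M) {y : E} (hy : y ∈ (extChartAt I x₀).target) :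
    y ∈ transDomain I x₀ ((extChartAt I x₀).symm y) := ⟨hy, mem_extChartAt_source _⟩

theorem formInChart_eq {k : ℕ} (ξ : DForm I M k) (x₀ : M) (y : E) (v : Fin k → E) :
    formInChart ξ x₀ y v = ξ ((extChartAt I x₀).symm y) (fun i => chartInv I x₀ y (v i)) := rfl

/-- A form at a point, read in the model space. -/
theorem formInChart_self {k : ℕ} (ξ : DForm I M k) (x : M) :
    formInChart ξ x (extChartAt I x x) = ξ x := by
  ext v
  rw [formInChart_eq, chartInv_self, extChartAt_to_inv]
  rfl

theorem form_congr_point {k : ℕ} (ξ : DForm I M k) {z w : M} (h : z = w) (v : Fin k → E) :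
    ξ z v = ξ w v := by subst h; rfl

theorem formInChart_trans {k : ℕ} (ξ : DForm I M k) {x₀ x₁ : M} {y : E} (hy : y ∈ transDomain I x₀ x₁) :
    formInChart ξ x₀ y = (formInChart ξ x₁ (transMap I x₀ x₁ y)).compContinuousLinearMap
      (fderiv ℝ (transMap I x₀ x₁) y) := by
  ext v
  rw [ContinuousAlternatingMap.compContinuousLinearMap_apply, formInChart_eq, formInChart_eq,
    chartInv_transMap hy, form_congr_point ξ (symm_transMap hy)]
  rfl

theorem extD_self {k : ℕ} (ξ : DForm I M k) (x : M) :
    extD ξ x = extDeriv (formInChart ξ x) (extChartAt I x x) := by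
  ext v
  change extDeriv (formInChart ξ x) (extChartAt I x x) (fun i => chartFwd I x x (v i)) = _
  rw [chartFwd_self]
  rfl

theorem formInChart_extD {k : ℕ} {ξ : DForm I M k} (hξ : IsSmoothForm ξ) {x₀ : M} {y : E}
    (hy : y ∈ (extChartAt I x₀).target) :
    formInChart (extD ξ) x₀ y = extDeriv (formInChart ξ x₀) y := by
  set x₁ := (extChartAt I x₀).symm y with hx₁
  have hyt := mem_transDomain_self x₀ hy
  have hev : formInChart ξ x₀ =ᶠ[nhds y] fun z => (formInChart ξ x₁ (transMap I x₀ x₁ z)).compContinuousLinearMap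
      (fderiv ℝ (transMap I x₀ x₁) z) := by
    filter_upwards [(isOpen_transDomain x₀ x₁).mem_nhds hyt] with z hz
    exact formInChart_trans ξ hz
  rw [hev.extDeriv_eq, extDeriv_pullback (r := ∞)
    (differentiableAt_of_contDiffOn (hξ x₁) (isOpen_extChartAt_target x₁) (transMap_mem hyt))
    ((contDiffOn_transMap x₀ x₁).contDiffAt ((isOpen_transDomain x₀ x₁).mem_nhds hyt))
    minSmoothness_two_le_infty, formInChart_trans (extD ξ) hyt]
  congr 1
  have : transMap I x₀ x₁ y = extChartAt I x₁ x₁ := rfl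
  rw [this, formInChart_self, extD_self]

theorem isSmoothForm_extD [FiniteDimensional ℝ E] {k : ℕ} {ξ : DForm I M k} (hξ : IsSmoothForm ξ) :
    IsSmoothForm (extD ξ) := fun x₀ =>
  (contDiffOn_extDeriv (isOpen_extChartAt_target x₀) (hξ x₀)).congr fun _ hy => formInChart_extD hξ hy

theorem formInChart_wedge {k l : ℕ} (ξ : DForm I M k) (η : DForm I M l) (x₀ : M) (y : E) :
    formInChart (wedge ξ η) x₀ y = wedgeAt (formInChart ξ x₀ y) (formInChart η x₀ y) := by
  ext v
  rw [formInChart_eq, wedgeAt_apply]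
  exact wedgeAt_apply _ _ _

theorem isSmoothForm_wedge [FiniteDimensional ℝ E] {k l : ℕ} {ξ : DForm I M k} {η : DForm I M l}
    (hξ : IsSmoothForm ξ) (hη : IsSmoothForm η) : IsSmoothForm (wedge ξ η) := fun x₀ =>
  (contDiffOn_wedgeAt (hξ x₀) (hη x₀)).congr fun _ _ => formInChart_wedge ξ η x₀ _

theorem isSmoothForm_add {k : ℕ} {ξ η : DForm I M k} (hξ : IsSmoothForm ξ) (hη : IsSmoothForm η) :
    IsSmoothForm (ξ + η) := fun x₀ => (hξ x₀).add (hη x₀)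

theorem isSmoothForm_sub {k : ℕ} {ξ η : DForm I M k} (hξ : IsSmoothForm ξ) (hη : IsSmoothForm η) :
    IsSmoothForm (ξ - η) := fun x₀ => (hξ x₀).sub (hη x₀)

theorem symm_mdiff (x₀ : M) : ContMDiffOn 𝓘(ℝ, E) I ∞ (extChartAt I x₀).symm (extChartAt I x₀).target :=
  contMDiffOn_extChartAt_symm x₀

theorem contDiffOn_function {φ : M → ℝ} (hφ : ContMDiff I 𝓘(ℝ, ℝ) ∞ φ) (x₀ : M) :
    ContDiffOn ℝ ∞ (fun y => φ ((extChartAt I x₀).symm y)) (extChartAt I x₀).target :=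
  contMDiffOn_iff_contDiffOn.1 (hφ.comp_contMDiffOn (symm_mdiff x₀))

theorem formInChart_dFun {φ : M → ℝ} (hφ : ContMDiff I 𝓘(ℝ, ℝ) ∞ φ) {x₀ : M} {y : E}
    (hy : y ∈ (extChartAt I x₀).target) :
    formInChart (dFun φ : DForm I M 1) x₀ y = gradForm (fun y => φ ((extChartAt I x₀).symm y)) y := by
  ext v
  have h := mfderiv_comp y ((hφ.mdifferentiable (by simp)) ((extChartAt I x₀).symm y)) (mdifferentiableAt_symm hy)
  rw [gradForm_apply, ← mfderiv_eq_fderiv]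
  change _ = mfderiv 𝓘(ℝ, E) 𝓘(ℝ, ℝ) (φ ∘ (extChartAt I x₀).symm) y (v 0)
  rw [h]
  rfl

theorem isSmoothForm_dFun [FiniteDimensional ℝ E] {φ : M → ℝ} (hφ : ContMDiff I 𝓘(ℝ, ℝ) ∞ φ) :
    IsSmoothForm (dFun φ : DForm I M 1) := by
  intro x₀
  have h : ContDiffOn ℝ ∞ (fderiv ℝ fun y => φ ((extChartAt I x₀).symm y)) (extChartAt I x₀).target :=
    (contDiffOn_function hφ x₀).fderiv_of_isOpen (isOpen_extChartAt_target x₀) (by simp)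
  have h2 : ContDiffOn ℝ ∞ (gradForm fun y => φ ((extChartAt I x₀).symm y)) (extChartAt I x₀).target :=
    contDiffOn_form fun v => h.clm_apply contDiffOn_const
  exact h2.congr fun y hy => formInChart_dFun hφ hy

end Charts

section MetricCharts

variable {E : Type*} [NormedAddCommGroup E] [NormedSpace ℝ E] [FiniteDimensional ℝ E]
  {H : Type*} [TopologicalSpace H] {I : ModelWithCorners ℝ E H} [I.Boundaryless]
  {M : Type*} [TopologicalSpace M] [ChartedSpace H M] [IsManifold I ∞ M]
  {n : ℕ} {b : Module.Basis (Fin n) ℝ E}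

/-- A bilinear form on a finite-dimensional space as a continuous bilinear form. -/
def bilinCLM (g : LinearMap.BilinForm ℝ E) : E →L[ℝ] E →L[ℝ] ℝ :=
  LinearMap.toContinuousLinearMap
    ((LinearMap.toContinuousLinearMap : (E →ₗ[ℝ] ℝ) ≃ₗ[ℝ] (E →L[ℝ] ℝ)).toLinearMap ∘ₗ g)

/-- The coordinate representation of a field of bilinear forms in the chart at `x₀`. -/
def metricChart (g : BilinField I M) (x₀ : M) (y : E) : E →L[ℝ] E →L[ℝ] ℝ :=
  bilinCLM (LinearMap.BilinForm.comp (g ((extChartAt I x₀).symm y) : LinearMap.BilinForm ℝ E)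
    (chartInv I x₀ y : E →ₗ[ℝ] E) (chartInv I x₀ y : E →ₗ[ℝ] E))

theorem metricChart_apply (g : BilinField I M) (x₀ : M) (y u v : E) :
    metricChart g x₀ y u v = g ((extChartAt I x₀).symm y) (chartInv I x₀ y u) (chartInv I x₀ y v) := rfl

theorem metricInChart_eq (g : BilinField I M) (x₀ : M) (y : E) :
    metricInChart b g x₀ y = gramM b (fun u v => metricChart g x₀ y u v) := rfl

theorem metricChart_eq_sum (b : Module.Basis (Fin n) ℝ E) (g : BilinField I M) (x₀ : M) (y u v : E) :
    metricChart g x₀ y u v = ∑ i, ∑ j, b.repr u i * b.repr v j * metricInChart b g x₀ y i j := by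
  have h : metricChart g x₀ y (∑ i, b.repr u i • b i) (∑ j, b.repr v j • b j)
      = ∑ i, ∑ j, b.repr u i * b.repr v j * metricInChart b g x₀ y i j := by
    simp only [map_sum, map_smul, _root_.sum_apply, _root_.smul_apply, smul_eq_mul,
      metricInChart_eq, gramM, Matrix.of_apply, Finset.mul_sum, mul_assoc]
    rw [Finset.sum_comm]
    exact Finset.sum_congr rfl fun _ _ => Finset.sum_congr rfl fun _ _ => by ring
  rwa [b.sum_repr, b.sum_repr] at h

theorem contDiffOn_metricChart {g : BilinField I M} (hg : IsSmoothBilin b g) (x₀ : M) :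
    ContDiffOn ℝ ∞ (metricChart g x₀) (extChartAt I x₀).target := by
  refine contDiffOn_clm_apply.2 fun u => contDiffOn_clm_apply.2 fun v => ?_
  simp only [metricChart_eq_sum b]
  exact ContDiffOn.sum fun i _ => ContDiffOn.sum fun j _ => contDiffOn_const.mul (hg x₀ i j)

theorem bilin_congr_point (g : BilinField I M) {z w : M} (h : z = w) (u v : E) : g z u v = g w u v := by
  subst h; rfl

theorem metricChart_self (g : BilinField I M) (x : M) (u v : E) :
    metricChart g x (extChartAt I x x) u v = g x u v := by
  rw [metricChart_apply, chartInv_self, bilin_congr_point g (extChartAt_to_inv (I := I) x)]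
  rfl

theorem metricChart_trans (g : BilinField I M) {x₀ x₁ : M} {y : E} (hy : y ∈ transDomain I x₀ x₁) (u v : E) :
    metricChart g x₀ y u v = metricChart g x₁ (transMap I x₀ x₁ y) (fderiv ℝ (transMap I x₀ x₁) y u)
      (fderiv ℝ (transMap I x₀ x₁) y v) := by
  rw [metricChart_apply, metricChart_apply, chartInv_transMap hy, bilin_congr_point g (symm_transMap hy)]
  rfl

theorem metricChart_symm {g : BilinField I M} (hg : ∀ x, ∀ u v : E, g x u v = g x v u) (x₀ : M) (y u v : E) :
    metricChart g x₀ y u v = metricChart g x₀ y v u := hg _ _ _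

theorem det_gram_ne_zero {g : BilinField I M} (hg : IsLorentzMetric b g) (c : Module.Basis (Fin n) ℝ E)
    (x : M) : IsUnit (gramM c (fun u v : E => g x u v)).det := by
  obtain ⟨e, t, he⟩ := hg.signature x
  refine det_gramM_change (V := E) (isBilinearMap_form (V := E) (g x)) (e : Module.Basis (Fin n) ℝ E) c ?_
  refine isUnit_det_diagonal (V := E) (d := fun i => if i = t then -1 else 1) (fun i => ?_) he
  split_ifs <;> norm_num

theorem det_metricChart {g : BilinField I M} (hg : IsLorentzMetric b g) (c : Module.Basis (Fin n) ℝ E)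
    {x₀ : M} {y : E} (hy : y ∈ (extChartAt I x₀).target) :
    IsUnit (gramM c (fun u v => metricChart g x₀ y u v)).det := by
  have : gramM c (fun u v => metricChart g x₀ y u v)
      = gramM (c.map (chartEquiv I x₀ y hy).toLinearEquiv) (fun u v : E => g ((extChartAt I x₀).symm y) u v) := by
    ext i j
    simp only [gramM, Matrix.of_apply, Module.Basis.map_apply, metricChart_apply]
    rfl
  rw [this]
  exact det_gram_ne_zero hg _ _

theorem scalarCurvature_eq_self {g : BilinField I M} (hg : IsLorentzMetric b g) (x : M) :
    scalarCurvature b g x = scalAt b (metricChart g x) (extChartAt I x x) :=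
  sum_ricci_eq_scalAt b (isOpen_extChartAt_target x) (contDiffOn_metricChart hg.smooth x)
    (fun z _ => metricChart_symm (fun x u v => hg.symm x u v) x z) (fun _ hz => det_metricChart hg b hz)
    (fun _ _ => rfl) (mem_extChartAt_target x)

theorem scalarCurvature_eq {g : BilinField I M} (hg : IsLorentzMetric b g) {x₀ : M} {y : E}
    (hy : y ∈ (extChartAt I x₀).target) :
    scalarCurvature b g ((extChartAt I x₀).symm y) = scalAt b (metricChart g x₀) y := by
  set x₁ := (extChartAt I x₀).symm y with hx₁
  have hyt := mem_transDomain_self x₀ hy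
  have hF : (chartEquiv I x₀ y hy : E →L[ℝ] E) = fderiv ℝ (transMap I x₀ x₁) y := by
    rw [fderiv_transMap hyt, coe_chartEquiv, ← hx₁, chartFwd_self, ContinuousLinearMap.id_comp]
  have h := scalAt_pullback b (isOpen_transDomain x₀ x₁) (isOpen_extChartAt_target x₁)
    (contDiffOn_transMap x₀ x₁) (fun z hz => transMap_mem hz) (contDiffOn_metricChart hg.smooth x₁)
    (fun z _ => metricChart_symm (fun x u v => hg.symm x u v) x₁ z)
    (fun z hz u v => metricChart_trans g hz u v) hyt (chartEquiv I x₀ y hy) hF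
    (det_metricChart hg _ (transMap_mem hyt))
  rw [h, scalarCurvature_eq_self hg x₁]
  exact scalAt_basis _ b _ _ (det_metricChart hg _ (transMap_mem hyt))

theorem innerForm_eq {g : BilinField I M} (hg : IsLorentzMetric b g) {k : ℕ} (F G : DForm I M k) {x₀ : M} {y : E}
    (hy : y ∈ (extChartAt I x₀).target) : innerForm b g F G ((extChartAt I x₀).symm y)
      = innerAt b (bilinOf (metricChart g x₀ y)) (formInChart F x₀ y) (formInChart G x₀ y) :=
  (innerAt_comp (V := E) (V' := E) b b (g ((extChartAt I x₀).symm y)) (chartEquiv I x₀ y hy)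
    (det_gram_ne_zero hg b _) (F ((extChartAt I x₀).symm y)) (G ((extChartAt I x₀).symm y))).symm

theorem formInChart_volForm (b : Module.Basis (Fin n) ℝ E) (g : BilinField I M) (τ : DForm I M n) {x₀ : M} {y : E}
    (hy : y ∈ (extChartAt I x₀).target) : formInChart (volForm b τ g) x₀ y
      = volAt b (bilinOf (metricChart g x₀ y)) (formInChart τ x₀ y) :=
  (volAt_comp (V := E) (V' := E) b b (g ((extChartAt I x₀).symm y)) (chartEquiv I x₀ y hy)
    (τ ((extChartAt I x₀).symm y))).symm

theorem formInChart_dilatonFlux {b : Module.Basis (Fin 10) ℝ E} {g : BilinField I M} (hg : IsLorentzMetric b g)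
    (τ : DForm I M 10) {φ : M → ℝ} (hφ : ContMDiff I 𝓘(ℝ, ℝ) ∞ φ) {x₀ : M} {y : E}
    (hy : y ∈ (extChartAt I x₀).target) : formInChart (dilatonFlux b τ g φ) x₀ y
      = fluxField b (metricChart g x₀) (fun y => φ ((extChartAt I x₀).symm y)) (formInChart τ x₀) y := by
  have h1 := sharpAt_comp (V := E) (V' := E) b b (g ((extChartAt I x₀).symm y)) (chartEquiv I x₀ y hy)
    (det_gram_ne_zero hg b _) (dFun (I := I) φ ((extChartAt I x₀).symm y))
  have h2 := formInChart_volForm b g τ hy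
  have h3 := formInChart_dFun hφ hy
  unfold fluxField
  rw [← h2, ← h3]
  have h4 := interiorAt_comp (V := E) (V' := E) (chartEquiv I x₀ y hy : E →L[ℝ] E)
    (sharpAt b (bilinOf (metricChart g x₀ y)) (formInChart (dFun φ : DForm I M 1) x₀ y))
    (volForm b τ g ((extChartAt I x₀).symm y))
  have h5 : (chartEquiv I x₀ y hy : E →L[ℝ] E)
    (sharpAt b (bilinOf (metricChart g x₀ y)) (formInChart (dFun φ : DForm I M 1) x₀ y))
    = sharpAt (V := E) b (g ((extChartAt I x₀).symm y)) (dFun (I := I) φ ((extChartAt I x₀).symm y)) := h1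
  rw [h5] at h4
  have h6 : interiorAt (sharpAt b (bilinOf (metricChart g x₀ y)) (formInChart (dFun φ : DForm I M 1) x₀ y))
    (formInChart (volForm b τ g) x₀ y) = _ := h4
  rw [h6]
  rfl

theorem isOrientation_ne_zero {τ : DForm I M n} (hτ : IsOrientationForm τ) (c : Module.Basis (Fin n) ℝ E)
    {x₀ : M} {y : E} (hy : y ∈ (extChartAt I x₀).target) : formInChart τ x₀ y c ≠ 0 := by
  intro h
  refine hτ.ne_zero ((extChartAt I x₀).symm y) ?_
  exact topForm_eq_zero (E := E) (f := τ ((extChartAt I x₀).symm y))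
    (c.map (chartEquiv I x₀ y hy).toLinearEquiv) h

theorem isSmoothForm_volForm {g : BilinField I M} (hg : IsLorentzMetric b g) {τ : DForm I M n}
    (hτ : IsOrientationForm τ) : IsSmoothForm (volForm b τ g) := fun x₀ =>
  (contDiffOn_volAt b (contDiffOn_metricChart hg.smooth x₀)
    (fun _ hy => (det_metricChart hg b hy).ne_zero) (hτ.smooth x₀)
    fun _ hy => isOrientation_ne_zero hτ b hy).congr fun _ hy => formInChart_volForm b g τ hy

theorem isSmoothForm_dilatonFlux {b : Module.Basis (Fin 10) ℝ E} {g : BilinField I M} (hg : IsLorentzMetric b g)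
    {τ : DForm I M 10} (hτ : IsOrientationForm τ) {φ : M → ℝ} (hφ : ContMDiff I 𝓘(ℝ, ℝ) ∞ φ) :
    IsSmoothForm (dilatonFlux b τ g φ) := fun x₀ =>
  (contDiffOn_fluxField b (isOpen_extChartAt_target x₀) (contDiffOn_metricChart hg.smooth x₀)
    (fun _ hy => (det_metricChart hg b hy).ne_zero) (hτ.smooth x₀)
    (fun _ hy => isOrientation_ne_zero hτ b hy) (contDiffOn_function hφ x₀)).congr
    fun _ hy => formInChart_dilatonFlux hg τ hφ hy

/-- A form is continuous if all its coordinate representations are. -/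
def IsContinuousForm {k : ℕ} (ξ : DForm I M k) : Prop :=
  ∀ x₀ : M, ContinuousOn (formInChart ξ x₀) (extChartAt I x₀).target

theorem IsSmoothForm.continuous {k : ℕ} {ξ : DForm I M k} (h : IsSmoothForm ξ) : IsContinuousForm ξ :=
  fun x₀ => (h x₀).continuousOn

theorem isContinuousForm_smul {k : ℕ} {ξ : DForm I M k} (h : IsContinuousForm ξ) {f : M → ℝ}
    (hf : ∀ x₀ : M, ContinuousOn (fun y => f ((extChartAt I x₀).symm y)) (extChartAt I x₀).target) :
    IsContinuousForm (fun x => f x • ξ x : DForm I M k) := fun x₀ =>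
  ((hf x₀).smul (h x₀)).congr fun y _ => by ext v; rfl

theorem continuousOn_scalarCurvature {g : BilinField I M} (hg : IsLorentzMetric b g) (x₀ : M) :
    ContinuousOn (fun y => scalarCurvature b g ((extChartAt I x₀).symm y)) (extChartAt I x₀).target :=
  (continuousOn_scalAt b (isOpen_extChartAt_target x₀) (contDiffOn_metricChart hg.smooth x₀)
    fun _ hy => det_metricChart hg b hy).congr fun _ hy => scalarCurvature_eq hg hy

theorem continuousOn_normSq {g : BilinField I M} (hg : IsLorentzMetric b g) {k : ℕ} {F : DForm I M k}
    (hF : IsContinuousForm F) (x₀ : M) :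
    ContinuousOn (fun y => normSq b g F ((extChartAt I x₀).symm y)) (extChartAt I x₀).target := by
  have h : ContinuousOn (fun y => innerAt b (bilinOf (metricChart g x₀ y)) (formInChart F x₀ y)
      (formInChart F x₀ y)) (extChartAt I x₀).target := by
    have hi : ∀ i j, ContinuousOn (fun y => (gram b (bilinOf (metricChart g x₀ y)))⁻¹ i j)
        (extChartAt I x₀).target := fun i j =>
      (contDiffOn_matrix_inv (contDiffOn_gramM (contDiffOn_metricChart hg.smooth x₀) b)
        (fun _ hy => det_metricChart hg b hy) i j).continuousOn
    have hv : ∀ v : Fin k → E, ContinuousOn (fun y => formInChart F x₀ y v) (extChartAt I x₀).target :=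
      fun v => (evalForm v).continuous.comp_continuousOn (hF x₀)
    unfold innerAt
    exact continuousOn_const.mul (continuousOn_finsetSum _ fun μ _ => continuousOn_finsetSum _ fun ν _ =>
      ((continuousOn_finsetProd _ fun i _ => hi _ _).mul (hv _)).mul (hv _))
  exact h.congr fun y hy => innerForm_eq hg F F hy

end MetricCharts

section Gluing

open MeasureTheory

variable {X : Type*} [TopologicalSpace X] [SecondCountableTopology X] [MeasurableSpace X]
  [OpensMeasurableSpace X] {U : X → Set X}

theorem exists_measurable_partition [Nonempty X] (hU : ∀ x, IsOpen (U x)) (hx : ∀ x, x ∈ U x) :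
    ∃ (x : ℕ → X) (A : ℕ → Set X), (∀ i, MeasurableSet (A i)) ∧ (∀ i, A i ⊆ U (x i)) ∧
      Pairwise (Function.onFun Disjoint A) ∧ ⋃ i, A i = Set.univ := by
  obtain ⟨s, hs, hsU⟩ := TopologicalSpace.countable_cover_nhds fun x => (hU x).mem_nhds (hx x)
  have hne : s.Nonempty := by
    by_contra h
    rw [Set.not_nonempty_iff_eq_empty] at h
    subst h
    simp at hsU
    exact (Set.empty_ne_univ hsU)
  obtain ⟨x, rfl⟩ := hs.exists_eq_range hne
  refine ⟨x, disjointed fun i => U (x i), fun i => MeasurableSet.disjointed (fun i => (hU _).measurableSet) i,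
    fun i => disjointed_subset _ i, disjoint_disjointed _, ?_⟩
  rw [iUnion_disjointed]
  simpa using hsU

theorem eq_sum_restrict (μ : Measure X) {A : ℕ → Set X} (hA : ∀ i, MeasurableSet (A i))
    (hd : Pairwise (Function.onFun Disjoint A)) (hu : ⋃ i, A i = Set.univ) :
    μ = Measure.sum fun i => μ.restrict (A i) := by
  rw [← Measure.restrict_iUnion hd hA, hu, Measure.restrict_univ]

theorem measure_sum_mono {μ ν : ℕ → Measure X} (h : ∀ i, μ i ≤ ν i) : Measure.sum μ ≤ Measure.sum ν := by
  refine Measure.le_iff.2 fun s hs => ?_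
  rw [Measure.sum_apply _ hs, Measure.sum_apply _ hs]
  exact ENNReal.tsum_le_tsum fun i => h i s

theorem iSup_restrict (μ : Measure X) (hU : ∀ x, IsOpen (U x)) (hx : ∀ x, x ∈ U x) :
    ⨆ x, μ.restrict (U x) = μ := by
  rcases isEmpty_or_nonempty X with hX | hX
  · rw [Measure.eq_zero_of_isEmpty μ, Measure.eq_zero_of_isEmpty (⨆ x, _)]
  refine le_antisymm (iSup_le fun x => Measure.restrict_le_self) ?_
  obtain ⟨x, A, hA, hAU, hd, hu⟩ := exists_measurable_partition hU hx
  rw [eq_sum_restrict (⨆ x, μ.restrict (U x)) hA hd hu]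
  conv_lhs => rw [eq_sum_restrict μ hA hd hu]
  refine measure_sum_mono fun i => ?_
  calc μ.restrict (A i) = (μ.restrict (U (x i))).restrict (A i) := by
        rw [Measure.restrict_restrict (hA i), Set.inter_eq_left.2 (hAU i)]
    _ ≤ _ := Measure.restrict_mono le_rfl (le_iSup (fun x => μ.restrict (U x)) (x i))

theorem restrict_iSup (hU : ∀ x, IsOpen (U x)) (hx : ∀ x, x ∈ U x) {ν : X → Measure X}
    (hν : ∀ x, (ν x).restrict (U x) = ν x)
    (hνν : ∀ x y, (ν x).restrict (U x ∩ U y) = (ν y).restrict (U x ∩ U y)) (x : X) :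
    (⨆ x, ν x).restrict (U x) = ν x := by
  haveI : Nonempty X := ⟨x⟩
  obtain ⟨p, A, hA, hAU, hd, hu⟩ := exists_measurable_partition hU hx
  set μ := Measure.sum fun i => (ν (p i)).restrict (A i) with hμ
  have hμU : ∀ x, μ.restrict (U x) = ν x := by
    intro x
    rw [hμ, Measure.restrict_sum _ (hU x).measurableSet, eq_sum_restrict (ν x) hA hd hu]
    congr 1
    ext1 i
    have e : U x ∩ A i = A i ∩ (U x ∩ U (p i)) := by
      ext z; constructor
      · rintro ⟨h1, h2⟩; exact ⟨h2, h1, hAU i h2⟩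
      · rintro ⟨h1, h2, -⟩; exact ⟨h2, h1⟩
    have e' : A i ∩ U x = A i ∩ (U x ∩ U (p i)) := by rw [Set.inter_comm, e]
    rw [Measure.restrict_restrict (hU x).measurableSet, ← hν x, Measure.restrict_restrict (hA i), e, e',
      ← Measure.restrict_restrict (hA i), ← Measure.restrict_restrict (hA i), hνν x (p i)]
  have : ⨆ x, ν x = μ := by
    rw [← iSup_restrict μ hU hx]
    exact iSup_congr fun x => (hμU x).symm
  rw [this, hμU]

theorem sFinite_of_restrict [Nonempty X] (hU : ∀ x, IsOpen (U x)) (hx : ∀ x, x ∈ U x) {μ : Measure X}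
    (h : ∀ x, SFinite (μ.restrict (U x))) : SFinite μ := by
  obtain ⟨p, A, hA, hAU, hd, hu⟩ := exists_measurable_partition hU hx
  rw [eq_sum_restrict μ hA hd hu]
  haveI : ∀ i, SFinite (μ.restrict (A i)) := fun i => by
    haveI := h (p i)
    rw [← Set.inter_eq_left.2 (hAU i), ← Measure.restrict_restrict (hA i)]
    infer_instance
  infer_instance

end Gluing

section FormMeasure

open MeasureTheory

variable {E : Type*} [NormedAddCommGroup E] [NormedSpace ℝ E] [FiniteDimensional ℝ E]
  [MeasurableSpace E] [BorelSpace E]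
  {H : Type*} [TopologicalSpace H] {I : ModelWithCorners ℝ E H} [I.Boundaryless]
  {M : Type*} [TopologicalSpace M] [ChartedSpace H M] [IsManifold I ∞ M] [MeasurableSpace M] [BorelSpace M]
  {n : ℕ} {b : Module.Basis (Fin n) ℝ E}

/-- The measure `|ξ|` on the domain of a chart. -/
def chartMeasure (b : Module.Basis (Fin n) ℝ E) (ξ : DForm I M n) (x₀ : M) : Measure M :=
  Measure.map (extChartAt I x₀).symm ((b.addHaar.restrict (extChartAt I x₀).target).withDensity
    fun y => ENNReal.ofReal |formInChart ξ x₀ y b|)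

theorem aemeasurable_symm (x₀ : M) (f : E → ENNReal) : AEMeasurable (extChartAt I x₀).symm
    ((b.addHaar.restrict (extChartAt I x₀).target).withDensity f) :=
  ((continuousOn_extChartAt_symm x₀).aemeasurable (isOpen_extChartAt_target x₀).measurableSet).mono_ac
    (withDensity_absolutelyContinuous _ _)

theorem measurableSet_preimage (x₀ : M) {s : Set M} (hs : MeasurableSet s) :
    MeasurableSet ((extChartAt I x₀).target ∩ (extChartAt I x₀).symm ⁻¹' s) := by
  have ht := (isOpen_extChartAt_target (I := I) x₀).measurableSet
  have h := ((continuousOn_extChartAt_symm (I := I) x₀).restrict).measurable hs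
  have := MeasurableSet.subtype_image ht h
  convert this using 1
  ext y; simp [and_comm]

theorem chartMeasure_apply (b : Module.Basis (Fin n) ℝ E) (ξ : DForm I M n) (x₀ : M) {s : Set M}
    (hs : MeasurableSet s) : chartMeasure b ξ x₀ s =
      ∫⁻ y in (extChartAt I x₀).target ∩ (extChartAt I x₀).symm ⁻¹' s,
        ENNReal.ofReal |formInChart ξ x₀ y b| ∂b.addHaar := by
  have ht := (isOpen_extChartAt_target (I := I) x₀).measurableSet
  set f : E → ENNReal := fun y => ENNReal.ofReal |formInChart ξ x₀ y b|
  set ν := (b.addHaar.restrict (extChartAt I x₀).target).withDensity f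
  have h0 : ν (extChartAt I x₀).targetᶜ = 0 :=
    withDensity_absolutelyContinuous _ _ (by rw [Measure.restrict_apply ht.compl]; simp)
  rw [chartMeasure, Measure.map_apply_of_aemeasurable (aemeasurable_symm x₀ f) hs]
  have : ν ((extChartAt I x₀).symm ⁻¹' s) = ν ((extChartAt I x₀).target ∩ (extChartAt I x₀).symm ⁻¹' s) := by
    refine le_antisymm ?_ (measure_mono Set.inter_subset_right)
    calc ν ((extChartAt I x₀).symm ⁻¹' s)
        ≤ ν ((extChartAt I x₀).target ∩ (extChartAt I x₀).symm ⁻¹' s ∪ (extChartAt I x₀).targetᶜ) :=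
          measure_mono fun y hy => by
            by_cases h : y ∈ (extChartAt I x₀).target
            · exact Or.inl ⟨h, hy⟩
            · exact Or.inr h
      _ ≤ _ := (measure_union_le _ _).trans (by rw [h0, add_zero])
  rw [this, withDensity_apply _ (measurableSet_preimage x₀ hs), Measure.restrict_restrict
    (measurableSet_preimage x₀ hs), Set.inter_eq_left.2 Set.inter_subset_left]

theorem chartMeasure_restrict_source (b : Module.Basis (Fin n) ℝ E) (ξ : DForm I M n) (x₀ : M) :
    (chartMeasure b ξ x₀).restrict (extChartAt I x₀).source = chartMeasure b ξ x₀ := by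
  ext s hs
  have ho := (isOpen_extChartAt_source (I := I) x₀).measurableSet
  rw [Measure.restrict_apply hs, chartMeasure_apply b ξ x₀ hs, chartMeasure_apply b ξ x₀ (hs.inter ho)]
  congr 2
  ext y
  constructor
  · rintro ⟨h1, h2, -⟩; exact ⟨h1, h2⟩
  · rintro ⟨h1, h2⟩; exact ⟨h1, h2, (extChartAt I x₀).map_target h1⟩

theorem topForm_comp (b : Module.Basis (Fin n) ℝ E) (f : E [⋀^Fin n]→L[ℝ] ℝ) (L : E →L[ℝ] E) :
    f.compContinuousLinearMap L b = L.det * f b := by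
  have := congrArg (fun l : E [⋀^Fin n]→ₗ[ℝ] ℝ => l (fun i => L (b i))) (f.toAlternatingMap.eq_smul_basis_det b)
  change f (fun i => L (b i)) = f b * b.det (fun i => L (b i)) at this
  rw [ContinuousAlternatingMap.compContinuousLinearMap_apply]
  change f (fun i => L (b i)) = _
  rw [this, mul_comm]
  congr 1
  have h := b.det_comp (L : E →ₗ[ℝ] E) b
  rw [b.det_self, mul_one] at h
  exact h

theorem chartMeasure_restrict_inter (b : Module.Basis (Fin n) ℝ E) (ξ : DForm I M n) (x₀ x₁ : M) :
    (chartMeasure b ξ x₀).restrict ((extChartAt I x₀).source ∩ (extChartAt I x₁).source)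
      = (chartMeasure b ξ x₁).restrict ((extChartAt I x₀).source ∩ (extChartAt I x₁).source) := by
  have ho := (isOpen_extChartAt_source (I := I) x₀).measurableSet
  have ho' := (isOpen_extChartAt_source (I := I) x₁).measurableSet
  ext s hs
  have hm := hs.inter (ho.inter ho')
  rw [Measure.restrict_apply hs, Measure.restrict_apply hs, chartMeasure_apply b ξ x₀ hm,
    chartMeasure_apply b ξ x₁ hm]
  set S := (extChartAt I x₀).target ∩ (extChartAt I x₀).symm ⁻¹'
    (s ∩ ((extChartAt I x₀).source ∩ (extChartAt I x₁).source)) with hS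
  have hSt : S ⊆ transDomain I x₀ x₁ := fun y hy => ⟨hy.1, hy.2.2.2⟩
  have himg : (extChartAt I x₁).target ∩ (extChartAt I x₁).symm ⁻¹'
      (s ∩ ((extChartAt I x₀).source ∩ (extChartAt I x₁).source)) = transMap I x₀ x₁ '' S := by
    ext z
    constructor
    · rintro ⟨h1, h2, h3, h4⟩
      refine ⟨extChartAt I x₀ ((extChartAt I x₁).symm z), ⟨(extChartAt I x₀).map_source h3, ?_⟩, ?_⟩
      · rw [Set.mem_preimage, (extChartAt I x₀).left_inv h3]; exact ⟨h2, h3, h4⟩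
      · rw [transMap, (extChartAt I x₀).left_inv h3, (extChartAt I x₁).right_inv h1]
    · rintro ⟨y, hy, rfl⟩
      refine ⟨transMap_mem (hSt hy), ?_⟩
      rw [Set.mem_preimage, symm_transMap (hSt hy)]
      exact hy.2
  have hinj : Set.InjOn (transMap I x₀ x₁) S := by
    intro y hy z hz h
    have h2 := congrArg (extChartAt I x₁).symm h
    rw [symm_transMap (hSt hy), symm_transMap (hSt hz)] at h2
    have h3 := congrArg (extChartAt I x₀) h2
    rwa [(extChartAt I x₀).right_inv hy.1, (extChartAt I x₀).right_inv hz.1] at h3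
  rw [himg, lintegral_image_eq_lintegral_abs_det_fderiv_mul b.addHaar (measurableSet_preimage x₀ hm)
    (fun y hy => ((differentiableAt_of_contDiffOn (contDiffOn_transMap x₀ x₁) (isOpen_transDomain x₀ x₁)
      (hSt hy)).hasFDerivAt).hasFDerivWithinAt) hinj]
  refine setLIntegral_congr_fun (measurableSet_preimage x₀ hm) fun y hy => ?_
  beta_reduce
  rw [formInChart_trans ξ (hSt hy), topForm_comp, abs_mul, ENNReal.ofReal_mul (abs_nonneg _)]

theorem restrict_iSup_chartMeasure [SecondCountableTopology M] (b : Module.Basis (Fin n) ℝ E)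
    (ξ : DForm I M n) (x : M) :
    (⨆ x, chartMeasure b ξ x).restrict (extChartAt I x).source = chartMeasure b ξ x :=
  restrict_iSup (U := fun x => (extChartAt I x).source) (fun x => isOpen_extChartAt_source x)
    (fun x => mem_extChartAt_source x) (fun x => chartMeasure_restrict_source b ξ x)
    (fun x y => chartMeasure_restrict_inter b ξ x y) x

theorem iSup_chartMeasure_eq [SecondCountableTopology M] {ξ : DForm I M n} {μ : Measure M}
    (h : ∀ x, μ.restrict (extChartAt I x).source = chartMeasure b ξ x) : ⨆ x, chartMeasure b ξ x = μ := by
  rw [← iSup_restrict (U := fun x => (extChartAt I x).source) μ (fun x => isOpen_extChartAt_source x)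
    (fun x => mem_extChartAt_source x)]
  exact iSup_congr fun x => (h x).symm

theorem sFinite_iSup_chartMeasure [SecondCountableTopology M] [Nonempty M] (b : Module.Basis (Fin n) ℝ E)
    (ξ : DForm I M n) : SFinite (⨆ x, chartMeasure b ξ x) := by
  refine sFinite_of_restrict (U := fun x => (extChartAt I x).source) (fun x => isOpen_extChartAt_source x)
    (fun x => mem_extChartAt_source x) fun x => ?_
  rw [restrict_iSup_chartMeasure, chartMeasure]
  infer_instance

end FormMeasure

section Integration

open MeasureTheory

variable {E : Type*} [NormedAddCommGroup E] [NormedSpace ℝ E] [FiniteDimensional ℝ E]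
  [MeasurableSpace E] [BorelSpace E]
  {H : Type*} [TopologicalSpace H] {I : ModelWithCorners ℝ E H} [I.Boundaryless]
  {M : Type*} [TopologicalSpace M] [ChartedSpace H M] [IsManifold I ∞ M] [MeasurableSpace M] [BorelSpace M]
  {n : ℕ} {b : Module.Basis (Fin n) ℝ E}

/-- The function `ξ / τ` for a form `ξ` of top degree and an orientation form `τ`. -/
def formRatio (b : Module.Basis (Fin n) ℝ E) (τ ξ : DForm I M n) (x : M) : ℝ :=
  ξ x (tbasis b x) / τ x (tbasis b x)

theorem formInChart_topForm (b : Module.Basis (Fin n) ℝ E) (ξ : DForm I M n) (x₀ : M) (y : E) :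
    formInChart ξ x₀ y b = (chartInv I x₀ y).det * ξ ((extChartAt I x₀).symm y) (tbasis b _) :=
  topForm_comp b (ξ ((extChartAt I x₀).symm y) : E [⋀^Fin n]→L[ℝ] ℝ) (chartInv I x₀ y)

theorem det_chartInv_ne_zero {x₀ : M} {y : E} (hy : y ∈ (extChartAt I x₀).target) :
    (chartInv I x₀ y).det ≠ 0 := by
  have h := congrArg ContinuousLinearMap.det (chartFwd_comp_chartInv I hy)
  rw [ContinuousLinearMap.det, ContinuousLinearMap.toLinearMap_comp, LinearMap.det_comp] at h
  intro h0
  change LinearMap.det (chartInv I x₀ y : E →ₗ[ℝ] E) = 0 at h0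
  rw [h0, mul_zero] at h
  simp [ContinuousLinearMap.det] at h

theorem formRatio_symm (b : Module.Basis (Fin n) ℝ E) (τ ξ : DForm I M n) {x₀ : M} {y : E}
    (hy : y ∈ (extChartAt I x₀).target) :
    formRatio b τ ξ ((extChartAt I x₀).symm y) = formInChart ξ x₀ y b / formInChart τ x₀ y b := by
  rw [formInChart_topForm, formInChart_topForm, mul_div_mul_left _ _ (det_chartInv_ne_zero hy)]
  rfl

theorem continuous_of_chart {f : M → ℝ}
    (hf : ∀ x₀ : M, ContinuousOn (fun y => f ((extChartAt I x₀).symm y)) (extChartAt I x₀).target) :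
    Continuous f := by
  refine continuous_iff_continuousAt.2 fun x => ?_
  have h := ((hf x).continuousAt ((isOpen_extChartAt_target x).mem_nhds (mem_extChartAt_target x))).comp
    (continuousAt_extChartAt (I := I) x)
  refine h.congr ?_
  filter_upwards [(isOpen_extChartAt_source (I := I) x).mem_nhds (mem_extChartAt_source x)] with z hz
  simp only [Function.comp_apply, (extChartAt I x).left_inv hz]

theorem continuous_formRatio {τ ξ : DForm I M n} (hτ : IsOrientationForm τ) (hξ : IsContinuousForm ξ) :
    Continuous (formRatio b τ ξ) := by
  refine continuous_of_chart (I := I) fun x₀ => ?_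
  have hv : ∀ {ζ : DForm I M n}, IsContinuousForm ζ →
      ContinuousOn (fun y => formInChart ζ x₀ y b) (extChartAt I x₀).target :=
    fun h => (evalForm _).continuous.comp_continuousOn (h x₀)
  exact ((hv hξ).div (hv hτ.smooth.continuous) fun y hy => isOrientation_ne_zero hτ b hy).congr
    fun y hy => formRatio_symm b τ ξ hy

theorem aemeasurable_density {ξ : DForm I M n} (hξ : IsContinuousForm ξ) (x₀ : M) :
    AEMeasurable (fun y => ENNReal.ofReal |formInChart ξ x₀ y b|)
      (b.addHaar.restrict (extChartAt I x₀).target) := by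
  have h : ContinuousOn (fun y => formInChart ξ x₀ y b) (extChartAt I x₀).target :=
    (evalForm _).continuous.comp_continuousOn (hξ x₀)
  exact (ENNReal.continuous_ofReal.comp_continuousOn h.abs).aemeasurable (isOpen_extChartAt_target x₀).measurableSet

theorem formRatio_mul {τ : DForm I M n} (hτ : IsOrientationForm τ) (ξ : DForm I M n) {x₀ : M} {y : E}
    (hy : y ∈ (extChartAt I x₀).target) :
    formInChart τ x₀ y b * formRatio b τ ξ ((extChartAt I x₀).symm y) = formInChart ξ x₀ y b := by
  rw [formRatio_symm b τ ξ hy, mul_div_cancel₀ _ (isOrientation_ne_zero hτ b hy)]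

theorem chartMeasure_withDensity {τ ξ : DForm I M n} (hτ : IsOrientationForm τ) (hξ : IsContinuousForm ξ)
    (x₀ : M) : (chartMeasure b τ x₀).withDensity (fun x => ENNReal.ofReal |formRatio b τ ξ x|)
      = chartMeasure b ξ x₀ := by
  have hf : Measurable (fun x => ENNReal.ofReal |formRatio b τ ξ x|) :=
    (continuous_formRatio hτ hξ).abs.measurable.ennreal_ofReal
  ext s hs
  rw [withDensity_apply _ hs, ← lintegral_indicator hs, chartMeasure,
    lintegral_map' (hf.indicator hs).aemeasurable (aemeasurable_symm x₀ _),
    lintegral_withDensity_eq_lintegral_mul₀' (aemeasurable_density hτ.smooth.continuous x₀),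
    chartMeasure_apply b ξ x₀ hs]
  · have hm := measurableSet_preimage (I := I) x₀ hs
    have ht := (isOpen_extChartAt_target (I := I) x₀).measurableSet
    rw [← lintegral_indicator hm, ← lintegral_indicator ht]
    congr 1
    ext y
    by_cases hy : y ∈ (extChartAt I x₀).target
    · rw [Set.indicator_of_mem hy, Pi.mul_apply]
      by_cases hys : (extChartAt I x₀).symm y ∈ s
      · rw [Set.indicator_of_mem hys, Set.indicator_of_mem (Set.mem_inter hy hys),
          ← ENNReal.ofReal_mul (abs_nonneg _), ← abs_mul, formRatio_mul hτ ξ hy]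
      · rw [Set.indicator_of_notMem hys, Set.indicator_of_notMem fun h => hys h.2, mul_zero]
    · rw [Set.indicator_of_notMem hy, Set.indicator_of_notMem fun h => hy h.1]
  · exact (hf.indicator hs).comp_aemeasurable (aemeasurable_symm x₀ _)

/-- The measure of an orientation form. -/
def orientMeasure (b : Module.Basis (Fin n) ℝ E) (τ : DForm I M n) : Measure M := ⨆ x₀, chartMeasure b τ x₀

theorem iSup_chartMeasure_eq_withDensity [SecondCountableTopology M] {τ ξ : DForm I M n}
    (hτ : IsOrientationForm τ) (hξ : IsContinuousForm ξ) : ⨆ x, chartMeasure b ξ x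
      = (orientMeasure b τ).withDensity fun x => ENNReal.ofReal |formRatio b τ ξ x| := by
  refine iSup_chartMeasure_eq fun x => ?_
  rw [restrict_withDensity (isOpen_extChartAt_source x).measurableSet, orientMeasure,
    restrict_iSup_chartMeasure, chartMeasure_withDensity hτ hξ]

theorem abs_formRatio_mul_sign (τ ξ : DForm I M n) (x : M) :
    |formRatio b τ ξ x| * formSign b τ ξ x = formRatio b τ ξ x := by
  unfold formRatio formSign
  set p := τ x (tbasis b x)
  set q := ξ x (tbasis b x)
  have : Real.sign (p * q) = Real.sign (q / p) := by
    rcases eq_or_ne p 0 with h | h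
    · simp [h]
    · have e : p * q = (q / p) * (p * p) := by field_simp
      rw [e]
      have hp : 0 < p * p := mul_self_pos.2 h
      rcases lt_trichotomy (q / p) 0 with h' | h' | h'
      · rw [Real.sign_of_neg h', Real.sign_of_neg (mul_neg_of_neg_of_pos h' hp)]
      · simp [h']
      · rw [Real.sign_of_pos h', Real.sign_of_pos (mul_pos h' hp)]
  rw [this]
  rcases lt_trichotomy (q / p) 0 with h' | h' | h'
  · rw [Real.sign_of_neg h', abs_of_neg h']; ring
  · simp [h']
  · rw [Real.sign_of_pos h', abs_of_pos h']; ring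

theorem integralForm_eq [SecondCountableTopology M] {τ ξ : DForm I M n}
    (hτ : IsOrientationForm τ) (hξ : IsContinuousForm ξ) :
    integralForm b τ ξ = ∫ x, formRatio b τ ξ x ∂(orientMeasure b τ) := by
  rename_i inst hB _
  obtain rfl := hB.measurable_eq
  letI : MeasurableSpace M := borel M
  have h : formMeasure b ξ = (orientMeasure b τ).withDensity fun x => ENNReal.ofReal |formRatio b τ ξ x| :=
    iSup_chartMeasure_eq_withDensity hτ hξ
  unfold integralForm
  rw [h, integral_withDensity_eq_integral_toReal_smul
    (continuous_formRatio hτ hξ).abs.measurable.ennreal_ofReal (by simp)]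
  refine integral_congr_ae (Filter.Eventually.of_forall fun x => ?_)
  beta_reduce
  rw [ENNReal.toReal_ofReal (abs_nonneg _), smul_eq_mul, abs_formRatio_mul_sign]

theorem integrableForm_iff [SecondCountableTopology M] {τ ξ : DForm I M n}
    (hτ : IsOrientationForm τ) (hξ : IsContinuousForm ξ) :
    IntegrableForm b τ ξ ↔ Integrable (formRatio b τ ξ) (orientMeasure b τ) := by
  rename_i inst hB _
  obtain rfl := hB.measurable_eq
  letI : MeasurableSpace M := borel M
  have h : formMeasure b ξ = (orientMeasure b τ).withDensity fun x => ENNReal.ofReal |formRatio b τ ξ x| :=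
    iSup_chartMeasure_eq_withDensity hτ hξ
  unfold IntegrableForm
  rw [h, integrable_withDensity_iff_integrable_smul'
    (continuous_formRatio hτ hξ).abs.measurable.ennreal_ofReal (by simp)]
  refine integrable_congr (Filter.Eventually.of_forall fun x => ?_)
  beta_reduce
  rw [ENNReal.toReal_ofReal (abs_nonneg _), smul_eq_mul, abs_formRatio_mul_sign]

theorem setIntegral_source [SecondCountableTopology M] {τ : DForm I M n} (hτ : IsOrientationForm τ) (x₀ : M)
    {f : M → ℝ} (hf : Continuous f) : ∫ x in (extChartAt I x₀).source, f x ∂(orientMeasure b τ)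
      = ∫ y in (extChartAt I x₀).target, |formInChart τ x₀ y b| * f ((extChartAt I x₀).symm y) ∂b.addHaar := by
  rw [orientMeasure, restrict_iSup_chartMeasure, chartMeasure, integral_map (aemeasurable_symm x₀ _)
    hf.aestronglyMeasurable, integral_withDensity_eq_integral_toReal_smul₀
    (aemeasurable_density hτ.smooth.continuous x₀) (by simp)]
  refine integral_congr_ae (Filter.Eventually.of_forall fun x => ?_)
  beta_reduce
  rw [ENNReal.toReal_ofReal (abs_nonneg _), smul_eq_mul]

theorem sFinite_orientMeasure [SecondCountableTopology M] (b : Module.Basis (Fin n) ℝ E)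
    (ξ : DForm I M n) : SFinite (orientMeasure b ξ) := by
  rcases isEmpty_or_nonempty M with h | h
  · rw [Measure.eq_zero_of_isEmpty (orientMeasure b ξ)]; infer_instance
  · exact sFinite_iSup_chartMeasure b ξ

theorem isLocallyFinite_orientMeasure [SecondCountableTopology M] {τ : DForm I M n} (hτ : IsOrientationForm τ) :
    IsLocallyFiniteMeasure (orientMeasure b τ) := by
  refine ⟨fun x => ?_⟩
  have h : ContinuousOn (fun y => |formInChart τ x y b|) (extChartAt I x).target :=
    ((evalForm _).continuous.comp_continuousOn (hτ.smooth.continuous x)).abs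
  obtain ⟨K, hK, hKt, hKc⟩ := exists_compact_subset (isOpen_extChartAt_target (I := I) x) (mem_extChartAt_target x)
  obtain ⟨C, hC⟩ := hK.bddAbove_image (h.mono hKc)
  refine ⟨(extChartAt I x).source ∩ extChartAt I x ⁻¹' interior K, Filter.inter_mem
    ((isOpen_extChartAt_source x).mem_nhds (mem_extChartAt_source x))
    ((continuousAt_extChartAt x).preimage_mem_nhds (isOpen_interior.mem_nhds hKt)), ?_⟩
  have ho : IsOpen ((extChartAt I x).source ∩ extChartAt I x ⁻¹' interior K) :=
    (continuousOn_extChartAt x).isOpen_inter_preimage (isOpen_extChartAt_source x) isOpen_interior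
  have e : orientMeasure b τ ((extChartAt I x).source ∩ extChartAt I x ⁻¹' interior K)
      = chartMeasure b τ x ((extChartAt I x).source ∩ extChartAt I x ⁻¹' interior K) := by
    rw [← restrict_iSup_chartMeasure b τ x, Measure.restrict_apply ho.measurableSet, orientMeasure]
    congr 1
    ext z; simp only [Set.mem_inter_iff]; tauto
  rw [e, chartMeasure_apply _ _ _ ho.measurableSet]
  have hsub : (extChartAt I x).target ∩ (extChartAt I x).symm ⁻¹'
      ((extChartAt I x).source ∩ extChartAt I x ⁻¹' interior K) ⊆ K := by
    rintro y ⟨h1, h2, h3⟩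
    rw [Set.mem_preimage, (extChartAt I x).right_inv h1] at h3
    exact interior_subset h3
  calc _ ≤ ∫⁻ y in K, ENNReal.ofReal |formInChart τ x y b| ∂b.addHaar := lintegral_mono_set hsub
    _ ≤ ∫⁻ y in K, ENNReal.ofReal C ∂b.addHaar :=
        setLIntegral_mono' hK.measurableSet fun y hy =>
          ENNReal.ofReal_le_ofReal (hC ⟨y, hy, rfl⟩)
    _ < ⊤ := by
        rw [setLIntegral_const]
        exact ENNReal.mul_lt_top ENNReal.ofReal_lt_top hK.measure_lt_top

theorem integrable_of_compact [SecondCountableTopology M] [CompactSpace M] {τ : DForm I M n}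
    (hτ : IsOrientationForm τ) {f : M → ℝ} (hf : Continuous f) : Integrable f (orientMeasure b τ) := by
  haveI := isLocallyFinite_orientMeasure (b := b) hτ
  exact hf.integrable_of_hasCompactSupport (HasCompactSupport.of_compactSpace f)

end Integration

section ExteriorDerivative

variable {E : Type*} [NormedAddCommGroup E] [NormedSpace ℝ E] [FiniteDimensional ℝ E]
  {H : Type*} [TopologicalSpace H] {I : ModelWithCorners ℝ E H} [I.Boundaryless]
  {M : Type*} [TopologicalSpace M] [ChartedSpace H M] [IsManifold I ∞ M]

theorem extDeriv_zero_form {k : ℕ} (y : E) : extDeriv (fun _ : E => (0 : E [⋀^Fin k]→L[ℝ] ℝ)) y = 0 := by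
  rw [extDeriv, fderiv_fun_const]
  exact map_zero (ContinuousAlternatingMap.alternatizeUncurryFinCLM ℝ E ℝ)

theorem extD_add {k : ℕ} {ξ η : DForm I M k} (hξ : IsSmoothForm ξ) (hη : IsSmoothForm η) :
    extD (ξ + η) = extD ξ + extD η := by
  funext x
  have hd : ∀ {ζ : DForm I M k}, IsSmoothForm ζ → DifferentiableAt ℝ (formInChart ζ x) (extChartAt I x x) :=
    fun h => differentiableAt_of_contDiffOn (h x) (isOpen_extChartAt_target x) (mem_extChartAt_target x)
  rw [Pi.add_apply, extD_self, extD_self, extD_self]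
  exact extDeriv_add (hd hξ) (hd hη)

theorem isSmoothForm_zero {k : ℕ} : IsSmoothForm (0 : DForm I M k) := fun x₀ => by
  have : formInChart (0 : DForm I M k) x₀ = 0 := rfl
  rw [this]
  exact contDiffOn_const

theorem extD_zero {k : ℕ} : extD (0 : DForm I M k) = 0 := by
  funext x
  have h : formInChart (0 : DForm I M k) x = fun _ => 0 := rfl
  rw [extD_self, h]
  exact extDeriv_zero_form _

theorem isSmoothForm_sum {ι : Type*} {k : ℕ} (s : Finset ι) {ξ : ι → DForm I M k} (h : ∀ i, IsSmoothForm (ξ i)) :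
    IsSmoothForm (∑ i ∈ s, ξ i) := by
  classical
  induction s using Finset.induction_on with
  | empty => exact isSmoothForm_zero
  | insert i s hi ih => rw [Finset.sum_insert hi]; exact isSmoothForm_add (h i) ih

theorem extD_sum {ι : Type*} {k : ℕ} (s : Finset ι) {ξ : ι → DForm I M k} (h : ∀ i, IsSmoothForm (ξ i)) :
    extD (∑ i ∈ s, ξ i) = ∑ i ∈ s, extD (ξ i) := by
  classical
  induction s using Finset.induction_on with
  | empty => exact extD_zero
  | insert i s hi ih =>
    rw [Finset.sum_insert hi, Finset.sum_insert hi, extD_add (h i) (isSmoothForm_sum s h), ih]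

theorem isSmoothForm_smul {k : ℕ} {ξ : DForm I M k} (h : IsSmoothForm ξ) {f : M → ℝ}
    (hf : ContMDiff I 𝓘(ℝ, ℝ) ∞ f) : IsSmoothForm (fun x => f x • ξ x : DForm I M k) := fun x₀ =>
  ((contDiffOn_function hf x₀).smul (h x₀)).congr fun y _ => by ext v; rfl

end ExteriorDerivative

section Stokes

open MeasureTheory

variable {E : Type*} [NormedAddCommGroup E] [NormedSpace ℝ E] [FiniteDimensional ℝ E]
  [MeasurableSpace E] [BorelSpace E]

theorem integral_fderiv_eq_zero {μ : Measure E} [μ.IsAddHaarMeasure] {f : E → ℝ} (hf : ContDiff ℝ ∞ f)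
    (hc : HasCompactSupport f) (v : E) : ∫ y, fderiv ℝ f y v ∂μ = 0 := by
  have hd : HasCompactSupport fun y => fderiv ℝ f y v := hc.fderiv_apply ℝ v
  have hcd : Continuous fun y => fderiv ℝ f y v := (hf.continuous_fderiv (by simp)).clm_apply continuous_const
  have h := integral_mul_fderiv_eq_neg_fderiv_mul_of_integrable (μ := μ) (f := fun _ : E => (1 : ℝ)) (g := f) (v := v)
    (by simp) (by simpa using hcd.integrable_of_hasCompactSupport hd)
    (by simpa using hf.continuous.integrable_of_hasCompactSupport hc) (fun x _ => differentiableAt_const _)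
    (fun x _ => hf.differentiable (by simp) x)
  simpa using h

theorem integral_extDeriv_eq_zero {μ : Measure E} [μ.IsAddHaarMeasure] {k : ℕ} {F : E → E [⋀^Fin k]→L[ℝ] ℝ}
    (hF : ContDiff ℝ ∞ F) (hc : HasCompactSupport F) (v : Fin (k + 1) → E) :
    ∫ y, extDeriv F y v ∂μ = 0 := by
  have hi : ∀ w : Fin k → E, ContDiff ℝ ∞ fun y => F y w := fun w => (evalForm w).contDiff.comp hF
  have hs : ∀ w : Fin k → E, HasCompactSupport fun y => F y w := fun w =>
    hc.comp_left (g := fun ξ : E [⋀^Fin k]→L[ℝ] ℝ => ξ w) rfl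
  have : ∀ y, extDeriv F y v = ∑ i : Fin (k + 1), (-1 : ℝ) ^ (i : ℕ) * fderiv ℝ (fun y => F y (i.removeNth v)) y (v i) := by
    intro y
    rw [extDeriv_apply (hF.differentiable (by simp) y)]
    exact Finset.sum_congr rfl fun i _ => by rw [zsmul_eq_mul]; push_cast; rfl
  simp_rw [this]
  rw [integral_finset_sum]
  · refine Finset.sum_eq_zero fun i _ => ?_
    rw [integral_const_mul, integral_fderiv_eq_zero (hi _) (hs _), mul_zero]
  · intro i _
    exact ((((hi _).continuous_fderiv (by simp)).clm_apply continuous_const).integrable_of_hasCompactSupport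
      ((hs _).fderiv_apply ℝ _)).const_mul _

variable
  {H : Type*} [TopologicalSpace H] {I : ModelWithCorners ℝ E H} [I.Boundaryless]
  {M : Type*} [TopologicalSpace M] [ChartedSpace H M] [IsManifold I ∞ M]

variable {k : ℕ} {b : Module.Basis (Fin (k + 1)) ℝ E}

/-- The coordinate representation of a form supported in the domain of a chart, extended by zero and
multiplied with the sign of the orientation. -/
def signedExtension (b : Module.Basis (Fin (k + 1)) ℝ E) (τ : DForm I M (k + 1)) (ζ : DForm I M k) (x₀ : M) (y : E) :
    E [⋀^Fin k]→L[ℝ] ℝ :=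
  open Classical in
  if y ∈ (extChartAt I x₀).target then Real.sign (formInChart τ x₀ y b) • formInChart ζ x₀ y else 0

theorem eventually_sign_eq {τ : DForm I M (k + 1)} (hτ : IsOrientationForm τ) {x₀ : M} {y : E}
    (hy : y ∈ (extChartAt I x₀).target) :
    ∀ᶠ z in nhds y, Real.sign (formInChart τ x₀ z b) = Real.sign (formInChart τ x₀ y b) := by
  have hc : ContinuousAt (fun z => formInChart τ x₀ z b) y :=
    ((evalForm _).continuous.comp_continuousOn (hτ.smooth.continuous x₀)).continuousAt
      ((isOpen_extChartAt_target x₀).mem_nhds hy)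
  rcases lt_or_gt_of_ne (isOrientation_ne_zero hτ b hy) with h | h
  · filter_upwards [hc.eventually_lt continuousAt_const h] with z hz
    rw [Real.sign_of_neg hz, Real.sign_of_neg h]
  · filter_upwards [continuousAt_const.eventually_lt hc h] with z hz
    rw [Real.sign_of_pos hz, Real.sign_of_pos h]

theorem signedExtension_eventuallyEq {τ : DForm I M (k + 1)} (hτ : IsOrientationForm τ) (ζ : DForm I M k) {x₀ : M}
    {y : E} (hy : y ∈ (extChartAt I x₀).target) :
    signedExtension b τ ζ x₀ =ᶠ[nhds y] Real.sign (formInChart τ x₀ y b) • formInChart ζ x₀ := by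
  filter_upwards [eventually_sign_eq (b := b) hτ hy, (isOpen_extChartAt_target x₀).mem_nhds hy] with z hz hzt
  rw [signedExtension, if_pos hzt, hz]
  rfl

theorem signedExtension_support (τ : DForm I M (k + 1)) {ζ : DForm I M k} {x₀ : M} {K : Set M}
    (hζ : ∀ z, z ∉ K → ζ z = 0) {y : E} (hy : y ∉ extChartAt I x₀ '' K) :
    signedExtension b τ ζ x₀ y = 0 := by
  unfold signedExtension
  split_ifs with h
  · have : formInChart ζ x₀ y = 0 := by
      ext v
      rw [formInChart_eq, hζ _ fun hK => hy ⟨_, hK, (extChartAt I x₀).right_inv h⟩]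
      rfl
    rw [this, smul_zero]
  · rfl

theorem contDiff_signedExtension {τ : DForm I M (k + 1)} (hτ : IsOrientationForm τ) {ζ : DForm I M k}
    (hs : IsSmoothForm ζ) {x₀ : M} {K : Set M} (hK : IsCompact K) (hKs : K ⊆ (extChartAt I x₀).source)
    (hζ : ∀ z, z ∉ K → ζ z = 0) : ContDiff ℝ ∞ (signedExtension b τ ζ x₀) := by
  have hKc : IsCompact (extChartAt I x₀ '' K) := hK.image_of_continuousOn ((continuousOn_extChartAt x₀).mono hKs)
  refine contDiff_iff_contDiffAt.2 fun y => ?_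
  by_cases hy : y ∈ (extChartAt I x₀).target
  · have h : ContDiffAt ℝ ∞ (formInChart ζ x₀) y := (hs x₀).contDiffAt ((isOpen_extChartAt_target x₀).mem_nhds hy)
    exact (h.const_smul (Real.sign (formInChart τ x₀ y b))).congr_of_eventuallyEq (signedExtension_eventuallyEq hτ ζ hy)
  · have hy' : y ∉ extChartAt I x₀ '' K := by
      rintro ⟨z, hz, rfl⟩
      exact hy ((extChartAt I x₀).map_source (hKs hz))
    refine (contDiffAt_const (c := (0 : E [⋀^Fin k]→L[ℝ] ℝ))).congr_of_eventuallyEq ?_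
    filter_upwards [hKc.isClosed.isOpen_compl.mem_nhds hy'] with z hz
    exact signedExtension_support τ hζ hz

theorem extD_eq_zero_of_notMem {ζ : DForm I M k} {K : Set M} (hK : IsClosed K)
    (hζ : ∀ z, z ∉ K → ζ z = 0) {z : M} (hz : z ∉ K) : extD ζ z = 0 := by
  have hev : formInChart ζ z =ᶠ[nhds (extChartAt I z z)] fun _ => 0 := by
    have h := (continuousAt_extChartAt_symm (I := I) z).preimage_mem_nhds
      (t := Kᶜ) (by rw [extChartAt_to_inv]; exact hK.isOpen_compl.mem_nhds hz)
    filter_upwards [h] with y hy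
    ext v
    rw [formInChart_eq, hζ _ hy]
    rfl
  rw [extD_self, hev.extDeriv_eq, extDeriv_zero_form]
  rfl

theorem formRatio_eq_zero {n : ℕ} {b : Module.Basis (Fin n) ℝ E} (τ : DForm I M n) {ξ : DForm I M n} {x : M}
    (h : ξ x = 0) : formRatio b τ ξ x = 0 := by
  rw [formRatio, h]
  exact zero_div _

theorem integral_extD_of_support [MeasurableSpace M] [BorelSpace M] [SecondCountableTopology M]
    {τ : DForm I M (k + 1)} (hτ : IsOrientationForm τ) {ζ : DForm I M k}
    (hs : IsSmoothForm ζ) {x₀ : M} {K : Set M} (hK : IsCompact K) (hKl : IsClosed K) (hKs : K ⊆ (extChartAt I x₀).source)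
    (hζ : ∀ z, z ∉ K → ζ z = 0) : ∫ x, formRatio b τ (extD ζ) x ∂(orientMeasure b τ) = 0 := by
  have hcont : Continuous (formRatio b τ (extD ζ)) := continuous_formRatio hτ (isSmoothForm_extD hs).continuous
  have hKc : IsCompact (extChartAt I x₀ '' K) := hK.image_of_continuousOn ((continuousOn_extChartAt x₀).mono hKs)
  have ht := isOpen_extChartAt_target (I := I) x₀
  rw [← setIntegral_eq_integral_of_forall_compl_eq_zero (s := (extChartAt I x₀).source) fun x hx =>
    formRatio_eq_zero τ (extD_eq_zero_of_notMem hKl hζ fun h => hx (hKs h)), setIntegral_source hτ x₀ hcont]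
  rw [← integral_extDeriv_eq_zero (μ := b.addHaar) (contDiff_signedExtension (b := b) hτ hs hK hKs hζ)
    (HasCompactSupport.intro hKc fun y hy => signedExtension_support τ hζ hy) b]
  rw [← setIntegral_eq_integral_of_forall_compl_eq_zero (s := (extChartAt I x₀).target)
    (f := fun y => extDeriv (signedExtension b τ ζ x₀) y b)]
  · refine setIntegral_congr_fun ht.measurableSet fun y hy => ?_
    beta_reduce
    rw [(signedExtension_eventuallyEq hτ ζ hy).extDeriv_eq, extDeriv_smul, formRatio_symm b τ _ hy,
      formInChart_extD hs hy]
    have h0 := isOrientation_ne_zero hτ b hy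
    change _ = Real.sign (formInChart τ x₀ y b) * extDeriv (formInChart ζ x₀) y b
    rcases lt_or_gt_of_ne h0 with h | h
    · rw [Real.sign_of_neg h, abs_of_neg h]; field_simp
    · rw [Real.sign_of_pos h, abs_of_pos h]; field_simp
  · intro y hy
    have hy' : y ∉ extChartAt I x₀ '' K := by
      rintro ⟨z, hz, rfl⟩
      exact hy ((extChartAt I x₀).map_source (hKs hz))
    have hev : signedExtension b τ ζ x₀ =ᶠ[nhds y] fun _ => 0 := by
      filter_upwards [hKc.isClosed.isOpen_compl.mem_nhds hy'] with z hz
      exact signedExtension_support τ hζ hz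
    rw [hev.extDeriv_eq, extDeriv_zero_form]
    rfl

/-- Stokes' theorem on a compact manifold without boundary. -/
theorem integral_extD [MeasurableSpace M] [BorelSpace M] [SecondCountableTopology M] [T2Space M] [CompactSpace M]
    {τ : DForm I M (k + 1)} (hτ : IsOrientationForm τ) {ζ : DForm I M k} (hs : IsSmoothForm ζ) :
    ∫ x, formRatio b τ (extD ζ) x ∂(orientMeasure b τ) = 0 := by
  obtain ⟨f, hf⟩ := SmoothPartitionOfUnity.exists_isSubordinate_chartAt_source I M
  have hfin := f.locallyFinite.finite_nonempty_of_compact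
  set s := hfin.toFinset with hsdef
  have hsm : ∀ i, IsSmoothForm (fun x => f i x • ζ x : DForm I M k) := fun i => isSmoothForm_smul hs (f i).contMDiff
  have hsum : ζ = ∑ i ∈ s, (fun x => f i x • ζ x : DForm I M k) := by
    funext x
    have h1 : ∑ᶠ i, f i x = ∑ i ∈ s, f i x := finsum_eq_sum_of_support_subset _ fun i hi => by
      rw [hsdef, Set.Finite.coe_toFinset]
      exact ⟨x, hi⟩
    rw [f.sum_eq_one (Set.mem_univ x)] at h1
    rw [Finset.sum_apply, ← Finset.sum_smul, ← h1, one_smul]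
  have hr : ∀ x, formRatio b τ (extD ζ) x = ∑ i ∈ s, formRatio b τ (extD (fun x => f i x • ζ x : DForm I M k)) x := by
    intro x
    conv_lhs => rw [hsum, extD_sum s hsm]
    unfold formRatio
    rw [Finset.sum_apply, ← Finset.sum_div]
    congr 1
    exact ContinuousAlternatingMap.sum_apply _ _
  simp_rw [hr]
  rw [integral_finset_sum]
  · refine Finset.sum_eq_zero fun i _ => ?_
    refine integral_extD_of_support hτ (hsm i) (x₀ := i) (K := tsupport (f i)) (isClosed_tsupport _).isCompact
      (isClosed_tsupport _) ?_ ?_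
    · rw [extChartAt_source]; exact hf i
    · intro z hz
      change f i z • ζ z = 0
      rw [image_eq_zero_of_notMem_tsupport hz, zero_smul]
  · intro i _
    exact integrable_of_compact hτ (continuous_formRatio hτ (isSmoothForm_extD (hsm i)).continuous)

end Stokes

theorem form_eq_zero_of_finrank_lt {V : Type*} [AddCommGroup V] [Module ℝ V] [TopologicalSpace V]
    [FiniteDimensional ℝ V] {k : ℕ} (h : Module.finrank ℝ V < k) (ξ : V [⋀^Fin k]→L[ℝ] ℝ) : ξ = 0 := by
  ext v
  refine AlternatingMap.map_linearDependent ξ.toAlternatingMap v fun hv => ?_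
  have := hv.fintype_card_le_finrank
  rw [Fintype.card_fin] at this
  omega

theorem wedgeAt_one_right {V : Type*} [NormedAddCommGroup V] [NormedSpace ℝ V] [FiniteDimensional ℝ V] {k : ℕ}
    (ξ : V [⋀^Fin k]→L[ℝ] ℝ) (α : V [⋀^Fin 1]→L[ℝ] ℝ) (v : Fin (k + 1) → V) :
    wedgeAt ξ α v = ∑ i : Fin (k + 1), (-1) ^ (k + (i : ℕ)) * (α (fun _ => v i) * ξ (i.removeNth v)) := by
  have h := wedgeAt_one_left α ξ v
  rw [wedgeAt_comm, mul_one]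
  erw [h]
  rw [Finset.mul_sum]
  exact Finset.sum_congr rfl fun i _ => by rw [pow_add, mul_assoc]

section Product

variable {E : Type*} [NormedAddCommGroup E] [NormedSpace ℝ E] [FiniteDimensional ℝ E]
  {F : Type*} [NormedAddCommGroup F] [NormedSpace ℝ F] [FiniteDimensional ℝ F]
  {H : Type*} [TopologicalSpace H] {I : ModelWithCorners ℝ E H} [I.Boundaryless]
  {H' : Type*} [TopologicalSpace H'] {J : ModelWithCorners ℝ F H'} [J.Boundaryless]
  {N : Type*} [TopologicalSpace N] [ChartedSpace H N] [IsManifold I ∞ N]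
  {S : Type*} [TopologicalSpace S] [ChartedSpace H' S] [IsManifold J ∞ S]

theorem mem_target_prod {p : N × S} {z : E × F} (hz : z ∈ (extChartAt (I.prod J) p).target) :
    z.1 ∈ (extChartAt I p.1).target ∧ z.2 ∈ (extChartAt J p.2).target := by
  rwa [extChartAt_prod] at hz

theorem extChartAt_prod_symm (p : N × S) (z : E × F) : (extChartAt (I.prod J) p).symm z
    = ((extChartAt I p.1).symm z.1, (extChartAt J p.2).symm z.2) := by
  rw [extChartAt_prod]; rfl

theorem extChartAt_prod_self (p : N × S) : extChartAt (I.prod J) p p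
    = (extChartAt I p.1 p.1, extChartAt J p.2 p.2) := by
  rw [extChartAt_prod]; rfl

theorem fst_chartInv {p : N × S} {z : E × F} (hz : z ∈ (extChartAt (I.prod J) p).target) (v : E × F) :
    (chartInv (I.prod J) p z v).1 = chartInv I p.1 z.1 v.1 := by
  have hz' := mem_target_prod hz
  have h1 := mfderiv_comp z (mdifferentiableAt_fst (x := (extChartAt (I.prod J) p).symm z)) (mdifferentiableAt_symm hz)
  have e : (Prod.fst ∘ (extChartAt (I.prod J) p).symm : E × F → N) = (extChartAt I p.1).symm ∘ Prod.fst := by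
    funext w; simp only [Function.comp_apply, extChartAt_prod_symm]
  have h2 := mfderiv_comp (I := 𝓘(ℝ, E × F)) (I' := 𝓘(ℝ, E)) z (mdifferentiableAt_symm hz'.1)
    (differentiableAt_fst (𝕜 := ℝ) (p := z)).mdifferentiableAt
  rw [e, h2, mfderiv_fst, mfderiv_eq_fderiv, fderiv_fst] at h1
  exact (DFunLike.congr_fun h1 v).symm

theorem snd_chartInv {p : N × S} {z : E × F} (hz : z ∈ (extChartAt (I.prod J) p).target) (v : E × F) :
    (chartInv (I.prod J) p z v).2 = chartInv J p.2 z.2 v.2 := by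
  have hz' := mem_target_prod hz
  have h1 := mfderiv_comp z (mdifferentiableAt_snd (x := (extChartAt (I.prod J) p).symm z)) (mdifferentiableAt_symm hz)
  have e : (Prod.snd ∘ (extChartAt (I.prod J) p).symm : E × F → S) = (extChartAt J p.2).symm ∘ Prod.snd := by
    funext w; simp only [Function.comp_apply, extChartAt_prod_symm]
  have h2 := mfderiv_comp (I := 𝓘(ℝ, E × F)) (I' := 𝓘(ℝ, F)) z (mdifferentiableAt_symm hz'.2)
    (differentiableAt_snd (𝕜 := ℝ) (p := z)).mdifferentiableAt
  rw [e, h2, mfderiv_snd, mfderiv_eq_fderiv, fderiv_snd] at h1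
  exact (DFunLike.congr_fun h1 v).symm

/-- The pull-back of a form on `N` to `N × S`. -/
abbrev pullFst (S : Type*) [TopologicalSpace S] [ChartedSpace H' S] (J : ModelWithCorners ℝ F H')
    {k : ℕ} (ξ : DForm I N k) : DForm (I.prod J) (N × S) k := pullback Prod.fst ξ

/-- The pull-back of a form on `S` to `N × S`. -/
abbrev pullSnd (N : Type*) [TopologicalSpace N] [ChartedSpace H N] (I : ModelWithCorners ℝ E H)
    {k : ℕ} (ξ : DForm J S k) : DForm (I.prod J) (N × S) k := pullback Prod.snd ξ

theorem pullFst_apply {k : ℕ} (ξ : DForm I N k) (p : N × S) :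
    pullFst S J ξ p = (ξ p.1 : E [⋀^Fin k]→L[ℝ] ℝ).compContinuousLinearMap (ContinuousLinearMap.fst ℝ E F) := by
  unfold pullFst pullback
  rw [mfderiv_fst]; rfl

theorem pullSnd_apply {k : ℕ} (ξ : DForm J S k) (p : N × S) :
    pullSnd N I ξ p = (ξ p.2 : F [⋀^Fin k]→L[ℝ] ℝ).compContinuousLinearMap (ContinuousLinearMap.snd ℝ E F) := by
  unfold pullSnd pullback
  rw [mfderiv_snd]; rfl

theorem formInChart_pullFst {k : ℕ} (ξ : DForm I N k) {p : N × S} {z : E × F}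
    (hz : z ∈ (extChartAt (I.prod J) p).target) : formInChart (pullFst S J ξ) p z
      = (formInChart ξ p.1 z.1).compContinuousLinearMap (ContinuousLinearMap.fst ℝ E F) := by
  ext v
  rw [formInChart_eq, pullFst_apply]
  have h : ∀ i, (chartInv (I.prod J) p z (v i)).1 = _ := fun i => fst_chartInv hz (v i)
  have h2 : ((extChartAt (I.prod J) p).symm z).1 = (extChartAt I p.1).symm z.1 := by rw [extChartAt_prod_symm]
  change (ξ ((extChartAt (I.prod J) p).symm z).1 : E [⋀^Fin k]→L[ℝ] ℝ) (fun i => (chartInv (I.prod J) p z (v i)).1) = _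
  simp_rw [h]
  exact form_congr_point ξ h2 _

theorem formInChart_pullSnd {k : ℕ} (ξ : DForm J S k) {p : N × S} {z : E × F}
    (hz : z ∈ (extChartAt (I.prod J) p).target) : formInChart (pullSnd N I ξ) p z
      = (formInChart ξ p.2 z.2).compContinuousLinearMap (ContinuousLinearMap.snd ℝ E F) := by
  ext v
  rw [formInChart_eq, pullSnd_apply]
  have h : ∀ i, (chartInv (I.prod J) p z (v i)).2 = _ := fun i => snd_chartInv hz (v i)
  have h2 : ((extChartAt (I.prod J) p).symm z).2 = (extChartAt J p.2).symm z.2 := by rw [extChartAt_prod_symm]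
  change (ξ ((extChartAt (I.prod J) p).symm z).2 : F [⋀^Fin k]→L[ℝ] ℝ) (fun i => (chartInv (I.prod J) p z (v i)).2) = _
  simp_rw [h]
  exact form_congr_point ξ h2 _

theorem isSmoothForm_pullFst {k : ℕ} {ξ : DForm I N k} (hξ : IsSmoothForm ξ) : IsSmoothForm (pullFst S J ξ) := by
  intro p
  have h : ContDiffOn ℝ ∞ (fun z : E × F => (formInChart ξ p.1 z.1).compContinuousLinearMap
      (ContinuousLinearMap.fst ℝ E F)) (extChartAt (I.prod J) p).target :=
    contDiffOn_form fun v => (contDiffOn_form_apply (hξ p.1) _).comp contDiff_fst.contDiffOn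
      fun z hz => (mem_target_prod hz).1
  exact h.congr fun z hz => formInChart_pullFst ξ hz

theorem isSmoothForm_pullSnd {k : ℕ} {ξ : DForm J S k} (hξ : IsSmoothForm ξ) : IsSmoothForm (pullSnd N I ξ) := by
  intro p
  have h : ContDiffOn ℝ ∞ (fun z : E × F => (formInChart ξ p.2 z.2).compContinuousLinearMap
      (ContinuousLinearMap.snd ℝ E F)) (extChartAt (I.prod J) p).target :=
    contDiffOn_form fun v => (contDiffOn_form_apply (hξ p.2) _).comp contDiff_snd.contDiffOn
      fun z hz => (mem_target_prod hz).2
  exact h.congr fun z hz => formInChart_pullSnd ξ hz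

theorem extD_pullFst {k : ℕ} {ξ : DForm I N k} (hξ : IsSmoothForm ξ) :
    extD (pullFst S J ξ) = pullFst S J (extD ξ) := by
  funext p
  have hev : formInChart (pullFst S J ξ : DForm (I.prod J) (N × S) k) p =ᶠ[nhds (extChartAt (I.prod J) p p)] fun z : E × F =>
      (formInChart ξ p.1 (Prod.fst z)).compContinuousLinearMap (fderiv ℝ Prod.fst z) := by
    filter_upwards [(isOpen_extChartAt_target (I := I.prod J) p).mem_nhds (mem_extChartAt_target (I := I.prod J) p)] with z hz
    rw [formInChart_pullFst ξ hz, fderiv_fst]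
  rw [pullFst_apply, extD_self, hev.extDeriv_eq, extDeriv_pullback (r := ∞) ?_ contDiff_fst.contDiffAt
    minSmoothness_two_le_infty, fderiv_fst, extChartAt_prod_self, extD_self]
  · rfl
  · exact differentiableAt_of_contDiffOn (hξ p.1) (isOpen_extChartAt_target _)
      (mem_target_prod (mem_extChartAt_target (I := I.prod J) p)).1

theorem extD_pullSnd {k : ℕ} {ξ : DForm J S k} (hξ : IsSmoothForm ξ) :
    extD (pullSnd N I ξ) = pullSnd N I (extD ξ) := by
  funext p
  have hev : formInChart (pullSnd N I ξ : DForm (I.prod J) (N × S) k) p =ᶠ[nhds (extChartAt (I.prod J) p p)] fun z : E × F =>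
      (formInChart ξ p.2 (Prod.snd z)).compContinuousLinearMap (fderiv ℝ Prod.snd z) := by
    filter_upwards [(isOpen_extChartAt_target (I := I.prod J) p).mem_nhds (mem_extChartAt_target (I := I.prod J) p)] with z hz
    rw [formInChart_pullSnd ξ hz, fderiv_snd]
  rw [pullSnd_apply, extD_self, hev.extDeriv_eq, extDeriv_pullback (r := ∞) ?_ contDiff_snd.contDiffAt
    minSmoothness_two_le_infty, fderiv_snd, extChartAt_prod_self, extD_self]
  · rfl
  · exact differentiableAt_of_contDiffOn (hξ p.2) (isOpen_extChartAt_target _)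
      (mem_target_prod (mem_extChartAt_target (I := I.prod J) p)).2

theorem extD_wedge {k l : ℕ} {ξ : DForm I N k} {η : DForm I N l} (hξ : IsSmoothForm ξ) (hη : IsSmoothForm η)
    (x : N) (v : Fin (k + l + 1) → E) : extD (wedge ξ η) x v
      = wedgeAt (extD ξ x) (η x) (v ∘ Fin.cast (Nat.add_right_comm k 1 l))
        + (-1) ^ k * wedgeAt (ξ x) (extD η x) v := by
  have hd : ∀ {k : ℕ} {ζ : DForm I N k}, IsSmoothForm ζ → DifferentiableAt ℝ (formInChart ζ x) (extChartAt I x x) :=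
    fun h => differentiableAt_of_contDiffOn (h x) (isOpen_extChartAt_target x) (mem_extChartAt_target x)
  have h := extDeriv_wedgeAt (hd hξ) (hd hη) v
  rw [← extD_self, ← extD_self, formInChart_self, formInChart_self] at h
  have hf : formInChart (wedge ξ η) x = fun z => wedgeAt (formInChart ξ x z) (formInChart η x z) :=
    funext fun y => formInChart_wedge ξ η x y
  rw [← hf, ← extD_self] at h
  exact h

end Product

section ProductMeasure

open MeasureTheory

variable {E : Type*} [NormedAddCommGroup E] [NormedSpace ℝ E] [FiniteDimensional ℝ E]
  {F : Type*} [NormedAddCommGroup F] [NormedSpace ℝ F] [FiniteDimensional ℝ F] {n : ℕ}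

/-- The basis of a product consisting of the two bases. -/
def prodBasis (b : Module.Basis (Fin n) ℝ E) (c : Module.Basis (Fin 1) ℝ F) : Module.Basis (Fin (n + 1)) ℝ (E × F) :=
  (b.prod c).reindex finSumFinEquiv

theorem prodBasis_castSucc (b : Module.Basis (Fin n) ℝ E) (c : Module.Basis (Fin 1) ℝ F) (i : Fin n) :
    prodBasis b c i.castSucc = (b i, 0) := by
  have : finSumFinEquiv.symm i.castSucc = (Sum.inl i : Fin n ⊕ Fin 1) := by
    rw [Equiv.symm_apply_eq]; rfl
  rw [prodBasis, Module.Basis.reindex_apply, this]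
  ext1 <;> simp

theorem prodBasis_last (b : Module.Basis (Fin n) ℝ E) (c : Module.Basis (Fin 1) ℝ F) :
    prodBasis b c (Fin.last n) = (0, c 0) := by
  have : finSumFinEquiv.symm (Fin.last n) = (Sum.inr 0 : Fin n ⊕ Fin 1) := by
    rw [Equiv.symm_apply_eq]; rfl
  rw [prodBasis, Module.Basis.reindex_apply, this]
  ext1 <;> simp

theorem wedgeAt_prodBasis (b : Module.Basis (Fin n) ℝ E) (c : Module.Basis (Fin 1) ℝ F) (f : E [⋀^Fin n]→L[ℝ] ℝ)
    (α : F [⋀^Fin 1]→L[ℝ] ℝ) : wedgeAt (f.compContinuousLinearMap (ContinuousLinearMap.fst ℝ E F))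
      (α.compContinuousLinearMap (ContinuousLinearMap.snd ℝ E F)) (prodBasis b c) = f b * α c := by
  rw [wedgeAt_one_right, Fin.sum_univ_castSucc, Finset.sum_eq_zero, zero_add]
  · simp only [ContinuousAlternatingMap.compContinuousLinearMap_apply, Fin.val_last, prodBasis_last]
    rw [← two_mul, pow_mul, neg_one_sq, one_pow, one_mul, mul_comm]
    congr 2
    · funext i
      have := prodBasis_castSucc b c i
      simp [Fin.removeNth, Fin.init, this]
    · funext i
      rw [Subsingleton.elim i 0]; rfl
  · intro i _
    rw [prodBasis_castSucc, ContinuousAlternatingMap.compContinuousLinearMap_apply]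
    have : α (⇑(ContinuousLinearMap.snd ℝ E F) ∘ fun _ => (b i, 0)) = 0 := α.map_coord_zero 0 rfl
    rw [this, zero_mul, mul_zero]

variable [MeasurableSpace E] [BorelSpace E] [MeasurableSpace F] [BorelSpace F]
  {H : Type*} [TopologicalSpace H] {I : ModelWithCorners ℝ E H} [I.Boundaryless]
  {H' : Type*} [TopologicalSpace H'] {J : ModelWithCorners ℝ F H'} [J.Boundaryless]
  {N : Type*} [TopologicalSpace N] [ChartedSpace H N] [IsManifold I ∞ N]
  {S : Type*} [TopologicalSpace S] [ChartedSpace H' S] [IsManifold J ∞ S]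
  {b : Module.Basis (Fin n) ℝ E} {c : Module.Basis (Fin 1) ℝ F}

theorem wedge_pull_basis (b : Module.Basis (Fin n) ℝ E) (c : Module.Basis (Fin 1) ℝ F) (ξ : DForm I N n)
    (η : DForm J S 1) (p : N × S) : wedge (pullFst S J ξ) (pullSnd N I η) p (tbasis (prodBasis b c) p)
      = ξ p.1 (tbasis b p.1) * η p.2 (tbasis c p.2) := by
  unfold wedge
  rw [pullFst_apply, pullSnd_apply]
  exact wedgeAt_prodBasis b c _ _

theorem formRatio_wedge (τ ξ : DForm I N n) (σ η : DForm J S 1) (p : N × S) :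
    formRatio (prodBasis b c) (wedge (pullFst S J τ) (pullSnd N I σ)) (wedge (pullFst S J ξ) (pullSnd N I η)) p
      = formRatio b τ ξ p.1 * formRatio c σ η p.2 := by
  unfold formRatio
  rw [wedge_pull_basis, wedge_pull_basis, mul_div_mul_comm]

theorem isOrientation_wedge {τ : DForm I N n} (hτ : IsOrientationForm τ) {σ : DForm J S 1}
    (hσ : IsOrientationForm σ) (b : Module.Basis (Fin n) ℝ E) (c : Module.Basis (Fin 1) ℝ F) :
    IsOrientationForm (wedge (pullFst S J τ) (pullSnd N I σ)) where
  smooth := isSmoothForm_wedge (isSmoothForm_pullFst hτ.smooth) (isSmoothForm_pullSnd hσ.smooth)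
  ne_zero p h := by
    have h1 := wedge_pull_basis b c τ σ p
    rw [h] at h1
    have h2 : τ p.1 (tbasis b p.1) ≠ 0 := fun h0 => hτ.ne_zero p.1 (topForm_eq_zero (E := E) b h0)
    have h3 : σ p.2 (tbasis c p.2) ≠ 0 := fun h0 => hσ.ne_zero p.2 (topForm_eq_zero (E := F) c h0)
    exact mul_ne_zero h2 h3 h1.symm

theorem formInChart_wedge_pull (ξ : DForm I N n) (η : DForm J S 1) {p : N × S} {z : E × F}
    (hz : z ∈ (extChartAt (I.prod J) p).target) :
    formInChart (wedge (pullFst S J ξ) (pullSnd N I η)) p z (prodBasis b c)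
      = formInChart ξ p.1 z.1 b * formInChart η p.2 z.2 c := by
  rw [formInChart_wedge, formInChart_pullFst ξ hz, formInChart_pullSnd η hz]
  exact wedgeAt_prodBasis b c _ _

variable [MeasurableSpace N] [BorelSpace N] [MeasurableSpace S] [BorelSpace S]

theorem chartMeasure_eq_map (b : Module.Basis (Fin n) ℝ E) (ξ : DForm I N n) (x₀ : N) {f : E → N}
    (hf : Set.EqOn f (extChartAt I x₀).symm (extChartAt I x₀).target) : chartMeasure b ξ x₀ =
      Measure.map f ((b.addHaar.restrict (extChartAt I x₀).target).withDensity
        fun y => ENNReal.ofReal |formInChart ξ x₀ y b|) := by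
  refine Measure.map_congr ((withDensity_absolutelyContinuous _ _) ?_)
  exact (ae_restrict_iff' (isOpen_extChartAt_target x₀).measurableSet).2 (Filter.Eventually.of_forall fun y hy => (hf hy).symm)

theorem exists_measurable_symm (x₀ : N) : ∃ f : E → N, Measurable f ∧
    Set.EqOn f (extChartAt I x₀).symm (extChartAt I x₀).target := by
  classical
  have ht := (isOpen_extChartAt_target (I := I) x₀).measurableSet
  refine ⟨(extChartAt I x₀).target.piecewise (extChartAt I x₀).symm (fun _ => x₀), ?_, Set.piecewise_eqOn _ _ _⟩
  intro s hs
  rw [Set.piecewise_preimage]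
  exact (by simpa [Set.ite, Set.inter_comm] using measurableSet_preimage (I := I) x₀ hs :
    MeasurableSet ((extChartAt I x₀).symm ⁻¹' s ∩ (extChartAt I x₀).target)).union
    ((measurable_const hs).diff ht)

variable [SecondCountableTopology N] [SecondCountableTopology S]

theorem chartMeasure_prod {τ : DForm I N n} (hτ : IsOrientationForm τ) {σ : DForm J S 1}
    (hσ : IsOrientationForm σ) (p : N × S) :
    chartMeasure (prodBasis b c) (wedge (pullFst S J τ) (pullSnd N I σ)) p
      = (chartMeasure b τ p.1).prod (chartMeasure c σ p.2) := by
  obtain ⟨f, hf, hfe⟩ := exists_measurable_symm (I := I) p.1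
  obtain ⟨g, hg, hge⟩ := exists_measurable_symm (I := J) p.2
  have hfg : Set.EqOn (Prod.map f g) (extChartAt (I.prod J) p).symm (extChartAt (I.prod J) p).target := by
    intro z hz
    rw [extChartAt_prod_symm, Prod.map, hfe (mem_target_prod hz).1, hge (mem_target_prod hz).2]
  have ht := isOpen_extChartAt_target (I := I.prod J) p
  rw [chartMeasure_eq_map b τ p.1 hfe, chartMeasure_eq_map c σ p.2 hge, chartMeasure_eq_map _ _ p hfg,
    Measure.map_prod_map _ _ hf hg, prod_withDensity₀ (aemeasurable_density hτ.smooth.continuous p.1)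
      (aemeasurable_density hσ.smooth.continuous p.2), Measure.prod_restrict, prodBasis,
    Module.Basis.addHaar_reindex, Module.Basis.prod_addHaar]
  have htt : (extChartAt (I.prod J) p).target = (extChartAt I p.1).target ×ˢ (extChartAt J p.2).target := by
    rw [extChartAt_prod]; rfl
  rw [← htt]
  congr 1
  refine withDensity_congr_ae ((ae_restrict_iff' ht.measurableSet).2 (Filter.Eventually.of_forall fun z hz => ?_))
  beta_reduce
  rw [← ENNReal.ofReal_mul (abs_nonneg _), ← abs_mul, ← formInChart_wedge_pull τ σ hz]
  rfl

theorem orientMeasure_prod {τ : DForm I N n} (hτ : IsOrientationForm τ) {σ : DForm J S 1}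
    (hσ : IsOrientationForm σ) :
    orientMeasure (prodBasis b c) (wedge (pullFst S J τ) (pullSnd N I σ))
      = (orientMeasure b τ).prod (orientMeasure c σ) := by
  haveI := sFinite_orientMeasure b τ
  haveI := sFinite_orientMeasure c σ
  refine iSup_chartMeasure_eq fun p => ?_
  have hs : (extChartAt (I.prod J) p).source = (extChartAt I p.1).source ×ˢ (extChartAt J p.2).source := by
    rw [extChartAt_prod]; rfl
  rw [chartMeasure_prod hτ hσ, hs, ← Measure.prod_restrict, orientMeasure, orientMeasure,
    restrict_iSup_chartMeasure, restrict_iSup_chartMeasure]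

end ProductMeasure

section OneFormFactor

variable {V : Type*} [NormedAddCommGroup V] [NormedSpace ℝ V] [FiniteDimensional ℝ V]

theorem wedgeAt_one_self (a : V [⋀^Fin 1]→L[ℝ] ℝ) : wedgeAt a a = 0 := by
  ext v
  have h := wedgeAt_comm a a v
  have e : v ∘ Fin.cast (Nat.add_comm 1 1) = v := rfl
  rw [e] at h
  norm_num at h
  change _ = (0 : ℝ)
  linarith

theorem wedgeAt_zero_left {k l : ℕ} (η : V [⋀^Fin l]→L[ℝ] ℝ) : wedgeAt (0 : V [⋀^Fin k]→L[ℝ] ℝ) η = 0 := by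
  ext v
  have := wedgeAt_smul_left (0 : ℝ) (0 : V [⋀^Fin k]→L[ℝ] ℝ) η
  rw [zero_smul, zero_smul] at this
  rw [this]

theorem wedgeAt_zero_right {k l : ℕ} (ξ : V [⋀^Fin k]→L[ℝ] ℝ) : wedgeAt ξ (0 : V [⋀^Fin l]→L[ℝ] ℝ) = 0 := by
  have := wedgeAt_smul_right (0 : ℝ) ξ (0 : V [⋀^Fin l]→L[ℝ] ℝ)
  rwa [zero_smul, zero_smul] at this

theorem wedgeAt_cast_left {k k' l : ℕ} (h : k' = k) {ξ : V [⋀^Fin k]→L[ℝ] ℝ} {ξ' : V [⋀^Fin k']→L[ℝ] ℝ}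
    (hξ : ∀ v, ξ v = ξ' (v ∘ Fin.cast h)) (η : V [⋀^Fin l]→L[ℝ] ℝ) (v : Fin (k + l) → V) :
    wedgeAt ξ η v = wedgeAt ξ' η (v ∘ Fin.cast (by rw [h])) := by
  subst h
  have : ξ = ξ' := by ext v; exact hξ v
  rw [this]; rfl

theorem wedgeAt_cast_right {k l l' : ℕ} (h : l' = l) (ξ : V [⋀^Fin k]→L[ℝ] ℝ) {η : V [⋀^Fin l]→L[ℝ] ℝ}
    {η' : V [⋀^Fin l']→L[ℝ] ℝ} (hη : ∀ v, η v = η' (v ∘ Fin.cast h)) (v : Fin (k + l) → V) :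
    wedgeAt ξ η v = wedgeAt ξ η' (v ∘ Fin.cast (by rw [h])) := by
  subst h
  have : η = η' := by ext v; exact hη v
  rw [this]; rfl

variable (a : V [⋀^Fin 1]→L[ℝ] ℝ)

theorem wedgeAt_one_shift {k l : ℕ} (X : V [⋀^Fin k]→L[ℝ] ℝ) (Y : V [⋀^Fin l]→L[ℝ] ℝ) (v : Fin (k + (l + 1)) → V) :
    wedgeAt X (wedgeAt Y a) v = wedgeAt (wedgeAt X Y) a (v ∘ Fin.cast (Nat.add_assoc k l 1)) := by
  rw [wedgeAt_assoc]; rfl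

theorem wedgeAt_one_move {k l : ℕ} (X : V [⋀^Fin k]→L[ℝ] ℝ) (Y : V [⋀^Fin l]→L[ℝ] ℝ) (v : Fin (k + 1 + l) → V) :
    wedgeAt (wedgeAt X a) Y v = (-1) ^ l * wedgeAt (wedgeAt X Y) a (v ∘ Fin.cast (Nat.add_right_comm k l 1)) := by
  rw [wedgeAt_assoc, wedgeAt_assoc]
  have h : ∀ w, wedgeAt a Y w = ((-1 : ℝ) ^ l • wedgeAt Y a) (w ∘ Fin.cast (Nat.add_comm l 1)) := fun w => by
    rw [wedgeAt_comm, one_mul]; rfl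
  rw [wedgeAt_cast_right (Nat.add_comm l 1) X h, wedgeAt_smul_right]
  rfl

theorem wedgeAt_one_twice {k l : ℕ} (X : V [⋀^Fin k]→L[ℝ] ℝ) (Y : V [⋀^Fin l]→L[ℝ] ℝ) :
    wedgeAt (wedgeAt X a) (wedgeAt Y a) = 0 := by
  ext v
  have h : ∀ w, wedgeAt (wedgeAt X a) Y w
      = ((-1 : ℝ) ^ l • wedgeAt (wedgeAt X Y) a) (w ∘ Fin.cast (Nat.add_right_comm k l 1)) := fun w =>
    wedgeAt_one_move a X Y w
  rw [wedgeAt_one_shift, wedgeAt_cast_left (Nat.add_right_comm k l 1) h, wedgeAt_smul_left,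
    ContinuousAlternatingMap.smul_apply, wedgeAt_assoc, wedgeAt_one_self, wedgeAt_zero_right]
  simp

theorem wedgeAt_right_comm {k l m : ℕ} (hlm : Even (l * m)) (X : V [⋀^Fin k]→L[ℝ] ℝ) (Y : V [⋀^Fin l]→L[ℝ] ℝ)
    (Z : V [⋀^Fin m]→L[ℝ] ℝ) (v : Fin (k + l + m) → V) :
    wedgeAt (wedgeAt X Y) Z v = wedgeAt (wedgeAt X Z) Y (v ∘ Fin.cast (Nat.add_right_comm k m l)) := by
  rw [wedgeAt_assoc, wedgeAt_assoc]
  have h : ∀ w, wedgeAt Y Z w = wedgeAt Z Y (w ∘ Fin.cast (Nat.add_comm m l)) := fun w => by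
    rw [wedgeAt_comm, hlm.neg_one_pow, one_mul]
  rw [wedgeAt_cast_right (Nat.add_comm m l) X h]
  rfl

theorem chernSimons_algebra {q r : ℕ} (hr : Even (r + 1)) (c : V [⋀^Fin (q + 1)]→L[ℝ] ℝ) (b : V [⋀^Fin q]→L[ℝ] ℝ)
    (g : V [⋀^Fin (r + 1)]→L[ℝ] ℝ) (h : V [⋀^Fin r]→L[ℝ] ℝ) (h0 : wedgeAt (wedgeAt c g) g = 0)
    (v : Fin (q + 1 + (r + 1) + (r + 1)) → V) :
    wedgeAt (wedgeAt (c + wedgeAt b a) (g + wedgeAt h a)) (g + wedgeAt h a) v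
      = 2 * wedgeAt (wedgeAt (wedgeAt c g) h) a v
        + wedgeAt (wedgeAt (wedgeAt b g) g) a (v ∘ Fin.cast (by omega)) := by
  have hg : (-1 : ℝ) ^ (r + 1) = 1 := hr.neg_one_pow
  have hrr : Even (r * (r + 1)) := hr.mul_left r
  have t1 : wedgeAt (wedgeAt c g) g v = 0 := by rw [h0]; rfl
  have t2 : wedgeAt (wedgeAt c g) (wedgeAt h a) v = wedgeAt (wedgeAt (wedgeAt c g) h) a v :=
    wedgeAt_one_shift a (wedgeAt c g) h v
  have s1 : wedgeAt c (wedgeAt h a) = wedgeAt (wedgeAt c h) a := by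
    ext w; exact wedgeAt_one_shift a c h w
  have t3 : wedgeAt (wedgeAt c (wedgeAt h a)) g v = wedgeAt (wedgeAt (wedgeAt c g) h) a v := by
    refine (congrArg (fun f : V [⋀^Fin (q + 1 + r + 1)]→L[ℝ] ℝ => wedgeAt f g v) s1).trans ?_
    refine (wedgeAt_one_move a (wedgeAt c h) g v).trans ?_
    rw [hg, one_mul, wedgeAt_cast_left (Nat.add_right_comm (q + 1) (r + 1) r) (wedgeAt_right_comm hrr c h g)]
    rfl
  have t4 : wedgeAt (wedgeAt c (wedgeAt h a)) (wedgeAt h a) v = 0 := by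
    refine (congrArg (fun f : V [⋀^Fin (q + 1 + r + 1)]→L[ℝ] ℝ => wedgeAt f (wedgeAt h a) v) s1).trans ?_
    exact DFunLike.congr_fun (wedgeAt_one_twice a (wedgeAt c h) h) v
  have s4 : ∀ w, wedgeAt (wedgeAt b a) g w = wedgeAt (wedgeAt b g) a (w ∘ Fin.cast (Nat.add_right_comm q (r + 1) 1)) := by
    intro w
    rw [wedgeAt_one_move, hg, one_mul]
  have t5 : wedgeAt (wedgeAt (wedgeAt b a) g) g v = wedgeAt (wedgeAt (wedgeAt b g) g) a (v ∘ Fin.cast (by omega)) := by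
    rw [wedgeAt_cast_left (Nat.add_right_comm q (r + 1) 1) s4, wedgeAt_one_move, hg, one_mul]
    rfl
  have t6 : wedgeAt (wedgeAt (wedgeAt b a) g) (wedgeAt h a) v = 0 := by
    rw [wedgeAt_cast_left (Nat.add_right_comm q (r + 1) 1) s4, wedgeAt_one_twice]
    rfl
  have s5 : wedgeAt (wedgeAt b a) (wedgeAt h a) = 0 := wedgeAt_one_twice a b h
  have t7 : ∀ f : V [⋀^Fin (r + 1)]→L[ℝ] ℝ, wedgeAt (wedgeAt (wedgeAt b a) (wedgeAt h a)) f v = 0 := fun f => by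
    rw [s5, wedgeAt_zero_left]; rfl
  simp only [wedgeAt_add_left, wedgeAt_add_right, ContinuousAlternatingMap.add_apply, t1, t2, t3, t4, t5, t6, t7]
  ring

theorem wedgeAt_rotate {q r : ℕ} (hq : Even q) (b : V [⋀^Fin q]→L[ℝ] ℝ)
    (g : V [⋀^Fin r]→L[ℝ] ℝ) (v : Fin (r + r + q) → V) :
    wedgeAt (wedgeAt g g) b v = wedgeAt (wedgeAt b g) g (v ∘ Fin.cast (by omega)) := by
  rw [wedgeAt_comm, wedgeAt_assoc, (hq.mul_left (r + r)).neg_one_pow, one_mul]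
  rfl

end OneFormFactor

section ChernSimons

abbrev EN := EuclideanSpace ℝ (Fin 10)
abbrev ES := EuclideanSpace ℝ (Fin 1)

variable {N : Type*} [TopologicalSpace N] [ChartedSpace EN N] [IsManifold (𝓡 10) ∞ N]

variable {E : Type*} [NormedAddCommGroup E] [NormedSpace ℝ E] [FiniteDimensional ℝ E]
  {F : Type*} [NormedAddCommGroup F] [NormedSpace ℝ F] [FiniteDimensional ℝ F]
  {H : Type*} [TopologicalSpace H] {I : ModelWithCorners ℝ E H} [I.Boundaryless]
  {H' : Type*} [TopologicalSpace H'] {J : ModelWithCorners ℝ F H'} [J.Boundaryless]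
  {M : Type*} [TopologicalSpace M] [ChartedSpace H M] [IsManifold I ∞ M]
  {S : Type*} [TopologicalSpace S] [ChartedSpace H' S] [IsManifold J ∞ S] {q : ℕ}

theorem extD_extD {k : ℕ} {ξ : DForm I M k} (hξ : IsSmoothForm ξ) : extD (extD ξ) = 0 := by
  funext x
  have ht := (isOpen_extChartAt_target (I := I) x).mem_nhds (mem_extChartAt_target x)
  have hev : formInChart (extD ξ) x =ᶠ[nhds (extChartAt I x x)] extDeriv (formInChart ξ x) := by
    filter_upwards [ht] with y hy
    exact formInChart_extD hξ hy
  rw [extD_self, hev.extDeriv_eq]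
  exact extDeriv_extDeriv_apply ((hξ x).contDiffAt ht) minSmoothness_two_le_infty

/-- The value of a form at a point, as a form on the model space. -/
def formAt {k : ℕ} (ξ : DForm I M k) (x : M) : E [⋀^Fin k]→L[ℝ] ℝ := ξ x

theorem formAt_wedge {k l : ℕ} (ξ : DForm I M k) (η : DForm I M l) (x : M) :
    formAt (wedge ξ η) x = wedgeAt (formAt ξ x) (formAt η x) := rfl

theorem formAt_add {k : ℕ} (ξ η : DForm I M k) (x : M) : formAt (ξ + η) x = formAt ξ x + formAt η x := rfl

theorem formAt_zero {k : ℕ} (x : M) : formAt (0 : DForm I M k) x = 0 := rfl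

theorem formAt_pullFst {k : ℕ} (ξ : DForm I M k) (p : M × S) : formAt (pullFst S J ξ) p
    = (formAt ξ p.1).compContinuousLinearMap (ContinuousLinearMap.fst ℝ E F) := pullFst_apply ξ p

theorem formAt_pullSnd {k : ℕ} (ξ : DForm J S k) (p : M × S) : formAt (pullSnd M I ξ) p
    = (formAt ξ p.2).compContinuousLinearMap (ContinuousLinearMap.snd ℝ E F) := pullSnd_apply ξ p

theorem formAt_extD_wedge {k l : ℕ} {ξ : DForm I M k} {η : DForm I M l} (hξ : IsSmoothForm ξ) (hη : IsSmoothForm η)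
    (x : M) (v : Fin (k + l + 1) → E) : formAt (extD (wedge ξ η)) x v
      = wedgeAt (formAt (extD ξ) x) (formAt η x) (v ∘ Fin.cast (Nat.add_right_comm k 1 l))
        + (-1) ^ k * wedgeAt (formAt ξ x) (formAt (extD η) x) v := extD_wedge hξ hη x v

theorem formAt_extD_wedge_extD {k : ℕ} {C : DForm I M k} (hC : IsSmoothForm C) (x : M) (v : Fin (k + (k + 1) + 1) → E) :
    formAt (extD (wedge C (extD C))) x v
      = wedgeAt (formAt (extD C) x) (formAt (extD C) x) (v ∘ Fin.cast (Nat.add_right_comm k 1 (k + 1))) := by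
  rw [formAt_extD_wedge hC (isSmoothForm_extD hC), extD_extD hC, formAt_zero, wedgeAt_zero_right]
  change _ + (-1) ^ k * 0 = _
  rw [mul_zero, add_zero]

theorem formAt_extD_flux (hq : Even q) {B : DForm I M q} (hB : IsSmoothForm B) {C : DForm I M (q + 1)}
    (hC : IsSmoothForm C) (x : M) (v : Fin (q + 1 + (q + 1 + 1) + q + 1) → E) :
    formAt (extD (wedge (wedge C (extD C)) B)) x v
      = wedgeAt (wedgeAt (formAt B x) (formAt (extD C) x)) (formAt (extD C) x) (v ∘ Fin.cast (by omega))
        - wedgeAt (wedgeAt (formAt C x) (formAt (extD C) x)) (formAt (extD B) x) v := by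
  have hs : (-1 : ℝ) ^ (q + 1 + (q + 1 + 1)) = -1 := Odd.neg_one_pow ⟨q + 1, by ring⟩
  rw [formAt_extD_wedge (isSmoothForm_wedge hC (isSmoothForm_extD hC)) hB, hs, neg_one_mul, ← sub_eq_add_neg,
    wedgeAt_cast_left (by omega) (formAt_extD_wedge_extD hC x), wedgeAt_rotate hq]
  rfl

/-- The form `C + B ∧ α` on a product. -/
def liftForm (B : DForm I M q) (C : DForm I M (q + 1)) (α : DForm J S 1) : DForm (I.prod J) (M × S) (q + 1) :=
  pullFst S J C + wedge (pullFst S J B) (pullSnd M I α)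

theorem isSmoothForm_liftForm {B : DForm I M q} (hB : IsSmoothForm B) {C : DForm I M (q + 1)}
    (hC : IsSmoothForm C) {α : DForm J S 1} (hα : IsSmoothForm α) : IsSmoothForm (liftForm B C α) :=
  isSmoothForm_add (isSmoothForm_pullFst hC)
    (isSmoothForm_wedge (isSmoothForm_pullFst hB) (isSmoothForm_pullSnd hα))

theorem extD_liftForm {B : DForm I M q} (hB : IsSmoothForm B) {C : DForm I M (q + 1)}
    (hC : IsSmoothForm C) {α : DForm J S 1} (hα : IsSmoothForm α) (h0 : extD α = 0) :
    extD (liftForm B C α) = liftForm (extD B) (extD C) α := by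
  have hBS := isSmoothForm_pullFst (S := S) (J := J) hB
  have hαM := isSmoothForm_pullSnd (N := M) (I := I) hα
  rw [liftForm, extD_add (isSmoothForm_pullFst hC) (isSmoothForm_wedge hBS hαM), extD_pullFst hC, liftForm]
  congr 1
  funext p
  ext v
  have h0' : formAt (extD (pullSnd M I α)) p = 0 := by
    rw [extD_pullSnd hα, formAt_pullSnd, h0]; rfl
  refine (formAt_extD_wedge hBS hαM p v).trans ?_
  rw [h0', wedgeAt_zero_right, extD_pullFst hB]
  change _ + (-1) ^ q * 0 = _
  rw [mul_zero, add_zero]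
  rfl

theorem formAt_liftForm (B : DForm I M q) (C : DForm I M (q + 1)) (α : DForm J S 1) (p : M × S) :
    formAt (liftForm B C α) p = (formAt C p.1).compContinuousLinearMap (ContinuousLinearMap.fst ℝ E F)
      + wedgeAt ((formAt B p.1).compContinuousLinearMap (ContinuousLinearMap.fst ℝ E F))
        ((formAt α p.2).compContinuousLinearMap (ContinuousLinearMap.snd ℝ E F)) := by
  rw [liftForm, formAt_add, formAt_wedge, formAt_pullFst, formAt_pullFst, formAt_pullSnd]

theorem form_comp_cast {V W : Type*} [NormedAddCommGroup V] [NormedSpace ℝ V] [NormedAddCommGroup W] [NormedSpace ℝ W]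
    {k l : ℕ} (h : k = l) {f : V [⋀^Fin l]→L[ℝ] ℝ} {f' : V [⋀^Fin k]→L[ℝ] ℝ} (hf : ∀ v, f v = f' (v ∘ Fin.cast h))
    (P : W →L[ℝ] V) (w : Fin l → W) : f.compContinuousLinearMap P w = f'.compContinuousLinearMap P (w ∘ Fin.cast h) :=
  hf _

theorem chernSimons_liftForm (hq : Even q) {B : DForm I M q} (hB : IsSmoothForm B) {C : DForm I M (q + 1)}
    (hC : IsSmoothForm C) {α : DForm J S 1} (hα : IsSmoothForm α) (h0 : extD α = 0)
    (hE : Module.finrank ℝ E < q + 1 + (q + 1 + 1) + (q + 1 + 1)) (p : M × S)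
    (v : Fin (q + 1 + (q + 1 + 1) + (q + 1 + 1)) → E × F) :
    formAt (wedge (wedge (liftForm B C α) (extD (liftForm B C α))) (extD (liftForm B C α))) p v
      = 3 * formAt (wedge (pullFst S J (wedge (wedge B (extD C)) (extD C))) (pullSnd M I α)) p (v ∘ Fin.cast (by omega))
        - 2 * formAt (wedge (pullFst S J (extD (wedge (wedge C (extD C)) B))) (pullSnd M I α)) p (v ∘ Fin.cast (by omega)) := by
  set P : E × F →L[ℝ] E := ContinuousLinearMap.fst ℝ E F
  set a := (formAt α p.2).compContinuousLinearMap (ContinuousLinearMap.snd ℝ E F) with ha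
  have hz : wedgeAt (wedgeAt (formAt C p.1) (formAt (extD C) p.1)) (formAt (extD C) p.1) = 0 :=
    form_eq_zero_of_finrank_lt hE _
  have hz' : wedgeAt (wedgeAt ((formAt C p.1).compContinuousLinearMap P) ((formAt (extD C) p.1).compContinuousLinearMap P))
      ((formAt (extD C) p.1).compContinuousLinearMap P) = 0 := by
    rw [← wedgeAt_comp, ← wedgeAt_comp, hz]; rfl
  rw [extD_liftForm hB hC hα h0, formAt_wedge, formAt_wedge, formAt_liftForm, formAt_liftForm]
  rw [chernSimons_algebra (q := q) (r := q + 1) a (hq.add even_two) _ _ _ _ hz' v]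
  rw [formAt_wedge, formAt_wedge, formAt_pullFst, formAt_pullFst, formAt_pullSnd, ← ha]
  let W₀ : E [⋀^Fin (q + 1 + (q + 1 + 1) + (q + 1))]→L[ℝ] ℝ :=
    wedgeAt (wedgeAt (formAt C p.1) (formAt (extD C) p.1)) (formAt (extD B) p.1)
  obtain ⟨W, hW⟩ : ∃ W : E [⋀^Fin (q + 1 + (q + 1 + 1) + q + 1)]→L[ℝ] ℝ, W = W₀ := ⟨W₀, rfl⟩
  have hW' : wedgeAt (wedgeAt ((formAt C p.1).compContinuousLinearMap P) ((formAt (extD C) p.1).compContinuousLinearMap P))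
      ((formAt (extD B) p.1).compContinuousLinearMap P) = W.compContinuousLinearMap P := by
    rw [hW, ← wedgeAt_comp]
    exact (wedgeAt_comp _ _ P).symm
  have hD : ∀ w, formAt (wedge (wedge B (extD C)) (extD C)) p.1 w
      = (formAt (extD (wedge (wedge C (extD C)) B)) p.1 + W) (w ∘ Fin.cast (by omega)) := by
    intro w
    rw [ContinuousAlternatingMap.add_apply, formAt_extD_flux hq hB hC, hW]
    exact (sub_add_cancel _ _).symm
  have hD' := wedgeAt_cast_left (by omega) (form_comp_cast (by omega) hD P) a (v ∘ Fin.cast (by omega))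
  have hs : (formAt (extD (wedge (wedge C (extD C)) B)) p.1 + W).compContinuousLinearMap P
    = (formAt (extD (wedge (wedge C (extD C)) B)) p.1).compContinuousLinearMap P + W.compContinuousLinearMap P := rfl
  rw [hs, wedgeAt_add_left, ContinuousAlternatingMap.add_apply] at hD'
  have hB' : wedgeAt (wedgeAt ((formAt B p.1).compContinuousLinearMap P) ((formAt (extD C) p.1).compContinuousLinearMap P))
      ((formAt (extD C) p.1).compContinuousLinearMap P) = (formAt (wedge (wedge B (extD C)) (extD C)) p.1).compContinuousLinearMap P := by
    rw [formAt_wedge, formAt_wedge, wedgeAt_comp, wedgeAt_comp]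
  rw [hB']
  have hL : wedgeAt (wedgeAt (wedgeAt ((formAt C p.1).compContinuousLinearMap P) ((formAt (extD C) p.1).compContinuousLinearMap P))
      ((formAt (extD B) p.1).compContinuousLinearMap P)) a v = wedgeAt (W.compContinuousLinearMap P) a v := by
    exact congrArg (fun f => wedgeAt f a v) hW'
  rw [hL]
  refine (congrArg (fun t => 2 * wedgeAt (W.compContinuousLinearMap P) a v + t) hD').trans ?_
  refine Eq.trans ?_ (congrArg (fun t => 3 * t - 2 * _) hD').symm
  have e : ∀ (f : (E × F) [⋀^Fin (q + 1 + (q + 1 + 1) + q + 1 + 1)]→L[ℝ] ℝ)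
      (h₁ : q + (q + 1 + 1) + (q + 1 + 1) + 1 = q + 1 + (q + 1 + 1) + (q + 1 + 1))
      (h₂ : q + 1 + (q + 1 + 1) + q + 1 + 1 = q + (q + 1 + 1) + (q + 1 + 1) + 1),
      f ((v ∘ Fin.cast h₁) ∘ Fin.cast h₂) = f v := fun _ _ _ => rfl
  have e' : ∀ (f : (E × F) [⋀^Fin (q + 1 + (q + 1 + 1) + q + 1 + 1)]→L[ℝ] ℝ)
      (h₁ : q + 1 + (q + 1 + 1) + q + 1 + 1 = q + 1 + (q + 1 + 1) + (q + 1 + 1)),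
      f (v ∘ Fin.cast h₁) = f v := fun _ _ => rfl
  rw [e, e, e']
  ring

theorem chernSimons_reduction (hq : Even q) {B : DForm I M q} (hB : IsSmoothForm B) {d : ℕ} (hd : q + 1 = d)
    {C : DForm I M d} (hC : IsSmoothForm C) {α : DForm J S 1} (hα : IsSmoothForm α) (h0 : extD α = 0)
    (hE : Module.finrank ℝ E < d + (d + 1) + (d + 1)) {L : DForm (I.prod J) (M × S) d}
    (hL : ∀ p v, formAt L p v = formAt (pullFst S J C) p v
      + formAt (wedge (pullFst S J B) (pullSnd M I α)) p (v ∘ Fin.cast hd)) (p : M × S)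
    (v : Fin (d + (d + 1) + (d + 1)) → E × F) :
    formAt (wedge (wedge L (extD L)) (extD L)) p v
      = 3 * formAt (wedge (pullFst S J (wedge (wedge B (extD C)) (extD C))) (pullSnd M I α)) p (v ∘ Fin.cast (by omega))
        - 2 * formAt (wedge (pullFst S J (extD (wedge (wedge C (extD C)) B))) (pullSnd M I α)) p (v ∘ Fin.cast (by omega)) := by
  subst hd
  obtain rfl : L = liftForm B C α := by
    funext p
    ext v
    exact hL p v
  exact chernSimons_liftForm hq hB hC hα h0 hE p v

/-- Transport of a form along an equality of degrees. -/
def castDegree {k l : ℕ} (h : k = l) (ξ : DForm I M k) : DForm I M l := h ▸ ξ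

theorem formAt_cast {k l : ℕ} (h : k = l) (ξ : DForm I M k) (x : M) (v : Fin l → E) :
    formAt (castDegree h ξ) x v = formAt ξ x (v ∘ Fin.cast h) := by
  subst h; rfl

theorem formAt_wedge_pull_cast {k l : ℕ} (h : k = l) (D : DForm I M k) (α : DForm J S 1) (p : M × S)
    (v : Fin (l + 1) → E × F) : formAt (wedge (pullFst S J (castDegree h D)) (pullSnd M I α)) p v
      = formAt (wedge (pullFst S J D) (pullSnd M I α)) p (v ∘ Fin.cast (by rw [h])) := by
  subst h; rfl

theorem chernSimons_reduction_cast (hq : Even q) {B : DForm I M q} (hB : IsSmoothForm B) {d n : ℕ} (hd : q + 1 = d)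
    {C : DForm I M d} (hC : IsSmoothForm C) {α : DForm J S 1} (hα : IsSmoothForm α) (h0 : extD α = 0)
    (hE : Module.finrank ℝ E = n) {L : DForm (I.prod J) (M × S) d}
    (hL : ∀ p v, formAt L p v = formAt (pullFst S J C) p v
      + formAt (wedge (pullFst S J B) (pullSnd M I α)) p (v ∘ Fin.cast hd))
    (h₁ : q + (d + 1) + (d + 1) = n) (h₂ : d + (d + 1) + q + 1 = n) (h₃ : d + (d + 1) + (d + 1) = n + 1)
    {D X : DForm I M n} (hD : D = castDegree h₁ (wedge (wedge B (extD C)) (extD C)))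
    (hX : X = castDegree h₂ (extD (wedge (wedge C (extD C)) B))) {T : DForm (I.prod J) (M × S) (n + 1)}
    (hT : T = castDegree h₃ (wedge (wedge L (extD L)) (extD L))) (p : M × S) (v : Fin (n + 1) → E × F) :
    formAt T p v = 3 * formAt (wedge (pullFst S J D) (pullSnd M I α)) p v
      - 2 * formAt (wedge (pullFst S J X) (pullSnd M I α)) p v := by
  subst hD hX hT
  rw [formAt_wedge_pull_cast, formAt_wedge_pull_cast, formAt_cast,
    chernSimons_reduction hq hB hd hC hα h0 (by omega) hL]
  rfl

theorem formRatio_of_formAt [MeasurableSpace E] [BorelSpace E] [MeasurableSpace F] [BorelSpace F] {n : ℕ} (b : Module.Basis (Fin n) ℝ E) (c : Module.Basis (Fin 1) ℝ F)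
    (τ : DForm I M n) (σ : DForm J S 1) {D X : DForm I M n} {α : DForm J S 1} {T : DForm (I.prod J) (M × S) (n + 1)}
    {x y : ℝ} (p : M × S) (h : ∀ v, formAt T p v = x * formAt (wedge (pullFst S J D) (pullSnd M I α)) p v
      - y * formAt (wedge (pullFst S J X) (pullSnd M I α)) p v) :
    formRatio (prodBasis b c) (wedge (pullFst S J τ) (pullSnd M I σ)) T p
      = (x * formRatio b τ D p.1 - y * formRatio b τ X p.1) * formRatio c σ α p.2 := by
  have h1 := wedge_pull_basis b c D α p
  have h2 := wedge_pull_basis b c X α p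
  have h3 : T p (tbasis (prodBasis b c) p) = x * wedge (pullFst S J D) (pullSnd M I α) p (tbasis (prodBasis b c) p)
    - y * wedge (pullFst S J X) (pullSnd M I α) p (tbasis (prodBasis b c) p) := h _
  unfold formRatio
  rw [h3, h1, h2, wedge_pull_basis]
  ring

theorem extD_circle (α : DForm (𝓡 1) Circle 1) : extD α = 0 := by
  funext z
  exact form_eq_zero_of_finrank_lt (V := ES) (by simp) _

theorem formRatio_chernSimons_reduction [MeasurableSpace E] [BorelSpace E] [MeasurableSpace F] [BorelSpace F]
    (hq : Even q) {B : DForm I M q} (hB : IsSmoothForm B) {d n : ℕ} (hd : q + 1 = d)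
    {C : DForm I M d} (hC : IsSmoothForm C) {α : DForm J S 1} (hα : IsSmoothForm α) (h0 : extD α = 0)
    (hE : Module.finrank ℝ E = n) {L : DForm (I.prod J) (M × S) d}
    (hL : ∀ p v, formAt L p v = formAt (pullFst S J C) p v
      + formAt (wedge (pullFst S J B) (pullSnd M I α)) p (v ∘ Fin.cast hd))
    (h₁ : q + (d + 1) + (d + 1) = n) (h₂ : d + (d + 1) + q + 1 = n) (h₃ : d + (d + 1) + (d + 1) = n + 1)
    {D X : DForm I M n} (hD : D = castDegree h₁ (wedge (wedge B (extD C)) (extD C)))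
    (hX : X = castDegree h₂ (extD (wedge (wedge C (extD C)) B))) {T τM : DForm (I.prod J) (M × S) (n + 1)}
    (hT : T = castDegree h₃ (wedge (wedge L (extD L)) (extD L)))
    (b : Module.Basis (Fin n) ℝ E) (c : Module.Basis (Fin 1) ℝ F) {bb : Module.Basis (Fin (n + 1)) ℝ (E × F)}
    (hbb : bb = prodBasis b c)
    {τ : DForm I M n} {σ : DForm J S 1} (hτ : τM = wedge (pullFst S J τ) (pullSnd M I σ)) (p : M × S) :
    formRatio bb τM T p
      = (3 * formRatio b τ D p.1 - 2 * formRatio b τ X p.1) * formRatio c σ α p.2 := by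
  subst hτ hbb
  exact formRatio_of_formAt b c τ σ p fun v => chernSimons_reduction_cast hq hB hd hC hα h0 hE hL h₁ h₂ h₃ hD hX hT p v

theorem formRatio_chernSimons11 {B₂ : DForm (𝓡 10) N 2} (hB : IsSmoothForm B₂) {C₃ : DForm (𝓡 10) N 3}
    (hC : IsSmoothForm C₃) {α : DForm (𝓡 1) Circle 1} (hα : IsSmoothForm α)
    (τ : DForm (𝓡 10) N 10) (σ : DForm (𝓡 1) Circle 1) (p : N × Circle) :
    formRatio bM (productOrientation τ σ) (chernSimons11 (liftC B₂ C₃ α)) p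
      = (3 * formRatio bN τ (densityCS B₂ C₃) p.1 - 2 * formRatio bN τ (extD (chernSimonsFlux B₂ C₃)) p.1)
        * formRatio bS σ α p.2 := by
  have hL : ∀ (p : N × Circle) (v : Fin 3 → EN × ES), formAt (liftC B₂ C₃ α) p v = formAt (pullFst Circle (𝓡 1) C₃) p v
      + formAt (wedge (pullFst Circle (𝓡 1) B₂) (pullSnd N (𝓡 10) α)) p (v ∘ Fin.cast (rfl : 2 + 1 = 3)) := fun _ _ => rfl
  have h₁ : 2 + (3 + 1) + (3 + 1) = 10 := by norm_num
  have h₂ : 3 + (3 + 1) + 2 + 1 = 10 := by norm_num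
  have h₃ : 3 + (3 + 1) + (3 + 1) = 10 + 1 := by norm_num
  have hD' : densityCS B₂ C₃ = castDegree h₁ (wedge (wedge B₂ (extD C₃)) (extD C₃)) := rfl
  have hX' : extD (k := 9) (chernSimonsFlux B₂ C₃) = castDegree h₂ (extD (k := 3 + (3 + 1) + 2) (wedge (k := 3 + (3 + 1)) (wedge C₃ (extD C₃)) B₂)) := rfl
  have hT : chernSimons11 (liftC B₂ C₃ α) = castDegree h₃ (wedge (k := 3 + (3 + 1)) (wedge (liftC B₂ C₃ α) (extD (liftC B₂ C₃ α))) (extD (liftC B₂ C₃ α))) := rfl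
  exact formRatio_chernSimons_reduction (q := 2) (d := 3) (n := 10) even_two hB rfl hC hα (extD_circle α) (by simp)
    (L := liftC B₂ C₃ α) hL h₁ h₂ h₃ hD' hX' hT bN bS (bb := bM) rfl (τM := productOrientation τ σ) rfl p

end ChernSimons

section Frame

variable {V : Type*} [AddCommGroup V] [Module ℝ V] [TopologicalSpace V]
  {V' : Type*} [AddCommGroup V'] [Module ℝ V'] [TopologicalSpace V'] {n : ℕ}

theorem innerAt_zero (b : Module.Basis (Fin n) ℝ V) (g : LinearMap.BilinForm ℝ V)
    (F G : V [⋀^Fin 0]→L[ℝ] ℝ) : innerAt b g F G = F ![] * G ![] := by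
  have h : ∀ v : Fin 0 → V, v = ![] := fun v => Subsingleton.elim _ _
  simp [innerAt, h]

theorem innerAt_succ_diagonal {c : Module.Basis (Fin n) ℝ V} {g : LinearMap.BilinForm ℝ V} {d : Fin n → ℝ}
    (hd : ∀ i, d i ≠ 0) (hc : ∀ i j, g (c i) (c j) = if i = j then d i else 0) {k : ℕ}
    (F G : V [⋀^Fin (k + 1)]→L[ℝ] ℝ) : innerAt c g F G
      = ((k + 1 : ℕ) : ℝ)⁻¹ * ∑ i, (d i)⁻¹ * innerAt c g (interiorAt (c i) F) (interiorAt (c i) G) := by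
  rw [innerAt_succ, contr_diagonal hd hc]

theorem innerAt_one_diagonal {c : Module.Basis (Fin n) ℝ V} {g : LinearMap.BilinForm ℝ V} {d : Fin n → ℝ}
    (hd : ∀ i, d i ≠ 0) (hc : ∀ i j, g (c i) (c j) = if i = j then d i else 0)
    (F : V [⋀^Fin 1]→L[ℝ] ℝ) : innerAt c g F F = ∑ i, (d i)⁻¹ * F (fun _ => c i) ^ 2 := by
  rw [innerAt_succ_diagonal hd hc]
  simp only [innerAt_zero, interiorAt_apply, zero_add, Nat.cast_one, inv_one, one_mul]
  refine Finset.sum_congr rfl fun i _ => ?_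
  have h : Matrix.vecCons (c i) ![] = fun _ => c i := by
    ext j; fin_cases j; rfl
  rw [h, pow_two]

theorem innerAt_two_diagonal {c : Module.Basis (Fin n) ℝ V} {g : LinearMap.BilinForm ℝ V} {d : Fin n → ℝ}
    (hd : ∀ i, d i ≠ 0) (hc : ∀ i j, g (c i) (c j) = if i = j then d i else 0)
    (F : V [⋀^Fin 2]→L[ℝ] ℝ) :
    innerAt c g F F = (1 / 2) * ∑ i, (d i)⁻¹ * ∑ j, (d j)⁻¹ * F ![c i, c j] ^ 2 := by
  rw [innerAt_succ_diagonal hd hc]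
  simp only [innerAt_one_diagonal hd hc, interiorAt_apply]
  norm_num
  refine Finset.sum_congr rfl fun i _ => ?_
  congr 1
  refine Finset.sum_congr rfl fun j _ => ?_
  have h : Matrix.vecCons (c i) (fun _ : Fin 1 => c j) = ![c i, c j] := by
    ext j; fin_cases j <;> rfl
  rw [h]

theorem interiorAt_interiorAt_self {k : ℕ} (X : V) (ξ : V [⋀^Fin (k + 2)]→L[ℝ] ℝ) :
    interiorAt X (interiorAt X ξ) = 0 := by
  ext v
  rw [interiorAt_apply, interiorAt_apply]
  exact ξ.map_eq_zero_of_eq _ (i := 0) (j := 1) rfl (by simp)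

theorem interiorAt_interiorAt_swap {k : ℕ} (X Y : V) (ξ : V [⋀^Fin (k + 2)]→L[ℝ] ℝ) :
    interiorAt X (interiorAt Y ξ) = (-1 : ℝ) • interiorAt Y (interiorAt X ξ) := by
  have h := interiorAt_interiorAt_self (X + Y) ξ
  have e : ∀ η ζ : V [⋀^Fin (k + 1)]→L[ℝ] ℝ, ∀ Z : V, interiorAt Z (η + ζ) = interiorAt Z η + interiorAt Z ζ :=
    fun _ _ _ => rfl
  simp only [interiorAt_add, e, interiorAt_interiorAt_self, zero_add, add_zero] at h
  rw [neg_one_smul]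
  exact eq_neg_of_add_eq_zero_right h

theorem innerAt_interiorAt_swap (b : Module.Basis (Fin n) ℝ V') (g : LinearMap.BilinForm ℝ V') {k : ℕ} (X Y : V)
    (ξ : V [⋀^Fin (k + 2)]→L[ℝ] ℝ) (j : V' →L[ℝ] V) :
    innerAt b g ((interiorAt X (interiorAt Y ξ)).compContinuousLinearMap j)
      ((interiorAt X (interiorAt Y ξ)).compContinuousLinearMap j)
    = innerAt b g ((interiorAt Y (interiorAt X ξ)).compContinuousLinearMap j)
      ((interiorAt Y (interiorAt X ξ)).compContinuousLinearMap j) := by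
  have e : ∀ η : V [⋀^Fin k]→L[ℝ] ℝ, ((-1 : ℝ) • η).compContinuousLinearMap j = (-1 : ℝ) • η.compContinuousLinearMap j :=
    fun _ => rfl
  rw [interiorAt_interiorAt_swap X Y, e, innerAt_smul_left, innerAt_smul_right]
  ring

/-- The square of a form on a space with an orthogonal basis which extends the image of an orthogonal basis
of a hyperplane by one vector. -/
theorem innerAt_extend_basis {c : Module.Basis (Fin n) ℝ V} {g : LinearMap.BilinForm ℝ V} {d : Fin n → ℝ}
    (hd : ∀ i, d i ≠ 0) (hc : ∀ i j, g (c i) (c j) = if i = j then d i else 0)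
    {e : Module.Basis (Fin (n + 1)) ℝ V'} {G : LinearMap.BilinForm ℝ V'} {q : ℝ} (hq : q ≠ 0)
    (he : ∀ i j, G (e i) (e j) = if i = j then Fin.snoc (α := fun _ => ℝ) d q i else 0)
    (j : V →L[ℝ] V') (hj : ∀ i : Fin n, e i.castSucc = j (c i)) {k : ℕ} (ξ : V' [⋀^Fin (k + 1)]→L[ℝ] ℝ) :
    innerAt e G ξ ξ = innerAt c g (ξ.compContinuousLinearMap j) (ξ.compContinuousLinearMap j)
      + q⁻¹ * innerAt c g ((interiorAt (e (Fin.last n)) ξ).compContinuousLinearMap j)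
        ((interiorAt (e (Fin.last n)) ξ).compContinuousLinearMap j) := by
  have hd' : ∀ i : Fin (n + 1), Fin.snoc (α := fun _ => ℝ) d q i ≠ 0 := by
    intro i
    refine Fin.lastCases ?_ (fun i => ?_) i
    · simpa using hq
    · simpa using hd i
  have hi : ∀ {k : ℕ} (ζ : V' [⋀^Fin (k + 1)]→L[ℝ] ℝ) (i : Fin n),
      interiorAt (c i) (ζ.compContinuousLinearMap j) = (interiorAt (e i.castSucc) ζ).compContinuousLinearMap j := by
    intro k ζ i
    rw [hj, interiorAt_comp]
  induction k with
  | zero =>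
    rw [innerAt_succ_diagonal hd' he, innerAt_succ_diagonal hd hc, Fin.sum_univ_castSucc]
    simp only [Fin.snoc_castSucc, Fin.snoc_last, hi, innerAt_zero]
    norm_num
    have h0 : ∀ v : Fin 0 → V', v = ![] := fun v => Subsingleton.elim _ _
    simp [h0]
  | succ k ih =>
    rw [innerAt_succ_diagonal hd' he, Fin.sum_univ_castSucc]
    simp only [Fin.snoc_castSucc, Fin.snoc_last, ih]
    rw [innerAt_succ_diagonal hd hc (ξ.compContinuousLinearMap j), innerAt_succ_diagonal hd hc
      ((interiorAt (e (Fin.last n)) ξ).compContinuousLinearMap j)]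
    simp only [hi, interiorAt_interiorAt_self]
    have h1 : ∀ i : Fin n, innerAt c g
        ((interiorAt (e (Fin.last n)) (interiorAt (e i.castSucc) ξ)).compContinuousLinearMap j)
        ((interiorAt (e (Fin.last n)) (interiorAt (e i.castSucc) ξ)).compContinuousLinearMap j) = innerAt c g
        ((interiorAt (e i.castSucc) (interiorAt (e (Fin.last n)) ξ)).compContinuousLinearMap j)
        ((interiorAt (e i.castSucc) (interiorAt (e (Fin.last n)) ξ)).compContinuousLinearMap j) :=
      fun i => innerAt_interiorAt_swap c g _ _ ξ j
    simp only [h1, mul_add, Finset.sum_add_distrib]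
    have h2 : innerAt c g ((0 : V' [⋀^Fin k]→L[ℝ] ℝ).compContinuousLinearMap j)
        ((0 : V' [⋀^Fin k]→L[ℝ] ℝ).compContinuousLinearMap j) = 0 := by
      have : (0 : V' [⋀^Fin k]→L[ℝ] ℝ).compContinuousLinearMap j = (0 : ℝ) • 0 := by ext; simp
      rw [this, innerAt_smul_left, zero_mul]
    rw [h2]
    have h4 : ∀ x : Fin n → ℝ, ∑ i, (d i)⁻¹ * (q⁻¹ * x i) = q⁻¹ * ∑ i, (d i)⁻¹ * x i := by
      intro x
      rw [Finset.mul_sum]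
      exact Finset.sum_congr rfl fun i _ => by ring
    rw [h4]
    push_cast
    have : (k : ℝ) + 1 ≠ 0 := by positivity
    have : (k : ℝ) + 1 + 1 ≠ 0 := by positivity
    field_simp
    ring

theorem innerAt_smul_metric {c : Module.Basis (Fin n) ℝ V} {g : LinearMap.BilinForm ℝ V} {d : Fin n → ℝ}
    (hd : ∀ i, d i ≠ 0) (hc : ∀ i j, g (c i) (c j) = if i = j then d i else 0) {p : ℝ} (hp : p ≠ 0) {k : ℕ}
    (F G : V [⋀^Fin k]→L[ℝ] ℝ) : innerAt c (p • g) F G = (p ^ k)⁻¹ * innerAt c g F G := by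
  induction k with
  | zero => simp [innerAt_zero]
  | succ k ih =>
    rw [innerAt_succ_diagonal (d := fun i => p * d i) (fun i => mul_ne_zero hp (hd i))
      (fun i j => by simp [hc]), innerAt_succ_diagonal hd hc]
    simp only [ih, Finset.mul_sum]
    refine Finset.sum_congr rfl fun i _ => ?_
    rw [pow_succ, mul_inv, mul_inv]
    ring

end Frame

section KaluzaKleinFrame

variable {E : Type*} [NormedAddCommGroup E] [NormedSpace ℝ E] [FiniteDimensional ℝ E]
  {F : Type*} [NormedAddCommGroup F] [NormedSpace ℝ F] [FiniteDimensional ℝ F] {n : ℕ}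

/-- A `1`-form as a continuous linear functional. -/
def oneCLM (α : E [⋀^Fin 1]→L[ℝ] ℝ) : E →L[ℝ] ℝ := (ContinuousAlternatingMap.ofSubsingleton ℝ E ℝ (0 : Fin 1)).symm α

theorem oneCLM_apply (α : E [⋀^Fin 1]→L[ℝ] ℝ) (X : E) : oneCLM α X = α (fun _ => X) := rfl

/-- The horizontal lift of a basis with respect to the connection form `A`, with a vertical vector. -/
def kkFrame (c : Module.Basis (Fin n) ℝ E) (w : Module.Basis (Fin 1) ℝ F) (A : E →L[ℝ] ℝ) :
    Module.Basis (Fin (n + 1)) ℝ (E × F) :=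
  (prodBasis c w).map (LinearEquiv.skewProd (LinearEquiv.refl ℝ E) (LinearEquiv.refl ℝ F)
    (A.smulRight (w 0) : E →L[ℝ] F).toLinearMap)

variable {c : Module.Basis (Fin n) ℝ E} {w : Module.Basis (Fin 1) ℝ F} {A : E →L[ℝ] ℝ} {θ : F →L[ℝ] ℝ}

theorem kkFrame_castSucc (c : Module.Basis (Fin n) ℝ E) (w : Module.Basis (Fin 1) ℝ F) (A : E →L[ℝ] ℝ) (i : Fin n) :
    kkFrame c w A i.castSucc = (c i, A (c i) • w 0) := by
  simp [kkFrame, prodBasis_castSucc]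

theorem kkFrame_last (c : Module.Basis (Fin n) ℝ E) (w : Module.Basis (Fin 1) ℝ F) (A : E →L[ℝ] ℝ) :
    kkFrame c w A (Fin.last n) = (0, w 0) := by
  simp [kkFrame, prodBasis_last]

theorem gram_kkFrame {d : Fin n → ℝ} {g : E → E → ℝ} (hc : ∀ i j, g (c i) (c j) = if i = j then d i else 0)
    (hw : θ (w 0) = 1) {G : E × F → E × F → ℝ} (hg0 : ∀ u, g u 0 = 0) (hg0' : ∀ u, g 0 u = 0) {p q : ℝ}
    (hG : ∀ u v, G u v = p * g u.1 v.1 + q * ((A u.1 - θ u.2) * (A v.1 - θ v.2))) (i j : Fin (n + 1)) :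
    G (kkFrame c w A i) (kkFrame c w A j)
      = if i = j then Fin.snoc (α := fun _ => ℝ) (fun i => p * d i) q i else 0 := by
  refine Fin.lastCases ?_ (fun i => ?_) i <;> refine Fin.lastCases ?_ (fun j => ?_) j <;>
    simp [hG, kkFrame_castSucc, kkFrame_last, hw, hc, hg0, hg0', Fin.castSucc_ne_last, (Fin.castSucc_ne_last _).symm]

theorem snoc_ne_zero {d : Fin n → ℝ} (hd : ∀ i, d i ≠ 0) {p q : ℝ} (hp : p ≠ 0) (hq : q ≠ 0) (i : Fin (n + 1)) :
    Fin.snoc (α := fun _ => ℝ) (fun i => p * d i) q i ≠ 0 := by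
  refine Fin.lastCases ?_ (fun i => ?_) i
  · simpa using hq
  · simpa using ⟨hp, hd i⟩

/-- `|π^*X + π^*Y ∧ π^*α|² = p^{-k-1} |X + Y ∧ A|² + q⁻¹ p^{-k} |Y|²`. -/
theorem innerAt_kkFrame {d : Fin n → ℝ} (hd : ∀ i, d i ≠ 0) {g : LinearMap.BilinForm ℝ E}
    (hc : ∀ i j, g (c i) (c j) = if i = j then d i else 0) {θ : F [⋀^Fin 1]→L[ℝ] ℝ}
    {C : E [⋀^Fin 1]→L[ℝ] ℝ}
    (hw : oneCLM θ (w 0) = 1) {G : LinearMap.BilinForm ℝ (E × F)} {p q : ℝ} (hp : p ≠ 0) (hq : q ≠ 0)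
    (hG : ∀ u v, G u v = p * g u.1 v.1 + q * ((oneCLM C u.1 - oneCLM θ u.2) * (oneCLM C v.1 - oneCLM θ v.2)))
    {k : ℕ} (X : E [⋀^Fin (k + 1)]→L[ℝ] ℝ) (Y : E [⋀^Fin k]→L[ℝ] ℝ) (b : Module.Basis (Fin (n + 1)) ℝ (E × F))
    {Z : (E × F) [⋀^Fin (k + 1)]→L[ℝ] ℝ} (hZ : Z = X.compContinuousLinearMap (.fst ℝ E F)
      + wedgeAt (Y.compContinuousLinearMap (.fst ℝ E F)) (θ.compContinuousLinearMap (.snd ℝ E F))) :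
    innerAt b G Z Z = (p ^ (k + 1))⁻¹ * innerAt c g (X + wedgeAt Y C) (X + wedgeAt Y C)
      + q⁻¹ * (p ^ k)⁻¹ * innerAt c g Y Y := by
  have he := gram_kkFrame (A := oneCLM C) (g := fun u v => g u v) (G := fun u v => G u v) hc hw (by simp) (by simp) hG
  have hgram : IsUnit (gram (kkFrame c w (oneCLM C)) G).det := by
    rw [gram_eq_gramM]
    exact isUnit_det_diagonal (g := fun u v => G u v) (snoc_ne_zero hd hp hq) he
  set j : E →L[ℝ] E × F := (ContinuousLinearMap.id ℝ E).prod ((oneCLM C).smulRight (w 0)) with hj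
  have h1 : Z.compContinuousLinearMap j = X + wedgeAt Y C := by
    have e1 : (wedgeAt (Y.compContinuousLinearMap (.fst ℝ E F)) (θ.compContinuousLinearMap (.snd ℝ E F))).compContinuousLinearMap j
        = wedgeAt Y C := by
      rw [wedgeAt_comp]
      congr 1
      ext v
      have e2 : θ (⇑(ContinuousLinearMap.snd ℝ E F) ∘ ⇑j ∘ v) = oneCLM θ (oneCLM C (v 0) • w 0) := by
        rw [oneCLM_apply]
        congr 1
        funext i
        rw [Subsingleton.elim i 0]; rfl
      refine e2.trans ?_
      rw [map_smul, hw, smul_eq_mul, mul_one, oneCLM_apply]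
      congr 1
      funext i
      rw [Subsingleton.elim i 0]
    rw [← e1, hZ]
    rfl
  have h2 : (interiorAt (kkFrame c w (oneCLM C) (Fin.last n)) Z).compContinuousLinearMap j = ((-1 : ℝ) ^ k) • Y := by
    ext v
    have e1 : X.compContinuousLinearMap (.fst ℝ E F) (Matrix.vecCons (0, w 0) (j ∘ v)) = 0 :=
      X.map_coord_zero 0 rfl
    have e2 : ∀ i : Fin k, Y.compContinuousLinearMap (.fst ℝ E F)
        (i.succ.removeNth (Matrix.vecCons (0, w 0) (j ∘ v) : Fin (k + 1) → E × F)) = 0 := by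
      intro i
      refine Y.map_coord_zero ⟨0, i.pos⟩ ?_
      have : (i.succ.removeNth (Matrix.vecCons (0, w 0) (j ∘ v) : Fin (k + 1) → E × F)) ⟨0, i.pos⟩ = (0, w 0) := by
        obtain ⟨k, rfl⟩ : ∃ l, k = l + 1 := ⟨k - 1, by have := i.pos; omega⟩
        rfl
      simp [this]
    have e3 : θ.compContinuousLinearMap (.snd ℝ E F) (fun _ => (0, w 0)) = 1 := hw
    have e4 : Z (Matrix.vecCons (0, w 0) (j ∘ v)) = (-1 : ℝ) ^ k * Y v := by
      rw [hZ, ContinuousAlternatingMap.add_apply, e1, wedgeAt_one_right, Fin.sum_univ_succ]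
      simp only [e2, mul_zero, Finset.sum_const_zero, add_zero, zero_add, Fin.val_zero, Matrix.cons_val_zero, e3, one_mul]
      rfl
    rw [kkFrame_last]
    exact e4
  rw [innerAt_basis _ b G hgram, innerAt_extend_basis (c := c) (g := p • g) (fun i => mul_ne_zero hp (hd i))
    (fun i j => by simp [hc]) hq he j
    (fun i => by rw [kkFrame_castSucc]; rfl), innerAt_smul_metric hd hc hp, innerAt_smul_metric hd hc hp, ← mul_assoc,
    h1, h2, innerAt_smul_left, innerAt_smul_right, ← mul_assoc ((-1 : ℝ) ^ k), ← mul_pow]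
  norm_num

/-- The coefficient of the volume form of `p g + q (A - θ)²`. -/
theorem volAt_kkFrame {d : Fin n → ℝ} {g : LinearMap.BilinForm ℝ E}
    (hc : ∀ i j, g (c i) (c j) = if i = j then d i else 0) {θ τS : F [⋀^Fin 1]→L[ℝ] ℝ} {τ : E [⋀^Fin n]→L[ℝ] ℝ}
    {C : E [⋀^Fin 1]→L[ℝ] ℝ}
    (hw : oneCLM θ (w 0) = 1) {r : ℝ} (hr : 0 < r) (hθ : θ = r • τS) {G : LinearMap.BilinForm ℝ (E × F)} {p q : ℝ} (hp : 0 < p) (hq : 0 < q)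
    (hG : ∀ u v, G u v = p * g u.1 v.1 + q * ((oneCLM C u.1 - oneCLM θ u.2) * (oneCLM C v.1 - oneCLM θ v.2)))
    (b : Module.Basis (Fin n) ℝ E) (bb : Module.Basis (Fin (n + 1)) ℝ (E × F)) :
    volAt bb G (wedgeAt (τ.compContinuousLinearMap (.fst ℝ E F)) (τS.compContinuousLinearMap (.snd ℝ E F)))
      = Real.sqrt (p ^ n * q) • wedgeAt ((volAt b g τ).compContinuousLinearMap (.fst ℝ E F)) (θ.compContinuousLinearMap (.snd ℝ E F)) := by
  have he := gram_kkFrame (A := oneCLM C) (g := fun u v => g u v) (G := fun u v => G u v) hc hw (by simp) (by simp) hG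
  have hτ : wedgeAt (τ.compContinuousLinearMap (.fst ℝ E F)) (τS.compContinuousLinearMap (.snd ℝ E F))
      (kkFrame c w (oneCLM C)) = τ c * τS (fun _ => w 0) := by
    rw [wedgeAt_one_right, Fin.sum_univ_castSucc, Finset.sum_eq_zero, zero_add]
    · rw [Fin.val_last, ← two_mul, pow_mul, neg_one_sq, one_pow, one_mul, mul_comm, kkFrame_last]
      congr 1
      change τ _ = _
      congr 1
      funext i
      simp [Fin.removeNth, Fin.init, kkFrame_castSucc]
    · intro i _
      have : τ.compContinuousLinearMap (.fst ℝ E F) (i.castSucc.removeNth (kkFrame c w (oneCLM C))) = 0 := by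
        obtain ⟨m, rfl⟩ : ∃ l, n = l + 1 := ⟨n - 1, by have := i.pos; omega⟩
        refine τ.map_coord_zero (Fin.last m) ?_
        have : i.castSucc.succAbove (Fin.last m) = Fin.last (m + 1) := Fin.succAbove_ne_last_last (Fin.castSucc_ne_last i)
        simp [Fin.removeNth, this, kkFrame_last]
      rw [this, mul_zero, mul_zero]
  have hw' : r * τS (fun _ => w 0) = 1 := by rw [← hw, oneCLM_apply, hθ]; rfl
  have hτS : |τS (fun _ => w 0)| = r⁻¹ := by
    rw [← abs_of_pos (inv_pos.2 hr)]
    congr 1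
    field_simp
    linarith
  have hdG : (gram (kkFrame c w (oneCLM C)) G).det = p ^ n * q * ∏ i, d i := by
    have : gram (kkFrame c w (oneCLM C)) G = Matrix.diagonal (Fin.snoc (α := fun _ => ℝ) (fun i => p * d i) q) := by
      ext i j
      rw [Matrix.diagonal_apply, ← he i j]; rfl
    rw [this, Matrix.det_diagonal, Fin.prod_univ_castSucc]
    simp only [Fin.snoc_castSucc, Fin.snoc_last, Finset.prod_mul_distrib, Finset.prod_const, Finset.card_univ, Fintype.card_fin]
    ring
  have hdg : (gram c g).det = ∏ i, d i := by
    have : gram c g = Matrix.diagonal d := by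
      ext i j
      rw [Matrix.diagonal_apply, ← hc i j]; rfl
    rw [this, Matrix.det_diagonal]
  have e1 : (r • τS).compContinuousLinearMap (ContinuousLinearMap.snd ℝ E F) = r • τS.compContinuousLinearMap (.snd ℝ E F) := rfl
  have e2 : ∀ x : ℝ, (x • τ).compContinuousLinearMap (ContinuousLinearMap.fst ℝ E F) = x • τ.compContinuousLinearMap (.fst ℝ E F) := fun _ => rfl
  rw [volAt_basis (kkFrame c w (oneCLM C)) bb, volAt_basis c b, volAt, volAt, hτ, hdG, hdg, hθ, e1, e2, wedgeAt_smul_right, wedgeAt_smul_left,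
    smul_smul, smul_smul, abs_mul (τ c), abs_mul (p ^ n * q), hτS, abs_of_pos (by positivity : 0 < p ^ n * q), Real.sqrt_mul (by positivity)]
  congr 1
  rw [div_mul_eq_div_div, div_inv_eq_mul]
  ring

end KaluzaKleinFrame

section Lift

variable {E : Type*} [NormedAddCommGroup E] [NormedSpace ℝ E] [FiniteDimensional ℝ E]
  {F : Type*} [NormedAddCommGroup F] [NormedSpace ℝ F] [FiniteDimensional ℝ F] {n : ℕ}

/-- On a line, a smooth `1`-form is locally exact. -/
theorem exists_primitive (w : Module.Basis (Fin 1) ℝ F) {θ : F → F →L[ℝ] ℝ} {W : Set F} (hW : IsOpen W)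
    (hθ : ContDiffOn ℝ ∞ θ W) {s₀ : F} (hs : s₀ ∈ W) :
    ∃ (W' : Set F) (ψ : F → ℝ), IsOpen W' ∧ s₀ ∈ W' ∧ W' ⊆ W ∧ ContDiffOn ℝ ∞ ψ W' ∧ ∀ s ∈ W', fderiv ℝ ψ s = θ s := by
  obtain ⟨r, hr, hrW⟩ := Metric.isOpen_iff.1 hW s₀ hs
  have h1 : ∀ L : F →L[ℝ] F →L[ℝ] ℝ, ∀ x y, L x y = L y x := by
    intro L x y
    rw [← w.sum_repr x, ← w.sum_repr y]
    simp only [Finset.univ_unique, Finset.sum_singleton, map_smul, ContinuousLinearMap.smul_apply]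
    rw [smul_comm]
  obtain ⟨ψ, hψ⟩ := (convex_ball s₀ r).exists_forall_hasFDerivAt_of_fderiv_symmetric Metric.isOpen_ball
    ((hθ.mono hrW).differentiableOn (by simp)) fun a _ => h1 _
  have h2 : ∀ s ∈ Metric.ball s₀ r, fderiv ℝ ψ s = θ s := fun s hs => (hψ s hs).fderiv
  refine ⟨Metric.ball s₀ r, ψ, Metric.isOpen_ball, Metric.mem_ball_self hr, hrW, ?_, h2⟩
  rw [contDiffOn_infty_iff_fderiv_of_isOpen Metric.isOpen_ball]
  exact ⟨fun s hs => (hψ s hs).differentiableAt.differentiableWithinAt, (hθ.mono hrW).congr h2⟩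

variable {a b : ℝ} {g : E → E →L[ℝ] E →L[ℝ] ℝ} {φ : E → ℝ} {A : E → E →L[ℝ] ℝ} {U : Set E} {y₀ : E}
  {Γ : E →L[ℝ] E →L[ℝ] E} {θ : F → F →L[ℝ] ℝ} {W : Set F} {s₀ : F}

/-- The scalar curvature of `e^{aφ} g + e^{bφ} (A - θ)²` on a product with a line. -/
theorem scalAt_lift {ε : Fin n → ℝ} (hε : ∀ i, ε i * ε i = 1) (hU : IsOpen U)
    (hg : ContDiffOn ℝ ∞ g U) (hgs : ∀ z ∈ U, ∀ u v, g z u v = g z v u)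
    (hφ : ContDiffOn ℝ ∞ φ U) (hA : ContDiffOn ℝ ∞ A U) (hy : y₀ ∈ U)
    (c : Module.Basis (Fin n) ℝ E) (hc : ∀ i j, g y₀ (c i) (c j) = if i = j then ε i else 0)
    (hΓ : ∀ u v, Γ u v = Γ v u) (hK : ∀ u v w, g y₀ (Γ u v) w = jetK (fderiv ℝ g y₀) u v w)
    (hW : IsOpen W) (hθ : ContDiffOn ℝ ∞ θ W) (hs : s₀ ∈ W) (w : Module.Basis (Fin 1) ℝ F) (hw : θ s₀ (w 0) = 1)
    {B : E × F → E × F →L[ℝ] E × F →L[ℝ] ℝ}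
    (hB : ∀ z ∈ U ×ˢ W, ∀ u v, B z u v = Real.exp (a * φ z.1) * g z.1 u.1 v.1
      + Real.exp (b * φ z.1) * ((A z.1 u.1 - θ z.2 u.2) * (A z.1 v.1 - θ z.2 v.2)))
    (c' : Module.Basis (Fin (n + 1)) ℝ (E × F)) :
    scalAt c' B (y₀, s₀) = (Real.exp (a * φ y₀))⁻¹ * (scalAt c g y₀
      - (((n : ℝ) - 1) * a + b) *
        ∑ i, ε i * (hessAt φ y₀ (c i) (c i) - fderiv ℝ φ y₀ (Γ (c i) (c i)))
      - ((1 / 4) * a ^ 2 * ((n : ℝ) - 1) * ((n : ℝ) - 2) + (1 / 2) * b ^ 2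
        + (1 / 2) * a * b * ((n : ℝ) - 2)) * ∑ i, ε i * fderiv ℝ φ y₀ (c i) ^ 2)
      - Real.exp (b * φ y₀) * (Real.exp (a * φ y₀) ^ 2)⁻¹ * ∑ j, ε j * ∑ i, ε i *
        ((1 / 2) * (fderiv ℝ A y₀ (c i) (c j) - fderiv ℝ A y₀ (c j) (c i))) ^ 2 := by
  obtain ⟨W', ψ, hW', hs', hWW, hψ, hψθ⟩ := exists_primitive w hW hθ hs
  have hε0 : ∀ i, ε i ≠ 0 := fun i h => by simpa [h] using hε i
  have hdf : ∀ z ∈ U ×ˢ W', HasFDerivAt (fun z : E × F => (z.1, ψ z.2))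
      ((ContinuousLinearMap.fst ℝ E F).prod ((θ z.2).comp (.snd ℝ E F))) z := by
    intro z hz
    have h1 : HasFDerivAt ψ (θ z.2) z.2 := by
      rw [← hψθ z.2 hz.2]
      exact (differentiableAt_of_contDiffOn hψ hW' hz.2).hasFDerivAt
    exact hasFDerivAt_fst.prodMk (h1.comp z hasFDerivAt_snd)
  have hθw : ∀ v : F, θ s₀ v • w 0 = v := by
    intro v
    conv_rhs => rw [← w.sum_repr v]
    conv_lhs => rw [← w.sum_repr v]
    simp [hw]
  let T : F ≃L[ℝ] ℝ := ContinuousLinearEquiv.equivOfInverse (θ s₀)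
    ((ContinuousLinearMap.id ℝ ℝ).smulRight (w 0)) (fun v => by simpa using hθw v) (fun t => by simp [hw])
  let L : (E × F) ≃L[ℝ] E × ℝ := (ContinuousLinearEquiv.refl ℝ E).prodCongr T
  have hd : IsUnit (gramM (c'.map L.toLinearEquiv) (fun u v => kkMetric a b g φ A (y₀, ψ s₀) u v)).det := by
    have he := gram_kkFrame (c := c) (w := Module.Basis.singleton (Fin 1) ℝ) (A := A y₀) (θ := ContinuousLinearMap.id ℝ ℝ)
      (g := fun u v => g y₀ u v) (G := fun u v => kkMetric a b g φ A (y₀, ψ s₀) u v) hc (by simp) (by simp) (by simp)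
      (p := Real.exp (a * φ y₀)) (q := Real.exp (b * φ y₀)) (fun u v => by rw [kkMetric_apply]; rfl)
    exact det_gramM_change (isBilinearMap_clm _) _ _
      (isUnit_det_diagonal (snoc_ne_zero hε0 (Real.exp_ne_zero _) (Real.exp_ne_zero _)) he)
  have h := scalAt_pullback c' (hU.prod hW') (hU.prod isOpen_univ) (f := fun z : E × F => (z.1, ψ z.2))
    (contDiffOn_fst.prodMk (hψ.comp contDiffOn_snd fun z hz => hz.2)) (fun z hz => Set.mk_mem_prod hz.1 (Set.mem_univ (ψ z.2)))
    (contDiffOn_kkMetric (a := a) (b := b) hg hφ hA) (fun z hz u v => by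
      rw [kkMetric_apply, kkMetric_apply, kkComp, kkComp, hgs _ hz.1 u.1 v.1]; ring)
    (B' := B) (fun z hz u v => by
      rw [hB z ⟨hz.1, hWW hz.2⟩, kkMetric_apply, (hdf z hz).fderiv]; rfl) (y := (y₀, s₀)) (Set.mk_mem_prod hy hs') L (by
      rw [(hdf (y₀, s₀) ⟨hy, hs'⟩).fderiv]; rfl) hd
  rw [h, scalAt_kkMetric hε hU hg hgs hφ hA hy c hc (ψ s₀) hΓ hK, Fintype.card_fin]

end Lift

section KaluzaKleinField

variable {E : Type*} [NormedAddCommGroup E] [NormedSpace ℝ E] [FiniteDimensional ℝ E]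
  {F : Type*} [NormedAddCommGroup F] [NormedSpace ℝ F] [FiniteDimensional ℝ F]
  {H : Type*} [TopologicalSpace H] {I : ModelWithCorners ℝ E H} [I.Boundaryless]
  {H' : Type*} [TopologicalSpace H'] {J : ModelWithCorners ℝ F H'} [J.Boundaryless]
  {N : Type*} [TopologicalSpace N] [ChartedSpace H N] [IsManifold I ∞ N]
  {S : Type*} [TopologicalSpace S] [ChartedSpace H' S] [IsManifold J ∞ S] {n : ℕ}

/-- The metric `e^{aφ} g + e^{bφ} (C - α)²` on a product. -/
def IsKaluzaKlein (a b : ℝ) (g : BilinField I N) (φ : N → ℝ) (C : DForm I N 1) (α : DForm J S 1)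
    (G : BilinField (I.prod J) (N × S)) : Prop :=
  ∀ (p : N × S) (u v : E × F), G p u v = Real.exp (a * φ p.1) * g p.1 u.1 v.1 + Real.exp (b * φ p.1) *
    ((oneCLM (E := E) (C p.1) u.1 - oneCLM (E := F) (α p.2) u.2) * (oneCLM (E := E) (C p.1) v.1 - oneCLM (E := F) (α p.2) v.2))

variable {a b : ℝ} {g : BilinField I N} {φ : N → ℝ} {C : DForm I N 1} {α : DForm J S 1}
    {G : BilinField (I.prod J) (N × S)}

theorem metricChart_kaluzaKlein (hG : IsKaluzaKlein a b g φ C α G) {p : N × S} {z : E × F}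
    (hz : z ∈ (extChartAt (I.prod J) p).target) (u v : E × F) : metricChart G p z u v
      = Real.exp (a * φ ((extChartAt I p.1).symm z.1)) * metricChart g p.1 z.1 u.1 v.1
        + Real.exp (b * φ ((extChartAt I p.1).symm z.1)) *
          ((oneCLM (formInChart C p.1 z.1) u.1 - oneCLM (formInChart α p.2 z.2) u.2)
            * (oneCLM (formInChart C p.1 z.1) v.1 - oneCLM (formInChart α p.2 z.2) v.2)) := by
  rw [metricChart_apply, extChartAt_prod_symm, hG, fst_chartInv hz, fst_chartInv hz, snd_chartInv hz, snd_chartInv hz]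
  rfl

theorem contDiffOn_oneCLM {E' : Type*} [NormedAddCommGroup E'] [NormedSpace ℝ E'] {U : Set E'}
    {ξ : E' → E [⋀^Fin 1]→L[ℝ] ℝ} (h : ContDiffOn ℝ ∞ ξ U) : ContDiffOn ℝ ∞ (fun y => oneCLM (ξ y)) U :=
  contDiffOn_clm_apply.2 fun v => contDiffOn_form_apply h fun _ => v

/-- A basis of a line on which a given nonzero functional is `1`. -/
theorem exists_basis_one (c : Module.Basis (Fin 1) ℝ F) {θ : F →L[ℝ] ℝ} (h : θ (c 0) ≠ 0) :
    ∃ w : Module.Basis (Fin 1) ℝ F, θ (w 0) = 1 :=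
  ⟨c.unitsSMul fun _ => (Units.mk0 _ h)⁻¹, by
    simp [Module.Basis.unitsSMul_apply, Units.smul_def, h]⟩

theorem exists_lorentz_frame {g : LinearMap.BilinForm ℝ E} {e : Module.Basis (Fin n) ℝ E} {t : Fin n}
    (he : ∀ i j, g (e i) (e j) = if i = j then (if i = t then -1 else 1) else 0) {A : E →L[ℝ] ℝ} {θ : F →L[ℝ] ℝ}
    (c : Module.Basis (Fin 1) ℝ F) (hθ : θ (c 0) ≠ 0) {p q : ℝ} (hp : 0 < p) (hq : 0 < q)
    {G : LinearMap.BilinForm ℝ (E × F)}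
    (hG : ∀ u v, G u v = p * g u.1 v.1 + q * ((A u.1 - θ u.2) * (A v.1 - θ v.2))) :
    ∃ (e' : Module.Basis (Fin (n + 1)) ℝ (E × F)) (t' : Fin (n + 1)),
      ∀ i j, G (e' i) (e' j) = if i = j then (if i = t' then -1 else 1) else 0 := by
  obtain ⟨w, hw⟩ := exists_basis_one c hθ
  set d : Fin (n + 1) → ℝ := Fin.snoc (α := fun _ => ℝ) (fun i => p * (if i = t then -1 else 1)) q with hd
  have hgr : ∀ i j, G (kkFrame e w A i) (kkFrame e w A j) = if i = j then d i else 0 :=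
    gram_kkFrame (g := fun u v => g u v) (G := fun u v => G u v) he hw (by simp) (by simp) hG
  have hd0 : ∀ i, d i ≠ 0 := snoc_ne_zero (fun i => by split_ifs <;> norm_num) hp.ne' hq.ne'
  have hd1 : ∀ i, d i / |d i| = if i = t.castSucc then -1 else 1 := by
    intro i
    refine Fin.lastCases ?_ (fun i => ?_) i
    · have : Fin.last n ≠ t.castSucc := (Fin.castSucc_ne_last t).symm
      simp [hd, this, abs_of_pos hq, hq.ne']
    · by_cases h : i = t
      · simp [hd, h, neg_div, hp.ne', abs_of_pos hp]
      · simp [hd, h, hp.ne', abs_of_pos hp]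
  refine ⟨(kkFrame e w A).unitsSMul fun i =>
    Units.mk0 (Real.sqrt |d i|)⁻¹ (inv_ne_zero (Real.sqrt_ne_zero'.2 (abs_pos.2 (hd0 i)))), t.castSucc, fun i j => ?_⟩
  simp only [Module.Basis.unitsSMul_apply, Units.smul_def, Units.val_mk0, map_smul, LinearMap.smul_apply, smul_eq_mul, hgr]
  by_cases hij : i = j
  · subst hij
    rw [if_pos rfl, if_pos rfl, ← hd1]
    have h1 : Real.sqrt |d i| * Real.sqrt |d i| = |d i| := Real.mul_self_sqrt (abs_nonneg _)
    rw [← mul_assoc, ← mul_inv, h1, div_eq_inv_mul]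
  · rw [if_neg hij, if_neg hij, mul_zero, mul_zero]

theorem isLorentzMetric_kaluzaKlein {bN : Module.Basis (Fin n) ℝ E} (hg : IsLorentzMetric bN g)
    (hφ : ContMDiff I 𝓘(ℝ, ℝ) ∞ φ) (hC : IsSmoothForm C) (hα : IsSmoothForm α) (c : Module.Basis (Fin 1) ℝ F)
    (hα0 : ∀ z, oneCLM (E := F) (α z) (c 0) ≠ 0) (hG : IsKaluzaKlein a b g φ C α G)
    (bb : Module.Basis (Fin (n + 1)) ℝ (E × F)) : IsLorentzMetric bb G where
  smooth := by
    intro p i j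
    have hm : ∀ z ∈ (extChartAt (I.prod J) p).target, z.1 ∈ (extChartAt I p.1).target ∧ z.2 ∈ (extChartAt J p.2).target :=
      fun z hz => mem_target_prod hz
    have h1 : ∀ r : ℝ, ContDiffOn ℝ ∞ (fun z : E × F => Real.exp (r * φ ((extChartAt I p.1).symm z.1)))
        (extChartAt (I.prod J) p).target := fun r =>
      (contDiffOn_exp_mul (contDiffOn_function hφ p.1) r).comp contDiffOn_fst fun z hz => (hm z hz).1
    have h2 : ContDiffOn ℝ ∞ (fun z : E × F => metricChart g p.1 z.1 (bb i).1 (bb j).1)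
        (extChartAt (I.prod J) p).target :=
      (((contDiffOn_metricChart hg.smooth p.1).comp contDiffOn_fst fun z hz => (hm z hz).1).clm_apply
        contDiffOn_const).clm_apply contDiffOn_const
    have h3 : ∀ i, ContDiffOn ℝ ∞ (fun z : E × F => oneCLM (formInChart C p.1 z.1) (bb i).1
        - oneCLM (formInChart α p.2 z.2) (bb i).2) (extChartAt (I.prod J) p).target := fun i =>
      (((contDiffOn_oneCLM (hC p.1)).comp contDiffOn_fst fun z hz => (hm z hz).1).clm_apply contDiffOn_const).sub
      (((contDiffOn_oneCLM (hα p.2)).comp contDiffOn_snd fun z hz => (hm z hz).2).clm_apply contDiffOn_const)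
    exact (((h1 a).mul h2).add ((h1 b).mul ((h3 i).mul (h3 j)))).congr fun z hz => metricChart_kaluzaKlein hG hz _ _
  symm p u v := by
    rw [hG p u v, hG p v u, hg.symm p.1 u.1 v.1]
    ring
  signature p := by
    obtain ⟨e, t, he⟩ := hg.signature p.1
    exact exists_lorentz_frame (E := E) (F := F) (g := g p.1) (e := e) (t := t) he c (hα0 p.2) (Real.exp_pos (a * φ p.1))
      (Real.exp_pos (b * φ p.1)) (G := G p) (A := oneCLM (E := E) (C p.1)) (hG p)

theorem det_gram_line (c : Module.Basis (Fin 1) ℝ F) (g : LinearMap.BilinForm ℝ F) : (gram c g).det = g (c 0) (c 0) := by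
  rw [Matrix.det_fin_one]; rfl

theorem volAt_line {g : LinearMap.BilinForm ℝ F} {c : Module.Basis (Fin 1) ℝ F} (hg : 0 < g (c 0) (c 0))
    {τ : F [⋀^Fin 1]→L[ℝ] ℝ} (hτ : τ ≠ 0) : (∃ r : ℝ, 0 < r ∧ volAt c g τ = r • τ) ∧
      oneCLM (volAt c g τ) (c 0) ≠ 0 ∧ ∀ u v : F, g u v = oneCLM (volAt c g τ) u * oneCLM (volAt c g τ) v := by
  have hτc : τ c ≠ 0 := fun h => hτ (topForm_eq_zero c h)
  have hr : 0 < Real.sqrt |g (c 0) (c 0)| / |τ c| :=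
    div_pos (Real.sqrt_pos.2 (abs_pos.2 hg.ne')) (abs_pos.2 hτc)
  have h0 : oneCLM τ (c 0) = τ c := by
    rw [oneCLM_apply]
    congr 1
    funext i
    rw [Subsingleton.elim i 0]
  have h1 : oneCLM (volAt c g τ) (c 0) = Real.sqrt |g (c 0) (c 0)| / |τ c| * τ c := by
    rw [volAt, det_gram_line, ← h0]; rfl
  refine ⟨⟨_, hr, by rw [volAt, det_gram_line]⟩, ?_, fun u v => ?_⟩
  · rw [h1]
    exact mul_ne_zero hr.ne' hτc
  · have h2 : oneCLM (volAt c g τ) (c 0) * oneCLM (volAt c g τ) (c 0) = g (c 0) (c 0) := by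
      have h3 : Real.sqrt |g (c 0) (c 0)| ^ 2 = g (c 0) (c 0) := by
        rw [Real.sq_sqrt (abs_nonneg _), abs_of_pos hg]
      have h4 : |τ c| ^ 2 = τ c ^ 2 := sq_abs _
      rw [h1]
      have : |τ c| ≠ 0 := abs_ne_zero.2 hτc
      field_simp
      rw [h3, h4, mul_comm]
    rw [← c.sum_repr u, ← c.sum_repr v]
    simp only [Finset.univ_unique, Finset.sum_singleton, map_smul, LinearMap.smul_apply, smul_eq_mul, Fin.default_eq_zero]
    rw [← h2]
    ring

/-- The volume form of a Riemannian metric on an oriented line. -/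
theorem volForm_line {gS : BilinField J S} {c : Module.Basis (Fin 1) ℝ F} (hgS : IsRiemannianMetric c gS) {τ : DForm J S 1}
    (hτ : IsOrientationForm τ) (z : S) : (∃ r : ℝ, 0 < r ∧ volForm c τ gS z = r • τ z) ∧
      oneCLM (E := F) (volForm c τ gS z) (c 0) ≠ 0 ∧
      ∀ u v : F, gS z u v = oneCLM (E := F) (volForm c τ gS z) u * oneCLM (E := F) (volForm c τ gS z) v :=
  volAt_line (F := F) (g := gS z) (τ := τ z) (hgS.pos z (c 0) (c.ne_zero 0)) (hτ.ne_zero z)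

theorem isSmoothForm_volForm_line {gS : BilinField J S} {c : Module.Basis (Fin 1) ℝ F} (hgS : IsRiemannianMetric c gS) {τ : DForm J S 1}
    (hτ : IsOrientationForm τ) : IsSmoothForm (volForm c τ gS) := fun x₀ =>
  (contDiffOn_volAt c (contDiffOn_metricChart hgS.smooth x₀)
    (fun y hy => by
      rw [det_gram_line]
      have h : chartInv J x₀ y (c 0) ≠ 0 := fun h =>
        c.ne_zero 0 ((chartEquiv J x₀ y hy).map_eq_zero_iff.1 h)
      exact (hgS.pos _ _ h).ne') (hτ.smooth x₀)
    fun _ hy => isOrientation_ne_zero hτ c hy).congr fun _ hy => formInChart_volForm c gS τ hy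

end KaluzaKleinField

section KaluzaKleinReduction

variable {E : Type*} [NormedAddCommGroup E] [NormedSpace ℝ E] [FiniteDimensional ℝ E]
  {F : Type*} [NormedAddCommGroup F] [NormedSpace ℝ F] [FiniteDimensional ℝ F]
  {H : Type*} [TopologicalSpace H] {I : ModelWithCorners ℝ E H} [I.Boundaryless]
  {H' : Type*} [TopologicalSpace H'] {J : ModelWithCorners ℝ F H'} [J.Boundaryless]
  {N : Type*} [TopologicalSpace N] [ChartedSpace H N] [IsManifold I ∞ N]
  {S : Type*} [TopologicalSpace S] [ChartedSpace H' S] [IsManifold J ∞ S] {n : ℕ}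

theorem innerAt_two_orthonormal {V : Type*} [AddCommGroup V] [Module ℝ V] [TopologicalSpace V]
    {c : Module.Basis (Fin n) ℝ V} {g : LinearMap.BilinForm ℝ V} {ε : Fin n → ℝ} (hε : ∀ i, ε i * ε i = 1)
    (hc : ∀ i j, g (c i) (c j) = if i = j then ε i else 0) (b : Module.Basis (Fin n) ℝ V) (F : V [⋀^Fin 2]→L[ℝ] ℝ) :
    innerAt b g F F = (1 / 2) * ∑ i, ε i * ∑ j, ε j * F ![c i, c j] ^ 2 := by
  have hε0 : ∀ i, ε i ≠ 0 := fun i h => by simpa [h] using hε i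
  have hinv : ∀ i, (ε i)⁻¹ = ε i := fun i => inv_eq_of_mul_eq_one_left (hε i)
  rw [innerAt_basis c b g (by rw [gram_eq_gramM]; exact isUnit_det_diagonal (g := fun u v => g u v) hε0 hc),
    innerAt_two_diagonal hε0 hc]
  simp only [hinv]

theorem innerAt_one_orthonormal {V : Type*} [AddCommGroup V] [Module ℝ V] [TopologicalSpace V]
    {c : Module.Basis (Fin n) ℝ V} {g : LinearMap.BilinForm ℝ V} {ε : Fin n → ℝ} (hε : ∀ i, ε i * ε i = 1)
    (hc : ∀ i j, g (c i) (c j) = if i = j then ε i else 0) (b : Module.Basis (Fin n) ℝ V) (F : V [⋀^Fin 1]→L[ℝ] ℝ) :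
    innerAt b g F F = ∑ i, ε i * F (fun _ => c i) ^ 2 := by
  have hε0 : ∀ i, ε i ≠ 0 := fun i h => by simpa [h] using hε i
  have hinv : ∀ i, (ε i)⁻¹ = ε i := fun i => inv_eq_of_mul_eq_one_left (hε i)
  rw [innerAt_basis c b g (by rw [gram_eq_gramM]; exact isUnit_det_diagonal (g := fun u v => g u v) hε0 hc),
    innerAt_one_diagonal hε0 hc]
  simp only [hinv]

theorem extDeriv_oneForm {ξ : E → E [⋀^Fin 1]→L[ℝ] ℝ} {y : E} (h : DifferentiableAt ℝ ξ y) (u v : E) :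
    extDeriv ξ y ![u, v] = fderiv ℝ (fun z => oneCLM (ξ z)) y u v - fderiv ℝ (fun z => oneCLM (ξ z)) y v u := by
  have h1 : DifferentiableAt ℝ (fun z => oneCLM (ξ z)) y :=
    ((ContinuousAlternatingMap.ofSubsingletonLIE (𝕜 := ℝ) (E := E) (F := ℝ) (0 : Fin 1)).symm.toContinuousLinearEquiv.differentiableAt).comp y h
  have h2 : ∀ s t, fderiv ℝ (fun z => oneCLM (ξ z)) y s t = fderiv ℝ ξ y s (fun _ => t) := by
    intro s t
    rw [← fderiv_form_apply h]
    have := fderiv_clm_apply (c := fun z => oneCLM (ξ z)) (u := fun _ => t) h1 (differentiableAt_const t)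
    have h3 : fderiv ℝ (fun z => oneCLM (ξ z) t) y s = fderiv ℝ (fun z => oneCLM (ξ z)) y s t := by
      rw [this]; simp
    rw [← h3]; rfl
  rw [h2, h2, extDeriv_apply h, Fin.sum_univ_two]
  have e0 : (0 : Fin 2).removeNth ![u, v] = fun _ => v := by
    funext i; rw [Subsingleton.elim i 0]; rfl
  have e1 : (1 : Fin 2).removeNth ![u, v] = fun _ => u := by
    funext i; rw [Subsingleton.elim i 0]; rfl
  rw [e0, e1, fderiv_form_apply h, fderiv_form_apply h]
  simp [sub_eq_add_neg]

variable {a b : ℝ} {g : BilinField I N} {φ : N → ℝ} {C : DForm I N 1} {α : DForm J S 1}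
    {G : BilinField (I.prod J) (N × S)}

/-- The scalar curvature of a Kaluza-Klein metric, in an orthonormal frame of the base. -/
theorem scalarCurvature_kaluzaKlein {bN : Module.Basis (Fin n) ℝ E} (hg : IsLorentzMetric bN g)
    (hφ : ContMDiff I 𝓘(ℝ, ℝ) ∞ φ) (hC : IsSmoothForm C) (hα : IsSmoothForm α)
    (hG : IsKaluzaKlein a b g φ C α G) {bb : Module.Basis (Fin (n + 1)) ℝ (E × F)} (hGL : IsLorentzMetric bb G)
    (p : N × S) {w : Module.Basis (Fin 1) ℝ F} (hw : oneCLM (E := F) (α p.2) (w 0) = 1) {ε : Fin n → ℝ} (hε : ∀ i, ε i * ε i = 1)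
    (c : Module.Basis (Fin n) ℝ E) (hc : ∀ i j, g p.1 (c i) (c j) = if i = j then ε i else 0)
    {Γ : E →L[ℝ] E →L[ℝ] E} (hΓ : Γ = christoffelMap ε c (fderiv ℝ (metricChart g p.1) (extChartAt I p.1 p.1)))
    {f : E → ℝ} (hf : f = fun y => φ ((extChartAt I p.1).symm y)) {y : E} (hy : y = extChartAt I p.1 p.1) :
    scalarCurvature bb G p = (Real.exp (a * φ p.1))⁻¹ * (scalarCurvature bN g p.1
      - (((n : ℝ) - 1) * a + b) * ∑ i, ε i * (hessAt f y (c i) (c i) - fderiv ℝ f y (Γ (c i) (c i)))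
      - ((1 / 4) * a ^ 2 * ((n : ℝ) - 1) * ((n : ℝ) - 2) + (1 / 2) * b ^ 2
        + (1 / 2) * a * b * ((n : ℝ) - 2)) * ∑ i, ε i * fderiv ℝ f y (c i) ^ 2)
      - Real.exp (b * φ p.1) * (Real.exp (a * φ p.1) ^ 2)⁻¹ * ((1 / 2) * normSq bN g (extD C) p.1) := by
  have hym : y ∈ (extChartAt I p.1).target := hy ▸ mem_extChartAt_target p.1
  have hsm : ∀ z ∈ (extChartAt I p.1).target, ∀ u v, metricChart g p.1 z u v = metricChart g p.1 z v u :=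
    fun z _ u v => metricChart_symm hg.symm p.1 z u v
  have hms := contDiffOn_metricChart hg.smooth p.1
  have hcc : ∀ i j, metricChart g p.1 y (c i) (c j) = if i = j then ε i else 0 := fun i j => by
    rw [hy, metricChart_self]; exact hc i j
  have hε0 : ∀ i, ε i ≠ 0 := fun i h => by simpa [h] using hε i
  have hop := isOpen_extChartAt_target (I := I) p.1
  have hfy : f y = φ p.1 := by
    rw [hf, hy]
    exact congrArg φ (extChartAt_to_inv p.1)
  have h := scalAt_lift (a := a) (b := b) (φ := f) (A := fun z => oneCLM (formInChart C p.1 z)) (g := metricChart g p.1)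
    (θ := fun s => oneCLM (formInChart α p.2 s)) (s₀ := extChartAt J p.2 p.2) (Γ := Γ) (B := metricChart G p)
    hε hop hms hsm (hf ▸ contDiffOn_function hφ p.1) (contDiffOn_oneCLM (hC p.1)) hym c hcc
    (fun u v => hΓ ▸ christoffelMap_symm (fun s u v => by
      rw [← hy]; exact fderiv_symm_apply hop hms hsm hym s u v) u v)
    (fun u v w => by
      rw [hΓ, apply_christoffelMap hε c hcc, hy])
    (isOpen_extChartAt_target (I := J) p.2) (contDiffOn_oneCLM (hα p.2)) (mem_extChartAt_target p.2) w
    (by rw [formInChart_self]; exact hw) (fun z hz u v => by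
      rw [hf]
      exact metricChart_kaluzaKlein hG (by rw [extChartAt_prod, PartialEquiv.prod_target]; exact hz) u v) bb
  have hscal : scalAt c (metricChart g p.1) y = scalarCurvature bN g p.1 := by
    rw [scalarCurvature_eq_self hg, hy]
    exact (scalAt_basis c bN _ _ (isUnit_det_diagonal hε0 (hy ▸ hcc))).symm
  have hnorm : normSq bN g (extD C) p.1 = (1 / 2) * ∑ j, ε j * ∑ i, ε i *
      (fderiv ℝ (fun z => oneCLM (formInChart C p.1 z)) y (c i) (c j) - fderiv ℝ (fun z => oneCLM (formInChart C p.1 z)) y (c j) (c i)) ^ 2 := by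
    have h1 : normSq bN g (extD C) p.1 = _ := innerAt_two_orthonormal (V := E) (g := g p.1) hε hc bN (extD C p.1)
    rw [h1]
    congr 1
    refine Finset.sum_congr rfl fun j _ => ?_
    congr 1
    refine Finset.sum_congr rfl fun i _ => ?_
    have h2 := extDeriv_oneForm (differentiableAt_of_contDiffOn (hC p.1) hop hym) (c j) (c i)
    have h3 : extD C p.1 = extDeriv (formInChart C p.1) y := hy ▸ extD_self C p.1
    have h4 : extD C p.1 ![c j, c i] = extDeriv (formInChart C p.1) y ![c j, c i] :=
      congrArg (fun F : E [⋀^Fin 2]→L[ℝ] ℝ => F ![c j, c i]) h3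
    refine congrArg (ε i * ·) ?_
    refine (congrArg (· ^ 2) (h4.trans h2)).trans ?_
    ring
  rw [scalarCurvature_eq_self hGL, extChartAt_prod_self, ← hy, h, hscal, hnorm, hfy]
  congr 2
  simp only [Finset.mul_sum]
  refine Finset.sum_congr rfl fun j _ => Finset.sum_congr rfl fun i _ => ?_
  ring

theorem wedge_pull_apply {k l : ℕ} (ξ : DForm I N k) (η : DForm J S l) (p : N × S) :
    wedge (pullFst S J ξ) (pullSnd N I η) p
      = wedgeAt (V := E × F) ((ξ p.1 : E [⋀^Fin k]→L[ℝ] ℝ).compContinuousLinearMap (ContinuousLinearMap.fst ℝ E F))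
        ((η p.2 : F [⋀^Fin l]→L[ℝ] ℝ).compContinuousLinearMap (ContinuousLinearMap.snd ℝ E F)) :=
  congrArg₂ wedgeAt (pullFst_apply ξ p) (pullSnd_apply η p)

/-- `|X + Y ∧ α|²` for a Kaluza-Klein metric. -/
theorem normSq_kaluzaKlein {bN : Module.Basis (Fin n) ℝ E} (hg : IsLorentzMetric bN g)
    (hG : IsKaluzaKlein a b g φ C α G) (bb : Module.Basis (Fin (n + 1)) ℝ (E × F))
    (p : N × S) {w : Module.Basis (Fin 1) ℝ F} (hw : oneCLM (E := F) (α p.2) (w 0) = 1)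
    {k : ℕ} {X : DForm I N (k + 1)} {Y : DForm I N k} {Z : DForm (I.prod J) (N × S) (k + 1)}
    (hZ : Z = liftForm Y X α) : normSq bb G Z p = (Real.exp (a * φ p.1) ^ (k + 1))⁻¹ * normSq bN g (X + wedge Y C) p.1
      + (Real.exp (b * φ p.1))⁻¹ * (Real.exp (a * φ p.1) ^ k)⁻¹ * normSq bN g Y p.1 := by
  obtain ⟨c, t, hc⟩ := hg.signature p.1
  have hd : ∀ i : Fin n, (if i = t then (-1 : ℝ) else 1) ≠ 0 := fun i => by split_ifs <;> norm_num
  have h := innerAt_kkFrame (E := E) (F := F) (w := w) hd (g := g p.1) (c := c) hc (θ := α p.2) (C := C p.1) hw (G := G p)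
    (Real.exp_ne_zero _) (Real.exp_ne_zero _) (hG p) (X p.1) (Y p.1) bb (Z := Z p) (by
      subst hZ
      exact congrArg₂ (· + ·) (pullFst_apply X p) (wedge_pull_apply Y α p))
  have hgr : IsUnit (gram (V := E) c (g p.1)).det :=
    isUnit_det_diagonal (V := E) (g := fun u v : E => g p.1 u v) hd hc
  refine h.trans ?_
  exact congrArg₂ (fun x y => (Real.exp (a * φ p.1) ^ (k + 1))⁻¹ * x + (Real.exp (b * φ p.1))⁻¹ * (Real.exp (a * φ p.1) ^ k)⁻¹ * y)
    (innerAt_basis (V := E) c bN (g p.1) hgr (X p.1 + wedgeAt (Y p.1) (C p.1)) (X p.1 + wedgeAt (Y p.1) (C p.1))).symm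
    (innerAt_basis (V := E) c bN (g p.1) hgr (Y p.1) (Y p.1)).symm

theorem volForm_kaluzaKlein [MeasurableSpace E] [BorelSpace E] [MeasurableSpace F] [BorelSpace F] {bN : Module.Basis (Fin n) ℝ E} (hg : IsLorentzMetric bN g)
    (hG : IsKaluzaKlein a b g φ C α G) {bS : Module.Basis (Fin 1) ℝ F} {bb : Module.Basis (Fin (n + 1)) ℝ (E × F)}
    (hbb : bb = prodBasis bN bS)
    (p : N × S) {w : Module.Basis (Fin 1) ℝ F} (hw : oneCLM (E := F) (α p.2) (w 0) = 1) {τ : DForm I N n} {σ : DForm J S 1}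
    (hα : ∃ r : ℝ, 0 < r ∧ α p.2 = r • σ p.2) {τM : DForm (I.prod J) (N × S) (n + 1)}
    (hτM : τM = wedge (pullFst S J τ) (pullSnd N I σ)) :
    formRatio bb τM (volForm bb τM G) p = Real.sqrt (Real.exp (a * φ p.1) ^ n * Real.exp (b * φ p.1)) *
      formRatio bN τ (volForm bN τ g) p.1 * formRatio bS σ α p.2 := by
  obtain ⟨c, t, hc⟩ := hg.signature p.1
  obtain ⟨r, hr, hr'⟩ := hα
  have h := volAt_kkFrame (E := E) (F := F) (w := w) (g := g p.1) (c := c) hc (θ := α p.2) (C := C p.1) hw hr (τS := σ p.2) hr' (G := G p)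
    (τ := τ p.1) (Real.exp_pos _) (Real.exp_pos _) (hG p) bN bb
  subst hτM hbb
  have h1 : volForm (prodBasis bN bS) (wedge (pullFst S J τ) (pullSnd N I σ)) G p
      = Real.sqrt (Real.exp (a * φ p.1) ^ n * Real.exp (b * φ p.1)) •
        wedge (pullFst S J (volForm bN τ g)) (pullSnd N I α) p := by
    rw [wedge_pull_apply (volForm bN τ g)]
    refine Eq.trans ?_ h
    exact congrArg (volAt (V := E × F) (prodBasis bN bS) (G p)) (wedge_pull_apply τ σ p)
  have h2 := formRatio_wedge (b := bN) (c := bS) τ (volForm bN τ g) σ α p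
  rw [mul_assoc, ← h2]
  unfold formRatio
  rw [h1]
  exact mul_div_assoc _ _ _

end KaluzaKleinReduction

section EinsteinMaxwell

variable {E : Type*} [NormedAddCommGroup E] [NormedSpace ℝ E] [FiniteDimensional ℝ E]
  {F : Type*} [NormedAddCommGroup F] [NormedSpace ℝ F] [FiniteDimensional ℝ F]
  {H : Type*} [TopologicalSpace H] {I : ModelWithCorners ℝ E H} [I.Boundaryless]
  {H' : Type*} [TopologicalSpace H'] {J : ModelWithCorners ℝ F H'} [J.Boundaryless]
  {N : Type*} [TopologicalSpace N] [ChartedSpace H N] [IsManifold I ∞ N]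
  {S : Type*} [TopologicalSpace S] [ChartedSpace H' S] [IsManifold J ∞ S] {n m q : ℕ}
  {a b : ℝ} {g : BilinField I N} {φ : N → ℝ} {C₁ : DForm I N 1} {α : DForm J S 1}
    {G : BilinField (I.prod J) (N × S)}

theorem normSq_dFun {bN : Module.Basis (Fin n) ℝ E} {φ : N → ℝ} (hφ : ContMDiff I 𝓘(ℝ, ℝ) ∞ φ) {x : N}
    {c : Module.Basis (Fin n) ℝ E} {ε : Fin n → ℝ} (hε : ∀ i, ε i * ε i = 1)
    (hc : ∀ i j, g x (c i) (c j) = if i = j then ε i else 0) {f : E → ℝ}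
    (hf : f = fun y => φ ((extChartAt I x).symm y)) {y : E} (hy : y = extChartAt I x x) :
    normSq bN g (dFun φ) x = ∑ i, ε i * fderiv ℝ f y (c i) ^ 2 := by
  have h1 : (dFun φ : DForm I N 1) x = gradForm f y := by
    rw [hf, hy]
    exact (formInChart_self (dFun φ : DForm I N 1) x).symm.trans (formInChart_dFun hφ (mem_extChartAt_target x))
  have h2 : normSq bN g (dFun φ) x = _ := innerAt_one_orthonormal (V := E) (g := g x) hε hc bN (dFun φ x)
  rw [h2]
  refine Finset.sum_congr rfl fun i _ => congrArg (fun t => ε i * t ^ 2) ?_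
  exact congrArg (fun F : E [⋀^Fin 1]→L[ℝ] ℝ => F fun _ => c i) h1

theorem extD_flux {bN : Module.Basis (Fin (m + 1)) ℝ E} (hg : IsLorentzMetric bN g)
    (hφ : ContMDiff I 𝓘(ℝ, ℝ) ∞ φ) {τ : DForm I N (m + 1)} (hτ : IsOrientationForm τ) {x : N}
    {c : Module.Basis (Fin (m + 1)) ℝ E} {ε : Fin (m + 1) → ℝ} (hε : ∀ i, ε i * ε i = 1)
    (hc : ∀ i j, g x (c i) (c j) = if i = j then ε i else 0) {f : E → ℝ}
    (hf : f = fun y => φ ((extChartAt I x).symm y)) {y : E} (hy : y = extChartAt I x x)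
    {Φ : DForm I N m} (hΦ : ∀ z ∈ (extChartAt I x).target,
      formInChart Φ x z = fluxField bN (metricChart g x) f (formInChart τ x) z) :
    extD Φ x = (Real.exp (-2 * φ x) *
      (∑ i, ε i * (hessAt f y (c i) (c i) - fderiv ℝ f y (christoffelMap ε c (fderiv ℝ (metricChart g x) y) (c i) (c i)))
        - 2 * ∑ i, ε i * fderiv ℝ f y (c i) ^ 2)) • volForm bN τ g x := by
  have hym : y ∈ (extChartAt I x).target := hy ▸ mem_extChartAt_target x
  have hop := isOpen_extChartAt_target (I := I) x
  have h := extDeriv_fluxField (B := metricChart g x) (φ := f) (τ := formInChart τ x) hε bN c hop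
    (contDiffOn_metricChart hg.smooth x) (fun z _ u v => metricChart_symm hg.symm x z u v)
    (fun z hz => (det_metricChart hg bN hz).ne_zero) (hτ.smooth x)
    (fun z hz h => isOrientation_ne_zero hτ bN hz (by rw [h]; rfl)) (hf ▸ contDiffOn_function hφ x) hym
    (fun i j => by rw [hy, metricChart_self]; exact hc i j)
  have hfy : f y = φ x := by
    rw [hf, hy]
    exact congrArg φ (extChartAt_to_inv x)
  have hv : volAt bN (bilinOf (metricChart g x y)) (formInChart τ x y) = volForm bN τ g x := by
    rw [← formInChart_volForm bN g τ hym, hy]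
    exact formInChart_self (volForm bN τ g) x
  have h1 : extDeriv (formInChart Φ x) y = extDeriv (fluxField bN (metricChart g x) f (formInChart τ x)) y :=
    Filter.EventuallyEq.extDeriv_eq (Filter.eventuallyEq_of_mem (hop.mem_nhds hym) hΦ)
  have h2 : extD Φ x = extDeriv (formInChart Φ x) y := hy ▸ extD_self Φ x
  rw [hfy] at h
  exact (h2.trans h1).trans (h.trans (congrArg _ hv))

variable [MeasurableSpace E] [BorelSpace E] [MeasurableSpace F] [BorelSpace F]

theorem formRatio_fun_smul (b : Module.Basis (Fin n) ℝ E) (τ ξ : DForm I N n) (f : N → ℝ) (x : N) :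
    formRatio b τ (fun x => f x • ξ x) x = f x * formRatio b τ ξ x :=
  mul_div_assoc _ _ _

theorem kaluzaKlein_exponents (u R D P F2 H2 G2 V A : ℝ) {n q : ℕ} (hn : (n : ℝ) = 10) (hq : (q : ℝ) = 2) :
    ((Real.exp ((-2 / 3) * u))⁻¹ * (R - (((n : ℝ) - 1) * (-2 / 3) + 4 / 3) * D
        - ((1 / 4) * (-2 / 3) ^ 2 * ((n : ℝ) - 1) * ((n : ℝ) - 2) + (1 / 2) * (4 / 3) ^ 2
          + (1 / 2) * (-2 / 3) * (4 / 3) * ((n : ℝ) - 2)) * P)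
        - Real.exp ((4 / 3) * u) * (Real.exp ((-2 / 3) * u) ^ 2)⁻¹ * ((1 / 2) * F2)
      - (1 / 2) * ((Real.exp ((-2 / 3) * u) ^ (q + 1 + 1))⁻¹ * G2
        + (Real.exp ((4 / 3) * u))⁻¹ * (Real.exp ((-2 / 3) * u) ^ (q + 1))⁻¹ * H2))
      * (Real.sqrt (Real.exp ((-2 / 3) * u) ^ n * Real.exp ((4 / 3) * u)) * V * A)
    = ((Real.exp (-2 * u) * (R + 4 * P - (1 / 2) * H2)) * V - (1 / 2) * ((F2 + G2) * V)
      + (14 / 3) * ((Real.exp (-2 * u) * (D - 2 * P)) * V)) * A := by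
  obtain rfl : n = 10 := by exact_mod_cast hn
  obtain rfl : q = 2 := by exact_mod_cast hq
  have h1 : Real.exp ((-2 / 3) * u) = (Real.exp ((2 / 3) * u))⁻¹ := by
    rw [← Real.exp_neg]; congr 1; ring
  have h2 : Real.exp ((4 / 3) * u) = Real.exp ((2 / 3) * u) ^ 2 := by
    rw [← Real.exp_nat_mul]; congr 1; push_cast; ring
  have h3 : Real.exp (-2 * u) = (Real.exp ((2 / 3) * u) ^ 3)⁻¹ := by
    rw [← Real.exp_nat_mul, ← Real.exp_neg]; congr 1; push_cast; ring
  rw [h1, h2, h3]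
  have ht := Real.exp_pos ((2 / 3) * u)
  set t := Real.exp ((2 / 3) * u)
  have h4 : Real.sqrt (t⁻¹ ^ 10 * t ^ 2) = (t ^ 4)⁻¹ := by
    rw [show t⁻¹ ^ 10 * t ^ 2 = ((t ^ 4)⁻¹) ^ 2 by field_simp, Real.sqrt_sq (by positivity)]
  rw [h4]
  push_cast
  field_simp
  ring

/-- The reduction of the Einstein-Maxwell density. -/
theorem formRatio_einsteinMaxwell {bN : Module.Basis (Fin (m + 1)) ℝ E} (hm : ((m + 1 : ℕ) : ℝ) = 10) (hq : (q : ℝ) = 2)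
    (hg : IsLorentzMetric bN g)
    (hφ : ContMDiff I 𝓘(ℝ, ℝ) ∞ φ) {τ : DForm I N (m + 1)} (hτ : IsOrientationForm τ)
    {Φ : DForm I N m} (hΦ : ∀ x, ∀ z ∈ (extChartAt I x).target, formInChart Φ x z
      = fluxField bN (metricChart g x) (fun y => φ ((extChartAt I x).symm y)) (formInChart τ x) z)
    (hC₁ : IsSmoothForm C₁) {B : DForm I N q} (hB : IsSmoothForm B) {C : DForm I N (q + 1)}
    (hC : IsSmoothForm C) (hα : IsSmoothForm α) (h0 : extD α = 0)
    (hG : IsKaluzaKlein (-2 / 3) (4 / 3) g φ C₁ α G) {bS : Module.Basis (Fin 1) ℝ F}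
    {bb : Module.Basis (Fin (m + 1 + 1)) ℝ (E × F)} (hbb : bb = prodBasis bN bS) (hGL : IsLorentzMetric bb G)
    {σ : DForm J S 1} (hα0 : ∀ z, (∃ r : ℝ, 0 < r ∧ α z = r • σ z) ∧ oneCLM (E := F) (α z) (bS 0) ≠ 0)
    {τM : DForm (I.prod J) (N × S) (m + 1 + 1)} (hτM : τM = wedge (pullFst S J τ) (pullSnd N I σ)) (p : N × S) :
    (scalarCurvature bb G p - (1 / 2) * normSq bb G (extD (liftForm B C α)) p) * formRatio bb τM (volForm bb τM G) p
      = ((Real.exp (-2 * φ p.1) * (scalarCurvature bN g p.1 + 4 * normSq bN g (dFun φ) p.1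
            - (1 / 2) * normSq bN g (extD B) p.1)) * formRatio bN τ (volForm bN τ g) p.1
          - (1 / 2) * ((normSq bN g (extD C₁) p.1 + normSq bN g (extD C + wedge (extD B) C₁) p.1)
            * formRatio bN τ (volForm bN τ g) p.1)
          + (14 / 3) * formRatio bN τ (extD Φ) p.1) * formRatio bS σ α p.2 := by
  obtain ⟨c, t, hc⟩ := hg.signature p.1
  obtain ⟨hr, h1⟩ := hα0 p.2
  obtain ⟨w, hw⟩ := exists_basis_one bS h1
  have hε : ∀ i : Fin (m + 1), (if i = t then (-1 : ℝ) else 1) * (if i = t then (-1 : ℝ) else 1) = 1 := fun i => by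
    split_ifs <;> norm_num
  have hflux := extD_flux hg hφ hτ hε (c := c) hc rfl rfl (hΦ p.1)
  have hfr : formRatio bN τ (extD Φ) p.1 = _ * formRatio bN τ (volForm bN τ g) p.1 :=
    (congrArg (fun ξ : E [⋀^Fin (m + 1)]→L[ℝ] ℝ => ξ bN / τ p.1 (tbasis bN p.1)) hflux).trans (mul_div_assoc _ _ _)
  rw [hfr, scalarCurvature_kaluzaKlein hg hφ hC₁ hα hG hGL p hw hε c hc rfl rfl rfl, extD_liftForm hB hC hα h0,
    normSq_kaluzaKlein hg hG bb p hw rfl, volForm_kaluzaKlein hg hG hbb p hw hr hτM,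
    ← normSq_dFun (bN := bN) hφ hε (c := c) hc rfl rfl]
  exact kaluzaKlein_exponents _ _ _ _ _ _ _ _ _ hm hq

end EinsteinMaxwell

section TypeIIAReduction

variable {N : Type*} [TopologicalSpace N] [ChartedSpace EN N] [IsManifold (𝓡 10) ∞ N]

theorem isKaluzaKlein_liftMetric {gN : BilinField (𝓡 10) N} {φ : N → ℝ} {C₁ : DForm (𝓡 10) N 1}
    {gS : BilinField (𝓡 1) Circle} {α : DForm (𝓡 1) Circle 1}
    (h : ∀ (z : Circle) (u v : ES), gS z u v = oneCLM (E := ES) (α z) u * oneCLM (E := ES) (α z) v) :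
    IsKaluzaKlein (-2 / 3) (4 / 3) gN φ C₁ α (liftMetric gN φ C₁ gS α) := by
  intro p u v
  have hN : (mfderiv IM (𝓡 10) Prod.fst p : EN × ES →L[ℝ] EN) = ContinuousLinearMap.fst ℝ EN ES := mfderiv_fst
  have hS : (mfderiv IM (𝓡 1) Prod.snd p : EN × ES →L[ℝ] ES) = ContinuousLinearMap.snd ℝ EN ES := mfderiv_snd
  let k (dN : EN × ES →L[ℝ] EN) (dS : EN × ES →L[ℝ] ES) : ℝ :=
    Real.exp (-2 * φ p.1 / 3) * gN p.1 (dN u) (dN v) + Real.exp (4 * φ p.1 / 3) *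
      (oneCLM (E := EN) (C₁ p.1) (dN u) * oneCLM (E := EN) (C₁ p.1) (dN v)
        - oneCLM (E := EN) (C₁ p.1) (dN u) * oneCLM (E := ES) (α p.2) (dS v)
        - oneCLM (E := ES) (α p.2) (dS u) * oneCLM (E := EN) (C₁ p.1) (dN v) + gS p.2 (dS u) (dS v))
  have h1 : liftMetric gN φ C₁ gS α p u v = k (mfderiv IM (𝓡 10) Prod.fst p) (mfderiv IM (𝓡 1) Prod.snd p) := rfl
  have h2 : k (mfderiv IM (𝓡 10) Prod.fst p) (mfderiv IM (𝓡 1) Prod.snd p)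
      = k (ContinuousLinearMap.fst ℝ EN ES) (ContinuousLinearMap.snd ℝ EN ES) := congrArg₂ k hN hS
  refine (h1.trans h2).trans ?_
  simp only [k, h]
  rw [show -2 * φ p.1 / 3 = -2 / 3 * φ p.1 by ring, show 4 * φ p.1 / 3 = 4 / 3 * φ p.1 by ring]
  simp only [ContinuousLinearMap.coe_fst', ContinuousLinearMap.coe_snd']
  ring

theorem wedge_oneForm_comm {E : Type*} [NormedAddCommGroup E] [NormedSpace ℝ E] [FiniteDimensional ℝ E] {H : Type*} [TopologicalSpace H]
    {I : ModelWithCorners ℝ E H} [I.Boundaryless] {M : Type*} [TopologicalSpace M] [ChartedSpace H M] [IsManifold I ∞ M] {k n : ℕ} (hk : Odd k)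
    (h : 1 + k = n) (h' : k + 1 = n) (C : DForm I M 1) (Y : DForm I M k) :
    castDegree h (wedge C Y) = - castDegree h' (wedge Y C) := by
  funext x
  ext v
  have h1 : ∀ v : Fin n → E, formAt (castDegree h (wedge C Y)) x v = - formAt (castDegree h' (wedge Y C)) x v := by
    intro v
    rw [formAt_cast, formAt_cast, formAt_wedge, formAt_wedge, wedgeAt_comm (formAt Y x), mul_one, hk.neg_one_pow,
      neg_one_mul, neg_neg]
    rfl
  exact h1 v

theorem tildeG4_eq (C₁ : DForm (𝓡 10) N 1) (B₂ : DForm (𝓡 10) N 2) (C₃ : DForm (𝓡 10) N 3) :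
    tildeG4 C₁ B₂ C₃ = extD C₃ + wedge (extD B₂) C₁ := by
  have h1 : 1 + (2 + 1) = 4 := by norm_num
  have h2 : 2 + 1 + 1 = 4 := by norm_num
  have h := wedge_oneForm_comm (by decide : Odd (2 + 1)) h1 h2 C₁ (extD B₂)
  have e1 : tildeG4 C₁ B₂ C₃ = extD C₃ - castDegree h1 (wedge C₁ (extD B₂)) := rfl
  rw [e1, h, sub_neg_eq_add]
  rfl

theorem formRatio_einsteinMaxwell11 {τ : DForm (𝓡 10) N 10} (hτ : IsOrientationForm τ) {g : BilinField (𝓡 10) N}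
    (hg : IsLorentzMetric bN g) {φ : N → ℝ} (hφ : ContMDiff (𝓡 10) 𝓘(ℝ, ℝ) ∞ φ) {C₁ : DForm (𝓡 10) N 1} (hC₁ : IsSmoothForm C₁)
    {B₂ : DForm (𝓡 10) N 2} (hB : IsSmoothForm B₂) {C₃ : DForm (𝓡 10) N 3} (hC : IsSmoothForm C₃)
    {σ α : DForm (𝓡 1) Circle 1} (hα : IsSmoothForm α)
    (hα0 : ∀ z, (∃ r : ℝ, 0 < r ∧ α z = r • σ z) ∧ oneCLM (E := ES) (α z) (bS 0) ≠ 0) {G : BilinField IM (N × Circle)}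
    (hG : IsKaluzaKlein (-2 / 3) (4 / 3) g φ C₁ α G) (hGL : IsLorentzMetric bM G) (p : N × Circle) :
    formRatio bM (productOrientation τ σ) (einsteinMaxwell11 bM (productOrientation τ σ) G (liftC B₂ C₃ α)) p
      = (formRatio bN τ (densityNS bN τ g φ B₂) p.1 - (1 / 2) * formRatio bN τ (densityR bN τ g C₁ B₂ C₃) p.1
          + (14 / 3) * formRatio bN τ (extD (dilatonFlux bN τ g φ)) p.1) * formRatio bS σ α p.2 := by
  have h := formRatio_einsteinMaxwell (bN := bN) (m := 9) (q := 2) (by norm_num) (by norm_num) hg hφ hτ (Φ := dilatonFlux bN τ g φ)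
    (fun x z hz => formInChart_dilatonFlux hg τ hφ hz) hC₁ hB hC hα (extD_circle α) hG (bS := bS) (bb := bM) rfl hGL hα0
    (τM := productOrientation τ σ) rfl p
  have e1 : formRatio bM (productOrientation τ σ) (einsteinMaxwell11 bM (productOrientation τ σ) G (liftC B₂ C₃ α)) p
    = (scalarCurvature bM G p - (1 / 2) * normSq bM G (extD (liftForm B₂ C₃ α)) p)
      * formRatio bM (productOrientation τ σ) (volForm bM (productOrientation τ σ) G) p := formRatio_fun_smul _ _ _ _ _
  have e2 : formRatio bN τ (densityNS bN τ g φ B₂) p.1 = (Real.exp (-2 * φ p.1) * (scalarCurvature bN g p.1 + 4 * normSq bN g (dFun φ) p.1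
            - (1 / 2) * normSq bN g (extD B₂) p.1)) * formRatio bN τ (volForm bN τ g) p.1 := formRatio_fun_smul _ _ _ _ _
  have e3 : formRatio bN τ (densityR bN τ g C₁ B₂ C₃) p.1 = (normSq bN g (extD C₁) p.1 + normSq bN g (tildeG4 C₁ B₂ C₃) p.1)
      * formRatio bN τ (volForm bN τ g) p.1 := formRatio_fun_smul _ _ _ _ _
  rw [tildeG4_eq] at e3
  rw [e1, e2, e3]
  exact h

end TypeIIAReduction

section Densities

open MeasureTheory

variable {N : Type*} [TopologicalSpace N] [ChartedSpace EN N] [IsManifold (𝓡 10) ∞ N]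

theorem isContinuousForm_einsteinMaxwell11 {E : Type*} [NormedAddCommGroup E] [NormedSpace ℝ E] [FiniteDimensional ℝ E]
    {H : Type*} [TopologicalSpace H] {I : ModelWithCorners ℝ E H} [I.Boundaryless]
    {M : Type*} [TopologicalSpace M] [ChartedSpace H M] [IsManifold I ∞ M] {b : Module.Basis (Fin 11) ℝ E}
    {τ : DForm I M 11} (hτ : IsOrientationForm τ) {g : BilinField I M} (hg : IsLorentzMetric b g) {C : DForm I M 3}
    (hC : IsSmoothForm C) : IsContinuousForm (einsteinMaxwell11 b τ g C) :=
  isContinuousForm_smul (isSmoothForm_volForm hg hτ).continuous fun x₀ =>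
    (continuousOn_scalarCurvature hg x₀).sub
      (continuousOn_const.mul (continuousOn_normSq hg (isSmoothForm_extD hC).continuous x₀))

theorem isContinuousForm_densityNS {τ : DForm (𝓡 10) N 10} (hτ : IsOrientationForm τ) {g : BilinField (𝓡 10) N}
    (hg : IsLorentzMetric bN g) {φ : N → ℝ} (hφ : ContMDiff (𝓡 10) 𝓘(ℝ, ℝ) ∞ φ) {B₂ : DForm (𝓡 10) N 2} (hB : IsSmoothForm B₂) :
    IsContinuousForm (densityNS bN τ g φ B₂) :=
  isContinuousForm_smul (isSmoothForm_volForm hg hτ).continuous fun x₀ =>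
    (contDiffOn_exp_mul (contDiffOn_function hφ x₀) (-2)).continuousOn.mul
      (((continuousOn_scalarCurvature hg x₀).add
        (continuousOn_const.mul (continuousOn_normSq hg (isSmoothForm_dFun hφ).continuous x₀))).sub
      (continuousOn_const.mul (continuousOn_normSq hg (isSmoothForm_extD hB).continuous x₀)))

theorem isSmoothForm_castDegree {E : Type*} [NormedAddCommGroup E] [NormedSpace ℝ E] [FiniteDimensional ℝ E]
    {H : Type*} [TopologicalSpace H] {I : ModelWithCorners ℝ E H} [I.Boundaryless]
    {M : Type*} [TopologicalSpace M] [ChartedSpace H M] [IsManifold I ∞ M] {k l : ℕ} (h : k = l) {ξ : DForm I M k}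
    (hξ : IsSmoothForm ξ) : IsSmoothForm (castDegree h ξ) := by
  subst h
  exact hξ

theorem isSmoothForm_tildeG4 {C₁ : DForm (𝓡 10) N 1} (hC₁ : IsSmoothForm C₁)
    {B₂ : DForm (𝓡 10) N 2} (hB : IsSmoothForm B₂) {C₃ : DForm (𝓡 10) N 3} (hC : IsSmoothForm C₃) :
    IsSmoothForm (tildeG4 C₁ B₂ C₃) := by
  have h1 : 1 + (2 + 1) = 4 := by norm_num
  have e1 : tildeG4 C₁ B₂ C₃ = extD C₃ - castDegree h1 (wedge C₁ (extD B₂)) := rfl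
  rw [e1]
  exact isSmoothForm_sub (isSmoothForm_extD hC) (isSmoothForm_castDegree h1 (isSmoothForm_wedge hC₁ (isSmoothForm_extD hB)))

theorem isContinuousForm_densityR {τ : DForm (𝓡 10) N 10} (hτ : IsOrientationForm τ) {g : BilinField (𝓡 10) N}
    (hg : IsLorentzMetric bN g) {C₁ : DForm (𝓡 10) N 1} (hC₁ : IsSmoothForm C₁)
    {B₂ : DForm (𝓡 10) N 2} (hB : IsSmoothForm B₂) {C₃ : DForm (𝓡 10) N 3} (hC : IsSmoothForm C₃) :
    IsContinuousForm (densityR bN τ g C₁ B₂ C₃) :=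
  isContinuousForm_smul (isSmoothForm_volForm hg hτ).continuous fun x₀ =>
    (continuousOn_normSq hg (isSmoothForm_extD hC₁).continuous x₀).add
      (continuousOn_normSq hg (isSmoothForm_tildeG4 hC₁ hB hC).continuous x₀)

theorem isSmoothForm_densityCS {B₂ : DForm (𝓡 10) N 2} (hB : IsSmoothForm B₂) {C₃ : DForm (𝓡 10) N 3}
    (hC : IsSmoothForm C₃) : IsSmoothForm (densityCS B₂ C₃) :=
  isSmoothForm_wedge (isSmoothForm_wedge hB (isSmoothForm_extD hC)) (isSmoothForm_extD hC)

theorem isSmoothForm_chernSimonsFlux {B₂ : DForm (𝓡 10) N 2} (hB : IsSmoothForm B₂) {C₃ : DForm (𝓡 10) N 3}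
    (hC : IsSmoothForm C₃) : IsSmoothForm (chernSimonsFlux B₂ C₃) :=
  isSmoothForm_wedge (isSmoothForm_wedge hC (isSmoothForm_extD hC)) hB

theorem isSmoothForm_chernSimons11 {E : Type*} [NormedAddCommGroup E] [NormedSpace ℝ E] [FiniteDimensional ℝ E]
    {H : Type*} [TopologicalSpace H] {I : ModelWithCorners ℝ E H} [I.Boundaryless]
    {M : Type*} [TopologicalSpace M] [ChartedSpace H M] [IsManifold I ∞ M] {C : DForm I M 3}
    (hC : IsSmoothForm C) : IsSmoothForm (chernSimons11 C) :=
  isSmoothForm_wedge (isSmoothForm_wedge hC (isSmoothForm_extD hC)) (isSmoothForm_extD hC)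

theorem isSmoothForm_liftC {B₂ : DForm (𝓡 10) N 2} (hB : IsSmoothForm B₂) {C₃ : DForm (𝓡 10) N 3}
    (hC : IsSmoothForm C₃) {α : DForm (𝓡 1) Circle 1} (hα : IsSmoothForm α) : IsSmoothForm (liftC B₂ C₃ α) :=
  isSmoothForm_liftForm (q := 2) hB hC hα

/-- The integral of a top form on `N × S¹` whose density is a product. -/
theorem integralForm_prod [SecondCountableTopology N] {τ : DForm (𝓡 10) N 10} (hτ : IsOrientationForm τ)
    {σ α : DForm (𝓡 1) Circle 1} (hσ : IsOrientationForm σ) (hα : IsSmoothForm α)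
    {Ξ : DForm IM (N × Circle) 11} (hΞ : IsContinuousForm Ξ) [MeasurableSpace N] [BorelSpace N] {f : N → ℝ}
    (hf : Integrable f (orientMeasure bN τ))
    (h : ∀ p, formRatio bM (productOrientation τ σ) Ξ p = f p.1 * formRatio bS σ α p.2) :
    IntegrableForm bM (productOrientation τ σ) Ξ ∧
      integralForm bM (productOrientation τ σ) Ξ = (∫ x, f x ∂(orientMeasure bN τ)) * integralForm bS σ α := by
  letI : MeasurableSpace Circle := borel Circle
  haveI : BorelSpace Circle := ⟨rfl⟩
  haveI : SecondCountableTopology Circle := by infer_instance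
  have hM : IsOrientationForm (productOrientation τ σ) := isOrientation_wedge hτ hσ bN bS
  have hμ : orientMeasure bM (productOrientation τ σ) = (orientMeasure bN τ).prod (orientMeasure bS σ) :=
    orientMeasure_prod hτ hσ
  haveI := sFinite_orientMeasure bN τ
  haveI := sFinite_orientMeasure bS σ
  have hi : Integrable (formRatio bS σ α) (orientMeasure bS σ) :=
    integrable_of_compact hσ (continuous_formRatio hσ hα.continuous)
  have hfun : formRatio bM (productOrientation τ σ) Ξ = fun p => f p.1 * formRatio bS σ α p.2 := funext h
  rw [integrableForm_iff hM hΞ, integralForm_eq hM hΞ, integralForm_eq hσ hα.continuous, hμ, hfun]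
  exact ⟨hf.mul_prod hi, integral_prod_mul f (formRatio bS σ α)⟩

end Densities

end Sugra

end

theorem mainTheorem9 {N : Type*} [TopologicalSpace N] [T2Space N] [SecondCountableTopology N]
    [ChartedSpace (EuclideanSpace ℝ (Fin 10)) N] [IsManifold (𝓡 10) ∞ N]
    (τN : DForm (𝓡 10) N 10) (hτN : IsOrientationForm τN)
    (gN : BilinField (𝓡 10) N) (hgN : IsLorentzMetric bN gN)
    (φ : N → ℝ) (hφ : ContMDiff (𝓡 10) 𝓘(ℝ, ℝ) ∞ φ)
    (C₁ : DForm (𝓡 10) N 1) (hC₁ : IsSmoothForm C₁)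
    (B₂ : DForm (𝓡 10) N 2) (hB₂ : IsSmoothForm B₂)
    (C₃ : DForm (𝓡 10) N 3) (hC₃ : IsSmoothForm C₃)
    (τS : DForm (𝓡 1) Circle 1) (hτS : IsOrientationForm τS)
    (gS : BilinField (𝓡 1) Circle) (hgS : IsInvariantCircleMetric gS)
    (α : DForm (𝓡 1) Circle 1) (hα : α = volForm bS τS gS)
    (κ₁₁ κ₁₀ : ℝ) (hκ₁₁ : κ₁₁ ≠ 0) (hκ₁₀ : κ₁₀ ≠ 0)
    (hκ : 1 / κ₁₀ ^ 2 = 1 / κ₁₁ ^ 2 * integralForm bS τS α)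
    (hN : CompactSpace N ∨
      ((IntegrableForm bN τN (densityNS bN τN gN φ B₂) ∧
        IntegrableForm bN τN (densityR bN τN gN C₁ B₂ C₃) ∧
        IntegrableForm bN τN (densityCS B₂ C₃)) ∧
       (IntegrableForm bN τN (extD (dilatonFlux bN τN gN φ)) ∧
        integralForm bN τN (extD (dilatonFlux bN τN gN φ)) = 0) ∧
       (IntegrableForm bN τN (extD (chernSimonsFlux B₂ C₃)) ∧
        integralForm bN τN (extD (chernSimonsFlux B₂ C₃)) = 0))) :
    IsLorentzMetric bM (liftMetric gN φ C₁ gS α) ∧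
    IsSmoothForm (liftC B₂ C₃ α) ∧
    (IntegrableForm bN τN (densityNS bN τN gN φ B₂) ∧
      IntegrableForm bN τN (densityR bN τN gN C₁ B₂ C₃) ∧
      IntegrableForm bN τN (densityCS B₂ C₃)) ∧
    (IntegrableForm bM (productOrientation τN τS)
        (einsteinMaxwell11 bM (productOrientation τN τS) (liftMetric gN φ C₁ gS α)
          (liftC B₂ C₃ α)) ∧
      IntegrableForm bM (productOrientation τN τS) (chernSimons11 (liftC B₂ C₃ α))) ∧
    action11 bM κ₁₁ (productOrientation τN τS) (liftMetric gN φ C₁ gS α) (liftC B₂ C₃ α) =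
      actionIIA bN κ₁₀ τN gN φ C₁ B₂ C₃ := by
  letI : MeasurableSpace N := borel N
  haveI : BorelSpace N := ⟨rfl⟩
  have hline := volForm_line hgS.riemannian hτS
  have hαs : IsSmoothForm α := hα ▸ isSmoothForm_volForm_line hgS.riemannian hτS
  have hG : IsKaluzaKlein (-2 / 3) (4 / 3) gN φ C₁ α (liftMetric gN φ C₁ gS α) :=
    isKaluzaKlein_liftMetric fun z => hα ▸ (hline z).2.2
  have hα0 : ∀ z, (∃ r : ℝ, 0 < r ∧ α z = r • τS z) ∧ oneCLM (E := ES) (α z) (bS 0) ≠ 0 := fun z =>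
    hα ▸ ⟨(hline z).1, (hline z).2.1⟩
  have hGL : IsLorentzMetric bM (liftMetric gN φ C₁ gS α) :=
    isLorentzMetric_kaluzaKlein hgN hφ hC₁ hαs bS (fun z => (hα0 z).2) hG bM
  have hL : IsSmoothForm (liftC B₂ C₃ α) := isSmoothForm_liftC hB₂ hC₃ hαs
  have cNS := isContinuousForm_densityNS hτN hgN hφ hB₂
  have cR := isContinuousForm_densityR hτN hgN hC₁ hB₂ hC₃
  have cCS := (isSmoothForm_densityCS hB₂ hC₃).continuous
  have sD := isSmoothForm_dilatonFlux hgN hτN hφ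
  have sX := isSmoothForm_chernSimonsFlux hB₂ hC₃
  have cD := (isSmoothForm_extD sD).continuous
  have cX := (isSmoothForm_extD sX).continuous
  obtain ⟨⟨iNS, iR, iCS⟩, ⟨iD, zD⟩, ⟨iX, zX⟩⟩ :
      (MeasureTheory.Integrable (formRatio bN τN (densityNS bN τN gN φ B₂)) (orientMeasure bN τN) ∧
        MeasureTheory.Integrable (formRatio bN τN (densityR bN τN gN C₁ B₂ C₃)) (orientMeasure bN τN) ∧
        MeasureTheory.Integrable (formRatio bN τN (densityCS B₂ C₃)) (orientMeasure bN τN)) ∧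
      (MeasureTheory.Integrable (formRatio bN τN (extD (dilatonFlux bN τN gN φ))) (orientMeasure bN τN) ∧
        ∫ x, formRatio bN τN (extD (dilatonFlux bN τN gN φ)) x ∂(orientMeasure bN τN) = 0) ∧
      (MeasureTheory.Integrable (formRatio bN τN (extD (chernSimonsFlux B₂ C₃))) (orientMeasure bN τN) ∧
        ∫ x, formRatio bN τN (extD (chernSimonsFlux B₂ C₃)) x ∂(orientMeasure bN τN) = 0) := by
    rcases hN with hN | ⟨⟨h1, h2, h3⟩, ⟨h4, h5⟩, h6, h7⟩
    · exact ⟨⟨integrable_of_compact hτN (continuous_formRatio hτN cNS), integrable_of_compact hτN (continuous_formRatio hτN cR),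
        integrable_of_compact hτN (continuous_formRatio hτN cCS)⟩,
        ⟨integrable_of_compact hτN (continuous_formRatio hτN cD), integral_extD hτN sD⟩,
        ⟨integrable_of_compact hτN (continuous_formRatio hτN cX), integral_extD hτN sX⟩⟩
    · exact ⟨⟨(integrableForm_iff hτN cNS).1 h1, (integrableForm_iff hτN cR).1 h2, (integrableForm_iff hτN cCS).1 h3⟩,
        ⟨(integrableForm_iff hτN cD).1 h4, (integralForm_eq hτN cD).symm.trans h5⟩,
        ⟨(integrableForm_iff hτN cX).1 h6, (integralForm_eq hτN cX).symm.trans h7⟩⟩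
  have hM : IsOrientationForm (productOrientation τN τS) := isOrientation_wedge hτN hτS bN bS
  obtain ⟨jE, eE⟩ := integralForm_prod hτN hτS hαs (isContinuousForm_einsteinMaxwell11 hM hGL hL)
    ((iNS.sub (iR.const_mul (1 / 2))).add (iD.const_mul (14 / 3)))
    (formRatio_einsteinMaxwell11 hτN hgN hφ hC₁ hB₂ hC₃ hαs hα0 hG hGL)
  obtain ⟨jC, eC⟩ := integralForm_prod hτN hτS hαs (isSmoothForm_chernSimons11 hL).continuous
    ((iCS.const_mul 3).sub (iX.const_mul 2)) (formRatio_chernSimons11 hB₂ hC₃ hαs τN τS)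
  refine ⟨hGL, hL, ⟨(integrableForm_iff hτN cNS).2 iNS, (integrableForm_iff hτN cR).2 iR, (integrableForm_iff hτN cCS).2 iCS⟩,
    ⟨jE, jC⟩, ?_⟩
  have e1 : integralForm bM (productOrientation τN τS)
      (einsteinMaxwell11 bM (productOrientation τN τS) (liftMetric gN φ C₁ gS α) (liftC B₂ C₃ α))
      = (integralForm bN τN (densityNS bN τN gN φ B₂) - 1 / 2 * integralForm bN τN (densityR bN τN gN C₁ B₂ C₃))
        * integralForm bS τS α := by
    rw [eE, integralForm_eq hτN cNS, integralForm_eq hτN cR]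
    congr 1
    refine (MeasureTheory.integral_add (iNS.sub (iR.const_mul (1 / 2))) (iD.const_mul (14 / 3))).trans ?_
    rw [MeasureTheory.integral_const_mul, zD, mul_zero, add_zero]
    refine (MeasureTheory.integral_sub iNS (iR.const_mul (1 / 2))).trans ?_
    rw [MeasureTheory.integral_const_mul]
  have e2 : integralForm bM (productOrientation τN τS) (chernSimons11 (liftC B₂ C₃ α))
      = 3 * integralForm bN τN (densityCS B₂ C₃) * integralForm bS τS α := by
    rw [eC, integralForm_eq hτN cCS]
    congr 1
    refine (MeasureTheory.integral_sub (iCS.const_mul 3) (iX.const_mul 2)).trans ?_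
    rw [MeasureTheory.integral_const_mul, MeasureTheory.integral_const_mul, zX, mul_zero, sub_zero]
  rw [action11, actionIIA, e1, e2]
  have hk : ∀ x : ℝ, 1 / (x * κ₁₀ ^ 2) = 1 / (x * κ₁₁ ^ 2) * integralForm bS τS α := fun x => by
    rw [one_div, mul_inv, ← one_div (κ₁₀ ^ 2), hκ, one_div (x * _), mul_inv, one_div, mul_assoc]
  rw [hk 2, hk 4]
  have h12 : (1 : ℝ) / (12 * κ₁₁ ^ 2) = 1 / 3 * (1 / (4 * κ₁₁ ^ 2)) := by
    rw [one_div_mul_one_div]; ring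
  have h4 : (1 : ℝ) / (4 * κ₁₁ ^ 2) = 1 / 2 * (1 / (2 * κ₁₁ ^ 2)) := by
    rw [one_div_mul_one_div]; ring
  rw [h12, h4]
  ring
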